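/- Let $X$ be a complex Banach space. For $\psi\in(0,\pi]$ put $S_\psi=\{z\neq 0: |\arg z|<\psi\}$, and $S_0=(0,\infty)$. For $0<\omega\le \pi/2$, $a\ge 0$ put $BS_{\omega,a}=(-a+S_{\pi-\omega})\cap(a-S_{\pi-\omega})$, except that $BS_{\pi/2,0}=i\mathbb R$. Write $R(\lambda,A)=(\lambda I-A)^{-1}$. A closed operator $A$ in $X$ is *bisectorial of angle $\omega$ and half-width $a$* if $\sigma(A)\subset\overline{BS_{\omega,a}}$ and, for every $\omega'\in(0,\omega)$, $\min\{|\lambda-a|,|\lambda+a|\}\,\|R(\lambda,A)\|$ is bounded on $\mathbb C\setminus\overline{BS_{\omega',a}}$. A closed operator $G$ is *sectorial of angle $\theta\in[0,\pi)$* if $\sigma(G)\subset\overline{S_\theta}$ and, for every $\theta'\in(\theta,\pi)$, $\|\lambda R(\lambda,G)\|$ is bounded on $\{\lambda\ne0:\lambda\notin S_{\theta'}\}$. Let $A$ be bisectorial of angle $\pi/2$ and half-width $a\ge 0$, and let $\alpha>0$ not be an odd integer. Then there is a unique integer $n\ge 0$ with $\alpha\in(2n-1,2n+1)$, the operator $(A+aI)^\alpha$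 is well defined as $f(A)$, $f(z)=(a+z)^\alpha$ (principal branch), by the natural functional calculus of bisectorial operators, and the following hold. (i) For every $\varepsilon>0$ with $\pi|\frac{\alpha}{2}-n|+\varepsilon<\pi$ there is $\rho\ge 0$ such that $\rho I+(-1)^n(A+aI)^\alpha$ is sectorial of angle $\pi|\frac{\alpha}{2}-n|+\varepsilon$; if $a=0$ one can take $\rho=0$. (ii) In particular, $(-1)^{n+1}(A+aI)^\alpha$ generates an exponentially bounded holomorphic semigroup of angle $\delta$ for every $\delta\in\bigl(0,\frac{\pi}{2}-\pi|\frac{\alpha}{2}-n|\bigr)$. That is, there is a holomorphic $T:S_\delta\to\mathcal L(X)$ with $T(z)T(w)=T(z+w)$, bounded on $\{w\in S_{\delta'}:|w|\le1\}$ for every $\delta'\in(0,\delta)$, such that $R\bigl(\lambda,(-1)^{n+1}(A+aI)^\alpha\bigr)=\int_0^\infty e^{-\lambda t}T(t)\,dt$ for all $\lambda$ with $\Re\lambda$ large enough. (Strong continuity of $T$ at $0$ is not required, since the domain of $A$ need not be dense.) Here the natural functional calculus of an operator $A$ that is bisectorial of angle $\omega$ and half-width $a$ is as follows. For $\varphi\in(0,\omega)$,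 $\mathcal E_0(BS_{\varphi,a})$ is the set of bounded holomorphic $f$ on $BS_{\varphi,a}$ that tend to $0$ at $a$, $-a$ and $\infty$ and satisfy $\int_{\partial BS_{\omega',a}}\frac{|f(z)|}{\min\{|z-a|,|z+a|\}}|dz|<\infty$ for all $\omega'\in(\varphi,\pi/2]$. For such $f$ one puts $f(A)=\frac1{2\pi i}\int_{\partial BS_{\omega',a}}f(z)R(z,A)\,dz$ with any $\omega'\in(\varphi,\omega)$ and positive orientation. This is extended linearly to $\mathcal E(BS_{\varphi,a})=\mathcal E_0(BS_{\varphi,a})+\mathbb C\frac1{b+z}+\mathbb C\frac1{b-z}$, $b=a+1$, by $\frac1{b+z}\mapsto-R(-b,A)$ and $\frac1{b-z}\mapsto R(b,A)$. Finally, $f(A)=e(A)^{-1}(ef)(A)$ for $f$ holomorphic on some $BS_{\varphi,a}$ with $\varphi\in(0,\omega)$ and any $e\in\mathcal E(BS_{\varphi,a})$ with $e(A)$ injective and $ef\in\mathcal E(BS_{\varphi,a})$. -/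

import Mathlib

open Set Filter Topology MeasureTheory

noncomputable section

/-- The sector `S_ψ = {z ≠ 0 : |arg z| < ψ}` for `ψ > 0`, and `S_0 = (0, ∞)`. -/
def openSector (ψ : ℝ) : Set ℂ :=
  if ψ = 0 then {z | 0 < z.re ∧ z.im = 0} else {z | z ≠ 0 ∧ |Complex.arg z| < ψ}

/-- The bisector `BS_{ω,a} = (-a + S_{π-ω}) ∩ (a - S_{π-ω})`, and `BS_{π/2,0} = iℝ`. For
`ω = π/2` and `a > 0` this is the open strip `|Re z| < a`. -/
def bisector (ω a : ℝ) : Set ℂ :=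
  if ω = Real.pi / 2 ∧ a = 0 then {z | z.re = 0}
  else {z | z + (a : ℂ) ∈ openSector (Real.pi - ω) ∧ (a : ℂ) - z ∈ openSector (Real.pi - ω)}

section Operators

variable {X : Type*} [NormedAddCommGroup X] [NormedSpace ℂ X]

/-- `R` is a bounded two-sided inverse of `μ I - A : D(A) → X`. -/
def HasResolventAt (A : X →ₗ.[ℂ] X) (μ : ℂ) (R : X →L[ℂ] X) : Prop :=
  (∀ x : A.domain, R (μ • (x : X) - A x) = (x : X)) ∧
  (∀ y : X, ∃ x : A.domain, (x : X) = R y ∧ μ • (x : X) - A x = y)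

/-- The resolvent set of `A`. -/
def resolventSetOf (A : X →ₗ.[ℂ] X) : Set ℂ := {μ | ∃ R : X →L[ℂ] X, HasResolventAt A μ R}

/-- The spectrum of `A`. -/
def spectrumOf (A : X →ₗ.[ℂ] X) : Set ℂ := (resolventSetOf A)ᶜ

open scoped Classical in
/-- The resolvent `R(μ, A) = (μ I - A)⁻¹` for `μ` in the resolvent set (and `0` elsewhere). -/
def resolventOf (A : X →ₗ.[ℂ] X) (μ : ℂ) : X →L[ℂ] X :=
  if h : ∃ R : X →L[ℂ] X, HasResolventAt A μ R then h.choose else 0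

/-- `A` is a sectorial operator of angle `θ ∈ [0, π)`. The point `μ = 0` is excluded in the
resolvent bound because it may belong to the spectrum. -/
def IsSectorialOp (A : X →ₗ.[ℂ] X) (θ : ℝ) : Prop :=
  0 ≤ θ ∧ θ < Real.pi ∧ A.IsClosed ∧ spectrumOf A ⊆ closure (openSector θ) ∧
  ∀ θ' : ℝ, θ < θ' → θ' < Real.pi →
    ∃ M : ℝ, 0 < M ∧ ∀ μ : ℂ, μ ∉ openSector θ' → μ ≠ 0 → ‖μ • resolventOf A μ‖ ≤ M

/-- `A` is a bisectorial operator of angle `ω ∈ (0, π/2]` and half-width `a ≥ 0`. -/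
def IsBisectorialOp (A : X →ₗ.[ℂ] X) (ω a : ℝ) : Prop :=
  0 < ω ∧ ω ≤ Real.pi / 2 ∧ 0 ≤ a ∧ A.IsClosed ∧ spectrumOf A ⊆ closure (bisector ω a) ∧
  ∀ ω' : ℝ, 0 < ω' → ω' < ω →
    ∃ C : ℝ, ∀ μ : ℂ, μ ∉ closure (bisector ω' a) →
      min ‖μ - (a : ℂ)‖ ‖μ + (a : ℂ)‖ * ‖resolventOf A μ‖ ≤ C

end Operators

/-- The algebra `E₀(BS_{φ,a})`: bounded holomorphic functions on `BS_{φ,a}` that tend to `0` at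
`a`, `-a` and `∞`, with `∫ |f(z)| / min(|z - a|, |z + a|) |dz| < ∞` over the boundary of
`BS_{ω',a}` for all `φ < ω' ≤ π/2`. That boundary consists of the four rays
`a + t e^{±iω'}`, `-(a + t e^{±iω'})`, `t ≥ 0`, on which the minimum is `t`. -/
structure MemElemZero (φ a : ℝ) (f : ℂ → ℂ) : Prop where
  holo : DifferentiableOn ℂ f (bisector φ a)
  bdd : ∃ C : ℝ, ∀ z ∈ bisector φ a, ‖f z‖ ≤ C
  lim_right : Tendsto f (𝓝[bisector φ a] (a : ℂ)) (𝓝 0)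
  lim_left : Tendsto f (𝓝[bisector φ a] (-(a : ℂ))) (𝓝 0)
  lim_infty : Tendsto f (Bornology.cobounded ℂ ⊓ 𝓟 (bisector φ a)) (𝓝 0)
  integrable : ∀ ω' : ℝ, φ < ω' → ω' ≤ Real.pi / 2 → ∀ v : ℂ,
    (v = Complex.exp (ω' * Complex.I) ∨ v = Complex.exp (-(ω' * Complex.I))) →
      IntegrableOn (fun t : ℝ => f (a + t * v) / (t : ℂ)) (Ioi 0) ∧
      IntegrableOn (fun t : ℝ => f (-(a + t * v)) / (t : ℂ)) (Ioi 0)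

section Calculus

variable {X : Type*} [NormedAddCommGroup X] [NormedSpace ℂ X]

/-- `∫ f(z) R(z, A) dz` along the ray `z = d + t v`, `t` from `0` to `∞`. -/
def rayIntegral (A : X →ₗ.[ℂ] X) (f : ℂ → ℂ) (d v : ℂ) : X →L[ℂ] X :=
  ∫ t in Ioi (0 : ℝ), (v * f (d + t * v)) • resolventOf A (d + t * v)

/-- `(2πi)⁻¹ ∫_Γ f(z) R(z, A) dz`, where `Γ` is the positively oriented boundary of
`BS_{ω',a}`: its right part runs upwards through `a`, its left part runs downwards
through `-a`. -/
def contourCalc (A : X →ₗ.[ℂ] X) (a ω' : ℝ) (f : ℂ → ℂ) : X →L[ℂ] X :=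
  (2 * (Real.pi : ℂ) * Complex.I)⁻¹ •
    (rayIntegral A f a (Complex.exp (ω' * Complex.I))
      - rayIntegral A f a (Complex.exp (-(ω' * Complex.I)))
      + rayIntegral A f (-(a : ℂ)) (-Complex.exp (ω' * Complex.I))
      - rayIntegral A f (-(a : ℂ)) (-Complex.exp (-(ω' * Complex.I))))

/-- `h` belongs to `E(BS_{φ,a}) = E₀(BS_{φ,a}) + ℂ (b + z)⁻¹ + ℂ (b - z)⁻¹` and `h(A) = T` in the
elementary calculus of an operator `A` of angle `ω > φ` and half-width `a`, where
`(b + z)⁻¹(A) = -R(-b, A)` and `(b - z)⁻¹(A) = R(b, A)`. The algebra and the calculus do not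
depend on `b` outside the closed bisector; we take `b = a + 1`. -/
def HasElemCalc (A : X →ₗ.[ℂ] X) (ω a φ : ℝ) (h : ℂ → ℂ) (T : X →L[ℂ] X) : Prop :=
  ∃ (f₀ : ℂ → ℂ) (c d : ℂ) (ω' : ℝ), MemElemZero φ a f₀ ∧ φ < ω' ∧ ω' < ω ∧
    (∀ z ∈ bisector φ a, h z = f₀ z + c / (((a : ℂ) + 1) + z) + d / (((a : ℂ) + 1) - z)) ∧
    T = contourCalc A a ω' f₀ - c • resolventOf A (-((a : ℂ) + 1))
      + d • resolventOf A ((a : ℂ) + 1)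

/-- The natural functional calculus: for some `0 < φ < ω` the function `f` is holomorphic on
`BS_{φ,a}` and is regularized by some `e ∈ E(BS_{φ,a})` (that is, `e(A)` is injective and
`e f ∈ E(BS_{φ,a})`), and `B = f(A) = e(A)⁻¹ (e f)(A)` with its natural domain. -/
def HasNFC (A : X →ₗ.[ℂ] X) (ω a : ℝ) (f : ℂ → ℂ) (B : X →ₗ.[ℂ] X) : Prop :=
  ∃ φ : ℝ, 0 < φ ∧ φ < ω ∧ DifferentiableOn ℂ f (bisector φ a) ∧
    ∃ (e : ℂ → ℂ) (T S : X →L[ℂ] X),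
      HasElemCalc A ω a φ e T ∧ HasElemCalc A ω a φ (fun z => e z * f z) S ∧
      Function.Injective T ∧ ∀ x y : X, (x, y) ∈ B.graph ↔ T y = S x

end Calculus

section Semigroups

variable {X : Type*} [NormedAddCommGroup X] [NormedSpace ℂ X]

/-- `T : S_δ → L(X)` is an exponentially bounded holomorphic semigroup of angle `δ ∈ (0, π/2]`
(strong continuity at `0` is not required). -/
structure IsExpBddHolSemigroup (δ : ℝ) (T : ℂ → X →L[ℂ] X) : Prop where
  pos : 0 < δ
  le : δ ≤ Real.pi / 2
  mul : ∀ z ∈ openSector δ, ∀ w ∈ openSector δ, (T z).comp (T w) = T (z + w)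
  holo : DifferentiableOn ℂ T (openSector δ)
  bdd : ∀ δ' : ℝ, 0 < δ' → δ' < δ →
    ∃ C : ℝ, ∀ w ∈ openSector δ', ‖w‖ ≤ 1 → ‖T w‖ ≤ C

/-- `B` is the generator of `T`: `R(μ, B) = ∫₀^∞ e^{-μ t} T(t) dt` for all `μ` with large real
part. This determines `B` also when `D(B)` is not dense. -/
def IsGeneratorOf (B : X →ₗ.[ℂ] X) (T : ℂ → X →L[ℂ] X) : Prop :=
  ∃ r : ℝ, ∀ μ : ℂ, r < μ.re →
    IntegrableOn (fun t : ℝ => Complex.exp (-(μ * t)) • T t) (Ioi 0) ∧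
    HasResolventAt B μ (∫ t in Ioi (0 : ℝ), Complex.exp (-(μ * t)) • T t)

end Semigroups

end

/-! ### Geometry of sectors and bisectors -/

/-! Far out in a bisector whose angle is close to π/2, arg(a + z) is close to ±π/2. Hence (a + z)^α
has argument close to ±απ/2, and the factor (-1)^n reduces this to about ±π(α/2 - n), an angle below
π/2. So g(z) = (-1)^n (a + z)^α maps such a bisector into a sector of half-angle κ slightly larger
than π|α/2 - n|, together with a disc of radius G around 0 that collects the points near the
vertices; G = 0 if a = 0 (`exists_isPowerLike`). Scalar functions such as (μ + g)⁻¹ and exp(-w g)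
are then bounded and holomorphic on the bisector. What remains is to insert A into them, with bounds
uniform in μ, and to recognise the results as resolvents and semigroup operators.

The calculus uses only the resolvent outside the strip, abstracted as `IsOuterResolvent` in a normed
algebra. Cauchy's theorem (`contourInt_eq_zero`), residues in a sector (`rayDiff_residue`) and
Cauchy's formula (`contourInt_div_sub_eq`) make the contour integral multiplicative
(`contourOp_mul`). Bounded functions that do not vanish at ±a are handled by the relation `HasCalc`:
T is h(A) if f(A) T = (f h)(A) for all elementary f, and if T - h(±a) is annihilated asymptotically
by the resolvent at the vertices. The second condition is needed because elementary functions vanish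
at ±a and do not see eigenvectors for these values. Together the conditions determine T
(`HasCalc.eq_zero`, `HasCalc.unique`), so every identity between functions becomes an identity
between operators; commutation, the semigroup law and the resolvent equation come out this way.

Bounds come from dilation invariance. A function with limits at the vertices and decay at infinity,
measured at a scale s (`IsTame`), becomes elementary after subtraction of explicit rational
functions, and the remainder is dominated by bumps min(r^β, r^(-β)) at the scales s and 1
(`IsTame.norm_remainder_le`). Since the resolvent is O(1/t) on the contour and dt/t is dilation
invariant, the operator bound does not depend on s (`exists_hasCalc`). As |g(z)| = |z + a|^α, a
function F of ζ at scale σ gives a function F ∘ g at scale σ^(1/α) (`IsAdmissible.isTame`).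

For the fractional power itself, a power of s(2a + s)/((a + s)² - z²) with s = 1 is a regularizer
(`exists_hasNFC`), and the result does not depend on the regularizer (`HasNFC.graph_eq`). If r (ν -
c f) = 1 on a bisector, then r(A) is the resolvent of c f(A) at ν (`HasNFC.hasResolventAt_smul`).
Applying the bounds to μ/(μ + ζ) at scale |μ| gives sectoriality; the shift ρ only serves to keep
|μ| away from the disc. The operators T(w) = exp(-w g)(A) form the semigroup, and
`IsPowerSemigroup.laplace` identifies its Laplace transform with the resolvent. -/

/-- Because cosine is strictly decreasing on [0, π], the angle condition is a cone inequality. In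
this form openness, closures and distance estimates need no `Complex.arg`. -/
theorem mem_openSector_iff {ψ : ℝ} (h0 : 0 < ψ) (h1 : ψ ≤ Real.pi) {z : ℂ} :
    z ∈ openSector ψ ↔ ‖z‖ * Real.cos ψ < z.re := by
  rw [openSector, if_neg h0.ne', mem_ofPred_eq]
  rcases eq_or_ne z 0 with rfl | hz
  · simp
  have hn : 0 < ‖z‖ := norm_pos_iff.2 hz
  have hre : z.re = ‖z‖ * Real.cos |z.arg| := by rw [Real.cos_abs, Complex.norm_mul_cos_arg]
  rw [hre, mul_lt_mul_iff_right₀ hn,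
    Real.strictAntiOn_cos.lt_iff_gt ⟨h0.le, h1⟩ ⟨abs_nonneg _, Complex.abs_arg_le_pi z⟩]
  exact ⟨fun h => h.2, fun h => ⟨hz, h⟩⟩

theorem mem_bisector_iff {φ a : ℝ} (h0 : 0 < φ) (h1 : φ < Real.pi / 2) {z : ℂ} :
    z ∈ bisector φ a ↔ (z - a).re < Real.cos φ * ‖z - a‖ ∧
      -(z + a).re < Real.cos φ * ‖z + a‖ := by
  rw [bisector, if_neg (fun h => h1.ne h.1), mem_ofPred_eq,
    mem_openSector_iff (by linarith) (by linarith), mem_openSector_iff (by linarith) (by linarith),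
    Real.cos_pi_sub, norm_sub_rev]
  simp only [Complex.add_re, Complex.sub_re, Complex.ofReal_re]
  constructor
  · rintro ⟨h, h'⟩; constructor <;> nlinarith
  · rintro ⟨h, h'⟩; constructor <;> nlinarith

theorem neg_mem_bisector {φ a : ℝ} (h0 : 0 < φ) (h1 : φ < Real.pi / 2) {z : ℂ}
    (hz : z ∈ bisector φ a) : -z ∈ bisector φ a := by
  rw [mem_bisector_iff h0 h1] at hz ⊢
  have e1 : ‖-z - a‖ = ‖z + a‖ := by rw [← norm_neg]; ring_nf
  have e2 : ‖-z + a‖ = ‖z - a‖ := by rw [← norm_neg]; ring_nf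
  rw [e1, e2]
  simp only [Complex.add_re, Complex.sub_re, Complex.ofReal_re, Complex.neg_re] at hz ⊢
  constructor <;> linarith [hz.1, hz.2]

theorem cos_pos_of_lt {φ : ℝ} (h0 : 0 < φ) (h1 : φ < Real.pi / 2) : 0 < Real.cos φ :=
  Real.cos_pos_of_mem_Ioo ⟨by linarith, h1⟩

theorem cos_lt_cos_of_lt {φ ψ : ℝ} (h0 : 0 < φ) (h : φ < ψ) (h1 : ψ ≤ Real.pi / 2) :
    Real.cos ψ < Real.cos φ :=
  Real.cos_lt_cos_of_nonneg_of_le_pi_div_two h0.le h1 h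

theorem cos_lt_one_of_pos {φ : ℝ} (h0 : 0 < φ) (h1 : φ < Real.pi / 2) : Real.cos φ < 1 := by
  simpa using Real.cos_lt_cos_of_nonneg_of_le_pi_div_two le_rfl h1.le h0

theorem bisector_anti {φ ψ a : ℝ} (h0 : 0 < φ) (h : φ ≤ ψ) (h1 : ψ < Real.pi / 2) :
    bisector ψ a ⊆ bisector φ a := by
  intro z hz
  rw [mem_bisector_iff (by linarith) h1] at hz
  rw [mem_bisector_iff h0 (by linarith)]
  have : Real.cos ψ ≤ Real.cos φ :=
    Real.cos_le_cos_of_nonneg_of_le_pi h0.le (by linarith [Real.pi_pos]) h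
  exact ⟨hz.1.trans_le (by gcongr), hz.2.trans_le (by gcongr)⟩

theorem isOpen_bisector {φ a : ℝ} (h0 : 0 < φ) (h1 : φ < Real.pi / 2) :
    IsOpen (bisector φ a) := by
  have : bisector φ a = {z : ℂ | (z - a).re < Real.cos φ * ‖z - a‖} ∩
      {z : ℂ | -(z + a).re < Real.cos φ * ‖z + a‖} := by
    ext z; exact mem_bisector_iff h0 h1
  rw [this]
  exact (isOpen_lt (by fun_prop) (by fun_prop)).inter (isOpen_lt (by fun_prop) (by fun_prop))

theorem norm_sub_ofReal_le_norm_add {a : ℝ} (ha : 0 ≤ a) {z : ℂ} (hz : 0 ≤ z.re) :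
    ‖z - a‖ ≤ ‖z + a‖ := by
  refine (sq_le_sq₀ (norm_nonneg _) (norm_nonneg _)).1 ?_
  rw [Complex.sq_norm, Complex.sq_norm, Complex.normSq_apply, Complex.normSq_apply]
  simp only [Complex.add_re, Complex.sub_re, Complex.ofReal_re, Complex.add_im, Complex.sub_im,
    Complex.ofReal_im]
  nlinarith [mul_nonneg ha hz]

/-- Points in a cone and points outside a wider cone are at distance comparable to their norms. -/
theorem cone_separation {w x : ℂ} {κ₁ κ₂ : ℝ} (h0 : 0 ≤ κ₂) (h1 : κ₁ ≤ 1) (h : κ₂ ≤ κ₁)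
    (hw : κ₁ * ‖w‖ ≤ w.re) (hx : x.re ≤ κ₂ * ‖x‖) :
    (κ₁ - κ₂) / 4 * (‖w‖ + ‖x‖) ≤ ‖w - x‖ := by
  -- Real parts give κ₁‖w‖ - κ₂‖x‖ ≤ ‖w - x‖. Adding (κ₁ + κ₂)/2 times the reverse triangle
  -- inequality balances the two norms, at the cost of a total factor at most 2 on the right.
  have e1 : w.re - x.re ≤ ‖w - x‖ := by simpa using Complex.re_le_norm (w - x)
  have e2 : ‖x‖ - ‖w‖ ≤ ‖w - x‖ := by rw [norm_sub_rev]; exact norm_sub_norm_le x w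
  have e3 : (κ₁ + κ₂) / 2 * (‖x‖ - ‖w‖) ≤ (κ₁ + κ₂) / 2 * ‖w - x‖ :=
    mul_le_mul_of_nonneg_left e2 (by linarith)
  have e4 : (κ₁ + κ₂) / 2 * ‖w - x‖ ≤ 1 * ‖w - x‖ :=
    mul_le_mul_of_nonneg_right (by linarith) (norm_nonneg _)
  nlinarith [norm_nonneg w, norm_nonneg x]

/-! ### Contours -/

/-- The side (right or left) of each of the four boundary rays of a bisector. -/
def raySign : Fin 4 → ℂ := ![1, 1, -1, -1]

/-- The direction, up to the side, of the four boundary rays. -/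
noncomputable def rayDir (ω : ℝ) : Fin 4 → ℂ :=
  ![Complex.exp (ω * Complex.I), Complex.exp (-(ω * Complex.I)),
    Complex.exp (ω * Complex.I), Complex.exp (-(ω * Complex.I))]

/-- The point with parameter `t` on the `i`-th boundary ray of `BS_{ω,a}`. -/
noncomputable def contourPt (a ω : ℝ) (i : Fin 4) (t : ℝ) : ℂ :=
  raySign i * (a + t * rayDir ω i)

/-- The oriented tangent vector of the `i`-th boundary ray. -/
noncomputable def contourWt (ω : ℝ) (i : Fin 4) : ℂ :=
  ![Complex.exp (ω * Complex.I), -Complex.exp (-(ω * Complex.I)),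
    -Complex.exp (ω * Complex.I), Complex.exp (-(ω * Complex.I))] i

theorem norm_raySign (i : Fin 4) : ‖raySign i‖ = 1 := by
  fin_cases i <;> simp [raySign]

theorem raySign_eq (i : Fin 4) : raySign i = 1 ∨ raySign i = -1 := by
  fin_cases i <;> simp [raySign]

theorem norm_exp_neg_mul_I (ω : ℝ) : ‖Complex.exp (-(ω * Complex.I))‖ = 1 := by
  have := Complex.norm_exp_ofReal_mul_I (-ω)
  rwa [Complex.ofReal_neg, neg_mul] at this

theorem re_exp_mul_I (ω : ℝ) : (Complex.exp (ω * Complex.I)).re = Real.cos ω :=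
  Complex.exp_ofReal_mul_I_re ω

theorem im_exp_mul_I (ω : ℝ) : (Complex.exp (ω * Complex.I)).im = Real.sin ω :=
  Complex.exp_ofReal_mul_I_im ω

theorem re_exp_neg_mul_I (ω : ℝ) : (Complex.exp (-(ω * Complex.I))).re = Real.cos ω := by
  have := Complex.exp_ofReal_mul_I_re (-ω)
  rwa [Complex.ofReal_neg, neg_mul, Real.cos_neg] at this

theorem im_exp_neg_mul_I (ω : ℝ) : (Complex.exp (-(ω * Complex.I))).im = -Real.sin ω := by
  have := Complex.exp_ofReal_mul_I_im (-ω)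
  rwa [Complex.ofReal_neg, neg_mul, Real.sin_neg] at this

theorem norm_rayDir (ω : ℝ) (i : Fin 4) : ‖rayDir ω i‖ = 1 := by
  fin_cases i <;> simp [rayDir, Complex.norm_exp_ofReal_mul_I, norm_exp_neg_mul_I]

theorem re_rayDir (ω : ℝ) (i : Fin 4) : (rayDir ω i).re = Real.cos ω := by
  fin_cases i <;> simp [rayDir, re_exp_neg_mul_I]

theorem norm_contourWt (ω : ℝ) (i : Fin 4) : ‖contourWt ω i‖ = 1 := by
  fin_cases i <;> simp [contourWt, Complex.norm_exp_ofReal_mul_I, norm_exp_neg_mul_I]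

theorem rayDir_eq (ω : ℝ) (i : Fin 4) :
    rayDir ω i = Complex.exp (ω * Complex.I) ∨ rayDir ω i = Complex.exp (-(ω * Complex.I)) := by
  fin_cases i <;> simp [rayDir]

theorem continuous_contourPt (a ω : ℝ) (i : Fin 4) : Continuous (contourPt a ω i) := by
  unfold contourPt; fun_prop

theorem norm_ofReal_mul_rayDir {ω t : ℝ} (ht : 0 < t) (i : Fin 4) : ‖(t : ℂ) * rayDir ω i‖ = t := by
  rw [norm_mul, norm_rayDir, mul_one, Complex.norm_real, Real.norm_of_nonneg ht.le]

theorem right_mem_bisector {φ a : ℝ} (ha : 0 ≤ a) (h0 : 0 < φ) (h1 : φ < Real.pi / 2) {x : ℂ}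
    (hx : 0 ≤ x.re) (hx' : x.re < Real.cos φ * ‖x‖) : (a : ℂ) + x ∈ bisector φ a := by
  have hc := cos_pos_of_lt h0 h1
  rw [mem_bisector_iff h0 h1, add_sub_cancel_left]
  refine ⟨hx', ?_⟩
  have h2 : x ≠ 0 := by rintro rfl; simp at hx'
  have h3 : (a : ℂ) + x + a ≠ 0 := by
    intro h
    have := congrArg Complex.re h
    simp at this
    have ha0 : a = 0 := by linarith
    subst ha0
    simp at h; exact h2 h
  have : 0 < Real.cos φ * ‖(a : ℂ) + x + a‖ := by positivity
  simp only [Complex.add_re, Complex.ofReal_re]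
  linarith

theorem contourPt_mem_bisector {φ a ω t : ℝ} (ha : 0 ≤ a) (h0 : 0 < φ) (h : φ < ω)
    (h1 : ω ≤ Real.pi / 2) (ht : 0 < t) (i : Fin 4) : contourPt a ω i t ∈ bisector φ a := by
  have hφ : φ < Real.pi / 2 := by linarith
  have key : (a : ℂ) + t * rayDir ω i ∈ bisector φ a := by
    apply right_mem_bisector ha h0 hφ
    · rw [Complex.re_ofReal_mul, re_rayDir]
      exact mul_nonneg ht.le (Real.cos_nonneg_of_mem_Icc ⟨by linarith, h1⟩)
    · rw [Complex.re_ofReal_mul, re_rayDir, norm_ofReal_mul_rayDir ht, mul_comm]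
      exact mul_lt_mul_of_pos_right (cos_lt_cos_of_lt h0 h h1) ht
  rcases raySign_eq i with hs | hs
  · rw [contourPt, hs, one_mul]; exact key
  · rw [contourPt, hs, neg_one_mul]; exact neg_mem_bisector h0 hφ key

theorem contourPt_outer {a ω t : ℝ} (ha : 0 ≤ a) (h0 : 0 < ω) (h1 : ω < Real.pi / 2)
    (ht : 0 < t) (i : Fin 4) : a < |(contourPt a ω i t).re| := by
  have : a < |((a : ℂ) + t * rayDir ω i).re| := by
    rw [Complex.add_re, Complex.re_ofReal_mul, re_rayDir, Complex.ofReal_re]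
    have := mul_pos ht (cos_pos_of_lt h0 h1)
    rw [abs_of_nonneg (by linarith)]; linarith
  rcases raySign_eq i with hs | hs
  · rw [contourPt, hs, one_mul]; exact this
  · rw [contourPt, hs, neg_one_mul, Complex.neg_re, abs_neg]; exact this

/-- The integral of `F` over the oriented boundary of `BS_{ω,a}`. -/
noncomputable def contourInt {E : Type*} [NormedAddCommGroup E] [NormedSpace ℂ E] (a ω : ℝ)
    (F : ℂ → E) : E :=
  ∑ i : Fin 4, ∫ t in Ioi (0 : ℝ), contourWt ω i • F (contourPt a ω i t)

/-- The integral of `F` over the right half of the boundary of `BS_{ω,a}`. -/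
noncomputable def rayDiff {E : Type*} [NormedAddCommGroup E] [NormedSpace ℂ E] (a ω : ℝ)
    (F : ℂ → E) : E :=
  (∫ t in Ioi (0 : ℝ), Complex.exp (ω * Complex.I) • F (a + t * Complex.exp (ω * Complex.I)))
    - ∫ t in Ioi (0 : ℝ),
        Complex.exp (-(ω * Complex.I)) • F (a + t * Complex.exp (-(ω * Complex.I)))

/-- The left half of the contour is the image of the right half under z ↦ -z, and dz changes sign.
All residue computations can therefore be done in a sector on the right. -/
theorem contourInt_eq_rayDiff {E : Type*} [NormedAddCommGroup E] [NormedSpace ℂ E] (a ω : ℝ)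
    (F : ℂ → E) : contourInt a ω F = rayDiff a ω F - rayDiff a ω (fun z => F (-z)) := by
  simp only [contourInt, rayDiff, Fin.sum_univ_four, contourWt, contourPt, raySign, rayDir]
  simp only [Matrix.cons_val, one_mul, neg_smul, integral_neg, neg_mul]
  abel

/-! ### Resolvents -/

section Resolvent
variable {X : Type*} [NormedAddCommGroup X] [NormedSpace ℂ X]

theorem HasResolventAt.unique {A : X →ₗ.[ℂ] X} {μ : ℂ} {R S : X →L[ℂ] X}
    (hR : HasResolventAt A μ R) (hS : HasResolventAt A μ S) : R = S := by
  ext y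
  obtain ⟨x, hx, hxy⟩ := hS.2 y
  rw [← hx, ← hR.1 x, hxy]

theorem resolventOf_spec {A : X →ₗ.[ℂ] X} {μ : ℂ} (h : μ ∈ resolventSetOf A) :
    HasResolventAt A μ (resolventOf A μ) := by
  have h' : ∃ R : X →L[ℂ] X, HasResolventAt A μ R := h
  rw [resolventOf, dif_pos h']; exact h'.choose_spec

theorem HasResolventAt.resolventOf_eq {A : X →ₗ.[ℂ] X} {μ : ℂ} {R : X →L[ℂ] X}
    (hR : HasResolventAt A μ R) : resolventOf A μ = R :=
  (resolventOf_spec ⟨R, hR⟩).unique hR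

theorem HasResolventAt.injective {A : X →ₗ.[ℂ] X} {μ : ℂ} {R : X →L[ℂ] X}
    (hR : HasResolventAt A μ R) : Function.Injective R := by
  rw [injective_iff_map_eq_zero]
  intro y hy
  obtain ⟨x, hx, hxy⟩ := hR.2 y
  rw [hy] at hx
  have : x = 0 := Subtype.ext hx
  rw [← hxy, this]; simp

theorem HasResolventAt.sub_eq {A : X →ₗ.[ℂ] X} {μ ν : ℂ} {R S : X →L[ℂ] X}
    (hR : HasResolventAt A μ R) (hS : HasResolventAt A ν S) :
    R - S = (ν - μ) • (R * S) := by
  ext y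
  obtain ⟨x, hx, hxy⟩ := hS.2 y
  have h1 : R (μ • (x : X) - A x) = x := hR.1 x
  have h2 : μ • (x : X) - A x = y - (ν - μ) • (x : X) := by rw [← hxy]; module
  rw [h2, map_sub, map_smul] at h1
  simp only [sub_apply, smul_apply,
    mul_apply_eq_comp]
  rw [← hx, sub_eq_iff_eq_add, add_comm, ← sub_eq_iff_eq_add]; exact h1

/-- A family of operators that behaves like the resolvent of an operator with spectrum in the
strip `|Re z| ≤ a`, with the resolvent bounds of a bisectorial operator of angle `π/2`. -/
structure IsOuterResolvent {𝔸 : Type*} [NormedRing 𝔸] [NormedAlgebra ℂ 𝔸] (R : ℂ → 𝔸) (a : ℝ) :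
    Prop where
  nonneg : 0 ≤ a
  ident : ∀ μ ν : ℂ, a < |μ.re| → a < |ν.re| → R μ - R ν = (ν - μ) • (R μ * R ν)
  inj : ∀ μ : ℂ, a < |μ.re| → ∀ y : 𝔸, R μ * y = 0 → y = 0
  right : ∀ κ : ℝ, 0 < κ → κ < 1 → ∃ C : ℝ, 0 < C ∧ ∀ μ : ℂ, a < μ.re →
    κ * ‖μ - a‖ ≤ (μ - a).re → ‖R μ‖ * ‖μ - a‖ ≤ C
  left : ∀ κ : ℝ, 0 < κ → κ < 1 → ∃ C : ℝ, 0 < C ∧ ∀ μ : ℂ, a < μ.re →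
    κ * ‖μ - a‖ ≤ (μ - a).re → ‖R (-μ)‖ * ‖μ - a‖ ≤ C

/-- At angle π/2 the bisector degenerates to the strip or the imaginary axis, so the spectrum lies
in the closed strip |Re z| ≤ a. -/
theorem IsBisectorialOp.outer_mem {A : X →ₗ.[ℂ] X} {a : ℝ}
    (hA : IsBisectorialOp A (Real.pi / 2) a) {μ : ℂ} (hμ : a < |μ.re|) :
    μ ∈ resolventSetOf A := by
  obtain ⟨-, -, ha, -, hs, -⟩ := hA
  by_contra h
  have h1 : μ ∈ closure (bisector (Real.pi / 2) a) := hs h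
  have h2 : bisector (Real.pi / 2) a ⊆ {z : ℂ | |z.re| ≤ a} := by
    intro z hz
    rw [bisector] at hz
    have hp : 0 < Real.pi - Real.pi / 2 := by linarith [Real.pi_pos]
    split_ifs at hz with h0
    · simp only [mem_ofPred_eq] at hz ⊢; rw [hz, abs_zero]; exact ha
    · obtain ⟨h3, h4⟩ := hz
      rw [mem_openSector_iff hp (by linarith [Real.pi_pos])] at h3 h4
      have e : Real.cos (Real.pi - Real.pi / 2) = 0 := by rw [sub_half, Real.cos_pi_div_two]
      rw [e, mul_zero] at h3 h4
      simp only [Complex.add_re, Complex.sub_re, Complex.ofReal_re] at h3 h4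
      rw [mem_ofPred_eq, abs_le]; constructor <;> linarith
  have h3 : μ ∈ {z : ℂ | |z.re| ≤ a} :=
    closure_minimal h2 (isClosed_le (by fun_prop) (by fun_prop)) h1
  exact absurd hμ (not_lt.2 h3)

theorem IsBisectorialOp.bound {A : X →ₗ.[ℂ] X} {a : ℝ}
    (hA : IsBisectorialOp A (Real.pi / 2) a) {κ : ℝ} (h0 : 0 < κ) (h1 : κ < 1) :
    ∃ C : ℝ, 0 < C ∧ ∀ μ : ℂ, a < μ.re → κ * ‖μ - a‖ ≤ (μ - a).re →
      ‖resolventOf A μ‖ * ‖μ - a‖ ≤ C ∧ ‖resolventOf A (-μ)‖ * ‖μ - a‖ ≤ C := by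
  obtain ⟨-, -, ha, -, -, hb⟩ := hA
  -- Half of κ leaves room: the cone of slope κ must avoid the closure of the bisector of angle φ,
  -- and slope κ itself would allow contact along the boundary.
  set φ := Real.arccos (κ / 2) with hφ
  have hφ0 : 0 < φ := Real.arccos_pos.2 (by linarith)
  have hφ1 : φ < Real.pi / 2 := Real.arccos_lt_pi_div_two.2 (by linarith)
  have hc : Real.cos φ = κ / 2 := Real.cos_arccos (by linarith) (by linarith)
  obtain ⟨C, hC⟩ := hb φ hφ0 hφ1
  refine ⟨max C 1, by positivity, fun μ hμ hμ' => ?_⟩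
  have hn : 0 < ‖μ - a‖ := by
    rw [norm_pos_iff]
    intro h
    have := congrArg Complex.re h
    simp at this; linarith
  have hle : ‖μ - a‖ ≤ ‖μ + a‖ := norm_sub_ofReal_le_norm_add ha (by linarith)
  have out : μ ∉ closure (bisector φ a) := by
    intro h
    have h2 : bisector φ a ⊆ {z : ℂ | (z - a).re ≤ Real.cos φ * ‖z - a‖} := fun z hz =>
      ((mem_bisector_iff hφ0 hφ1).1 hz).1.le
    have h3 := closure_minimal h2 (isClosed_le (by fun_prop) (by fun_prop)) h
    rw [mem_ofPred_eq, hc] at h3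
    nlinarith
  have out' : -μ ∉ closure (bisector φ a) := by
    intro h
    have h2 : bisector φ a ⊆ {z : ℂ | -(z + a).re ≤ Real.cos φ * ‖z + a‖} := fun z hz =>
      ((mem_bisector_iff hφ0 hφ1).1 hz).2.le
    have h3 := closure_minimal h2 (isClosed_le (by fun_prop) (by fun_prop)) h
    have e2 : ‖-μ + a‖ = ‖μ - a‖ := by rw [← norm_neg]; ring_nf
    rw [mem_ofPred_eq, hc, e2] at h3
    simp only [Complex.add_re, Complex.sub_re, Complex.ofReal_re, Complex.neg_re] at h3 hμ'
    nlinarith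
  constructor
  · have := hC μ out
    rw [min_eq_left hle] at this
    rw [mul_comm]; exact this.trans (le_max_left _ _)
  · have := hC (-μ) out'
    have e1 : ‖-μ - a‖ = ‖μ + a‖ := by rw [← norm_neg]; ring_nf
    have e2 : ‖-μ + a‖ = ‖μ - a‖ := by rw [← norm_neg]; ring_nf
    rw [e1, e2, min_eq_right hle] at this
    rw [mul_comm]; exact this.trans (le_max_left _ _)

theorem IsBisectorialOp.isOuterResolvent {A : X →ₗ.[ℂ] X} {a : ℝ}
    (hA : IsBisectorialOp A (Real.pi / 2) a) : IsOuterResolvent (resolventOf A) a where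
  nonneg := hA.2.2.1
  ident μ ν hμ hν := (resolventOf_spec (hA.outer_mem hμ)).sub_eq (resolventOf_spec (hA.outer_mem hν))
  inj μ hμ y hy := by
    ext x
    refine (resolventOf_spec (hA.outer_mem hμ)).injective ?_
    rw [← mul_apply_eq_comp, hy]; simp
  right κ h0 h1 := by
    obtain ⟨C, hC, h⟩ := hA.bound h0 h1
    exact ⟨C, hC, fun μ hμ hμ' => (h μ hμ hμ').1⟩
  left κ h0 h1 := by
    obtain ⟨C, hC, h⟩ := hA.bound h0 h1
    exact ⟨C, hC, fun μ hμ hμ' => (h μ hμ hμ').2⟩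

end Resolvent

/-! ### Cauchy's theorem on bisectors -/

section Cauchy
variable {E : Type*} [NormedAddCommGroup E] [NormedSpace ℂ E] [CompleteSpace E]

/-- Primitives on a bisector are not defined at the vertices, so only a one-sided limit at 0 is
available; redefining Φ at 0 by this limit gives the usual fundamental theorem. -/
theorem integral_Ioi_of_hasDerivAt_of_tendsto_nhdsGT {Φ Φ' : ℝ → E} {S m : E}
    (hd : ∀ t ∈ Ioi (0 : ℝ), HasDerivAt Φ (Φ' t) t) (hi : IntegrableOn Φ' (Ioi 0))
    (h0 : Tendsto Φ (𝓝[>] 0) (𝓝 S)) (h1 : Tendsto Φ atTop (𝓝 m)) :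
    ∫ t in Ioi (0 : ℝ), Φ' t = m - S := by
  have key : ∀ t ∈ Ioi (0 : ℝ), Function.update Φ 0 S =ᶠ[𝓝 t] Φ := fun t ht => by
    filter_upwards [isOpen_Ioi.mem_nhds ht] with x hx
    exact Function.update_of_ne (ne_of_gt hx) _ _
  have := integral_Ioi_of_hasDerivAt_of_tendsto (f := Function.update Φ 0 S) (f' := Φ') (m := m)
    (a := 0) ?_ (fun t ht => (hd t ht).congr_of_eventuallyEq (key t ht)) hi ?_
  · simpa using this
  · rw [continuousWithinAt_update_same, Ici_sdiff_left]; exact h0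
  · refine h1.congr' ?_
    filter_upwards [Ioi_mem_atTop (0 : ℝ)] with x hx
    exact (Function.update_of_ne (ne_of_gt hx) _ _).symm

/-- The part of a bisector in the upper half plane is convex. -/
def upperBisector (φ a : ℝ) : Set ℂ :=
  ({z : ℂ | 0 < z.im} ∩ {z : ℂ | Real.sin φ * z.re - Real.cos φ * z.im < Real.sin φ * a}) ∩
    {z : ℂ | -(Real.sin φ) * z.re - Real.cos φ * z.im < Real.sin φ * a}

theorem isOpen_upperBisector (φ a : ℝ) : IsOpen (upperBisector φ a) :=
  ((isOpen_lt (by fun_prop) (by fun_prop)).inter (isOpen_lt (by fun_prop) (by fun_prop))).inter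
    (isOpen_lt (by fun_prop) (by fun_prop))

theorem convex_upperBisector (φ a : ℝ) : Convex ℝ (upperBisector φ a) := by
  refine ((convex_halfSpace_im_gt 0).inter (convex_halfSpace_lt (f := fun z : ℂ =>
    Real.sin φ * z.re - Real.cos φ * z.im) ⟨?_, ?_⟩ _)).inter (convex_halfSpace_lt
    (f := fun z : ℂ => -(Real.sin φ) * z.re - Real.cos φ * z.im) ⟨?_, ?_⟩ _) <;>
  · intros; simp; ring

/-- On the upper half plane the cone condition follows from a linear one, by squaring and using sin²
+ cos² = 1. This is how the convex set `upperBisector` is seen to lie in the bisector. -/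
theorem re_lt_cos_mul_norm {φ : ℝ} (h0 : 0 < φ) (h1 : φ < Real.pi / 2) {z : ℂ} (hz : 0 < z.im)
    (h : Real.sin φ * z.re < Real.cos φ * z.im) : z.re < Real.cos φ * ‖z‖ := by
  have hc := cos_pos_of_lt h0 h1
  have hs : 0 < Real.sin φ := Real.sin_pos_of_pos_of_lt_pi h0 (by linarith)
  have hn : 0 < ‖z‖ := norm_pos_iff.2 (by rintro rfl; simp at hz)
  rcases le_or_gt z.re 0 with h2 | h2
  · exact h2.trans_lt (by positivity)
  · rw [← sq_lt_sq₀ h2.le (by positivity), mul_pow, Complex.sq_norm, Complex.normSq_apply]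
    have h3 : (Real.sin φ * z.re) ^ 2 < (Real.cos φ * z.im) ^ 2 :=
      (sq_lt_sq₀ (by positivity) (by positivity)).2 h
    have h4 := Real.sin_sq_add_cos_sq φ
    have h5 : Real.sin φ ^ 2 = 1 - Real.cos φ ^ 2 := by linarith
    rw [mul_pow, h5] at h3
    nlinarith

theorem upperBisector_subset {φ a : ℝ} (h0 : 0 < φ) (h1 : φ < Real.pi / 2) :
    upperBisector φ a ⊆ bisector φ a := by
  rintro z ⟨⟨hz, hz1⟩, hz2⟩
  simp only [mem_ofPred_eq] at hz hz1 hz2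
  rw [mem_bisector_iff h0 h1]
  constructor
  · apply re_lt_cos_mul_norm h0 h1 <;> simp <;> linarith
  · have := re_lt_cos_mul_norm h0 h1 (z := ⟨-(z.re + a), z.im⟩) hz (by simp only; linarith)
    have e : ‖(⟨-(z.re + a), z.im⟩ : ℂ)‖ = ‖z + a‖ := by
      rw [Complex.norm_def, Complex.norm_def, Complex.normSq_apply, Complex.normSq_apply]
      simp only [Complex.add_re, Complex.ofReal_re, Complex.add_im, Complex.ofReal_im, add_zero,
        neg_mul_neg]
    rw [e] at this; simpa using this

theorem mk_mem_upperBisector {φ ω a t x : ℝ} (h0 : 0 < φ) (h : φ < ω) (h1 : ω < Real.pi / 2)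
    (ht : 0 < t) (hx : |x| ≤ a + t * Real.cos ω) :
    (⟨x, t * Real.sin ω⟩ : ℂ) ∈ upperBisector φ a := by
  have hs : 0 < Real.sin φ := Real.sin_pos_of_pos_of_lt_pi h0 (by linarith)
  have hs' : 0 < Real.sin ω := Real.sin_pos_of_pos_of_lt_pi (by linarith) (by linarith)
  have hd : 0 < Real.sin (ω - φ) := Real.sin_pos_of_pos_of_lt_pi (by linarith) (by linarith)
  rw [Real.sin_sub] at hd
  have h3 : t * (Real.cos ω * Real.sin φ) < t * (Real.sin ω * Real.cos φ) :=
    mul_lt_mul_of_pos_left (by linarith) ht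
  rw [abs_le] at hx
  refine ⟨⟨mul_pos ht hs', ?_⟩, ?_⟩
  · have := mul_le_mul_of_nonneg_left hx.2 hs.le
    simp only [mem_ofPred_eq]; linarith
  · have := mul_le_mul_of_nonneg_left hx.1 hs.le
    simp only [mem_ofPred_eq]; linarith

theorem add_mul_exp_eq (a t ω : ℝ) : (a : ℂ) + t * Complex.exp (ω * Complex.I) =
    ⟨a + t * Real.cos ω, t * Real.sin ω⟩ := by
  apply Complex.ext <;> simp

theorem neg_add_mul_exp_eq (a t ω : ℝ) : -((a : ℂ) + t * Complex.exp (-(ω * Complex.I))) =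
    ⟨-(a + t * Real.cos ω), t * Real.sin ω⟩ := by
  apply Complex.ext <;> simp [re_exp_neg_mul_I, im_exp_neg_mul_I]

omit [CompleteSpace E] in
theorem hasDerivAt_comp_ray {P : ℂ → E} {p' : E} {d v : ℂ} {t : ℝ} (h : HasDerivAt P p' (d + t * v)) :
    HasDerivAt (fun s : ℝ => P (d + s * v)) (v • p') t := by
  have h2 : HasDerivAt (fun s : ℝ => d + (s : ℂ) * v) v t := by
    simpa using ((Complex.ofRealCLM.hasDerivAt (x := t)).mul_const v).const_add d
  exact h.scomp t h2

variable {F : ℂ → E} {a φ ω C : ℝ}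

omit [CompleteSpace E] in
-- The horizontal chord joining the two upper rays collapses to the segment [-a, a]. Dominated
-- convergence applies because F is bounded, although F is not controlled at the vertices
-- themselves.
theorem tendsto_integral_horizontal (ha : 0 ≤ a) (h0 : 0 < φ) (h : φ < ω) (h1 : ω < Real.pi / 2)
    (hol : DifferentiableOn ℂ F (bisector φ a)) (hC : ∀ z ∈ bisector φ a, ‖F z‖ ≤ C) :
    Tendsto (fun t : ℝ => ∫ x in (-(a + t * Real.cos ω))..(a + t * Real.cos ω),
      F ⟨x, t * Real.sin ω⟩) (𝓝[>] 0) (𝓝 (∫ x in (-a)..a, F x)) := by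
  have hφ : φ < Real.pi / 2 := by linarith
  have hc : 0 < Real.cos ω := cos_pos_of_lt (by linarith) h1
  have hmem : ∀ t x : ℝ, 0 < t → |x| ≤ a + t * Real.cos ω →
      (⟨x, t * Real.sin ω⟩ : ℂ) ∈ bisector φ a := fun t x ht hx =>
    upperBisector_subset h0 hφ (mk_mem_upperBisector h0 h h1 ht hx)
  have hpt : ∀ t ∈ Ioi (0 : ℝ), ∫ x in (-(a + t * Real.cos ω))..(a + t * Real.cos ω),
      F ⟨x, t * Real.sin ω⟩ = ∫ x, (Ioc (-(a + t * Real.cos ω)) (a + t * Real.cos ω)).indicator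
        (fun x => F ⟨x, t * Real.sin ω⟩) x := fun t ht => by
    have : 0 < t * Real.cos ω := mul_pos ht hc
    rw [intervalIntegral.integral_of_le (by linarith), integral_indicator measurableSet_Ioc]
  have hlim : ∫ x in (-a)..a, F x = ∫ x, (Ioc (-a) a).indicator (fun x : ℝ => F x) x := by
    rw [intervalIntegral.integral_of_le (by linarith), integral_indicator measurableSet_Ioc]
  rw [hlim]
  refine Tendsto.congr' (f₁ := fun t : ℝ => ∫ x,
    (Ioc (-(a + t * Real.cos ω)) (a + t * Real.cos ω)).indicator
        (fun x => F ⟨x, t * Real.sin ω⟩) x) ?_ ?_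
  · filter_upwards [self_mem_nhdsWithin] with t ht using (hpt t ht).symm
  refine tendsto_integral_filter_of_dominated_convergence
    ((Icc (-(a + 1)) (a + 1)).indicator (fun _ => |C|)) ?_ ?_ ?_ ?_
  · filter_upwards [self_mem_nhdsWithin] with t ht
    rw [aestronglyMeasurable_indicator_iff measurableSet_Ioc]
    refine ContinuousOn.aestronglyMeasurable ?_ measurableSet_Ioc
    refine hol.continuousOn.comp (f := fun x : ℝ => (⟨x, t * Real.sin ω⟩ : ℂ)) ?_ ?_
    · have : (fun x : ℝ => (⟨x, t * Real.sin ω⟩ : ℂ)) =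
        fun x : ℝ => (x : ℂ) + (t * Real.sin ω : ℝ) * Complex.I := by
        ext x; exact Complex.mk_eq_add_mul_I _ _
      rw [this]; fun_prop
    · intro x hx; exact hmem t x ht (abs_le.2 ⟨hx.1.le, hx.2⟩)
  · filter_upwards [Ioo_mem_nhdsGT (show (0 : ℝ) < 1 by norm_num)] with t ht
    refine ae_of_all _ fun x => ?_
    by_cases hx : x ∈ Ioc (-(a + t * Real.cos ω)) (a + t * Real.cos ω)
    · have h2 : t * Real.cos ω ≤ 1 := by nlinarith [ht.1, ht.2, Real.cos_le_one ω]
      rw [indicator_of_mem hx, indicator_of_mem (show x ∈ Icc (-(a + 1)) (a + 1) from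
        ⟨by linarith [hx.1], by linarith [hx.2]⟩)]
      exact (hC _ (hmem t x ht.1 (abs_le.2 ⟨hx.1.le, hx.2⟩))).trans (le_abs_self _)
    · rw [indicator_of_notMem hx, norm_zero]
      exact indicator_nonneg (fun _ _ => abs_nonneg _) _
  · exact (integrable_indicator_iff measurableSet_Icc).2 (by simp)
  · have hnull : ∀ᵐ x : ℝ, x ≠ a ∧ x ≠ -a := by
      have h1 : ∀ᵐ x : ℝ, x ≠ a := by simp [ae_iff]
      have h2 : ∀ᵐ x : ℝ, x ≠ -a := by simp [ae_iff]
      exact h1.and h2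
    filter_upwards [hnull] with x hx
    have htc : Tendsto (fun t : ℝ => a + t * Real.cos ω) (𝓝[>] 0) (𝓝 a) := by
      have : Continuous (fun t : ℝ => a + t * Real.cos ω) := by fun_prop
      simpa using (this.tendsto 0).mono_left nhdsWithin_le_nhds
    rcases lt_or_ge a |x| with hxa | hxa
    · have hx' : x ∉ Ioc (-a) a := fun hm => absurd hxa (not_lt.2 (abs_le.2 ⟨hm.1.le, hm.2⟩))
      rw [indicator_of_notMem hx']
      refine tendsto_const_nhds.congr' ?_
      filter_upwards [htc.eventually (gt_mem_nhds hxa)] with t ht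
      rw [indicator_of_notMem]
      exact fun hm => absurd ht (not_lt.2 (abs_le.2 ⟨hm.1.le, hm.2⟩))
    · have hxa' : |x| < a := lt_of_le_of_ne hxa (fun e => by
        rcases abs_choice x with h' | h' <;> rw [h'] at e
        · exact hx.1 e
        · exact hx.2 (by linarith))
      have ha' : 0 < a := (abs_nonneg x).trans_lt hxa'
      have hxm : (x : ℂ) ∈ bisector φ a := by
        have hκ := cos_pos_of_lt h0 hφ
        rw [mem_bisector_iff h0 hφ]
        rw [abs_lt] at hxa'
        constructor
        · refine lt_of_lt_of_le (b := 0) ?_ (by positivity)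
          simp; linarith
        · refine lt_of_lt_of_le (b := 0) ?_ (by positivity)
          simp; linarith
      have hx' : x ∈ Ioc (-a) a := ⟨(abs_lt.1 hxa').1, (abs_lt.1 hxa').2.le⟩
      rw [indicator_of_mem hx']
      have hcont : ContinuousAt F x :=
        (hol.continuousOn.continuousAt ((isOpen_bisector h0 hφ).mem_nhds hxm))
      have hpath : Tendsto (fun t : ℝ => (⟨x, t * Real.sin ω⟩ : ℂ)) (𝓝[>] 0) (𝓝 (x : ℂ)) := by
        have e : (fun t : ℝ => (⟨x, t * Real.sin ω⟩ : ℂ)) =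
            fun t : ℝ => (x : ℂ) + (t * Real.sin ω : ℝ) * Complex.I := by
          ext x; exact Complex.mk_eq_add_mul_I _ _
        have : Continuous (fun t : ℝ => (x : ℂ) + (t * Real.sin ω : ℝ) * Complex.I) := by fun_prop
        rw [e]
        simpa using (this.tendsto 0).mono_left nhdsWithin_le_nhds
      refine (hcont.tendsto.comp hpath).congr' ?_
      filter_upwards [self_mem_nhdsWithin] with t ht
      have : 0 < t * Real.cos ω := mul_pos ht hc
      rw [indicator_of_mem (show x ∈ Ioc (-(a + t * Real.cos ω)) (a + t * Real.cos ω) from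
        ⟨by linarith [hx'.1], by linarith [hx'.2]⟩)]; rfl

/-- Close the two upper rays by a horizontal chord. A primitive on the convex set `upperBisector`
turns the sum of ray integrals into the limits of the chord integral: at height 0 it is the integral
over [-a, a], and at infinity it vanishes because z F(z) → 0 while the length of the chord is of the
order of its height. -/
theorem upper_contour_integral (ha : 0 ≤ a) (h0 : 0 < φ) (h : φ < ω) (h1 : ω < Real.pi / 2)
    (hol : DifferentiableOn ℂ F (bisector φ a)) (hC : ∀ z ∈ bisector φ a, ‖F z‖ ≤ C)
    (hinf : Tendsto (fun z => z • F z) (Bornology.cobounded ℂ ⊓ 𝓟 (bisector φ a)) (𝓝 0))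
    (hi1 : IntegrableOn (fun t : ℝ => F (a + t * Complex.exp (ω * Complex.I))) (Ioi 0))
    (hi2 : IntegrableOn (fun t : ℝ => F (-(a + t * Complex.exp (-(ω * Complex.I))))) (Ioi 0)) :
    (∫ t in Ioi (0 : ℝ), Complex.exp (ω * Complex.I) • F (a + t * Complex.exp (ω * Complex.I)))
      + (∫ t in Ioi (0 : ℝ), Complex.exp (-(ω * Complex.I)) •
          F (-(a + t * Complex.exp (-(ω * Complex.I))))) = -∫ x in (-a)..a, F x := by
  have hφ : φ < Real.pi / 2 := by linarith
  have hc : 0 < Real.cos ω := cos_pos_of_lt (by linarith) h1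
  have hs : 0 < Real.sin ω := Real.sin_pos_of_pos_of_lt_pi (by linarith) (by linarith)
  have hsub := upperBisector_subset (a := a) h0 hφ
  obtain ⟨P, hP⟩ := (convex_upperBisector φ a).exists_forall_hasDerivWithinAt (hol.mono hsub)
  replace hP : ∀ z ∈ upperBisector φ a, HasDerivAt P (F z) z := fun z hz =>
    (hP z hz).hasDerivAt ((isOpen_upperBisector φ a).mem_nhds hz)
  have hm1 : ∀ t : ℝ, 0 < t → (a : ℂ) + t * Complex.exp (ω * Complex.I) ∈ upperBisector φ a := by
    intro t ht
    have := mul_pos ht hc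
    rw [add_mul_exp_eq]; exact mk_mem_upperBisector h0 h h1 ht (abs_of_nonneg (by linarith)).le
  have hm2 : ∀ t : ℝ, 0 < t → -((a : ℂ) + t * Complex.exp (-(ω * Complex.I))) ∈
      upperBisector φ a := by
    intro t ht
    have := mul_pos ht hc
    rw [neg_add_mul_exp_eq]
    exact mk_mem_upperBisector h0 h h1 ht (by rw [abs_neg]; exact (abs_of_nonneg (by linarith)).le)
  have hi1' : IntegrableOn (fun t : ℝ => Complex.exp (ω * Complex.I) •
    F (a + t * Complex.exp (ω * Complex.I))) (Ioi 0) := hi1.smul _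
  have hi2' : IntegrableOn (fun t : ℝ => Complex.exp (-(ω * Complex.I)) •
    F (-(a + t * Complex.exp (-(ω * Complex.I))))) (Ioi 0) := hi2.smul _
  rw [← integral_add hi1' hi2']
  have hi12 : IntegrableOn (fun t : ℝ => Complex.exp (ω * Complex.I) •
      F (a + t * Complex.exp (ω * Complex.I)) + Complex.exp (-(ω * Complex.I)) •
      F (-(a + t * Complex.exp (-(ω * Complex.I))))) (Ioi 0) := hi1'.add hi2'
  rw [integral_Ioi_of_hasDerivAt_of_tendsto_nhdsGT (S := ∫ x in (-a)..a, F x) (m := 0)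
    (Φ := fun t : ℝ => P (a + t * Complex.exp (ω * Complex.I)) -
      P (-(a + t * Complex.exp (-(ω * Complex.I))))) ?_ hi12 ?_ ?_,
    zero_sub]
  · intro t ht
    have d1 := hasDerivAt_comp_ray (hP _ (hm1 t ht))
    have d2 : HasDerivAt (fun s : ℝ => P (-(a + s * Complex.exp (-(ω * Complex.I)))))
        (-Complex.exp (-(ω * Complex.I)) • F (-(a + t * Complex.exp (-(ω * Complex.I))))) t := by
      have e : ∀ s : ℝ, -((a : ℂ) + s * Complex.exp (-(ω * Complex.I))) =
        -(a : ℂ) + s * (-Complex.exp (-(ω * Complex.I))) := fun s => by ring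
      simp only [e]
      apply hasDerivAt_comp_ray
      rw [← e]; exact hP _ (hm2 t ht)
    have := d1.sub d2
    rw [neg_smul, sub_neg_eq_add] at this
    exact this
  · refine (tendsto_integral_horizontal ha h0 h h1 hol hC).congr' ?_
    filter_upwards [self_mem_nhdsWithin] with t ht
    have ht' : (0 : ℝ) < t := ht
    have hp := mul_pos ht' hc
    rw [add_mul_exp_eq, neg_add_mul_exp_eq]
    have e : ∀ x : ℝ, (⟨x, t * Real.sin ω⟩ : ℂ) = ⟨0, t * Real.sin ω⟩ + x * 1 := fun x => by
      apply Complex.ext <;> simp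
    have hu : uIcc (-(a + t * Real.cos ω)) (a + t * Real.cos ω) =
        Icc (-(a + t * Real.cos ω)) (a + t * Real.cos ω) := uIcc_of_le (by linarith)
    have hd : ∀ x ∈ uIcc (-(a + t * Real.cos ω)) (a + t * Real.cos ω),
        HasDerivAt (fun y : ℝ => P ⟨y, t * Real.sin ω⟩) (F ⟨x, t * Real.sin ω⟩) x := by
      intro x hx
      rw [hu] at hx
      have := hasDerivAt_comp_ray (P := P) (p' := F ⟨x, t * Real.sin ω⟩)
        (d := ⟨0, t * Real.sin ω⟩) (v := 1) (t := x) (by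
          rw [← e]; exact hP _ (mk_mem_upperBisector h0 h h1 ht (abs_le.2 hx)))
      simp only [← e, one_smul] at this
      exact this
    rw [intervalIntegral.integral_eq_sub_of_hasDerivAt hd]
    refine ContinuousOn.intervalIntegrable ?_
    refine hol.continuousOn.comp (f := fun x : ℝ => (⟨x, t * Real.sin ω⟩ : ℂ)) ?_ ?_
    · simp only [Complex.mk_eq_add_mul_I]; fun_prop
    · intro x hx; rw [hu] at hx
      exact hsub (mk_mem_upperBisector h0 h h1 ht (abs_le.2 hx))
  · rw [tendsto_zero_iff_norm_tendsto_zero, Metric.tendsto_nhds]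
    intro ε hε
    -- For t ≥ 1 the chord, of length 2(a + t cos ω), is at most K times its height t sin ω.
    set K := 2 * (a + 1) / Real.sin ω with hK
    have hKpos : 0 < K := by positivity
    have hinf' := (Metric.tendsto_nhds.1 hinf) (ε / (2 * K)) (by positivity)
    rw [eventually_inf_principal, ← comap_norm_atTop, eventually_comap,
      eventually_atTop] at hinf'
    obtain ⟨M, hM⟩ := hinf'
    filter_upwards [eventually_ge_atTop (max 1 (M / Real.sin ω))] with t ht
    have ht1 : 1 ≤ t := (le_max_left _ _).trans ht
    have ht0 : 0 < t := by linarith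
    have htM : M ≤ t * Real.sin ω := by
      rw [← div_le_iff₀ hs]; exact (le_max_right _ _).trans ht
    have hp := mul_pos ht0 hc
    rw [add_mul_exp_eq, neg_add_mul_exp_eq, Real.dist_0_eq_abs, abs_norm]
    set S : Set ℂ := {z : ℂ | -(a + t * Real.cos ω) ≤ z.re} ∩ {z : ℂ | z.re ≤ a + t * Real.cos ω} ∩
      ({z : ℂ | t * Real.sin ω ≤ z.im} ∩ {z : ℂ | z.im ≤ t * Real.sin ω})
    have hSc : Convex ℝ S := ((convex_halfSpace_re_ge _).inter (convex_halfSpace_re_le _)).inter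
      ((convex_halfSpace_im_ge _).inter (convex_halfSpace_im_le _))
    have hSm : ∀ z ∈ S, z ∈ upperBisector φ a := by
      rintro z ⟨⟨h2, h3⟩, h4, h5⟩
      have : z = ⟨z.re, t * Real.sin ω⟩ := Complex.ext rfl (le_antisymm h5 h4)
      rw [this]; exact mk_mem_upperBisector h0 h h1 ht0 (abs_le.2 ⟨h2, h3⟩)
    have hbd : ∀ z ∈ S, ‖F z‖ ≤ ε / (2 * K) / (t * Real.sin ω) := by
      intro z hz
      have him : t * Real.sin ω ≤ ‖z‖ := hz.2.1.trans ((le_abs_self _).trans (Complex.abs_im_le_norm z))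
      have := hM ‖z‖ (htM.trans him) z rfl (hsub (hSm z hz))
      rw [dist_zero_right, norm_smul] at this
      rw [le_div_iff₀ (by positivity)]
      have h6 : ‖F z‖ * (t * Real.sin ω) ≤ ‖F z‖ * ‖z‖ := by gcongr
      linarith [mul_comm ‖F z‖ ‖z‖]
    have := hSc.norm_image_sub_le_of_norm_hasDerivWithin_le
      (fun z hz => (hP z (hSm z hz)).hasDerivWithinAt) hbd
      (x := ⟨-(a + t * Real.cos ω), t * Real.sin ω⟩) (y := ⟨a + t * Real.cos ω, t * Real.sin ω⟩)
      ⟨⟨by simp, by simp only [mem_ofPred_eq]; linarith⟩, by simp, by simp⟩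
      ⟨⟨by simp only [mem_ofPred_eq]; linarith, by simp⟩, by simp, by simp⟩
    refine this.trans_lt ?_
    have e : ‖(⟨a + t * Real.cos ω, t * Real.sin ω⟩ : ℂ) - ⟨-(a + t * Real.cos ω), t * Real.sin ω⟩‖
        = 2 * (a + t * Real.cos ω) := by
      have : (⟨a + t * Real.cos ω, t * Real.sin ω⟩ : ℂ) - ⟨-(a + t * Real.cos ω), t * Real.sin ω⟩
        = ((2 * (a + t * Real.cos ω) : ℝ) : ℂ) := by
        apply Complex.ext
        · simp only [Complex.sub_re, Complex.ofReal_re]; ring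
        · simp only [Complex.sub_im, Complex.ofReal_im]; ring
      rw [this, Complex.norm_real, Real.norm_of_nonneg (by linarith)]
    rw [e]
    have h7 : 2 * (a + t * Real.cos ω) ≤ K * (t * Real.sin ω) := by
      have : K * (t * Real.sin ω) = 2 * (a + 1) * t := by rw [hK]; field_simp
      rw [this]; nlinarith [Real.cos_le_one ω]
    calc ε / (2 * K) / (t * Real.sin ω) * (2 * (a + t * Real.cos ω))
        ≤ ε / (2 * K) / (t * Real.sin ω) * (K * (t * Real.sin ω)) := by gcongr
      _ = ε / 2 := by field_simp
      _ < ε := by linarith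

/-- **Cauchy's theorem** for the boundary of a bisector. -/
theorem contourInt_eq_zero (ha : 0 ≤ a) (h0 : 0 < φ) (h : φ < ω) (h1 : ω < Real.pi / 2)
    (hol : DifferentiableOn ℂ F (bisector φ a)) (hC : ∀ z ∈ bisector φ a, ‖F z‖ ≤ C)
    (hinf : Tendsto (fun z => z • F z) (Bornology.cobounded ℂ ⊓ 𝓟 (bisector φ a)) (𝓝 0))
    (hi : ∀ i, IntegrableOn (fun t : ℝ => F (contourPt a ω i t)) (Ioi 0)) :
    contourInt a ω F = 0 := by
  have hφ : φ < Real.pi / 2 := by linarith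
  have i0 := hi 0
  have i1 := hi 1
  have i2 := hi 2
  have i3 := hi 3
  simp only [contourPt, raySign, rayDir, Matrix.cons_val, one_mul, neg_mul] at i0 i1 i2 i3
  have u := upper_contour_integral ha h0 h h1 hol hC hinf i0 i3
  -- The lower half is the upper half for z ↦ F(-z). Both halves produce the same integral over [-a,
  -- a], which cancels because the halves enter the oriented contour with opposite signs.
  have l := upper_contour_integral (F := fun z => F (-z)) (C := C) ha h0 h h1
    (hol.comp differentiable_neg.differentiableOn (fun z hz => neg_mem_bisector h0 hφ hz))
    (fun z hz => hC _ (neg_mem_bisector h0 hφ hz)) ?_ i2 (by simpa only [neg_neg] using i1)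
  · have e : ∫ x in (-a)..a, F (-(x : ℂ)) = ∫ x in (-a)..a, F x := by
      have := intervalIntegral.integral_comp_neg (a := -a) (b := a) (fun x : ℝ => F x)
      simpa using this
    rw [e] at l
    simp only [neg_neg] at l
    rw [contourInt_eq_rayDiff, rayDiff, rayDiff]
    rw [← sub_eq_zero.2 (u.trans l.symm)]
    abel
  · have hneg : Tendsto (fun z : ℂ => -z) (Bornology.cobounded ℂ ⊓ 𝓟 (bisector φ a))
        (Bornology.cobounded ℂ ⊓ 𝓟 (bisector φ a)) := by
      refine tendsto_inf.2 ⟨(tendsto_neg_cobounded.mono_left inf_le_left), ?_⟩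
      exact tendsto_principal.2 (eventually_inf_principal.2
        (Eventually.of_forall fun z hz => neg_mem_bisector h0 hφ hz))
    have := (hinf.comp hneg).neg
    simpa [Function.comp_def] using this

end Cauchy

/-! ### Residues in a sector -/

section Residue
variable {E : Type*} [NormedAddCommGroup E] [NormedSpace ℂ E] [CompleteSpace E]

omit [NormedSpace ℂ E] [CompleteSpace E] in
theorem integrableOn_of_le_inv_sq [NormedSpace ℝ E] {f : ℝ → E} {C : ℝ} (hf : ContinuousOn f (Ioi 0))
    (h : ∀ t, 0 < t → ‖f t‖ * (1 + t) ^ 2 ≤ C) : IntegrableOn f (Ioi 0) := by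
  have hi : Integrable (fun t : ℝ => C * (1 + t ^ 2)⁻¹) (volume.restrict (Ioi 0)) :=
    (integrable_inv_one_add_sq.const_mul C).restrict
  refine hi.mono' (hf.aestronglyMeasurable measurableSet_Ioi) ?_
  refine (ae_restrict_iff' measurableSet_Ioi).2 (ae_of_all _ fun t ht => ?_)
  have ht' : (0 : ℝ) < t := ht
  rw [← div_eq_mul_inv, le_div_iff₀ (by positivity)]
  refine le_trans ?_ (h t ht)
  gcongr
  nlinarith

/-- Cauchy's theorem in a sector, closed by vertical chords between the two rays. A chord with
parameter t has length 2t sin ω: boundedness of H suffices near the vertex, and quadratic decay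
suffices near infinity. -/
theorem rayDiff_eq_zero {H : ℂ → E} {a ω C r₀ r₁ : ℝ} {U : Set ℂ} (h0 : 0 < ω)
    (h1 : ω < Real.pi / 2) (hU : Convex ℝ U) (hUo : IsOpen U)
    (hUc : ∀ z : ℂ, a < z.re → Real.cos ω * ‖z - a‖ ≤ (z - a).re → z ∈ U)
    (hol : DifferentiableOn ℂ H U) (hr₀ : 0 < r₀)
    (hz : ∀ z : ℂ, a < z.re → z.re < a + r₀ → Real.cos ω * ‖z - a‖ ≤ (z - a).re → ‖H z‖ ≤ C)
    (hinf : ∀ z : ℂ, a < z.re → a + r₁ < z.re → Real.cos ω * ‖z - a‖ ≤ (z - a).re →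
      ‖H z‖ * ‖z - a‖ ^ 2 ≤ C)
    (hi1 : IntegrableOn (fun t : ℝ => H (a + t * Complex.exp (ω * Complex.I))) (Ioi 0))
    (hi2 : IntegrableOn (fun t : ℝ => H (a + t * Complex.exp (-(ω * Complex.I)))) (Ioi 0)) :
    rayDiff a ω H = 0 := by
  have hc : 0 < Real.cos ω := cos_pos_of_lt (by linarith) h1
  have hs : 0 < Real.sin ω := Real.sin_pos_of_pos_of_lt_pi (by linarith) (by linarith)
  obtain ⟨P, hP⟩ := hU.exists_forall_hasDerivWithinAt hol
  replace hP : ∀ z ∈ U, HasDerivAt P (H z) z := fun z hz => (hP z hz).hasDerivAt (hUo.mem_nhds hz)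
  have e1 : ∀ t : ℝ, ((a : ℂ) + t * Complex.exp (ω * Complex.I)) =
      ⟨a + t * Real.cos ω, t * Real.sin ω⟩ := fun t => add_mul_exp_eq a t ω
  have e2 : ∀ t : ℝ, ((a : ℂ) + t * Complex.exp (-(ω * Complex.I))) =
      ⟨a + t * Real.cos ω, -(t * Real.sin ω)⟩ := fun t => by
    apply Complex.ext <;> simp [re_exp_neg_mul_I, im_exp_neg_mul_I]
  have hseg : ∀ t K : ℝ, 0 < t → (∀ z : ℂ, z.re = a + t * Real.cos ω →
      Real.cos ω * ‖z - a‖ ≤ (z - a).re → ‖H z‖ ≤ K) →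
      ‖P (a + t * Complex.exp (ω * Complex.I)) - P (a + t * Complex.exp (-(ω * Complex.I)))‖ ≤
        K * (2 * (t * Real.sin ω)) := by
    intro t K ht hK
    have hp := mul_pos ht hc
    have hq := mul_pos ht hs
    set S : Set ℂ := ({z : ℂ | a + t * Real.cos ω ≤ z.re} ∩ {z : ℂ | z.re ≤ a + t * Real.cos ω}) ∩
      ({z : ℂ | -(t * Real.sin ω) ≤ z.im} ∩ {z : ℂ | z.im ≤ t * Real.sin ω})
    have hSc : Convex ℝ S := ((convex_halfSpace_re_ge _).inter (convex_halfSpace_re_le _)).inter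
      ((convex_halfSpace_im_ge _).inter (convex_halfSpace_im_le _))
    have hSm : ∀ z ∈ S, z.re = a + t * Real.cos ω ∧ Real.cos ω * ‖z - a‖ ≤ (z - a).re := by
      rintro z ⟨⟨h2, h3⟩, h4, h5⟩
      have h6 : z.re = a + t * Real.cos ω := le_antisymm h3 h2
      refine ⟨h6, ?_⟩
      have h7 : ‖z - a‖ ≤ t := by
        rw [← sq_le_sq₀ (norm_nonneg _) ht.le, Complex.sq_norm, Complex.normSq_apply]
        simp only [Complex.sub_re, Complex.ofReal_re, Complex.sub_im, Complex.ofReal_im, h6, sub_zero,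
          add_sub_cancel_left]
        have h8 : z.im ^ 2 ≤ (t * Real.sin ω) ^ 2 := sq_le_sq' h4 h5
        nlinarith [Real.sin_sq_add_cos_sq ω]
      rw [Complex.sub_re, h6, Complex.ofReal_re, add_sub_cancel_left, mul_comm]
      gcongr
    have := hSc.norm_image_sub_le_of_norm_hasDerivWithin_le
      (fun z hz => (hP z (hUc z (by rw [(hSm z hz).1]; linarith)
        (hSm z hz).2)).hasDerivWithinAt)
      (fun z hz => hK z (hSm z hz).1 (hSm z hz).2)
      (x := ⟨a + t * Real.cos ω, -(t * Real.sin ω)⟩) (y := ⟨a + t * Real.cos ω, t * Real.sin ω⟩)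
      ⟨⟨by simp, by simp⟩, by simp, by simp only [mem_ofPred_eq]; linarith⟩
      ⟨⟨by simp, by simp⟩, by simp only [mem_ofPred_eq]; linarith, by simp⟩
    rw [e1, e2]
    refine this.trans_eq ?_
    congr 1
    have : (⟨a + t * Real.cos ω, t * Real.sin ω⟩ : ℂ) - ⟨a + t * Real.cos ω, -(t * Real.sin ω)⟩
        = ((2 * (t * Real.sin ω) : ℝ) : ℂ) * Complex.I := by
        apply Complex.ext
        · simp only [Complex.sub_re, Complex.re_ofReal_mul, Complex.I_re]; ring
        · simp only [Complex.sub_im, Complex.im_ofReal_mul, Complex.I_im]; ring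
    rw [this, norm_mul, Complex.norm_I, mul_one, Complex.norm_real, Real.norm_of_nonneg (by linarith)]
  have hi1' : IntegrableOn (fun t : ℝ => Complex.exp (ω * Complex.I) •
    H (a + t * Complex.exp (ω * Complex.I))) (Ioi 0) := hi1.smul _
  have hi2' : IntegrableOn (fun t : ℝ => Complex.exp (-(ω * Complex.I)) •
    H (a + t * Complex.exp (-(ω * Complex.I)))) (Ioi 0) := hi2.smul _
  have hi12 : IntegrableOn (fun t : ℝ => Complex.exp (ω * Complex.I) •
    H (a + t * Complex.exp (ω * Complex.I)) - Complex.exp (-(ω * Complex.I)) •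
    H (a + t * Complex.exp (-(ω * Complex.I)))) (Ioi 0) := hi1'.sub hi2'
  rw [rayDiff, ← integral_sub hi1' hi2']
  rw [integral_Ioi_of_hasDerivAt_of_tendsto_nhdsGT (S := 0) (m := 0)
    (Φ := fun t : ℝ => P (a + t * Complex.exp (ω * Complex.I)) -
      P (a + t * Complex.exp (-(ω * Complex.I)))) ?_ hi12 ?_ ?_, sub_zero]
  · intro t ht
    have hp := mul_pos (show (0 : ℝ) < t from ht) hc
    have n : ∀ v : ℂ, ‖v‖ = 1 → v.re = Real.cos ω → (a : ℂ) + t * v ∈ U := fun v hv hv' => by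
      apply hUc
      · rw [Complex.add_re, Complex.re_ofReal_mul, Complex.ofReal_re, hv']; linarith
      · rw [add_sub_cancel_left, norm_mul, hv, Complex.norm_real, Real.norm_of_nonneg (le_of_lt ht),
          Complex.re_ofReal_mul, hv', mul_one, mul_comm]
    exact (hasDerivAt_comp_ray (hP _ (n _ (Complex.norm_exp_ofReal_mul_I ω) (re_exp_mul_I ω)))).sub
      (hasDerivAt_comp_ray (hP _ (n _ (norm_exp_neg_mul_I ω) (re_exp_neg_mul_I ω))))
  · rw [tendsto_zero_iff_norm_tendsto_zero]
    have hlim : Tendsto (fun t : ℝ => C * (2 * (t * Real.sin ω))) (𝓝[>] 0) (𝓝 0) := by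
      have : Continuous (fun t : ℝ => C * (2 * (t * Real.sin ω))) := by fun_prop
      simpa using (this.tendsto 0).mono_left nhdsWithin_le_nhds
    refine squeeze_zero' (Eventually.of_forall fun _ => norm_nonneg _) ?_ hlim
    filter_upwards [Ioo_mem_nhdsGT hr₀] with t ht
    have hp := mul_pos ht.1 hc
    refine hseg t C ht.1 fun z hz1 hz2 => hz z (by linarith) ?_ hz2
    have : t * Real.cos ω ≤ t * 1 := by gcongr; exacts [ht.1.le, Real.cos_le_one ω]
    linarith [ht.2]
  · rw [tendsto_zero_iff_norm_tendsto_zero]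
    have hlim : Tendsto (fun t : ℝ => (|C| * 2 * Real.sin ω / Real.cos ω ^ 2) * t⁻¹) atTop (𝓝 0) := by
      have := (tendsto_inv_atTop_zero (𝕜 := ℝ)).const_mul (|C| * 2 * Real.sin ω / Real.cos ω ^ 2)
      rwa [mul_zero] at this
    refine squeeze_zero' (Eventually.of_forall fun _ => norm_nonneg _) ?_ hlim
    filter_upwards [eventually_gt_atTop (max 0 (r₁ / Real.cos ω))] with t ht
    have ht0 : 0 < t := (le_max_left _ _).trans_lt ht
    have ht1 : r₁ < t * Real.cos ω := by
      rw [← div_lt_iff₀ hc]; exact (le_max_right _ _).trans_lt ht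
    have hp := mul_pos ht0 hc
    refine (hseg t (|C| / (t * Real.cos ω) ^ 2) ht0 fun z hz1 hz2 => ?_).trans_eq ?_
    · rw [le_div_iff₀ (by positivity)]
      refine le_trans ?_ ((hinf z (by linarith) (by linarith) hz2).trans (le_abs_self C))
      have : t * Real.cos ω ≤ ‖z - a‖ := by
        refine le_trans ?_ (Complex.re_le_norm _)
        rw [Complex.sub_re, hz1, Complex.ofReal_re]; linarith
      gcongr
    · field_simp

/-- The imaginary part of d - t v controls t, and after rotation by the conjugate of v the imaginary
part controls d; the bound is the average of the two. -/
theorem norm_sub_mul_ge {d t s : ℝ} {v : ℂ} (hd : 0 ≤ d) (ht : 0 ≤ t) (hv : ‖v‖ = 1)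
    (hs : |v.im| = s) : s / 2 * (d + t) ≤ ‖(d : ℂ) - t * v‖ := by
  have h1 : t * s ≤ ‖(d : ℂ) - t * v‖ := by
    have := Complex.abs_im_le_norm ((d : ℂ) - t * v)
    rw [Complex.sub_im, Complex.ofReal_im, Complex.im_ofReal_mul, zero_sub, abs_neg, abs_mul,
      abs_of_nonneg ht, hs] at this
    exact this
  have h2 : d * s ≤ ‖(d : ℂ) - t * v‖ := by
    have := Complex.abs_im_le_norm (((d : ℂ) - t * v) * (starRingEnd ℂ) v)
    have e : ((d : ℂ) - t * v) * (starRingEnd ℂ) v = d * (starRingEnd ℂ) v - (t : ℝ) := by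
      rw [sub_mul, mul_assoc, Complex.mul_conj, Complex.normSq_eq_norm_sq, hv]; simp
    rw [norm_mul, RCLike.norm_conj, hv, mul_one, e, Complex.sub_im, Complex.ofReal_im, sub_zero,
      Complex.im_ofReal_mul, Complex.conj_im, abs_mul, abs_neg, hs, abs_of_nonneg hd] at this
    exact this
  linarith

omit [CompleteSpace E] in
theorem integrableOn_ray_mul_inv {G : ℂ → E} {a b C : ℝ} {v : ℂ} (hv : ‖v‖ = 1)
    (hv1 : v.im ≠ 0) (hb : a < b) (hol : ContinuousOn (fun t : ℝ => G (a + t * v)) (Ioi 0))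
    (hG : ∀ t : ℝ, 0 < t → ‖G (a + t * v)‖ * (1 + t) ≤ C) :
    IntegrableOn (fun t : ℝ => ((b : ℂ) - (a + t * v))⁻¹ • G (a + t * v)) (Ioi 0) := by
  have hs : 0 < |v.im| := abs_pos.2 hv1
  have hlow : ∀ t : ℝ, 0 < t → |v.im| / 2 * ((b - a) + t) ≤ ‖(b : ℂ) - (a + t * v)‖ := by
    intro t ht
    have := norm_sub_mul_ge (d := b - a) (t := t) (by linarith) ht.le hv rfl
    rw [Complex.ofReal_sub, sub_sub] at this; exact this
  have hd : 0 < b - a := by linarith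
  refine integrableOn_of_le_inv_sq (C := C / (|v.im| / 2 * min (b - a) 1)) ?_ ?_
  · refine ContinuousOn.smul (ContinuousOn.inv₀ (by fun_prop) ?_) hol
    intro t ht h
    have := hlow t ht
    rw [h, norm_zero] at this
    have : 0 < |v.im| / 2 * ((b - a) + t) := mul_pos (by positivity) (add_pos hd ht)
    linarith
  · intro t ht
    have hm : 0 < min (b - a) 1 := lt_min hd one_pos
    rw [norm_smul, norm_inv, le_div_iff₀ (by positivity)]
    have h2 : |v.im| / 2 * (min (b - a) 1 * (1 + t)) ≤ ‖(b : ℂ) - (a + t * v)‖ := by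
      refine le_trans ?_ (hlow t ht)
      gcongr
      nlinarith [min_le_left (b - a) 1, min_le_right (b - a) 1]
    have h3 : 0 < ‖(b : ℂ) - (a + t * v)‖ := lt_of_lt_of_le (by positivity) h2
    calc ‖(b : ℂ) - (a + t * v)‖⁻¹ * ‖G (a + t * v)‖ * (1 + t) ^ 2 * (|v.im| / 2 * min (b - a) 1)
        = ‖(b : ℂ) - (a + t * v)‖⁻¹ * (|v.im| / 2 * (min (b - a) 1 * (1 + t))) *
          (‖G (a + t * v)‖ * (1 + t)) := by ring
      _ ≤ ‖(b : ℂ) - (a + t * v)‖⁻¹ * ‖(b : ℂ) - (a + t * v)‖ * (‖G (a + t * v)‖ * (1 + t)) := by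
          gcongr
      _ ≤ C := by rw [inv_mul_cancel₀ h3.ne', one_mul]; exact hG t ht

/-- With w = t v, partial fractions give the primitive (log(w + 1) - log(d - w))/(d + 1). The
principal branch is legitimate along the whole ray: w + 1 has positive real part, and d - w leaves
the real axis as soon as t > 0. -/
theorem integral_ray_inv {d : ℝ} {v : ℂ} (hd : 0 < d) (hv : ‖v‖ = 1) (hv0 : 0 < v.re)
    (hv1 : v.im ≠ 0) :
    ∫ t in Ioi (0 : ℝ), v * ((d - t * v)⁻¹ * (t * v + 1)⁻¹) =
      (Complex.log v - Complex.log (-v) + Complex.log d) / (d + 1) := by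
  have hs1 : ∀ t : ℝ, 0 ≤ t → (t * v + 1 : ℂ) ∈ Complex.slitPlane := fun t ht => by
    rw [Complex.mem_slitPlane_iff]; left
    have := mul_nonneg ht hv0.le
    simp only [Complex.add_re, Complex.re_ofReal_mul, Complex.one_re]; linarith
  have hs2 : ∀ t : ℝ, 0 ≤ t → (d - t * v : ℂ) ∈ Complex.slitPlane := fun t ht => by
    rw [Complex.mem_slitPlane_iff]
    rcases ht.eq_or_lt with rfl | ht
    · left; simpa using hd
    · right
      simp only [Complex.sub_im, Complex.im_ofReal_mul, Complex.ofReal_im, zero_sub, neg_ne_zero]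
      exact mul_ne_zero ht.ne' hv1
  have hd1 : (d : ℂ) + 1 ≠ 0 := by
    have : (0 : ℝ) < d + 1 := by linarith
    exact_mod_cast this.ne'
  have hv' : v ≠ 0 := by rintro rfl; simp at hv0
  have hderiv : ∀ t ∈ Ici (0 : ℝ), HasDerivAt (fun t : ℝ =>
      (Complex.log (t * v + 1) - Complex.log (d - t * v)) / (d + 1))
      (v * ((d - t * v)⁻¹ * (t * v + 1)⁻¹)) t := by
    intro t ht
    have l : HasDerivAt (fun t : ℝ => (t : ℂ) * v) v t := by
      simpa using (Complex.ofRealCLM.hasDerivAt (x := t)).mul_const v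
    have l1 := (l.add_const (1 : ℂ)).clog_real (hs1 t ht)
    have l2 := (l.const_sub (d : ℂ)).clog_real (hs2 t ht)
    refine ((l1.sub l2).div_const ((d : ℂ) + 1)).congr_deriv ?_
    have n1 := Complex.slitPlane_ne_zero (hs1 t ht)
    have n2 := Complex.slitPlane_ne_zero (hs2 t ht)
    have hpq : ((t : ℂ) * v + 1) + (d - t * v) = d + 1 := by ring
    rw [← hpq] at hd1 ⊢
    generalize (t : ℂ) * v + 1 = p at *
    generalize (d : ℂ) - t * v = q at *
    field_simp
    ring
  have hint : IntegrableOn (fun t : ℝ => v * ((d - t * v)⁻¹ * (t * v + 1)⁻¹)) (Ioi 0) := by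
    have := integrableOn_ray_mul_inv (a := 0) (b := d) (C := 2 / |v.im|)
      (G := fun z => (z + 1)⁻¹) hv hv1 hd ?_ ?_
    · refine IntegrableOn.congr_fun (this.const_mul v) (fun t _ => ?_) measurableSet_Ioi
      simp
    · refine ContinuousOn.inv₀ (by fun_prop) ?_
      intro t ht h
      have := Complex.slitPlane_ne_zero (hs1 t (le_of_lt ht))
      apply this
      simpa using h
    · intro t ht
      have h2 := norm_sub_mul_ge (d := 1) (t := t) (v := -v) zero_le_one ht.le (by rwa [norm_neg])
        (s := |v.im|) (by simp)
      have h3 : ((1 : ℝ) : ℂ) - t * -v = ((0 : ℝ) : ℂ) + t * v + 1 := by push_cast; ring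
      have hs : 0 < |v.im| := abs_pos.2 hv1
      rw [h3] at h2
      rw [norm_inv, inv_mul_le_iff₀ (lt_of_lt_of_le (by positivity) h2)]
      rw [mul_div_assoc', le_div_iff₀ hs]; linarith
  rw [integral_Ioi_of_hasDerivAt_of_tendsto' hderiv hint
    (m := (Complex.log v - Complex.log (-v)) / (d + 1))]
  · simp; ring
  · refine Tendsto.div_const ?_ _
    have hinv : Tendsto (fun t : ℝ => ((t⁻¹ : ℝ) : ℂ)) atTop (𝓝 0) := by
      have := (Complex.continuous_ofReal.tendsto 0).comp tendsto_inv_atTop_zero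
      simpa only [Complex.ofReal_zero, Function.comp_def] using this
    have t1 : Tendsto (fun t : ℝ => v + ((t⁻¹ : ℝ) : ℂ)) atTop (𝓝 v) := by
      simpa using hinv.const_add v
    have t2 : Tendsto (fun t : ℝ => d * ((t⁻¹ : ℝ) : ℂ) - v) atTop (𝓝 (-v)) := by
      simpa using (hinv.const_mul (d : ℂ)).sub_const v
    have := (t1.clog (Complex.mem_slitPlane_iff.2 (Or.inl hv0))).sub
      (t2.clog (Complex.mem_slitPlane_iff.2 (Or.inr (by simpa using hv1))))
    refine this.congr' ?_
    filter_upwards [eventually_gt_atTop 0] with t ht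
    have ht' : (t : ℂ) ≠ 0 := by exact_mod_cast ht.ne'
    -- Each logarithm diverges as t → ∞. Extracting the factor t from both arguments makes the terms
    -- log t cancel.
    have a1 : (t : ℂ) * v + 1 = (t : ℂ) * (v + ((t⁻¹ : ℝ) : ℂ)) := by
      push_cast; field_simp
    have a2 : (d : ℂ) - t * v = (t : ℂ) * (d * ((t⁻¹ : ℝ) : ℂ) - v) := by
      push_cast; field_simp
    have b1 : v + ((t⁻¹ : ℝ) : ℂ) ≠ 0 := fun h => by
      have := Complex.slitPlane_ne_zero (hs1 t ht.le); rw [a1, h] at this; simp at this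
    have b2 : d * ((t⁻¹ : ℝ) : ℂ) - v ≠ 0 := fun h => by
      have := Complex.slitPlane_ne_zero (hs2 t ht.le); rw [a2, h] at this; simp at this
    rw [a1, a2, Complex.log_ofReal_mul ht b1, Complex.log_ofReal_mul ht b2]; ring

/-- This is the model residue. The difference log v - log(-v) equals πi on the upper ray and -πi on
the lower one, while the terms with log(b - a) cancel; this is where 2πi comes from. -/
theorem rayDiff_inv_mul_inv {a b ω : ℝ} (h0 : 0 < ω) (h1 : ω < Real.pi / 2) (hb : a < b) :
    rayDiff a ω (fun z => ((b : ℂ) - z)⁻¹ * (z - a + 1)⁻¹) = 2 * Real.pi * Complex.I / (b - a + 1) := by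
  have hc : 0 < Real.cos ω := cos_pos_of_lt (by linarith) h1
  have hs : 0 < Real.sin ω := Real.sin_pos_of_pos_of_lt_pi (by linarith) (by linarith)
  have e1 := integral_ray_inv (d := b - a) (v := Complex.exp (ω * Complex.I)) (by linarith)
    (Complex.norm_exp_ofReal_mul_I ω) (by rwa [re_exp_mul_I]) (by rw [im_exp_mul_I]; exact hs.ne')
  have e2 := integral_ray_inv (d := b - a) (v := Complex.exp (-(ω * Complex.I))) (by linarith)
    (norm_exp_neg_mul_I ω) (by rwa [re_exp_neg_mul_I])
    (by rw [im_exp_neg_mul_I]; exact neg_ne_zero.2 hs.ne')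
  have e3 : ∀ v : ℂ, ∀ t : ℝ, v • (((b : ℂ) - (a + t * v))⁻¹ * (a + t * v - a + 1)⁻¹) =
      v * ((((b - a : ℝ) : ℂ) - t * v)⁻¹ * (t * v + 1)⁻¹) := fun v t => by
    rw [smul_eq_mul]; push_cast; congr 3 <;> ring
  have l1 : Complex.log (Complex.exp (ω * Complex.I)) = ω * Complex.I :=
    Complex.log_exp (by simp; linarith) (by simp; linarith)
  have l2 : Complex.log (Complex.exp (-(ω * Complex.I))) = -(ω * Complex.I) :=
    Complex.log_exp (by simp; linarith) (by simp; linarith)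
  have l3 : Complex.log (-Complex.exp (ω * Complex.I)) = ω * Complex.I - Real.pi * Complex.I := by
    rw [← Complex.exp_sub_pi_mul_I]
    exact Complex.log_exp (by simp; linarith) (by simp; linarith)
  have l4 : Complex.log (-Complex.exp (-(ω * Complex.I))) =
      -(ω * Complex.I) + Real.pi * Complex.I := by
    rw [← Complex.exp_add_pi_mul_I]
    exact Complex.log_exp (by simp; linarith) (by simp; linarith)
  rw [rayDiff]
  simp only [e3]
  rw [e1, e2, l1, l2, l3, l4]
  push_cast
  ring

omit [CompleteSpace E] in
theorem rayDiff_congr {a ω : ℝ} {F G : ℂ → E}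
    (h : ∀ t : ℝ, 0 < t → ∀ v : ℂ, (v = Complex.exp (ω * Complex.I) ∨
      v = Complex.exp (-(ω * Complex.I))) → F (a + t * v) = G (a + t * v)) :
    rayDiff a ω F = rayDiff a ω G := by
  rw [rayDiff, rayDiff]
  congr 1
  · exact setIntegral_congr_fun measurableSet_Ioi fun t ht => by
      simp only [h t ht _ (Or.inl rfl)]
  · exact setIntegral_congr_fun measurableSet_Ioi fun t ht => by
      simp only [h t ht _ (Or.inr rfl)]

omit [CompleteSpace E] in
theorem rayDiff_sub {a ω : ℝ} {F G : ℂ → E}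
    (hF : ∀ v : ℂ, (v = Complex.exp (ω * Complex.I) ∨ v = Complex.exp (-(ω * Complex.I))) →
      IntegrableOn (fun t : ℝ => F (a + t * v)) (Ioi 0))
    (hG : ∀ v : ℂ, (v = Complex.exp (ω * Complex.I) ∨ v = Complex.exp (-(ω * Complex.I))) →
      IntegrableOn (fun t : ℝ => G (a + t * v)) (Ioi 0)) :
    rayDiff a ω (fun z => F z - G z) = rayDiff a ω F - rayDiff a ω G := by
  have e : ∀ v : ℂ, (v = Complex.exp (ω * Complex.I) ∨ v = Complex.exp (-(ω * Complex.I))) →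
      ∫ t in Ioi (0 : ℝ), v • (F (a + t * v) - G (a + t * v)) =
        (∫ t in Ioi (0 : ℝ), v • F (a + t * v)) - ∫ t in Ioi (0 : ℝ), v • G (a + t * v) :=
    fun v hv => by
      simp only [smul_sub]
      exact integral_sub ((hF v hv).smul v) ((hG v hv).smul v)
  rw [rayDiff, rayDiff, rayDiff, e _ (Or.inl rfl), e _ (Or.inr rfl)]
  abel

theorem rayDiff_smul_const {a ω : ℝ} (g : ℂ → ℂ) (y : E) :
    rayDiff a ω (fun z => g z • y) = rayDiff a ω g • y := by
  simp only [rayDiff, smul_smul, sub_smul]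
  rw [integral_smul_const, integral_smul_const]
  rfl

/-- **Residue theorem** in a sector with vertex `a`: the pole `b` lies on the axis. -/
theorem rayDiff_residue {G : ℂ → E} {a b ω C : ℝ} {U : Set ℂ} (h0 : 0 < ω) (h1 : ω < Real.pi / 2)
    (hb : a < b) (hU : Convex ℝ U) (hUo : IsOpen U) (hUa : ∀ z ∈ U, a < z.re)
    (hUc : ∀ z : ℂ, a < z.re → Real.cos ω * ‖z - a‖ ≤ (z - a).re → z ∈ U)
    (hol : DifferentiableOn ℂ G U)
    (hG : ∀ z : ℂ, a < z.re → Real.cos ω * ‖z - a‖ ≤ (z - a).re → ‖G z‖ * (1 + ‖z - a‖) ≤ C) :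
    rayDiff a ω (fun z => ((b : ℂ) - z)⁻¹ • G z) = (2 * Real.pi * Complex.I) • G b := by
  have hc : 0 < Real.cos ω := cos_pos_of_lt (by linarith) h1
  have hs : 0 < Real.sin ω := Real.sin_pos_of_pos_of_lt_pi (by linarith) (by linarith)
  set c : ℂ := (b : ℂ) - a + 1 with hcdef
  have hc0 : c ≠ 0 := by
    have : (0 : ℝ) < b - a + 1 := by linarith
    rw [hcdef]; exact_mod_cast this.ne'
  -- Subtract a multiple of the model function (z - a + 1)⁻¹ with the same value at b. The
  -- difference vanishes at b, so division by b - z leaves the holomorphic function `dslope K b`;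
  -- the pole of the model function, at a - 1, is to the left of the sector.
  set K : ℂ → E := fun z => G z - (c * (z - a + 1)⁻¹) • G b with hK
  have hKb : K b = 0 := by simp only [hK]; rw [← hcdef, mul_inv_cancel₀ hc0, one_smul, sub_self]
  have hne : ∀ z : ℂ, a < z.re → z - a + 1 ≠ 0 := fun z hz h => by
    have := congrArg Complex.re h
    simp only [Complex.add_re, Complex.sub_re, Complex.one_re, Complex.zero_re,
      Complex.ofReal_re] at this
    linarith
  have hKd : DifferentiableOn ℂ K U := by
    refine hol.sub (DifferentiableOn.smul_const (DifferentiableOn.const_mul ?_ _) _)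
    exact DifferentiableOn.inv (by fun_prop) fun z hz => hne z (hUa z hz)
  have hbc : Real.cos ω * ‖(b : ℂ) - a‖ ≤ ((b : ℂ) - a).re := by
    rw [← Complex.ofReal_sub, Complex.norm_real, Complex.ofReal_re,
      Real.norm_of_nonneg (by linarith)]
    nlinarith [Real.cos_le_one ω]
  have hHd : DifferentiableOn ℂ (dslope K b) U :=
    (Complex.differentiableOn_dslope (hUo.mem_nhds (hUc b (by simpa using hb) hbc))).2 hKd
  set C₂ : ℝ := C + 2 * (‖c‖ * ‖G b‖) with hC₂
  have hKbd : ∀ z : ℂ, a < z.re → Real.cos ω * ‖z - a‖ ≤ (z - a).re →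
      ‖K z‖ * (1 + ‖z - a‖) ≤ C₂ := by
    intro z hz hz'
    have hre : 0 < (z - a).re := by simpa using hz
    have h2 : 1 + ‖z - a‖ ≤ 2 * ‖z - a + 1‖ := by
      have := norm_sub_ofReal_le_norm_add (a := 1) zero_le_one hre.le
      have h3 : 1 ≤ ‖z - a + 1‖ := by
        refine le_trans ?_ (Complex.re_le_norm _)
        rw [Complex.add_re, Complex.one_re]; linarith
      have h4 : ‖z - a‖ ≤ ‖z - a + 1‖ := by
        rw [← sq_le_sq₀ (norm_nonneg _) (norm_nonneg _), Complex.sq_norm, Complex.sq_norm,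
          Complex.normSq_apply, Complex.normSq_apply]
        simp only [Complex.add_re, Complex.one_re, Complex.add_im, Complex.one_im, add_zero]
        nlinarith
      linarith
    have hpos : 0 < ‖z - a + 1‖ := norm_pos_iff.2 (hne z hz)
    have h5 : ‖(c * (z - a + 1)⁻¹) • G b‖ * (1 + ‖z - a‖) ≤ 2 * (‖c‖ * ‖G b‖) := by
      rw [norm_smul, norm_mul, norm_inv]
      calc ‖c‖ * ‖z - a + 1‖⁻¹ * ‖G b‖ * (1 + ‖z - a‖)
          ≤ ‖c‖ * ‖z - a + 1‖⁻¹ * ‖G b‖ * (2 * ‖z - a + 1‖) := by gcongr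
        _ = 2 * (‖c‖ * ‖G b‖) := by field_simp
    calc ‖K z‖ * (1 + ‖z - a‖)
        ≤ (‖G z‖ + ‖(c * (z - a + 1)⁻¹) • G b‖) * (1 + ‖z - a‖) := by
          gcongr; exact norm_sub_le _ _
      _ ≤ C₂ := by rw [add_mul]; exact add_le_add (hG z hz hz') h5
  have hC₂0 : 0 ≤ C₂ := by
    have := hKbd b (by simpa using hb) hbc
    exact le_trans (by positivity) this
  have hHn : ∀ z : ℂ, z ≠ b → dslope K b z = -(((b : ℂ) - z)⁻¹ • K z) := fun z hz => by
    rw [dslope_of_ne _ hz, slope_def_module, hKb, sub_zero, ← neg_smul, ← inv_neg, neg_sub]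
  have hpt : ∀ v : ℂ, (v = Complex.exp (ω * Complex.I) ∨ v = Complex.exp (-(ω * Complex.I))) →
      ‖v‖ = 1 ∧ v.re = Real.cos ω ∧ v.im ≠ 0 := by
    rintro v (rfl | rfl)
    · exact ⟨Complex.norm_exp_ofReal_mul_I ω, re_exp_mul_I ω, by rw [im_exp_mul_I]; exact hs.ne'⟩
    · exact ⟨norm_exp_neg_mul_I ω, re_exp_neg_mul_I ω,
        by rw [im_exp_neg_mul_I]; exact neg_ne_zero.2 hs.ne'⟩
  have hbound : ∀ (L : ℂ → E) (D : ℝ), (∀ z : ℂ, a < z.re →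
      Real.cos ω * ‖z - a‖ ≤ (z - a).re → ‖L z‖ * (1 + ‖z - a‖) ≤ D) → ∀ v : ℂ,
      (v = Complex.exp (ω * Complex.I) ∨ v = Complex.exp (-(ω * Complex.I))) →
      ∀ t : ℝ, 0 < t → ‖L (a + t * v)‖ * (1 + t) ≤ D := by
    intro L D hL v hv t ht
    obtain ⟨n1, n2, -⟩ := hpt v hv
    have n3 : ‖(a : ℂ) + t * v - a‖ = t := by
      rw [add_sub_cancel_left, norm_mul, n1, mul_one, Complex.norm_real, Real.norm_of_nonneg ht.le]
    have := hL (a + t * v) ?_ ?_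
    · rwa [n3] at this
    · rw [Complex.add_re, Complex.re_ofReal_mul, Complex.ofReal_re, n2]
      have := mul_pos ht hc; linarith
    · rw [n3, add_sub_cancel_left, Complex.re_ofReal_mul, n2, mul_comm]
  have hvb : ∀ v : ℂ, (v = Complex.exp (ω * Complex.I) ∨ v = Complex.exp (-(ω * Complex.I))) →
      ∀ t : ℝ, 0 < t → (a : ℂ) + t * v ≠ b := by
    intro v hv t ht h
    have := congrArg Complex.im h
    simp only [Complex.add_im, Complex.ofReal_im, Complex.im_ofReal_mul, zero_add] at this
    exact mul_ne_zero ht.ne' (hpt v hv).2.2 this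
  have hint : ∀ (L : ℂ → E) (D : ℝ), DifferentiableOn ℂ L U →
      (∀ z : ℂ, a < z.re → Real.cos ω * ‖z - a‖ ≤ (z - a).re → ‖L z‖ * (1 + ‖z - a‖) ≤ D) →
      ∀ v : ℂ, (v = Complex.exp (ω * Complex.I) ∨ v = Complex.exp (-(ω * Complex.I))) →
      IntegrableOn (fun t : ℝ => ((b : ℂ) - (a + t * v))⁻¹ • L (a + t * v)) (Ioi 0) := by
    intro L D hLd hL v hv
    obtain ⟨n1, n2, n3⟩ := hpt v hv
    refine integrableOn_ray_mul_inv n1 n3 hb (hLd.continuousOn.comp (by fun_prop) ?_)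
      (hbound L D hL v hv)
    intro t ht
    have ht' : (0 : ℝ) < t := ht
    apply hUc
    · rw [Complex.add_re, Complex.re_ofReal_mul, Complex.ofReal_re, n2]
      have := mul_pos ht' hc; linarith
    · rw [add_sub_cancel_left, norm_mul, n1, mul_one, Complex.norm_real,
        Real.norm_of_nonneg ht'.le, Complex.re_ofReal_mul, n2, mul_comm]
  have hHint : ∀ v : ℂ, (v = Complex.exp (ω * Complex.I) ∨ v = Complex.exp (-(ω * Complex.I))) →
      IntegrableOn (fun t : ℝ => dslope K b (a + t * v)) (Ioi 0) := fun v hv =>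
    IntegrableOn.congr_fun (hint K C₂ hKd hKbd v hv).neg
      (fun t ht => (hHn _ (hvb v hv t ht)).symm) measurableSet_Ioi
  have hd : 0 < b - a := by linarith
  have hzero : rayDiff a ω (dslope K b) = 0 := by
    -- With these radii b - z stays bounded below: by (b - a)/2 near the vertex, and by ‖z - a‖/2
    -- far out.
    refine rayDiff_eq_zero (C := 2 * C₂ + 2 * C₂ / (b - a)) (r₀ := (b - a) / 2) (r₁ := 2 * (b - a))
      h0 h1 hU hUo hUc hHd (by linarith) ?_ ?_ (hHint _ (Or.inl rfl)) (hHint _ (Or.inr rfl))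
    · intro z hz hz1 hz2
      have h2 : (b - a) / 2 ≤ ‖(b : ℂ) - z‖ := by
        refine le_trans ?_ (Complex.re_le_norm _)
        rw [Complex.sub_re, Complex.ofReal_re]; linarith
      have h3 : z ≠ b := by rintro rfl; rw [sub_self, norm_zero] at h2; linarith
      rw [hHn z h3, norm_neg, norm_smul, norm_inv]
      have h4 : ‖K z‖ ≤ C₂ := le_trans (le_mul_of_one_le_right (norm_nonneg _)
        (by linarith [norm_nonneg (z - a)])) (hKbd z hz hz2)
      calc ‖(b : ℂ) - z‖⁻¹ * ‖K z‖ ≤ ((b - a) / 2)⁻¹ * C₂ := by gcongr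
        _ = 2 * C₂ / (b - a) := by field_simp
        _ ≤ _ := by linarith
    · intro z hz hz1 hz2
      have h2 : 2 * (b - a) ≤ ‖z - a‖ := by
        refine le_trans ?_ (Complex.re_le_norm _)
        rw [Complex.sub_re, Complex.ofReal_re]; linarith
      have h3 : ‖z - a‖ / 2 ≤ ‖(b : ℂ) - z‖ := by
        have e : ‖(b : ℂ) - a‖ = b - a := by
          rw [← Complex.ofReal_sub, Complex.norm_real, Real.norm_of_nonneg hd.le]
        have : ‖z - a‖ ≤ ‖(b : ℂ) - z‖ + ‖(b : ℂ) - a‖ := by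
          rw [norm_sub_rev (b : ℂ) z]
          have := norm_add_le (z - b) ((b : ℂ) - a)
          rwa [sub_add_sub_cancel] at this
        linarith
      have h5 : 0 < ‖z - a‖ := by linarith
      have h6 : z ≠ b := by rintro rfl; rw [sub_self, norm_zero] at h3; linarith
      rw [hHn z h6, norm_neg, norm_smul, norm_inv]
      have h4 : ‖K z‖ * ‖z - a‖ ≤ C₂ := by
        have := hKbd z hz hz2
        nlinarith [norm_nonneg (K z)]
      calc ‖(b : ℂ) - z‖⁻¹ * ‖K z‖ * ‖z - a‖ ^ 2
          ≤ (‖z - a‖ / 2)⁻¹ * ‖K z‖ * ‖z - a‖ ^ 2 := by gcongr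
        _ = 2 * (‖K z‖ * ‖z - a‖) := by field_simp
        _ ≤ 2 * C₂ := by linarith
        _ ≤ _ := by have : 0 ≤ 2 * C₂ / (b - a) := by positivity
                    linarith
  have hneg : rayDiff a ω (dslope K b) = rayDiff a ω (fun z => ((b : ℂ) - z)⁻¹ •
      ((c * (z - a + 1)⁻¹) • G b)) - rayDiff a ω (fun z => ((b : ℂ) - z)⁻¹ • G z) := by
    have i2 : ∀ v : ℂ, (v = Complex.exp (ω * Complex.I) ∨ v = Complex.exp (-(ω * Complex.I))) →
        IntegrableOn (fun t : ℝ => ((b : ℂ) - (a + t * v))⁻¹ •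
          ((c * ((a + t * v) - a + 1)⁻¹) • G b)) (Ioi 0) := fun v hv => by
      refine IntegrableOn.congr_fun ((hint G C hol hG v hv).sub (hint K C₂ hKd hKbd v hv))
        (fun t _ => ?_) measurableSet_Ioi
      simp only [Pi.sub_apply, hK, smul_sub, sub_sub_cancel]
    rw [← rayDiff_sub i2 (hint G C hol hG)]
    refine rayDiff_congr fun t ht v hv => ?_
    rw [hHn _ (hvb v hv t ht), ← smul_sub, ← smul_neg]
    simp only [hK, neg_sub]
  rw [hzero] at hneg
  rw [← sub_eq_zero.1 hneg.symm]
  have e : (fun z : ℂ => ((b : ℂ) - z)⁻¹ • ((c * (z - a + 1)⁻¹) • G b)) =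
      fun z : ℂ => (((b : ℂ) - z)⁻¹ * (z - a + 1)⁻¹) • (c • G b) := by
    ext z; simp only [smul_smul]; congr 1; ring
  rw [e, rayDiff_smul_const, rayDiff_inv_mul_inv h0 h1 hb, smul_smul, ← hcdef,
    div_mul_cancel₀ _ hc0]

end Residue

/-! ### Linearity of contour integrals -/

section ContourLinear
variable {E : Type*} [NormedAddCommGroup E] [NormedSpace ℂ E]

theorem contourInt_congr {a ω : ℝ} {F G : ℂ → E}
    (h : ∀ i t, 0 < t → F (contourPt a ω i t) = G (contourPt a ω i t)) :
    contourInt a ω F = contourInt a ω G :=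
  Finset.sum_congr rfl fun i _ => setIntegral_congr_fun measurableSet_Ioi fun t ht => by
    simp only [h i t ht]

theorem contourInt_sub {a ω : ℝ} {F G : ℂ → E}
    (hF : ∀ i, IntegrableOn (fun t : ℝ => F (contourPt a ω i t)) (Ioi 0))
    (hG : ∀ i, IntegrableOn (fun t : ℝ => G (contourPt a ω i t)) (Ioi 0)) :
    contourInt a ω (fun z => F z - G z) = contourInt a ω F - contourInt a ω G := by
  rw [contourInt, contourInt, contourInt, ← Finset.sum_sub_distrib]
  refine Finset.sum_congr rfl fun i _ => ?_
  simp only [smul_sub]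
  exact integral_sub ((hF i).smul _) ((hG i).smul _)

theorem contourInt_smul_const [CompleteSpace E] {a ω : ℝ} (g : ℂ → ℂ) (y : E) :
    contourInt a ω (fun z => g z • y) = contourInt a ω g • y := by
  simp only [contourInt, Finset.sum_smul, smul_smul]
  exact Finset.sum_congr rfl fun i _ => integral_smul_const _ _

theorem contourInt_map [CompleteSpace E] {E' : Type*} [NormedAddCommGroup E'] [NormedSpace ℂ E']
    [CompleteSpace E'] (L : E →L[ℂ] E') {a ω : ℝ} {F : ℂ → E}
    (hF : ∀ i, IntegrableOn (fun t : ℝ => F (contourPt a ω i t)) (Ioi 0)) :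
    L (contourInt a ω F) = contourInt a ω (fun z => L (F z)) := by
  rw [contourInt, contourInt, map_sum]
  refine Finset.sum_congr rfl fun i _ => ?_
  have hi : IntegrableOn (fun t : ℝ => contourWt ω i • F (contourPt a ω i t)) (Ioi 0) :=
    (hF i).smul _
  rw [← L.integral_comp_comm hi]
  simp only [map_smul]

theorem contourInt_mul_const {𝔸 : Type*} [NormedRing 𝔸] [NormedAlgebra ℂ 𝔸] [CompleteSpace 𝔸]
    {a ω : ℝ} {F : ℂ → 𝔸}
    (hF : ∀ i, IntegrableOn (fun t : ℝ => F (contourPt a ω i t)) (Ioi 0)) (y : 𝔸) :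
    contourInt a ω F * y = contourInt a ω (fun z => F z * y) :=
  contourInt_map ((ContinuousLinearMap.mul ℂ 𝔸).flip y) hF

theorem contourInt_const_mul {𝔸 : Type*} [NormedRing 𝔸] [NormedAlgebra ℂ 𝔸] [CompleteSpace 𝔸]
    {a ω : ℝ} {F : ℂ → 𝔸}
    (hF : ∀ i, IntegrableOn (fun t : ℝ => F (contourPt a ω i t)) (Ioi 0)) (y : 𝔸) :
    y * contourInt a ω F = contourInt a ω (fun z => y * F z) :=
  contourInt_map (ContinuousLinearMap.mul ℂ 𝔸 y) hF

theorem norm_contourInt_le {a ω : ℝ} {F : ℂ → E} {g : ℝ → ℝ} {K : ℝ} (hg : IntegrableOn g (Ioi 0))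
    (hK : ∫ t in Ioi (0 : ℝ), g t ≤ K)
    (h : ∀ i t, 0 < t → ‖F (contourPt a ω i t)‖ ≤ g t) : ‖contourInt a ω F‖ ≤ 4 * K := by
  refine (norm_sum_le _ _).trans ?_
  have : ∀ i ∈ (Finset.univ : Finset (Fin 4)),
      ‖∫ t in Ioi (0 : ℝ), contourWt ω i • F (contourPt a ω i t)‖ ≤ K := fun i _ => by
    refine le_trans (norm_integral_le_of_norm_le hg ?_) hK
    refine (ae_restrict_iff' measurableSet_Ioi).2 (ae_of_all _ fun t ht => ?_)
    rw [norm_smul, norm_contourWt, one_mul]; exact h i t ht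
  refine (Finset.sum_le_sum this).trans_eq ?_
  simp

end ContourLinear

/-! ### Separation estimates -/

theorem contourPt_sub_sign {a ω t : ℝ} (ht : 0 < t) (i : Fin 4) :
    ‖contourPt a ω i t - raySign i * a‖ = t := by
  rw [contourPt, ← mul_sub, norm_mul, norm_raySign, one_mul, add_sub_cancel_left,
    norm_ofReal_mul_rayDir ht]

theorem norm_contourPt_sub_ge {a ω ψ t : ℝ} (h0 : 0 < ω) (h : ω < ψ) (h1 : ψ < Real.pi / 2)
    {z : ℂ} (hz : z ∈ bisector ψ a) (ht : 0 < t) (i : Fin 4) :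
    (Real.cos ω - Real.cos ψ) / 4 * (t + ‖z - raySign i * a‖) ≤ ‖contourPt a ω i t - z‖ := by
  have hψ : 0 < ψ := by linarith
  have key : ∀ x ∈ bisector ψ a, (Real.cos ω - Real.cos ψ) / 4 * (t + ‖x - a‖) ≤
      ‖(a : ℂ) + t * rayDir ω i - x‖ := by
    intro x hx
    have := cone_separation (w := t * rayDir ω i) (x := x - a) (κ₁ := Real.cos ω)
      (κ₂ := Real.cos ψ) (cos_pos_of_lt hψ h1).le (Real.cos_le_one ω)
      (cos_lt_cos_of_lt h0 h h1.le).le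
      (by rw [norm_ofReal_mul_rayDir ht, Complex.re_ofReal_mul, re_rayDir, mul_comm])
      ((mem_bisector_iff hψ h1).1 hx).1.le
    rw [norm_ofReal_mul_rayDir ht] at this
    rwa [show (a : ℂ) + t * rayDir ω i - x = t * rayDir ω i - (x - a) by ring]
  rcases raySign_eq i with hs | hs
  · rw [contourPt, hs, one_mul, one_mul]; exact key z hz
  · have := key (-z) (neg_mem_bisector hψ h1 hz)
    rw [← norm_neg (-z - a), ← norm_neg ((a : ℂ) + t * rayDir ω i - -z)] at this
    rw [contourPt, hs, show z - -1 * (a : ℂ) = -(-z - a) by ring,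
      show -1 * ((a : ℂ) + t * rayDir ω i) - z = -((a : ℂ) + t * rayDir ω i - -z) by ring]
    exact this

theorem norm_right_sub_ge {a ψ κ : ℝ} (h0 : 0 < ψ) (h1 : ψ < Real.pi / 2) (hκ : Real.cos ψ ≤ κ)
    (hκ1 : κ ≤ 1) {z w : ℂ} (hz : z ∈ bisector ψ a) (hw : κ * ‖w - a‖ ≤ (w - a).re) :
    (κ - Real.cos ψ) / 4 * (‖w - a‖ + ‖z - a‖) ≤ ‖w - z‖ := by
  have := cone_separation (cos_pos_of_lt h0 h1).le hκ1 hκ hw ((mem_bisector_iff h0 h1).1 hz).1.le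
  rwa [sub_sub_sub_cancel_right] at this

theorem norm_left_sub_ge {a ψ κ : ℝ} (h0 : 0 < ψ) (h1 : ψ < Real.pi / 2) (hκ : Real.cos ψ ≤ κ)
    (hκ1 : κ ≤ 1) {z w : ℂ} (hz : z ∈ bisector ψ a) (hw : κ * ‖w - a‖ ≤ (w - a).re) :
    (κ - Real.cos ψ) / 4 * (‖w - a‖ + ‖z + a‖) ≤ ‖w + z‖ := by
  have := norm_right_sub_ge h0 h1 hκ hκ1 (neg_mem_bisector h0 h1 hz) hw
  rwa [sub_neg_eq_add, show -z - (a : ℂ) = -(z + a) by ring, norm_neg] at this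

/-- Real points outside the strip are far from the bisector. -/
theorem norm_ofReal_sub_ge {a ψ b : ℝ} (h0 : 0 < ψ) (h1 : ψ < Real.pi / 2) (hb : a ≤ b) {z : ℂ}
    (hz : z ∈ bisector ψ a) :
    (1 - Real.cos ψ) / 4 * (b - a + ‖z - a‖) ≤ ‖(b : ℂ) - z‖ := by
  have e : ‖(b : ℂ) - a‖ = b - a := by
    rw [← Complex.ofReal_sub, Complex.norm_real, Real.norm_of_nonneg (by linarith)]
  have := norm_right_sub_ge (w := b) h0 h1 (Real.cos_le_one ψ) le_rfl hz (by
    rw [e, ← Complex.ofReal_sub, Complex.ofReal_re, one_mul])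
  rwa [e] at this

theorem norm_ofReal_add_ge {a ψ b : ℝ} (h0 : 0 < ψ) (h1 : ψ < Real.pi / 2) (hb : a ≤ b) {z : ℂ}
    (hz : z ∈ bisector ψ a) :
    (1 - Real.cos ψ) / 4 * (b - a + ‖z + a‖) ≤ ‖(b : ℂ) + z‖ := by
  have := norm_ofReal_sub_ge h0 h1 hb (neg_mem_bisector h0 h1 hz)
  rwa [sub_neg_eq_add, show -z - (a : ℂ) = -(z + a) by ring, norm_neg] at this

/-! ### The algebra of elementary functions -/

theorem MemElemZero.integrableOn_contour {φ a ω : ℝ} {f : ℂ → ℂ} (hf : MemElemZero φ a f)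
    (h : φ < ω) (h1 : ω ≤ Real.pi / 2) (i : Fin 4) :
    IntegrableOn (fun t : ℝ => f (contourPt a ω i t) / (t : ℂ)) (Ioi 0) := by
  have := hf.integrable ω h h1 (rayDir ω i) (rayDir_eq ω i)
  rcases raySign_eq i with hs | hs
  · simp only [contourPt, hs, one_mul]; exact this.1
  · simp only [contourPt, hs, neg_one_mul]; exact this.2

/-- Elementary functions form an ideal among the bounded holomorphic ones. This is what allows
bounded functions to be tested against elementary ones. -/
theorem MemElemZero.mul {φ a C : ℝ} {f h : ℂ → ℂ} (hf : MemElemZero φ a f) (ha : 0 ≤ a)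
    (h0 : 0 < φ) (h1 : φ < Real.pi / 2) (hh : DifferentiableOn ℂ h (bisector φ a))
    (hC : ∀ z ∈ bisector φ a, ‖h z‖ ≤ C) : MemElemZero φ a (fun z => f z * h z) := by
  have lim : ∀ l : Filter ℂ, (∀ᶠ z in l, z ∈ bisector φ a) → Tendsto f l (𝓝 0) →
      Tendsto (fun z => f z * h z) l (𝓝 0) := by
    intro l hl hfl
    rw [tendsto_zero_iff_norm_tendsto_zero] at hfl ⊢
    have := hfl.mul_const C
    rw [zero_mul] at this
    refine squeeze_zero' (Eventually.of_forall fun _ => norm_nonneg _) ?_ this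
    filter_upwards [hl] with z hz
    rw [norm_mul]; gcongr; exact hC z hz
  refine ⟨hf.holo.mul hh, ?_, ?_, ?_, ?_, ?_⟩
  · obtain ⟨D, hD⟩ := hf.bdd
    refine ⟨D * C, fun z hz => ?_⟩
    rw [norm_mul]
    exact mul_le_mul (hD z hz) (hC z hz) (norm_nonneg _) ((norm_nonneg _).trans (hD z hz))
  · exact lim _ self_mem_nhdsWithin hf.lim_right
  · exact lim _ self_mem_nhdsWithin hf.lim_left
  · exact lim _ (mem_inf_of_right (mem_principal_self _)) hf.lim_infty
  · intro ω hω hω1 v hv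
    obtain ⟨i1, i2⟩ := hf.integrable ω hω hω1 v hv
    have hm : ∀ t : ℝ, 0 < t → (a : ℂ) + t * v ∈ bisector φ a := by
      intro t ht
      rcases hv with rfl | rfl
      · simpa [contourPt, raySign, rayDir] using contourPt_mem_bisector ha h0 hω hω1 ht 0
      · simpa [contourPt, raySign, rayDir] using contourPt_mem_bisector ha h0 hω hω1 ht 1
    have key : ∀ p : ℝ → ℂ, Continuous p → (∀ t, 0 < t → p t ∈ bisector φ a) →
        IntegrableOn (fun t : ℝ => f (p t) / (t : ℂ)) (Ioi 0) →
        IntegrableOn (fun t : ℝ => f (p t) * h (p t) / (t : ℂ)) (Ioi 0) := by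
      intro p hp hpm hi
      have c : ContinuousOn (fun t : ℝ => h (p t)) (Ioi 0) :=
        hh.continuousOn.comp hp.continuousOn fun t ht => hpm t ht
      have := Integrable.mul_bdd (c := C) hi (c.aestronglyMeasurable measurableSet_Ioi)
        ((ae_restrict_iff' measurableSet_Ioi).2 (ae_of_all _ fun t ht => hC _ (hpm t ht)))
      refine IntegrableOn.congr_fun this (fun t _ => ?_) measurableSet_Ioi
      ring
    exact ⟨key _ (by fun_prop) hm i1,
      key (fun t => -(a + t * v)) (by fun_prop) (fun t ht => neg_mem_bisector h0 h1 (hm t ht)) i2⟩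

theorem MemElemZero.integrableOn_smul {E : Type*} [NormedAddCommGroup E] [NormedSpace ℂ E]
    {φ a ω C : ℝ} {f : ℂ → ℂ} (hf : MemElemZero φ a f)
    (h : φ < ω) (h1 : ω ≤ Real.pi / 2) (i : Fin 4) {k : ℝ → E} (hk : ContinuousOn k (Ioi 0))
    (hC : ∀ t, 0 < t → ‖k t‖ * t ≤ C) :
    IntegrableOn (fun t : ℝ => f (contourPt a ω i t) • k t) (Ioi 0) := by
  have c : ContinuousOn (fun t : ℝ => (t : ℂ) • k t) (Ioi 0) :=
    Complex.continuous_ofReal.continuousOn.smul hk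
  have := Integrable.smul_bdd (hf.integrableOn_contour h h1 i) C
    (c.aestronglyMeasurable measurableSet_Ioi)
    ((ae_restrict_iff' measurableSet_Ioi).2 (ae_of_all _ fun t ht => by
      rw [norm_smul, Complex.norm_real, Real.norm_of_nonneg (le_of_lt ht), mul_comm]
      exact hC t ht))
  refine IntegrableOn.congr_fun this (fun t ht => ?_) measurableSet_Ioi
  have : (t : ℂ) ≠ 0 := by exact_mod_cast (ne_of_gt ht)
  simp only [Pi.smul_apply', smul_smul]
  rw [div_mul_cancel₀ _ this]

/-! ### Outer resolvents -/

section Outer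
variable {𝔸 : Type*} [NormedRing 𝔸] [NormedAlgebra ℂ 𝔸] {R : ℂ → 𝔸} {a : ℝ}

namespace IsOuterResolvent

theorem commute (hR : IsOuterResolvent R a) {μ ν : ℂ} (hμ : a < |μ.re|) (hν : a < |ν.re|) :
    R μ * R ν = R ν * R μ := by
  rcases eq_or_ne μ ν with rfl | h
  · rfl
  have h1 := hR.ident μ ν hμ hν
  have h2 := hR.ident ν μ hν hμ
  have h3 : (ν - μ) • (R μ * R ν) = (ν - μ) • (R ν * R μ) := by
    rw [← h1, ← neg_sub (R ν), h2, ← neg_smul, neg_sub]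
  exact smul_right_injective _ (sub_ne_zero.2 h.symm) h3

/-- No continuity is assumed. The resolvent identity bounds ‖R ν‖ by ‖R μ‖ plus a term that can be
absorbed for ν near μ; this gives continuity, and then the identity gives the derivative. -/
theorem hasDerivAt (hR : IsOuterResolvent R a) {μ : ℂ} (hμ : a < |μ.re|) :
    HasDerivAt R (-(R μ * R μ)) μ := by
  have hop : ∀ᶠ ν in 𝓝 μ, a < |ν.re| :=
    (isOpen_lt continuous_const (by fun_prop)).mem_nhds hμ
  have hb : ∀ᶠ ν in 𝓝 μ, ‖R ν‖ ≤ 2 * ‖R μ‖ := by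
    have hs : ∀ᶠ ν in 𝓝 μ, ‖ν - μ‖ * ‖R μ‖ < 1 / 2 := by
      have : Continuous fun ν : ℂ => ‖ν - μ‖ * ‖R μ‖ := by fun_prop
      exact this.continuousAt.eventually (gt_mem_nhds (by simp))
    filter_upwards [hop, hs] with ν h1 h2
    have h3 : R ν = R μ + (μ - ν) • (R ν * R μ) := by
      rw [← hR.ident ν μ h1 hμ]; abel
    have h4 : ‖R ν‖ ≤ ‖R μ‖ + ‖ν - μ‖ * (‖R ν‖ * ‖R μ‖) := by
      calc ‖R ν‖ = ‖R μ + (μ - ν) • (R ν * R μ)‖ := by rw [← h3]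
        _ ≤ ‖R μ‖ + ‖ν - μ‖ * (‖R ν‖ * ‖R μ‖) := by
          refine (norm_add_le _ _).trans ?_
          rw [norm_smul, norm_sub_rev]
          gcongr; exact norm_mul_le _ _
    nlinarith [norm_nonneg (R ν)]
  have hc : ContinuousAt R μ := by
    rw [ContinuousAt, tendsto_iff_norm_sub_tendsto_zero]
    have : Tendsto (fun ν : ℂ => ‖μ - ν‖ * (2 * ‖R μ‖ * ‖R μ‖)) (𝓝 μ) (𝓝 0) := by
      have : Continuous fun ν : ℂ => ‖μ - ν‖ * (2 * ‖R μ‖ * ‖R μ‖) := by fun_prop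
      simpa using this.tendsto μ
    refine squeeze_zero' (Eventually.of_forall fun _ => norm_nonneg _) ?_ this
    filter_upwards [hop, hb] with ν h1 h2
    rw [hR.ident ν μ h1 hμ, norm_smul]
    gcongr
    exact (norm_mul_le _ _).trans (by gcongr)
  rw [hasDerivAt_iff_tendsto_slope]
  have h5 : Tendsto (fun ν => -(R ν * R μ)) (𝓝[≠] μ) (𝓝 (-(R μ * R μ))) :=
    ((hc.tendsto.mono_left nhdsWithin_le_nhds).mul_const (R μ)).neg
  refine h5.congr' ?_
  filter_upwards [self_mem_nhdsWithin, mem_nhdsWithin_of_mem_nhds hop] with ν h1 h2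
  rw [slope_def_module, hR.ident ν μ h2 hμ, smul_smul, ← neg_sub ν μ, mul_neg,
    inv_mul_cancel₀ (sub_ne_zero.2 h1), neg_one_smul]

theorem continuousOn (hR : IsOuterResolvent R a) : ContinuousOn R {μ : ℂ | a < |μ.re|} :=
  fun _ hμ => (hR.hasDerivAt hμ).continuousAt.continuousWithinAt

theorem differentiableOn (hR : IsOuterResolvent R a) :
    DifferentiableOn ℂ R {μ : ℂ | a < |μ.re|} :=
  fun _ hμ => (hR.hasDerivAt hμ).differentiableAt.differentiableWithinAt

theorem contour_bound (hR : IsOuterResolvent R a) {ω : ℝ} (h0 : 0 < ω) (h1 : ω < Real.pi / 2) :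
    ∃ C : ℝ, 0 < C ∧ ∀ i t, 0 < t → ‖R (contourPt a ω i t)‖ * t ≤ C := by
  have hc := cos_pos_of_lt h0 h1
  obtain ⟨C, hC, hC'⟩ := hR.right (Real.cos ω) hc (cos_lt_one_of_pos h0 h1)
  obtain ⟨D, hD, hD'⟩ := hR.left (Real.cos ω) hc (cos_lt_one_of_pos h0 h1)
  refine ⟨max C D, lt_max_of_lt_left hC, fun i t ht => ?_⟩
  have e : ‖(a : ℂ) + t * rayDir ω i - a‖ = t := by
    rw [add_sub_cancel_left, norm_ofReal_mul_rayDir ht]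
  have h2 : a < ((a : ℂ) + t * rayDir ω i).re := by
    rw [Complex.add_re, Complex.re_ofReal_mul, re_rayDir, Complex.ofReal_re]
    have := mul_pos ht hc; linarith
  have h3 : Real.cos ω * ‖(a : ℂ) + t * rayDir ω i - a‖ ≤ ((a : ℂ) + t * rayDir ω i - a).re := by
    rw [e, add_sub_cancel_left, Complex.re_ofReal_mul, re_rayDir, mul_comm]
  rcases raySign_eq i with hs | hs
  · have := hC' _ h2 h3
    rw [e] at this
    rw [contourPt, hs, one_mul]; exact this.trans (le_max_left _ _)
  · have := hD' _ h2 h3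
    rw [e] at this
    rw [contourPt, hs, neg_one_mul]; exact this.trans (le_max_right _ _)

theorem continuousOn_contour (hR : IsOuterResolvent R a) {ω : ℝ} (h0 : 0 < ω)
    (h1 : ω < Real.pi / 2) (i : Fin 4) :
    ContinuousOn (fun t : ℝ => R (contourPt a ω i t)) (Ioi 0) :=
  hR.continuousOn.comp (continuous_contourPt a ω i).continuousOn
    fun _ ht => contourPt_outer hR.nonneg h0 h1 ht i

theorem integrableOn (hR : IsOuterResolvent R a) {φ ω : ℝ} {f : ℂ → ℂ} (hf : MemElemZero φ a f)
    (h0 : 0 < φ) (h : φ < ω) (h1 : ω < Real.pi / 2) (i : Fin 4) :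
    IntegrableOn (fun t : ℝ => f (contourPt a ω i t) • R (contourPt a ω i t)) (Ioi 0) := by
  obtain ⟨C, -, hC⟩ := hR.contour_bound (h0.trans h) h1
  exact hf.integrableOn_smul h h1.le i (hR.continuousOn_contour (h0.trans h) h1 i) (hC i)

end IsOuterResolvent

/-- `(2πi)⁻¹ ∫ f(z) R(z) dz` over the boundary of `BS_{ω,a}`. -/
noncomputable def contourOp (R : ℂ → 𝔸) (a ω : ℝ) (f : ℂ → ℂ) : 𝔸 :=
  (2 * (Real.pi : ℂ) * Complex.I)⁻¹ • contourInt a ω (fun z => f z • R z)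

theorem contourCalc_eq {X : Type*} [NormedAddCommGroup X] [NormedSpace ℂ X] (A : X →ₗ.[ℂ] X) (a ω : ℝ) (f : ℂ → ℂ) :
    contourCalc A a ω f = contourOp (resolventOf A) a ω f := by
  rw [contourCalc, contourOp, contourInt_eq_rayDiff]
  congr 1
  simp only [rayIntegral, rayDiff, smul_smul]
  have e : ∀ t : ℝ, ∀ v : ℂ, -(a : ℂ) + t * -v = -(a + t * v) := fun t v => by ring
  simp only [e, neg_mul, neg_smul, integral_neg]
  abel

theorem contourOp_congr {ω φ : ℝ} (ha : 0 ≤ a) (h0 : 0 < φ) (h : φ < ω) (h1 : ω ≤ Real.pi / 2)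
    {f g : ℂ → ℂ} (hfg : ∀ z ∈ bisector φ a, f z = g z) :
    contourOp R a ω f = contourOp R a ω g := by
  rw [contourOp, contourOp]
  congr 1
  exact contourInt_congr fun i t ht => by
    rw [hfg _ (contourPt_mem_bisector ha h0 h h1 ht i)]

variable [CompleteSpace 𝔸]

omit [CompleteSpace 𝔸] in
theorem contourOp_sub (hR : IsOuterResolvent R a) {φ ω : ℝ} {f g : ℂ → ℂ} (hf : MemElemZero φ a f)
    (hg : MemElemZero φ a g) (h0 : 0 < φ) (h : φ < ω) (h1 : ω < Real.pi / 2) :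
    contourOp R a ω (fun z => f z - g z) = contourOp R a ω f - contourOp R a ω g := by
  rw [contourOp, contourOp, contourOp, ← smul_sub, ← contourInt_sub
    (hR.integrableOn hf h0 h h1) (hR.integrableOn hg h0 h h1)]
  simp only [sub_smul]

omit [CompleteSpace 𝔸] in
theorem contourOp_const_mul {ω : ℝ} (c : ℂ) (f : ℂ → ℂ) :
    contourOp R a ω (fun z => c * f z) = c • contourOp R a ω f := by
  rw [contourOp, contourOp, smul_comm c]
  congr 1
  simp only [contourInt, Finset.smul_sum, ← integral_smul]
  refine Finset.sum_congr rfl fun i _ => ?_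
  congr 1; ext1 t
  rw [mul_smul, smul_comm]

theorem contourOp_commute (hR : IsOuterResolvent R a) {φ ω : ℝ} {f : ℂ → ℂ}
    (hf : MemElemZero φ a f) (h0 : 0 < φ) (h : φ < ω) (h1 : ω < Real.pi / 2) {μ : ℂ}
    (hμ : a < |μ.re|) : R μ * contourOp R a ω f = contourOp R a ω f * R μ := by
  have hi := hR.integrableOn hf h0 h h1
  have e1 := contourInt_const_mul (F := fun z => f z • R z) hi (R μ)
  have e2 := contourInt_mul_const (F := fun z => f z • R z) hi (R μ)
  rw [contourOp, mul_smul_comm, smul_mul_assoc, e1, e2]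
  congr 1
  exact contourInt_congr fun i t ht => by
    rw [mul_smul_comm, smul_mul_assoc,
      hR.commute hμ (contourPt_outer hR.nonneg (h0.trans h) h1 ht i)]

theorem differentiableOn_sub_inv {s : Set ℂ} {μ : ℂ} (h : ∀ z ∈ s, μ - z ≠ 0) :
    DifferentiableOn ℂ (fun z => (μ - z)⁻¹) s := by
  have : DifferentiableOn ℂ (fun z => μ - z) s := by fun_prop
  exact this.fun_inv h

theorem norm_div_sub_le {μ z : ℂ} {c : ℝ} (hc : 0 < c) (h : c ≤ ‖μ - z‖) :
    ‖z‖ * ‖(μ - z)⁻¹‖ ≤ 1 + ‖μ‖ / c := by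
  have hp : 0 < ‖μ - z‖ := hc.trans_le h
  rw [norm_inv, ← div_eq_mul_inv, div_le_iff₀ hp]
  have h1 : ‖z‖ ≤ ‖μ - z‖ + ‖μ‖ := by
    have := norm_sub_le μ (μ - z)
    rw [sub_sub_cancel] at this; linarith
  have h2 : ‖μ‖ ≤ ‖μ‖ / c * ‖μ - z‖ := by
    rw [div_mul_eq_mul_div, le_div_iff₀ hc]; gcongr
  linarith

/-- The pole μ stays at positive distance from the domain of f, and f → 0 at infinity makes z
f(z)/(μ - z) → 0, so Cauchy's theorem applies. -/
theorem contourInt_div_sub_eq_zero {φ ω c : ℝ} {f : ℂ → ℂ} (ha : 0 ≤ a) (hf : MemElemZero φ a f)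
    (h0 : 0 < φ) (h : φ < ω) (h1 : ω < Real.pi / 2) {μ : ℂ} (hc : 0 < c)
    (hd : ∀ z ∈ bisector φ a, c ≤ ‖μ - z‖) :
    (∀ i, IntegrableOn (fun t : ℝ => f (contourPt a ω i t) * (μ - contourPt a ω i t)⁻¹) (Ioi 0)) ∧
    contourInt a ω (fun z => f z * (μ - z)⁻¹) = 0 := by
  have hne : ∀ z ∈ bisector φ a, μ - z ≠ 0 := fun z hz h => by
    have := hd z hz; rw [h, norm_zero] at this; linarith
  have hi : ∀ i, IntegrableOn
      (fun t : ℝ => f (contourPt a ω i t) * (μ - contourPt a ω i t)⁻¹) (Ioi 0) := by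
    intro i
    refine hf.integrableOn_smul (C := 1 + ‖μ - raySign i * a‖ / c) h h1.le i
      (k := fun t => (μ - contourPt a ω i t)⁻¹) ?_ ?_
    · refine ContinuousOn.inv₀ (continuous_const.sub (continuous_contourPt a ω i)).continuousOn ?_
      exact fun t ht => hne _ (contourPt_mem_bisector ha h0 h h1.le ht i)
    · intro t ht
      have := norm_div_sub_le (μ := μ - raySign i * a) (z := contourPt a ω i t - raySign i * a) hc
        (by rw [sub_sub_sub_cancel_right]
            exact hd _ (contourPt_mem_bisector ha h0 h h1.le ht i))
      rw [contourPt_sub_sign ht, sub_sub_sub_cancel_right] at this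
      rw [mul_comm]; exact this
  refine ⟨hi, ?_⟩
  obtain ⟨C, hC⟩ := hf.bdd
  refine contourInt_eq_zero (C := C * c⁻¹) ha h0 h h1 ?_ ?_ ?_ hi
  · exact hf.holo.mul (differentiableOn_sub_inv hne)
  · intro z hz
    rw [norm_mul, norm_inv]
    have := hd z hz
    exact mul_le_mul (hC z hz) (by gcongr) (by positivity) ((norm_nonneg _).trans (hC z hz))
  · have hl := hf.lim_infty
    rw [tendsto_zero_iff_norm_tendsto_zero] at hl ⊢
    have := hl.mul_const (1 + ‖μ‖ / c)
    rw [zero_mul] at this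
    refine squeeze_zero' (Eventually.of_forall fun _ => norm_nonneg _) ?_ this
    filter_upwards [mem_inf_of_right (mem_principal_self _)] with z hz
    rw [smul_eq_mul, norm_mul, norm_mul, mul_left_comm]
    gcongr
    exact norm_div_sub_le hc (hd z hz)

/-- By the resolvent identity, f(z) R(z) R(μ) = f(z)/(μ - z) · (R(z) - R(μ)). The term with R(μ)
integrates to zero by `contourInt_div_sub_eq_zero`. -/
theorem contourOp_mul_resolvent (hR : IsOuterResolvent R a) {φ ω c : ℝ} {f : ℂ → ℂ}
    (hf : MemElemZero φ a f) (h0 : 0 < φ) (h : φ < ω) (h1 : ω < Real.pi / 2) {μ : ℂ}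
    (hμ : a < |μ.re|) (hc : 0 < c) (hd : ∀ z ∈ bisector φ a, c ≤ ‖μ - z‖) :
    contourOp R a ω f * R μ = contourOp R a ω (fun z => f z * (μ - z)⁻¹) := by
  have hi := hR.integrableOn hf h0 h h1
  obtain ⟨hi2, hz⟩ := contourInt_div_sub_eq_zero hR.nonneg hf h0 h h1 hc hd
  have hne : ∀ z ∈ bisector φ a, μ - z ≠ 0 := fun z hz h => by
    have := hd z hz; rw [h, norm_zero] at this; linarith
  have hg : MemElemZero φ a (fun z => f z * (μ - z)⁻¹) :=
    hf.mul (h := fun z => (μ - z)⁻¹) (C := c⁻¹) hR.nonneg h0 (h.trans h1)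
      (differentiableOn_sub_inv hne) fun z hz => by
        rw [norm_inv]; have := hd z hz; gcongr
  have e2 := contourInt_mul_const (F := fun z => f z • R z) hi (R μ)
  rw [contourOp, contourOp, smul_mul_assoc, e2]
  congr 1
  have e3 : contourInt a ω (fun z => (f z * (μ - z)⁻¹) • R μ) = 0 := by
    rw [contourInt_smul_const (fun z => f z * (μ - z)⁻¹), hz, zero_smul]
  have hi3 : ∀ i, IntegrableOn (fun t : ℝ =>
      (f (contourPt a ω i t) * (μ - contourPt a ω i t)⁻¹) • R μ) (Ioi 0) :=
    fun i => Integrable.smul_const (hi2 i) (R μ)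
  have hi4 := hR.integrableOn hg h0 h h1
  have e4 := contourInt_sub (F := fun z => (f z * (μ - z)⁻¹) • R z)
    (G := fun z => (f z * (μ - z)⁻¹) • R μ) hi4 hi3
  rw [e3, sub_zero] at e4
  rw [← e4]
  refine contourInt_congr (F := fun z => f z • R z * R μ)
    (G := fun z => (f z * (μ - z)⁻¹) • R z - (f z * (μ - z)⁻¹) • R μ) fun i t ht => ?_
  rw [← smul_sub, hR.ident _ μ (contourPt_outer hR.nonneg (h0.trans h) h1 ht i) hμ, smul_smul,
    mul_assoc, inv_mul_cancel₀ (hne _ (contourPt_mem_bisector hR.nonneg h0 h h1.le ht i)),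
    mul_one, smul_mul_assoc]

end Outer

/-! ### Cauchy's formula inside the bisector -/

theorem convex_cone (a κ : ℝ) (hκ : 0 ≤ κ) : Convex ℝ {w : ℂ | κ * ‖w - a‖ < (w - a).re} := by
  intro x hx y hy s t hs ht hst
  simp only [mem_ofPred_eq] at hx hy ⊢
  have e : s • x + t • y - a = s • (x - a) + t • (y - a) := by
    have : (s : ℂ) + t = 1 := by exact_mod_cast hst
    simp only [Complex.real_smul]; linear_combination (a : ℂ) * this
  have h1 : ‖s • (x - a) + t • (y - a)‖ ≤ s * ‖x - a‖ + t * ‖y - a‖ := by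
    refine (norm_add_le _ _).trans_eq ?_
    rw [norm_smul, norm_smul, Real.norm_of_nonneg hs, Real.norm_of_nonneg ht]
  rw [e, Complex.add_re, Complex.smul_re, Complex.smul_re, smul_eq_mul, smul_eq_mul]
  have h2 := mul_le_mul_of_nonneg_left h1 hκ
  rcases hs.eq_or_lt with rfl | hs'
  · have : t = 1 := by linarith
    subst this; nlinarith
  · nlinarith [mul_lt_mul_of_pos_left hx hs', mul_le_mul_of_nonneg_left hy.le ht]

theorem isOpen_cone (a κ : ℝ) : IsOpen {w : ℂ | κ * ‖w - a‖ < (w - a).re} :=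
  isOpen_lt (by fun_prop) (by fun_prop)

theorem ne_of_mem_bisector {a ψ : ℝ} (h0 : 0 < ψ) (h1 : ψ < Real.pi / 2) {z : ℂ}
    (hz : z ∈ bisector ψ a) : z ≠ a ∧ z ≠ -a := by
  have := (mem_bisector_iff h0 h1).1 hz
  constructor
  · rintro rfl; simp at this
  · rintro rfl; simp at this

theorem one_add_le_mul_add {d t : ℝ} (hd : 0 < d) (ht : 0 ≤ t) : 1 + t ≤ (1 + 1 / d) * (t + d) := by
  have : (1 + 1 / d) * (t + d) = 1 + t + (d + t / d) := by field_simp; ring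
  rw [this]
  have : 0 ≤ t / d := by positivity
  linarith

theorem norm_inv_mul_le {c d t : ℝ} {x : ℂ} (hc : 0 < c) (hd : 0 < d) (ht : 0 ≤ t)
    (h : c * (t + d) ≤ ‖x‖) : ‖x⁻¹‖ * (1 + t) ≤ (1 + 1 / d) / c := by
  have hp : 0 < c * (t + d) := by positivity
  rw [norm_inv, inv_mul_le_iff₀ (hp.trans_le h)]
  refine (one_add_le_mul_add hd ht).trans ?_
  calc (1 + 1 / d) * (t + d) = (1 + 1 / d) / c * (c * (t + d)) := by field_simp
    _ ≤ (1 + 1 / d) / c * ‖x‖ := by gcongr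
    _ = _ := mul_comm _ _

section Cauchy
variable {a ω ψ : ℝ} {z : ℂ}

/-- Since z lies outside the cone of half-angle ψ at a, which contains the contour of angle ω, the
only singularity enclosed on the right is b. -/
theorem rayDiff_right_pole (h0 : 0 < ω) (h : ω < ψ) (h1 : ψ < Real.pi / 2)
    (hz : z ∈ bisector ψ a) {b : ℝ} (hb : a < b) :
    rayDiff a ω (fun w => ((b : ℂ) - w)⁻¹ * (w - z)⁻¹) = 2 * Real.pi * Complex.I * (b - z)⁻¹ := by
  have hψ : 0 < ψ := h0.trans h
  have hc := cos_lt_cos_of_lt h0 h h1.le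
  have hd : 0 < ‖z - a‖ := norm_pos_iff.2 (sub_ne_zero.2 (ne_of_mem_bisector hψ h1 hz).1)
  refine rayDiff_residue (G := fun w => (w - z)⁻¹) h0 (h.trans h1) hb
    (convex_cone a (Real.cos ψ) (cos_pos_of_lt hψ h1).le) (isOpen_cone _ _) ?_ ?_
    (C := (1 + 1 / ‖z - a‖) / ((Real.cos ω - Real.cos ψ) / 4)) ?_ ?_
  · intro w hw
    have : 0 ≤ Real.cos ψ * ‖w - a‖ := mul_nonneg (cos_pos_of_lt hψ h1).le (norm_nonneg _)
    have := this.trans_lt hw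
    rwa [Complex.sub_re, Complex.ofReal_re, sub_pos] at this
  · intro w hw hw'
    rw [mem_ofPred_eq]
    have : 0 < ‖w - a‖ := norm_pos_iff.2 fun h => by
      rw [sub_eq_zero] at h; rw [h, Complex.ofReal_re] at hw; exact lt_irrefl _ hw
    nlinarith
  · have : DifferentiableOn ℂ (fun w => w - z) {w : ℂ | Real.cos ψ * ‖w - a‖ < (w - a).re} := by
      fun_prop
    refine this.fun_inv fun w hw h => ?_
    rw [sub_eq_zero] at h
    rw [h] at hw
    exact absurd ((mem_bisector_iff hψ h1).1 hz).1 (not_lt.2 (le_of_lt hw))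
  · intro w hw hw'
    exact norm_inv_mul_le (by linarith) hd (norm_nonneg _)
      (norm_right_sub_ge hψ h1 hc.le (Real.cos_le_one ω) hz hw')

/-- After reflection neither -b nor -z lies in the right cone, and the integrand decays
quadratically, so Cauchy's theorem in the sector gives zero. -/
theorem rayDiff_left_pole (ha : 0 ≤ a) (h0 : 0 < ω) (h : ω < ψ) (h1 : ψ < Real.pi / 2)
    (hz : z ∈ bisector ψ a) {b : ℝ} (hb : a < b) :
    rayDiff a ω (fun w => ((b : ℂ) - -w)⁻¹ * (-w - z)⁻¹) = 0 := by
  have hψ : 0 < ψ := h0.trans h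
  have hc := cos_lt_cos_of_lt h0 h h1.le
  have hd : 0 < ‖z + a‖ := norm_pos_iff.2 fun h => (ne_of_mem_bisector hψ h1 hz).2
    (eq_neg_of_add_eq_zero_left h)
  set c := (Real.cos ω - Real.cos ψ) / 4 with hcdef
  have hc' : 0 < c := by rw [hcdef]; linarith
  have hcz := (mem_bisector_iff hψ h1).1 (neg_mem_bisector hψ h1 hz)
  have hab : 0 < b - a := by linarith
  have l2 : ∀ w : ℂ, a < w.re → 1 * (‖w - a‖ + (b - a)) / 2 ≤ ‖(b : ℂ) - -w‖ := by
    intro w hw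
    have h1 : ‖w - a‖ ≤ ‖w + b‖ := by
      have := norm_sub_ofReal_le_norm_add ha (z := w) (by linarith)
      refine this.trans ?_
      rw [← sq_le_sq₀ (norm_nonneg _) (norm_nonneg _), ← Complex.normSq_eq_norm_sq,
        ← Complex.normSq_eq_norm_sq, Complex.normSq_apply, Complex.normSq_apply]
      simp only [Complex.add_re, Complex.ofReal_re, Complex.add_im, Complex.ofReal_im]
      nlinarith
    have h2 : b - a ≤ ‖w + b‖ := by
      refine le_trans ?_ (Complex.re_le_norm _)
      simp only [Complex.add_re, Complex.ofReal_re]; linarith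
    rw [sub_neg_eq_add, add_comm (b : ℂ)]; linarith
  have main : ∀ w : ℂ, a < w.re → Real.cos ω * ‖w - a‖ ≤ (w - a).re →
      ‖((b : ℂ) - -w)⁻¹ * (-w - z)⁻¹‖ * (1 + ‖w - a‖) ^ 2 ≤
        (1 + 1 / (b - a)) / (1 / 2) * ((1 + 1 / ‖z + a‖) / c) := by
    intro w hw hw'
    have b1 := norm_inv_mul_le (c := 1 / 2) (by norm_num) hab (norm_nonneg (w - a))
      (x := (b : ℂ) - -w) (by have := l2 w hw; linarith)
    have b2 := norm_inv_mul_le (c := c) hc' hd (norm_nonneg (w - a)) (x := -w - z) (by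
      have := norm_left_sub_ge hψ h1 hc.le (Real.cos_le_one ω) hz hw'
      rwa [← norm_neg (w + z), neg_add'] at this)
    rw [norm_mul, show ∀ p q r : ℝ, p * q * r ^ 2 = (p * r) * (q * r) by intros; ring]
    exact mul_le_mul b1 b2 (by positivity) (by positivity)
  have hUne : ∀ w ∈ {w : ℂ | Real.cos ψ * ‖w - a‖ < (w - a).re}, -w - z ≠ 0 := by
    intro w hw h
    have : w = -z := by linear_combination -h
    rw [this] at hw
    exact absurd hcz.1 (not_lt.2 (le_of_lt hw))
  have hUne2 : ∀ w ∈ {w : ℂ | Real.cos ψ * ‖w - a‖ < (w - a).re}, (b : ℂ) - -w ≠ 0 := by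
    intro w hw h
    have h3 : 0 ≤ Real.cos ψ * ‖w - a‖ := mul_nonneg (cos_pos_of_lt hψ h1).le (norm_nonneg _)
    have h4 := h3.trans_lt hw
    have h5 := congrArg Complex.re h
    simp only [Complex.sub_re, Complex.ofReal_re, Complex.neg_re, Complex.zero_re] at h4 h5
    linarith
  have hUc : ∀ w : ℂ, a < w.re → Real.cos ω * ‖w - a‖ ≤ (w - a).re →
      w ∈ {w : ℂ | Real.cos ψ * ‖w - a‖ < (w - a).re} := by
    intro w hw hw'
    rw [mem_ofPred_eq]
    have : 0 < ‖w - a‖ := norm_pos_iff.2 fun h => by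
      rw [sub_eq_zero] at h; rw [h, Complex.ofReal_re] at hw; exact lt_irrefl _ hw
    nlinarith
  have hol : DifferentiableOn ℂ (fun w => ((b : ℂ) - -w)⁻¹ * (-w - z)⁻¹)
      {w : ℂ | Real.cos ψ * ‖w - a‖ < (w - a).re} := by
    have d1 : DifferentiableOn ℂ (fun w => (b : ℂ) - -w)
      {w : ℂ | Real.cos ψ * ‖w - a‖ < (w - a).re} := by fun_prop
    have d2 : DifferentiableOn ℂ (fun w => -w - z)
      {w : ℂ | Real.cos ψ * ‖w - a‖ < (w - a).re} := by fun_prop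
    exact (d1.fun_inv hUne2).mul (d2.fun_inv hUne)
  have onray : ∀ i : Fin 2, ∀ v : ℂ, v = ![Complex.exp (ω * Complex.I),
      Complex.exp (-(ω * Complex.I))] i → ∀ t : ℝ, 0 < t →
      a < ((a : ℂ) + t * v).re ∧ ‖(a : ℂ) + t * v - a‖ = t ∧
      Real.cos ω * ‖(a : ℂ) + t * v - a‖ ≤ ((a : ℂ) + t * v - a).re := by
    intro i v hv t ht
    have hv' : ‖v‖ = 1 ∧ v.re = Real.cos ω := by
      fin_cases i
      · simp only [Fin.zero_eta, Matrix.cons_val_zero] at hv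
        rw [hv]; exact ⟨Complex.norm_exp_ofReal_mul_I ω, re_exp_mul_I ω⟩
      · simp only [Fin.mk_one, Matrix.cons_val_one] at hv
        rw [hv]; exact ⟨norm_exp_neg_mul_I ω, re_exp_neg_mul_I ω⟩
    have e : ‖(a : ℂ) + t * v - a‖ = t := by
      rw [add_sub_cancel_left, norm_mul, hv'.1, Complex.norm_real, Real.norm_of_nonneg ht.le,
        mul_one]
    refine ⟨?_, e, ?_⟩
    · rw [Complex.add_re, Complex.re_ofReal_mul, hv'.2, Complex.ofReal_re]
      have := mul_pos ht (cos_pos_of_lt h0 (h.trans h1)); linarith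
    · rw [e, add_sub_cancel_left, Complex.re_ofReal_mul, hv'.2, mul_comm]
  have hi : ∀ i : Fin 2, ∀ v : ℂ, v = ![Complex.exp (ω * Complex.I),
      Complex.exp (-(ω * Complex.I))] i →
      IntegrableOn (fun t : ℝ => ((b : ℂ) - -(a + t * v))⁻¹ * (-(a + t * v) - z)⁻¹) (Ioi 0) := by
    intro i v hv
    refine integrableOn_of_le_inv_sq
      (C := (1 + 1 / (b - a)) / (1 / 2) * ((1 + 1 / ‖z + a‖) / c)) ?_ ?_
    · have hc : Continuous fun t : ℝ => (a : ℂ) + t * v := by fun_prop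
      exact hol.continuousOn.comp hc.continuousOn fun t ht =>
        hUc _ (onray i v hv t ht).1 (onray i v hv t ht).2.2
    · intro t ht
      have := main _ (onray i v hv t ht).1 (onray i v hv t ht).2.2
      rwa [(onray i v hv t ht).2.1] at this
  have K0 : 0 ≤ (1 + 1 / (b - a)) / (1 / 2) * ((1 + 1 / ‖z + a‖) / c) := by positivity
  refine rayDiff_eq_zero (r₀ := 1) (r₁ := 0)
    (C := (1 + 1 / (b - a)) / (1 / 2) * ((1 + 1 / ‖z + a‖) / c)) h0 (h.trans h1)
    (convex_cone a (Real.cos ψ) (cos_pos_of_lt hψ h1).le) (isOpen_cone _ _) hUc hol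
    one_pos ?_ ?_ (hi 0 _ rfl) (hi 1 _ rfl)
  · intro w hw _ hw'
    refine le_trans ?_ (main w hw hw')
    exact le_mul_of_one_le_right (norm_nonneg _)
      (one_le_pow₀ (by linarith [norm_nonneg (w - a)]))
  · intro w hw _ hw'
    refine le_trans ?_ (main w hw hw')
    gcongr; linarith

/-- Cauchy's formula at an interior point. A rational function with the same value at z is
subtracted, the quotient is handled by Cauchy's theorem, and the rational part is evaluated by its
residue at the exterior point b. -/
theorem contourInt_div_sub_eq {φ : ℝ} {g : ℂ → ℂ} (ha : 0 ≤ a) (hg : MemElemZero φ a g)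
    (hφ : 0 < φ) (hφω : φ < ω) (h : ω < ψ) (h1 : ψ < Real.pi / 2) (hz : z ∈ bisector ψ a) :
    contourInt a ω (fun w => g w * (w - z)⁻¹) = 2 * Real.pi * Complex.I * g z := by
  have h0 : 0 < ω := hφ.trans hφω
  have hψ : 0 < ψ := h0.trans h
  have hφ1 : φ < Real.pi / 2 := by linarith
  have hc := cos_lt_cos_of_lt h0 h h1.le
  set c := (Real.cos ω - Real.cos ψ) / 4 with hcdef
  have hc' : 0 < c := by rw [hcdef]; linarith
  have hs : bisector ψ a ⊆ bisector φ a := bisector_anti hφ (hφω.trans h).le h1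
  have hzφ := hs hz
  set b : ℝ := a + 1 with hb
  set k : ℝ := (1 - Real.cos φ) / 4 with hk
  have hk0 : 0 < k := by have := cos_lt_one_of_pos hφ hφ1; rw [hk]; linarith
  have hbne : ∀ w ∈ bisector φ a, k ≤ ‖(b : ℂ) - w‖ := by
    intro w hw
    refine le_trans ?_ (norm_ofReal_sub_ge hφ hφ1 (b := b) (by rw [hb]; linarith) hw)
    rw [hb, ← hk]; nlinarith [norm_nonneg (w - a)]
  have hbne' : ∀ w ∈ bisector φ a, (b : ℂ) - w ≠ 0 := fun w hw h => by
    have := hbne w hw; rw [h, norm_zero] at this; linarith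
  -- Subtracting the constant g z would leave the non-integrable tail of (w - z)⁻¹. The factor (b -
  -- z)/(b - w) is 1 at w = z and decays.
  set D : ℂ → ℂ := fun w => g w - g z * (b - z) * ((b : ℂ) - w)⁻¹ with hD
  have hDz : D z = 0 := by
    simp only [hD]; rw [mul_assoc, mul_inv_cancel₀ (hbne' z hzφ), mul_one, sub_self]
  have hDhol : DifferentiableOn ℂ D (bisector φ a) :=
    hg.holo.sub ((differentiableOn_sub_inv hbne').const_mul _)
  have hop := isOpen_bisector hφ hφ1 (a := a)
  have hFhol : DifferentiableOn ℂ (dslope D z) (bisector φ a) :=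
    (Complex.differentiableOn_dslope (hop.mem_nhds hzφ)).2 hDhol
  have hFeq : ∀ w, w ≠ z → dslope D z w = g w * (w - z)⁻¹ -
      g z * (b - z) * (((b : ℂ) - w)⁻¹ * (w - z)⁻¹) := by
    intro w hw
    rw [dslope_of_ne _ hw, slope_def_field, hDz, sub_zero, div_eq_mul_inv]
    simp only [hD]; ring
  obtain ⟨Cg, hCg⟩ := hg.bdd
  have hDb : ∀ w ∈ bisector φ a, ‖D w‖ ≤ Cg + ‖g z * (b - z)‖ * k⁻¹ := by
    intro w hw
    refine (norm_sub_le _ _).trans (add_le_add (hCg w hw) ?_)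
    rw [norm_mul, norm_inv]
    have := hbne w hw
    gcongr
  obtain ⟨r, hr, hball⟩ := Metric.isOpen_iff.1 hop z hzφ
  -- The quotient is bounded by compactness near z and by the bound of D divided by the distance
  -- elsewhere.
  have hFb : ∃ C, ∀ w ∈ bisector φ a, ‖dslope D z w‖ ≤ C := by
    have hsub : Metric.closedBall z (r / 2) ⊆ bisector φ a :=
      (Metric.closedBall_subset_ball (by linarith)).trans hball
    obtain ⟨C1, hC1⟩ := (isCompact_closedBall z (r / 2)).exists_bound_of_continuousOn
      (hFhol.continuousOn.mono hsub)
    refine ⟨max C1 ((Cg + ‖g z * (b - z)‖ * k⁻¹) / (r / 2)), fun w hw => ?_⟩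
    by_cases hwz : w ∈ Metric.closedBall z (r / 2)
    · exact (hC1 w hwz).trans (le_max_left _ _)
    · refine le_trans ?_ (le_max_right _ _)
      rw [Metric.mem_closedBall, not_le, dist_eq_norm] at hwz
      have hne : w ≠ z := by rintro rfl; rw [sub_self, norm_zero] at hwz; linarith
      rw [dslope_of_ne _ hne, slope_def_field, hDz, sub_zero, norm_div]
      exact div_le_div₀ ((norm_nonneg _).trans (hDb w hw)) (hDb w hw) (by positivity) hwz.le
  have hpt : ∀ i t, 0 < t → contourPt a ω i t ≠ z := by
    intro i t ht h
    have := norm_contourPt_sub_ge h0 ‹ω < ψ› h1 hz ht i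
    rw [h, sub_self, norm_zero] at this
    have h5 : 0 < c * (t + ‖z - raySign i * a‖) := by positivity
    rw [← hcdef] at this; linarith
  have hcont : ∀ i, Continuous fun t : ℝ => contourPt a ω i t := continuous_contourPt a ω
  have hinvc : ∀ i, ContinuousOn (fun t : ℝ => (contourPt a ω i t - z)⁻¹) (Ioi 0) := fun i =>
    ContinuousOn.inv₀ ((hcont i).sub continuous_const).continuousOn
      fun t ht => sub_ne_zero.2 (hpt i t ht)
  have hbc : ∀ i, ContinuousOn (fun t : ℝ => ((b : ℂ) - contourPt a ω i t)⁻¹) (Ioi 0) := fun i =>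
    ContinuousOn.inv₀ (continuous_const.sub (hcont i)).continuousOn
      fun t ht => hbne' _ (contourPt_mem_bisector ha hφ hφω (h.trans h1).le ht i)
  have hi1 : ∀ i, IntegrableOn (fun t : ℝ => g (contourPt a ω i t) * (contourPt a ω i t - z)⁻¹)
      (Ioi 0) := by
    intro i
    refine hg.integrableOn_smul hφω (h.trans h1).le i
      (k := fun t => (contourPt a ω i t - z)⁻¹) (C := c⁻¹) (hinvc i) ?_
    intro t ht
    have h6 := norm_contourPt_sub_ge h0 h h1 hz ht i
    rw [← hcdef] at h6
    rw [norm_inv, inv_mul_le_iff₀ (norm_pos_iff.2 (sub_ne_zero.2 (hpt i t ht)))]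
    rw [← div_eq_mul_inv, le_div_iff₀ hc']
    nlinarith [norm_nonneg (z - raySign i * a)]
  have hi2 : ∀ i, IntegrableOn (fun t : ℝ => ((b : ℂ) - contourPt a ω i t)⁻¹ *
      (contourPt a ω i t - z)⁻¹) (Ioi 0) := by
    intro i
    have hd : 0 < ‖z - raySign i * a‖ := by
      rw [norm_pos_iff, sub_ne_zero]
      rcases raySign_eq i with hs | hs
      · rw [hs, one_mul]; exact (ne_of_mem_bisector hψ h1 hz).1
      · rw [hs, neg_one_mul]; exact (ne_of_mem_bisector hψ h1 hz).2
    refine integrableOn_of_le_inv_sq (C := ((1 + 1 / (1 : ℝ)) / (k / (2 * a + 1))) *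
      ((1 + 1 / ‖z - raySign i * a‖) / c)) ((hbc i).mul (hinvc i)) fun t ht => ?_
    have b2 := norm_inv_mul_le hc' hd ht.le (x := contourPt a ω i t - z)
      (norm_contourPt_sub_ge h0 h h1 hz ht i)
    have b1 := norm_inv_mul_le (c := k / (2 * a + 1)) (d := 1) (t := t)
      (by positivity) one_pos ht.le (x := (b : ℂ) - contourPt a ω i t) (by
        have hm := contourPt_mem_bisector ha hφ hφω (h.trans h1).le ht i
        have h7 := norm_ofReal_sub_ge hφ hφ1 (b := b) (by rw [hb]; linarith) hm
        rw [← hk] at h7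
        refine le_trans ?_ h7
        have h8 : t ≤ ‖contourPt a ω i t - a‖ + 2 * a := by
          have h9 := contourPt_sub_sign ht i (a := a) (ω := ω)
          rcases raySign_eq i with hs | hs
          · rw [hs, one_mul] at h9; rw [h9]; linarith
          · rw [hs] at h9
            calc t = ‖contourPt a ω i t - -1 * (a : ℂ)‖ := h9.symm
              _ = ‖(contourPt a ω i t - a) + 2 * a‖ := by congr 1; ring
              _ ≤ _ := by
                  refine (norm_add_le _ _).trans_eq ?_
                  rw [norm_mul, Complex.norm_real, Real.norm_of_nonneg ha]; norm_num
        rw [div_mul_eq_mul_div, div_le_iff₀ (by positivity), mul_assoc]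
        refine mul_le_mul_of_nonneg_left ?_ hk0.le
        rw [hb]
        nlinarith [norm_nonneg (contourPt a ω i t - a)])
    rw [norm_mul, show ∀ p q r : ℝ, p * q * r ^ 2 = (p * r) * (q * r) by intros; ring]
    exact mul_le_mul b1 b2 (by positivity) (by positivity)
  have hi3 : ∀ i, IntegrableOn (fun t : ℝ => g z * (b - z) * (((b : ℂ) - contourPt a ω i t)⁻¹ *
      (contourPt a ω i t - z)⁻¹)) (Ioi 0) := fun i => Integrable.const_mul (hi2 i) _
  have hzero : contourInt a ω (fun w => g w * (w - z)⁻¹ -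
      g z * (b - z) * (((b : ℂ) - w)⁻¹ * (w - z)⁻¹)) = 0 := by
    rw [← contourInt_congr (F := dslope D z) fun i t ht => hFeq _ (hpt i t ht)]
    obtain ⟨C, hC⟩ := hFb
    refine contourInt_eq_zero ha hφ hφω (h.trans h1) hFhol hC ?_ ?_
    · have hl := hg.lim_infty
      have hl2 : Tendsto (fun w : ℂ => ((b : ℂ) - w)⁻¹)
          (Bornology.cobounded ℂ ⊓ 𝓟 (bisector φ a)) (𝓝 0) :=
        (Filter.tendsto_inv₀_cobounded.comp (tendsto_const_sub_cobounded (b : ℂ))).mono_left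
          inf_le_left
      have hD0 : Tendsto D (Bornology.cobounded ℂ ⊓ 𝓟 (bisector φ a)) (𝓝 0) := by
        have := hl.sub (hl2.const_mul (g z * (b - z)))
        rwa [mul_zero, sub_zero] at this
      have hfar : ∀ᶠ w : ℂ in Bornology.cobounded ℂ ⊓ 𝓟 (bisector φ a), 1 ≤ ‖w - z‖ := by
        refine mem_inf_of_left ?_
        exact (tendsto_norm_cobounded_atTop.comp (tendsto_sub_const_cobounded z)).eventually_ge_atTop 1
      rw [tendsto_zero_iff_norm_tendsto_zero] at hD0 ⊢
      have := hD0.mul_const (1 + ‖z‖ / 1)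
      rw [zero_mul] at this
      refine squeeze_zero' (Eventually.of_forall fun _ => norm_nonneg _) ?_ this
      filter_upwards [hfar] with w hw
      have hne : w ≠ z := by rintro rfl; rw [sub_self, norm_zero] at hw; linarith
      rw [dslope_of_ne _ hne, slope_def_field, hDz, sub_zero, smul_eq_mul, norm_mul, norm_div,
        div_eq_mul_inv, mul_left_comm]
      have := norm_div_sub_le (μ := z) (z := w) (c := 1) one_pos (by rwa [norm_sub_rev])
      rw [norm_inv, norm_sub_rev] at this
      gcongr
    · intro i
      refine ((hi1 i).sub (hi3 i)).congr_fun (fun t ht => ?_) measurableSet_Ioi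
      exact (hFeq _ (hpt i t ht)).symm
  have e1 := contourInt_sub (F := fun w => g w * (w - z)⁻¹)
    (G := fun w => g z * (b - z) * (((b : ℂ) - w)⁻¹ * (w - z)⁻¹)) hi1 hi3
  rw [hzero] at e1
  have e2 := contourInt_const_mul (F := fun w => ((b : ℂ) - w)⁻¹ * (w - z)⁻¹) hi2 (g z * (b - z))
  have hab : a < b := by rw [hb]; linarith
  rw [contourInt_eq_rayDiff a ω (fun w => ((b : ℂ) - w)⁻¹ * (w - z)⁻¹),
    rayDiff_right_pole h0 h h1 hz hab, rayDiff_left_pole ha h0 h h1 hz hab, sub_zero] at e2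
  rw [← sub_eq_zero.1 e1.symm] at e2
  rw [← e2]
  have := hbne' z hzφ
  field_simp

end Cauchy

/-! ### Multiplicativity of the contour calculus -/

section Product

/-- Fubini on each of the sixteen pairs of rays, justified by a majorant in product form. -/
theorem contourInt_comm {E : Type*} [NormedAddCommGroup E] [NormedSpace ℂ E] [CompleteSpace E]
    {a ω ψ : ℝ} {K : ℂ → ℂ → E} {u v : Fin 4 → ℝ → ℝ} (hu : ∀ i, IntegrableOn (u i) (Ioi 0))
    (hv : ∀ i, IntegrableOn (v i) (Ioi 0))
    (hK : ∀ i j, ContinuousOn (fun p : ℝ × ℝ => K (contourPt a ω i p.1) (contourPt a ψ j p.2))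
      (Ioi 0 ×ˢ Ioi 0))
    (hb : ∀ i j s t, 0 < s → 0 < t →
      ‖K (contourPt a ω i s) (contourPt a ψ j t)‖ ≤ u i s * v j t) :
    contourInt a ω (fun w => contourInt a ψ (K w)) =
      contourInt a ψ (fun z => contourInt a ω (fun w => K w z)) := by
  have hint : ∀ i j, Integrable (fun p : ℝ × ℝ => (contourWt ω i * contourWt ψ j) •
      K (contourPt a ω i p.1) (contourPt a ψ j p.2))
      ((volume.restrict (Ioi 0)).prod (volume.restrict (Ioi 0))) := by
    intro i j
    refine Integrable.smul _ ?_
    refine Integrable.mono' ((hu i).mul_prod (hv j)) ?_ ?_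
    · rw [Measure.prod_restrict]
      exact (hK i j).aestronglyMeasurable (measurableSet_Ioi.prod measurableSet_Ioi)
    · rw [Measure.prod_restrict]
      refine (ae_restrict_iff' (measurableSet_Ioi.prod measurableSet_Ioi)).2
        (ae_of_all _ fun p hp => hb i j _ _ hp.1 hp.2)
  have hin1 : ∀ i j s, 0 < s → IntegrableOn (fun t => contourWt ψ j •
      K (contourPt a ω i s) (contourPt a ψ j t)) (Ioi 0) := by
    intro i j s hs
    refine Integrable.smul _ ?_
    refine Integrable.mono' ((hv j).const_mul (u i s)) ?_ ?_
    · refine ContinuousOn.aestronglyMeasurable ?_ measurableSet_Ioi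
      exact (hK i j).comp (f := fun t : ℝ => (s, t)) (by fun_prop) fun t ht => ⟨hs, ht⟩
    · exact (ae_restrict_iff' measurableSet_Ioi).2 (ae_of_all _ fun t ht => hb i j _ _ hs ht)
  have key : ∀ i j, ∫ s in Ioi (0 : ℝ), contourWt ω i • ∫ t in Ioi (0 : ℝ), contourWt ψ j •
      K (contourPt a ω i s) (contourPt a ψ j t) = ∫ t in Ioi (0 : ℝ), contourWt ψ j •
      ∫ s in Ioi (0 : ℝ), contourWt ω i • K (contourPt a ω i s) (contourPt a ψ j t) := by
    intro i j
    simp only [← integral_smul, smul_smul]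
    rw [integral_integral_swap (hint i j)]
    simp only [mul_comm]
  have hs1 : ∀ i j, IntegrableOn (fun s => contourWt ω i • ∫ t in Ioi (0 : ℝ), contourWt ψ j •
      K (contourPt a ω i s) (contourPt a ψ j t)) (Ioi 0) := by
    intro i j
    have := (hint i j).integral_prod_left
    simp only [mul_smul, integral_smul] at this
    simp only [integral_smul]
    exact this
  have hs2 : ∀ i j, IntegrableOn (fun t => contourWt ψ j • ∫ s in Ioi (0 : ℝ), contourWt ω i •
      K (contourPt a ω i s) (contourPt a ψ j t)) (Ioi 0) := by
    intro i j
    have := (hint i j).integral_prod_right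
    simp only [mul_comm (contourWt ω i), mul_smul, integral_smul] at this
    simp only [integral_smul]
    exact this
  calc contourInt a ω (fun w => contourInt a ψ (K w))
      = ∑ i, ∑ j, ∫ s in Ioi (0 : ℝ), contourWt ω i • ∫ t in Ioi (0 : ℝ), contourWt ψ j •
        K (contourPt a ω i s) (contourPt a ψ j t) := by
        refine Finset.sum_congr rfl fun i _ => ?_
        simp only [contourInt, Finset.smul_sum]
        exact integral_finsetSum _ fun j _ => hs1 i j
    _ = ∑ j, ∑ i, ∫ t in Ioi (0 : ℝ), contourWt ψ j • ∫ s in Ioi (0 : ℝ), contourWt ω i •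
        K (contourPt a ω i s) (contourPt a ψ j t) := by
        rw [Finset.sum_comm]
        exact Finset.sum_congr rfl fun j _ => Finset.sum_congr rfl fun i _ => key i j
    _ = _ := by
        refine Finset.sum_congr rfl fun j _ => ?_
        simp only [contourInt, Finset.smul_sum]
        exact (integral_finsetSum _ fun i _ => hs2 i j).symm

variable {𝔸 : Type*} [NormedRing 𝔸] [NormedAlgebra ℂ 𝔸] [CompleteSpace 𝔸] {R : ℂ → 𝔸} {a : ℝ}

/-- The contour of g runs outside the bisector of angle φ' on which f lives, so f(A) R(w) = (f/(w -
·))(A) for w on it. After interchanging the integrals, Cauchy's formula for g at the points z of the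
inner contour leaves f(z) g(z). The strict chain φ < ω < φ' < ψ separates the two contours. -/
theorem contourOp_mul (hR : IsOuterResolvent R a) {φ ω φ' ψ : ℝ} {f g : ℂ → ℂ}
    (hg : MemElemZero φ a g) (hf : MemElemZero φ' a f) (h0 : 0 < φ) (h1 : φ < ω) (h2 : ω < φ')
    (h3 : φ' < ψ) (h4 : ψ < Real.pi / 2) :
    contourOp R a ψ f * contourOp R a ω g = contourOp R a ψ (fun z => f z * g z) := by
  have hω : 0 < ω := h0.trans h1
  have hφ' : 0 < φ' := hω.trans h2
  have hψ : 0 < ψ := hφ'.trans h3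
  have h5 : φ' < Real.pi / 2 := h3.trans h4
  have h6 : ω < Real.pi / 2 := h2.trans h5
  have hc := cos_lt_cos_of_lt hω h2 h5.le
  set c := (Real.cos ω - Real.cos φ') / 4 with hcdef
  have hc' : 0 < c := by rw [hcdef]; linarith
  have hdist : ∀ i t, 0 < t → ∀ z ∈ bisector φ' a, c * t ≤ ‖contourPt a ω i t - z‖ := by
    intro i t ht z hz
    refine le_trans ?_ (norm_contourPt_sub_ge hω h2 h5 hz ht i)
    rw [← hcdef]
    gcongr; linarith [norm_nonneg (z - raySign i * a)]
  have hmem : ∀ j t, 0 < t → contourPt a ψ j t ∈ bisector φ' a := fun j t ht =>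
    contourPt_mem_bisector hR.nonneg hφ' h3 h4.le ht j
  have hne : ∀ i t, 0 < t → ∀ z ∈ bisector φ' a, contourPt a ω i t - z ≠ 0 := by
    intro i t ht z hz h
    have := hdist i t ht z hz
    rw [h, norm_zero] at this
    have : 0 < c * t := by positivity
    linarith
  have hig := hR.integrableOn hg h0 h1 h6
  have hif := hR.integrableOn hf hφ' h3 h4
  set K : ℂ → ℂ → 𝔸 := fun w z => (g w * (w - z)⁻¹) • (f z • R z) with hK
  have s1 : contourOp R a ψ f * contourInt a ω (fun w => g w • R w) =
      (2 * (Real.pi : ℂ) * Complex.I)⁻¹ • contourInt a ω (fun w => contourInt a ψ (K w)) := by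
    rw [contourInt_const_mul (F := fun w => g w • R w) hig]
    have : ∀ i t, 0 < t → contourOp R a ψ f * g (contourPt a ω i t) • R (contourPt a ω i t) =
        (2 * (Real.pi : ℂ) * Complex.I)⁻¹ • contourInt a ψ (K (contourPt a ω i t)) := by
      intro i t ht
      rw [mul_smul_comm, contourOp_mul_resolvent hR hf hφ' h3 h4
        (contourPt_outer hR.nonneg hω h6 ht i) (mul_pos hc' ht) (hdist i t ht), contourOp,
        smul_comm]
      congr 1
      simp only [contourInt, Finset.smul_sum, ← integral_smul]
      refine Finset.sum_congr rfl fun j _ => ?_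
      congr 1; ext1 s
      simp only [hK, smul_smul]
      congr 1; ring
    rw [contourInt_congr (G := fun w => (2 * (Real.pi : ℂ) * Complex.I)⁻¹ • contourInt a ψ (K w))
      this]
    rw [contourInt, contourInt, Finset.smul_sum]
    refine Finset.sum_congr rfl fun i _ => ?_
    rw [← integral_smul]
    simp only [smul_comm (contourWt ω i)]
  have s2 : contourInt a ω (fun w => contourInt a ψ (K w)) =
      contourInt a ψ (fun z => contourInt a ω (fun w => K w z)) := by
    -- On the outer contour |w - z| ≥ c s for all z in the inner bisector, so the kernel costs a
    -- factor 1/s, which the integrability condition on g is made to absorb.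
    refine contourInt_comm (u := fun i s => c⁻¹ * ‖g (contourPt a ω i s) / (s : ℂ)‖)
      (v := fun j t => ‖f (contourPt a ψ j t) • R (contourPt a ψ j t)‖) ?_ ?_ ?_ ?_
    · exact fun i => (hg.integrableOn_contour h1 h6.le i).norm.const_mul _
    · exact fun j => (hif j).norm
    · intro i j
      have q1 : ContinuousOn (fun p : ℝ × ℝ => contourPt a ω i p.1) (Ioi 0 ×ˢ Ioi 0) :=
        ((continuous_contourPt a ω i).comp continuous_fst).continuousOn
      have q2 : ContinuousOn (fun p : ℝ × ℝ => contourPt a ψ j p.2) (Ioi 0 ×ˢ Ioi 0) :=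
        ((continuous_contourPt a ψ j).comp continuous_snd).continuousOn
      have c1 : ContinuousOn (fun p : ℝ × ℝ => g (contourPt a ω i p.1)) (Ioi 0 ×ˢ Ioi 0) :=
        hg.holo.continuousOn.comp q1 fun p hp =>
          contourPt_mem_bisector hR.nonneg h0 h1 h6.le hp.1 i
      have c2 : ContinuousOn (fun p : ℝ × ℝ => f (contourPt a ψ j p.2)) (Ioi 0 ×ˢ Ioi 0) :=
        hf.holo.continuousOn.comp q2 fun p hp => hmem j _ hp.2
      have c3 : ContinuousOn (fun p : ℝ × ℝ => R (contourPt a ψ j p.2)) (Ioi 0 ×ˢ Ioi 0) :=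
        hR.continuousOn.comp q2 fun p hp => contourPt_outer hR.nonneg hψ h4 hp.2 j
      have c4 : ContinuousOn (fun p : ℝ × ℝ => (contourPt a ω i p.1 - contourPt a ψ j p.2)⁻¹)
          (Ioi 0 ×ˢ Ioi 0) :=
        ContinuousOn.inv₀ (q1.sub q2) fun p hp => hne i _ hp.1 _ (hmem j _ hp.2)
      exact (c1.mul c4).smul (c2.smul c3)
    · intro i j s t hs ht
      simp only [hK]
      rw [norm_smul]
      refine mul_le_mul_of_nonneg_right ?_ (norm_nonneg _)
      rw [norm_mul, norm_div, Complex.norm_real, Real.norm_of_nonneg hs.le, norm_inv,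
        ← mul_div_assoc, mul_comm c⁻¹, mul_div_assoc]
      gcongr
      have := hdist i s hs _ (hmem j t ht)
      calc ‖contourPt a ω i s - contourPt a ψ j t‖⁻¹ ≤ (c * s)⁻¹ := by gcongr
        _ = c⁻¹ / s := by rw [mul_inv, div_eq_mul_inv]
  have s3 : contourInt a ψ (fun z => contourInt a ω (fun w => K w z)) =
      (2 * (Real.pi : ℂ) * Complex.I) • contourInt a ψ (fun z => (f z * g z) • R z) := by
    rw [contourInt_congr (G := fun z => (2 * (Real.pi : ℂ) * Complex.I) • ((f z * g z) • R z))]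
    · rw [contourInt, contourInt, Finset.smul_sum]
      refine Finset.sum_congr rfl fun i _ => ?_
      rw [← integral_smul]
      simp only [smul_comm (contourWt ψ i)]
    · intro j t ht
      simp only [hK]
      rw [contourInt_smul_const (fun w => g w * (w - contourPt a ψ j t)⁻¹),
        contourInt_div_sub_eq hR.nonneg hg h0 h1 h2 h5 (hmem j t ht), smul_smul, smul_smul]
      congr 1; ring
  have hpi : (2 * (Real.pi : ℂ) * Complex.I) ≠ 0 := Complex.two_pi_I_ne_zero
  rw [contourOp.eq_1 R a ω g, mul_smul_comm, s1, s2, s3, smul_smul _ (2 * (Real.pi : ℂ) * Complex.I),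
    inv_mul_cancel₀ hpi, one_smul, contourOp]

end Product

/-! ### A scale-invariant majorant -/

/-- `min(r^β, r^{-β})`. -/
noncomputable def bump (β r : ℝ) : ℝ := min (r ^ β) (r ^ (-β))

section Bump
variable {β r s : ℝ}

theorem bump_nonneg (hr : 0 ≤ r) : 0 ≤ bump β r :=
  le_min (Real.rpow_nonneg hr _) (Real.rpow_nonneg hr _)

theorem bump_le_one (hβ : 0 ≤ β) (hr : 0 ≤ r) : bump β r ≤ 1 := by
  rcases le_total r 1 with h | h
  · exact (min_le_left _ _).trans (Real.rpow_le_one hr h hβ)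
  · exact (min_le_right _ _).trans (Real.rpow_le_one_of_one_le_of_nonpos h (by linarith))

theorem le_bump_of_le (hβ : 0 ≤ β) (hr : 0 < r) {x : ℝ} (h1 : r ≤ 1 → x ≤ r ^ β)
    (h2 : 1 ≤ r → x ≤ r ^ (-β)) : x ≤ bump β r := by
  rcases le_total r 1 with h | h
  · exact le_min (h1 h) ((h1 h).trans (Real.rpow_le_rpow_of_exponent_ge hr h (by linarith)))
  · exact le_min ((h2 h).trans (Real.rpow_le_rpow_of_exponent_le h (by linarith))) (h2 h)

theorem bump_of_le_one (hβ : 0 ≤ β) (hr : 0 < r) (h : r ≤ 1) : bump β r = r ^ β :=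
  min_eq_left (Real.rpow_le_rpow_of_exponent_ge hr h (by linarith))

theorem bump_of_one_le (hβ : 0 ≤ β) (h : 1 ≤ r) : bump β r = r ^ (-β) :=
  min_eq_right (Real.rpow_le_rpow_of_exponent_le h (by linarith))

theorem bump_div_le (hβ : 0 ≤ β) (hr : 0 < r) (hs : 0 < s) :
    bump β (r / s) ≤ (max s s⁻¹) ^ β * bump β r := by
  have hm : 0 < max s s⁻¹ := lt_max_of_lt_left hs
  rw [bump, bump, mul_min_of_nonneg _ _ (by positivity)]
  refine min_le_min ?_ ?_
  · rw [div_eq_mul_inv, mul_comm, Real.mul_rpow (by positivity) hr.le]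
    gcongr; exact le_max_right _ _
  · rw [div_eq_mul_inv, mul_comm, Real.mul_rpow (by positivity) hr.le]
    gcongr
    rw [Real.inv_rpow hs.le, Real.rpow_neg hs.le, inv_inv]
    gcongr; exact le_max_left _ _

theorem integrableOn_bump_div (hβ : 0 < β) : IntegrableOn (fun t => bump β t / t) (Ioi 0) := by
  rw [← Ioc_union_Ioi_eq_Ioi zero_le_one]
  refine IntegrableOn.union ?_ ?_
  · have := intervalIntegral.intervalIntegrable_rpow' (a := 0) (b := 1) (r := β - 1) (by linarith)
    rw [intervalIntegrable_iff_integrableOn_Ioc_of_le zero_le_one] at this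
    refine this.congr_fun (fun t ht => ?_) measurableSet_Ioc
    simp only
    rw [bump_of_le_one hβ.le ht.1 ht.2, Real.rpow_sub_one ht.1.ne']
  · have := integrableOn_Ioi_rpow_of_lt (a := -β - 1) (by linarith) zero_lt_one
    refine this.congr_fun (fun t ht => ?_) measurableSet_Ioi
    simp only
    have ht' : (1 : ℝ) < t := ht
    rw [bump_of_one_le hβ.le ht'.le, Real.rpow_sub_one (by linarith)]

theorem bump_div_scale (hs : 0 < s) (t : ℝ) :
    bump β (t / s) / t = s⁻¹ * (bump β (s⁻¹ * t) / (s⁻¹ * t)) := by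
  rw [div_eq_inv_mul t s]
  rcases eq_or_ne t 0 with rfl | ht
  · simp
  · field_simp

theorem integrableOn_bump_scale (hβ : 0 < β) (hs : 0 < s) :
    IntegrableOn (fun t => bump β (t / s) / t) (Ioi 0) := by
  simp only [bump_div_scale hs]
  refine Integrable.const_mul ?_ _
  have := (integrableOn_Ioi_comp_mul_left_iff (fun t => bump β t / t) 0 (inv_pos.2 hs)).2
  rw [mul_zero] at this
  exact this (integrableOn_bump_div hβ)

/-- Invariance of dt/t under dilations. All bounds that are uniform in the scale rest on this. -/
theorem integral_bump_scale (hs : 0 < s) :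
    ∫ t in Ioi (0 : ℝ), bump β (t / s) / t = ∫ t in Ioi (0 : ℝ), bump β t / t := by
  simp only [bump_div_scale hs]
  rw [integral_const_mul, integral_comp_mul_left_Ioi (fun t => bump β t / t) 0 (inv_pos.2 hs),
    mul_zero, smul_eq_mul, ← mul_assoc, mul_inv_cancel₀ (inv_pos.2 hs).ne', one_mul]

theorem tendsto_bump_zero (hβ : 0 < β) : Tendsto (bump β) (𝓝[≥] 0) (𝓝 0) := by
  have : Tendsto (fun r : ℝ => r ^ β) (𝓝[≥] 0) (𝓝 0) := by
    have := (Real.continuousAt_rpow_const 0 β (Or.inr hβ.le)).tendsto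
    rw [Real.zero_rpow hβ.ne'] at this
    exact this.mono_left nhdsWithin_le_nhds
  exact squeeze_zero' (eventually_nhdsWithin_of_forall fun _ hr => bump_nonneg hr)
    (Eventually.of_forall fun _ => min_le_left _ _) this

theorem tendsto_bump_atTop (hβ : 0 < β) : Tendsto (bump β) atTop (𝓝 0) :=
  squeeze_zero' ((eventually_ge_atTop 0).mono fun _ hr => bump_nonneg hr)
    (Eventually.of_forall fun _ => min_le_right _ _) (tendsto_rpow_neg_atTop hβ)

end Bump

/-! ### Elementary functions from bounds -/

section Majorant
variable {a φ ω β : ℝ} {f : ℂ → ℂ}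

theorem min_norm_contourPt (ha : 0 ≤ a) (h1 : ω ≤ Real.pi / 2) (h0 : 0 < ω) {t : ℝ} (ht : 0 < t)
    (i : Fin 4) : min ‖contourPt a ω i t - a‖ ‖contourPt a ω i t + a‖ = t := by
  have key : min ‖(a : ℂ) + t * rayDir ω i - a‖ ‖(a : ℂ) + t * rayDir ω i + a‖ = t := by
    have hre : 0 ≤ ((a : ℂ) + t * rayDir ω i).re := by
      rw [Complex.add_re, Complex.re_ofReal_mul, re_rayDir, Complex.ofReal_re]
      have := mul_nonneg ht.le (Real.cos_nonneg_of_mem_Icc ⟨by linarith, h1⟩)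
      linarith
    rw [min_eq_left (norm_sub_ofReal_le_norm_add ha hre), add_sub_cancel_left,
      norm_ofReal_mul_rayDir ht]
  rcases raySign_eq i with hs | hs
  · rw [contourPt, hs, one_mul]; exact key
  · rw [contourPt, hs, neg_one_mul, ← neg_add', norm_neg, min_comm,
      show -((a : ℂ) + t * rayDir ω i) + a = -((a : ℂ) + t * rayDir ω i - a) by ring, norm_neg]
    exact key

theorem memElemZero_of_le {C : ℝ} (ha : 0 ≤ a) (h0 : 0 < φ) (h1 : φ < Real.pi / 2) (hβ : 0 < β)
    (hf : DifferentiableOn ℂ f (bisector φ a))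
    (h : ∀ z ∈ bisector φ a, ‖f z‖ ≤ C * bump β (min ‖z - a‖ ‖z + a‖)) : MemElemZero φ a f := by
  have lim : ∀ (l : Filter ℂ) (m : Filter ℝ), (∀ᶠ z in l, z ∈ bisector φ a) →
      Tendsto (bump β) m (𝓝 0) → Tendsto (fun z : ℂ => min ‖z - a‖ ‖z + a‖) l m →
      Tendsto f l (𝓝 0) := by
    intro l m hl hb hm
    rw [tendsto_zero_iff_norm_tendsto_zero]
    have := (hb.comp hm).const_mul C
    rw [mul_zero] at this
    exact squeeze_zero' (Eventually.of_forall fun _ => norm_nonneg _) (hl.mono h) this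
  have lim0 : ∀ c : ℂ, min ‖c - a‖ ‖c + a‖ = 0 → Tendsto f (𝓝[bisector φ a] c) (𝓝 0) := by
    intro c hc
    refine lim _ (𝓝[≥] 0) self_mem_nhdsWithin (tendsto_bump_zero hβ) ?_
    have c1 : Continuous fun z : ℂ => min ‖z - a‖ ‖z + a‖ := by fun_prop
    refine tendsto_nhdsWithin_iff.2 ⟨?_, Eventually.of_forall fun z =>
      le_min (norm_nonneg _) (norm_nonneg _)⟩
    have := c1.tendsto c
    rw [hc] at this
    exact this.mono_left nhdsWithin_le_nhds
  refine ⟨hf, ⟨C, fun z hz => ?_⟩, lim0 _ (by simp), lim0 _ (by simp), ?_, ?_⟩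
  · have hb := bump_le_one (r := min ‖z - a‖ ‖z + a‖) hβ.le (le_min (norm_nonneg _) (norm_nonneg _))
    have hd : 0 < min ‖z - a‖ ‖z + a‖ := by
      obtain ⟨n1, n2⟩ := ne_of_mem_bisector h0 h1 hz
      exact lt_min (norm_pos_iff.2 (sub_ne_zero.2 n1))
        (norm_pos_iff.2 fun h => n2 (eq_neg_of_add_eq_zero_left h))
    have hbp : 0 < bump β (min ‖z - a‖ ‖z + a‖) :=
      lt_min (Real.rpow_pos_of_pos hd _) (Real.rpow_pos_of_pos hd _)
    have hC : 0 ≤ C := by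
      by_contra hC
      have := (norm_nonneg _).trans (h z hz)
      nlinarith
    exact (h z hz).trans (mul_le_of_le_one_right hC hb)
  · refine lim _ atTop (mem_inf_of_right (mem_principal_self _)) (tendsto_bump_atTop hβ) ?_
    have t1 : Tendsto (fun z : ℂ => ‖z - a‖) (Bornology.cobounded ℂ) atTop :=
      tendsto_norm_cobounded_atTop.comp (tendsto_sub_const_cobounded (a : ℂ))
    have t2 : Tendsto (fun z : ℂ => ‖z + a‖) (Bornology.cobounded ℂ) atTop := by
      have := tendsto_norm_cobounded_atTop.comp (tendsto_sub_const_cobounded (-(a : ℂ)))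
      simp only [Function.comp_def, sub_neg_eq_add] at this
      exact this
    refine Tendsto.mono_left ?_ inf_le_left
    refine tendsto_atTop.2 fun K => ?_
    filter_upwards [t1.eventually_ge_atTop K, t2.eventually_ge_atTop K] with z h1 h2
    exact le_min h1 h2
  · intro ω hω hω1 v hv
    have main : ∀ i, IntegrableOn (fun t : ℝ => f (contourPt a ω i t) / (t : ℂ)) (Ioi 0) := by
      intro i
      have hi := Integrable.const_mul (integrableOn_bump_div hβ) C
      refine Integrable.mono' hi ?_ ?_
      · refine ContinuousOn.aestronglyMeasurable ?_ measurableSet_Ioi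
        refine ContinuousOn.div (hf.continuousOn.comp (continuous_contourPt a ω i).continuousOn
          fun t ht => contourPt_mem_bisector ha h0 hω hω1 ht i)
          Complex.continuous_ofReal.continuousOn fun t ht => ?_
        exact_mod_cast (ne_of_gt ht)
      · refine (ae_restrict_iff' measurableSet_Ioi).2 (ae_of_all _ fun t ht => ?_)
        have ht' : (0 : ℝ) < t := ht
        have := h _ (contourPt_mem_bisector ha h0 hω hω1 ht' i)
        rw [min_norm_contourPt ha hω1 (h0.trans hω) ht'] at this
        rw [norm_div, Complex.norm_real, Real.norm_of_nonneg ht'.le, ← mul_div_assoc]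
        gcongr
    rcases hv with rfl | rfl
    · exact ⟨by simpa [contourPt, raySign, rayDir] using main 0,
        by simpa [contourPt, raySign, rayDir] using main 2⟩
    · exact ⟨by simpa [contourPt, raySign, rayDir] using main 1,
        by simpa [contourPt, raySign, rayDir] using main 3⟩

/-- The resolvent is O(1/t) on the contour, so the bumps are integrated against dt/t, and the scale
s disappears from the bound. -/
theorem norm_contourOp_le {𝔸 : Type*} [NormedRing 𝔸] [NormedAlgebra ℂ 𝔸] [CompleteSpace 𝔸]
    {R : ℂ → 𝔸} (hR : IsOuterResolvent R a) (h0 : 0 < ω) (h1 : ω < Real.pi / 2) (hβ : 0 < β) :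
    ∃ K : ℝ, 0 < K ∧ ∀ (f : ℂ → ℂ) (C s : ℝ), 0 < s → 0 ≤ C →
      (∀ i t, 0 < t → ‖f (contourPt a ω i t)‖ ≤ C * (bump β (t / s) + bump β t)) →
      ‖contourOp R a ω f‖ ≤ K * C := by
  obtain ⟨D, hD, hDb⟩ := hR.contour_bound h0 h1
  set J := ∫ t in Ioi (0 : ℝ), bump β t / t with hJ
  have hJ0 : 0 ≤ J := setIntegral_nonneg measurableSet_Ioi fun t ht =>
    div_nonneg (bump_nonneg (le_of_lt ht)) (le_of_lt ht)
  refine ⟨8 * D * J + 1, by positivity, fun f C s hs hC hf => ?_⟩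
  have i1 := (integrableOn_bump_scale hβ hs).add (integrableOn_bump_div hβ)
  have e1 : ∫ t in Ioi (0 : ℝ), (bump β (t / s) / t + bump β t / t) = 2 * J := by
    rw [integral_add (integrableOn_bump_scale hβ hs) (integrableOn_bump_div hβ),
      integral_bump_scale hs]; ring
  have key := norm_contourInt_le (F := fun z => f z • R z) (a := a) (ω := ω)
    (g := fun t => C * D * (bump β (t / s) / t + bump β t / t)) (K := C * D * (2 * J))
    (Integrable.const_mul i1 _) (by rw [integral_const_mul, e1]) (fun i t ht => by
      rw [norm_smul]
      have h2 := hDb i t ht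
      have h3 := hf i t ht
      have h4 : ‖R (contourPt a ω i t)‖ ≤ D / t := by rwa [le_div_iff₀ ht]
      refine (mul_le_mul h3 h4 (norm_nonneg _) ((norm_nonneg _).trans h3)).trans_eq ?_
      field_simp)
  rw [contourOp, norm_smul]
  have hpi : ‖(2 * (Real.pi : ℂ) * Complex.I)⁻¹‖ ≤ 1 := by
    rw [norm_inv, norm_mul, norm_mul, Complex.norm_I, Complex.norm_real,
      Real.norm_of_nonneg Real.pi_pos.le, Complex.norm_ofNat, mul_one]
    exact inv_le_one_of_one_le₀ (by linarith [Real.pi_gt_three])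
  calc _ ≤ 1 * (4 * (C * D * (2 * J))) := by gcongr
    _ ≤ (8 * D * J + 1) * C := by nlinarith

end Majorant

/-! ### The bounded part of the calculus -/

section Calc
variable {𝔸 : Type*} [NormedRing 𝔸] [NormedAlgebra ℂ 𝔸]

/-- The action of an outer resolvent at a vertex of the bisector: `λ R(ε(a + λ)) y → 0` as
`λ → 0+`, where `ε = ±1`. -/
def VanishesAtVertex (R : ℂ → 𝔸) (a : ℝ) (ε : ℂ) (y : 𝔸) : Prop :=
  Tendsto (fun l : ℝ => (l : ℂ) • (R (ε * (a + l)) * y)) (𝓝[>] 0) (𝓝 0)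

/-- `h(A) = T`, where `h` is a bounded holomorphic function on the bisector with limits at the
vertices and `A` is an operator with resolvent `R`. -/
structure HasCalc (R : ℂ → 𝔸) (a φ : ℝ) (h : ℂ → ℂ) (T : 𝔸) : Prop where
  holo : DifferentiableOn ℂ h (bisector φ a)
  bdd : ∃ C : ℝ, ∀ z ∈ bisector φ a, ‖h z‖ ≤ C
  mul_left : ∀ (f : ℂ → ℂ) (φ' ψ : ℝ), φ ≤ φ' → φ' < ψ → ψ < Real.pi / 2 → MemElemZero φ' a f →
    contourOp R a ψ f * T = contourOp R a ψ (fun z => f z * h z)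
  vertex : ∀ ε : ℂ, (ε = 1 ∨ ε = -1) → ∃ p : ℂ, Tendsto h (𝓝[bisector φ a] (ε * a)) (𝓝 p) ∧
    VanishesAtVertex R a ε (T - p • 1)

variable {R : ℂ → 𝔸} {a φ : ℝ}

theorem VanishesAtVertex.add {ε : ℂ} {x y : 𝔸} (hx : VanishesAtVertex R a ε x)
    (hy : VanishesAtVertex R a ε y) : VanishesAtVertex R a ε (x + y) := by
  have := Tendsto.add hx hy
  simpa only [VanishesAtVertex, mul_add, smul_add, add_zero] using this

theorem VanishesAtVertex.smul {ε : ℂ} {x : 𝔸} (c : ℂ) (hx : VanishesAtVertex R a ε x) :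
    VanishesAtVertex R a ε (c • x) := by
  have := Tendsto.const_smul hx c
  simpa only [VanishesAtVertex, mul_smul_comm, smul_comm c, smul_zero] using this

theorem VanishesAtVertex.mul_right {ε : ℂ} {x : 𝔸} (hx : VanishesAtVertex R a ε x) (y : 𝔸) :
    VanishesAtVertex R a ε (x * y) := by
  have := Tendsto.mul_const y hx
  simpa only [VanishesAtVertex, zero_mul, smul_mul_assoc, mul_assoc] using this

theorem vertex_re {ε : ℂ} (hε : ε = 1 ∨ ε = -1) (ha : 0 ≤ a) {l : ℝ} (hl : 0 < l) :
    a < |(ε * (a + l)).re| := by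
  rcases hε with rfl | rfl
  · rw [one_mul, ← Complex.ofReal_add, Complex.ofReal_re, abs_of_nonneg (by linarith)]; linarith
  · rw [neg_one_mul, ← Complex.ofReal_add, Complex.neg_re, Complex.ofReal_re, abs_neg,
      abs_of_nonneg (by linarith)]; linarith

theorem IsOuterResolvent.vertex_bound (hR : IsOuterResolvent R a) {ε : ℂ} (hε : ε = 1 ∨ ε = -1) :
    ∃ C : ℝ, 0 < C ∧ ∀ l : ℝ, 0 < l → ‖R (ε * (a + l))‖ * l ≤ C := by
  have h1 : ∀ l : ℝ, 0 < l → a < ((a : ℂ) + l).re ∧ ‖(a : ℂ) + l - a‖ = l ∧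
      1 / 2 * ‖(a : ℂ) + l - a‖ ≤ ((a : ℂ) + l - a).re := by
    intro l hl
    have e : ‖(a : ℂ) + l - a‖ = l := by
      rw [add_sub_cancel_left, Complex.norm_real, Real.norm_of_nonneg hl.le]
    refine ⟨?_, e, ?_⟩
    · rw [← Complex.ofReal_add, Complex.ofReal_re]; linarith
    · rw [e, add_sub_cancel_left, Complex.ofReal_re]; linarith
  rcases hε with rfl | rfl
  · obtain ⟨C, hC, h⟩ := hR.right (1 / 2) (by norm_num) (by norm_num)
    refine ⟨C, hC, fun l hl => ?_⟩
    have := h _ (h1 l hl).1 (h1 l hl).2.2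
    rwa [(h1 l hl).2.1, ← one_mul ((a : ℂ) + l)] at this
  · obtain ⟨C, hC, h⟩ := hR.left (1 / 2) (by norm_num) (by norm_num)
    refine ⟨C, hC, fun l hl => ?_⟩
    have := h _ (h1 l hl).1 (h1 l hl).2.2
    rwa [(h1 l hl).2.1, ← neg_one_mul ((a : ℂ) + l)] at this

/-- The vertices are limits of points of the bisector. -/
theorem nhdsWithin_bisector_neBot (ha : 0 ≤ a) (h0 : 0 < φ) (h1 : φ < Real.pi / 2) {ε : ℂ}
    (hε : ε = 1 ∨ ε = -1) : (𝓝[bisector φ a] (ε * a)).NeBot := by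
  obtain ⟨i, hi⟩ : ∃ i : Fin 4, raySign i = ε := by
    rcases hε with rfl | rfl
    · exact ⟨0, by simp [raySign]⟩
    · exact ⟨2, by simp [raySign]⟩
  have t1 : Tendsto (fun t : ℝ => contourPt a (Real.pi / 2) i t) (𝓝[>] 0)
      (𝓝[bisector φ a] (ε * a)) := by
    refine tendsto_nhdsWithin_iff.2 ⟨?_, ?_⟩
    · have := (continuous_contourPt a (Real.pi / 2) i).tendsto 0
      have e : contourPt a (Real.pi / 2) i 0 = ε * a := by
        rw [contourPt, hi]; simp
      rw [e] at this
      exact this.mono_left nhdsWithin_le_nhds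
    · exact eventually_nhdsWithin_of_forall fun t ht =>
        contourPt_mem_bisector ha h0 h1 le_rfl ht i
  exact t1.neBot

namespace HasCalc

theorem congr (ha : 0 ≤ a) (h0 : 0 < φ) {h k : ℂ → ℂ} {T : 𝔸}
    (hT : HasCalc R a φ h T) (e : ∀ z ∈ bisector φ a, k z = h z) : HasCalc R a φ k T := by
  refine ⟨hT.holo.congr e, ⟨hT.bdd.choose, fun z hz => ?_⟩, ?_, ?_⟩
  · rw [e z hz]; exact hT.bdd.choose_spec z hz
  · intro f φ' ψ hφ hψ hψ1 hf
    rw [hT.mul_left f φ' ψ hφ hψ hψ1 hf]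
    refine contourOp_congr (φ := φ') ha (h0.trans_le hφ) hψ hψ1.le fun z hz => ?_
    rw [e z (bisector_anti h0 hφ (hψ.trans hψ1) hz)]
  · intro ε hε
    obtain ⟨p, hp, hv⟩ := hT.vertex ε hε
    exact ⟨p, hp.congr' (eventually_nhdsWithin_of_forall fun z hz => (e z hz).symm), hv⟩

theorem mono (h0 : 0 < φ) {φ' : ℝ} (h : φ ≤ φ') (h1 : φ' < Real.pi / 2) {k : ℂ → ℂ} {T : 𝔸}
    (hT : HasCalc R a φ k T) : HasCalc R a φ' k T := by
  have hs : bisector φ' a ⊆ bisector φ a := bisector_anti h0 h h1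
  refine ⟨hT.holo.mono hs, ⟨hT.bdd.choose, fun z hz => hT.bdd.choose_spec z (hs hz)⟩,
    fun f φ₁ ψ h2 => hT.mul_left f φ₁ ψ (h.trans h2), fun ε hε => ?_⟩
  obtain ⟨p, hp, hv⟩ := hT.vertex ε hε
  exact ⟨p, hp.mono_left (nhdsWithin_mono _ hs), hv⟩

theorem mul (hR : IsOuterResolvent R a) (h0 : 0 < φ) {h k : ℂ → ℂ}
    {T S : 𝔸} (hT : HasCalc R a φ h T) (hS : HasCalc R a φ k S) :
    HasCalc R a φ (fun z => h z * k z) (T * S) := by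
  obtain ⟨C, hC⟩ := hT.bdd
  obtain ⟨D, hD⟩ := hS.bdd
  refine ⟨hT.holo.mul hS.holo, ⟨C * D, fun z hz => ?_⟩, ?_, ?_⟩
  · rw [norm_mul]
    exact mul_le_mul (hC z hz) (hD z hz) (norm_nonneg _) ((norm_nonneg _).trans (hC z hz))
  · intro f φ' ψ hφ hψ hψ1 hf
    have hs := bisector_anti h0 hφ (hψ.trans hψ1) (a := a)
    rw [← mul_assoc, hT.mul_left f φ' ψ hφ hψ hψ1 hf, hS.mul_left _ φ' ψ hφ hψ hψ1
      (hf.mul hR.nonneg (h0.trans_le hφ) (hψ.trans hψ1) (hT.holo.mono hs)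
        fun z hz => hC z (hs hz))]
    simp only [mul_assoc]
  · intro ε hε
    obtain ⟨p, hp, hv⟩ := hT.vertex ε hε
    obtain ⟨q, hq, hw⟩ := hS.vertex ε hε
    refine ⟨p * q, hp.mul hq, ?_⟩
    have e : T * S - (p * q) • (1 : 𝔸) = (T - p • 1) * S + p • (S - q • 1) := by
      rw [sub_mul, smul_mul_assoc, one_mul, smul_sub, smul_smul]; abel
    rw [e]
    exact (hv.mul_right S).add (hw.smul p)

theorem smul (c : ℂ) {h : ℂ → ℂ} {T : 𝔸} (hT : HasCalc R a φ h T) :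
    HasCalc R a φ (fun z => c * h z) (c • T) := by
  obtain ⟨C, hC⟩ := hT.bdd
  refine ⟨hT.holo.const_mul c, ⟨‖c‖ * C, fun z hz => ?_⟩, ?_, ?_⟩
  · rw [norm_mul]; gcongr; exact hC z hz
  · intro f φ' ψ hφ hψ hψ1 hf
    rw [mul_smul_comm, hT.mul_left f φ' ψ hφ hψ hψ1 hf, ← contourOp_const_mul]
    simp only [mul_left_comm]
  · intro ε hε
    obtain ⟨p, hp, hv⟩ := hT.vertex ε hε
    refine ⟨c * p, hp.const_mul c, ?_⟩
    rw [mul_smul, ← smul_sub]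
    exact hv.smul c

theorem sub (hR : IsOuterResolvent R a) (h0 : 0 < φ) {h k : ℂ → ℂ}
    {T S : 𝔸} (hT : HasCalc R a φ h T) (hS : HasCalc R a φ k S) :
    HasCalc R a φ (fun z => h z - k z) (T - S) := by
  obtain ⟨C, hC⟩ := hT.bdd
  obtain ⟨D, hD⟩ := hS.bdd
  refine ⟨hT.holo.sub hS.holo, ⟨C + D, fun z hz => ?_⟩, ?_, ?_⟩
  · exact (norm_sub_le _ _).trans (add_le_add (hC z hz) (hD z hz))
  · intro f φ' ψ hφ hψ hψ1 hf
    have hs := bisector_anti h0 hφ (hψ.trans hψ1) (a := a)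
    have hφ' := h0.trans_le hφ
    rw [mul_sub, hT.mul_left f φ' ψ hφ hψ hψ1 hf, hS.mul_left f φ' ψ hφ hψ hψ1 hf,
      ← contourOp_sub hR (φ := φ')
        (hf.mul hR.nonneg hφ' (hψ.trans hψ1) (hT.holo.mono hs) fun z hz => hC z (hs hz))
        (hf.mul hR.nonneg hφ' (hψ.trans hψ1) (hS.holo.mono hs) fun z hz => hD z (hs hz))
        hφ' hψ hψ1]
    simp only [mul_sub]
  · intro ε hε
    obtain ⟨p, hp, hv⟩ := hT.vertex ε hε
    obtain ⟨q, hq, hw⟩ := hS.vertex ε hε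
    refine ⟨p - q, hp.sub hq, ?_⟩
    have e : T - S - (p - q) • (1 : 𝔸) = (T - p • 1) + (-1 : ℂ) • (S - q • 1) := by
      rw [sub_smul, neg_one_smul]; abel
    rw [e]
    exact hv.add (hw.smul _)

theorem add (hR : IsOuterResolvent R a) (h0 : 0 < φ) {h k : ℂ → ℂ}
    {T S : 𝔸} (hT : HasCalc R a φ h T) (hS : HasCalc R a φ k S) :
    HasCalc R a φ (fun z => h z + k z) (T + S) := by
  have := hT.sub hR h0 (hS.smul (-1))
  simpa only [neg_one_mul, neg_one_smul, sub_neg_eq_add] using this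

theorem one : HasCalc R a φ (fun _ => 1) (1 : 𝔸) := by
  refine ⟨differentiableOn_const _, ⟨1, fun z _ => by simp⟩, ?_, ?_⟩
  · intro f φ' ψ _ _ _ _
    simp only [mul_one]
  · intro ε _
    refine ⟨1, tendsto_const_nhds, ?_⟩
    simp [VanishesAtVertex]

variable [CompleteSpace 𝔸]

theorem resolvent (hR : IsOuterResolvent R a) (h0 : 0 < φ) (h1 : φ < Real.pi / 2) {ε : ℂ}
    (hε : ε = 1 ∨ ε = -1) {l : ℝ} (hl : 0 < l) :
    HasCalc R a φ (fun z => (ε * (a + l) - z)⁻¹) (R (ε * (a + l))) := by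
  have hk : 0 < (1 - Real.cos φ) / 4 := by have := cos_lt_one_of_pos h0 h1; linarith
  have hd : ∀ z ∈ bisector φ a, (1 - Real.cos φ) / 4 * l ≤ ‖ε * (a + l) - z‖ := by
    intro z hz
    rcases hε with rfl | rfl
    · have := norm_ofReal_sub_ge h0 h1 (b := a + l) (by linarith) hz
      rw [one_mul, ← Complex.ofReal_add]
      refine le_trans ?_ this
      gcongr; linarith [norm_nonneg (z - a)]
    · have := norm_ofReal_add_ge h0 h1 (b := a + l) (by linarith) hz
      rw [neg_one_mul, ← norm_neg, neg_sub, sub_neg_eq_add, add_comm, ← Complex.ofReal_add]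
      refine le_trans ?_ this
      gcongr; linarith [norm_nonneg (z + a)]
  have hp : 0 < (1 - Real.cos φ) / 4 * l := by positivity
  have hne : ∀ z ∈ bisector φ a, ε * (a + l) - z ≠ 0 := fun z hz h => by
    have := hd z hz; rw [h, norm_zero] at this; linarith
  refine ⟨differentiableOn_sub_inv hne, ⟨((1 - Real.cos φ) / 4 * l)⁻¹, fun z hz => ?_⟩, ?_, ?_⟩
  · rw [norm_inv]; have := hd z hz; gcongr
  · intro f φ' ψ hφ hψ hψ1 hf
    have hs := bisector_anti h0 hφ (hψ.trans hψ1) (a := a)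
    exact contourOp_mul_resolvent hR hf (h0.trans_le hφ) hψ hψ1 (vertex_re hε hR.nonneg hl) hp
      fun z hz => hd z (hs hz)
  · intro δ hδ
    set μ : ℂ := ε * (a + l) with hμ
    have hμre : a < |μ.re| := vertex_re hε hR.nonneg hl
    have hne0 : μ - δ * a ≠ 0 := by
      intro h
      rw [sub_eq_zero] at h
      rw [h] at hμre
      rcases hδ with rfl | rfl <;>
      · simp [abs_of_nonneg hR.nonneg] at hμre
    refine ⟨(μ - δ * a)⁻¹, ?_, ?_⟩
    · have : Tendsto (fun z : ℂ => μ - z) (𝓝 (δ * a)) (𝓝 (μ - δ * a)) :=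
        (continuous_const.sub continuous_id).tendsto _
      exact (this.inv₀ hne0).mono_left nhdsWithin_le_nhds
    · obtain ⟨C, hC, hb⟩ := hR.vertex_bound hδ
      have c0 : Tendsto (fun t : ℝ => μ - δ * (a + t)) (𝓝[>] 0) (𝓝 (μ - δ * a)) := by
        have : Continuous fun t : ℝ => μ - δ * (a + t) := by fun_prop
        have := this.tendsto 0
        simp only [Complex.ofReal_zero, add_zero] at this
        exact this.mono_left nhdsWithin_le_nhds
      have c1 : Tendsto (fun t : ℝ => ‖(μ - δ * (a + t))⁻¹ - (μ - δ * a)⁻¹‖ * C +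
          ‖(t : ℂ) * (μ - δ * (a + t))⁻¹‖ * ‖R μ‖) (𝓝[>] 0) (𝓝 0) := by
        have t1 := ((c0.inv₀ hne0).sub_const (μ - δ * a)⁻¹).norm.mul_const C
        have t2 : Tendsto (fun t : ℝ => (t : ℂ)) (𝓝[>] 0) (𝓝 0) := by
          have := Complex.continuous_ofReal.tendsto 0
          rw [Complex.ofReal_zero] at this
          exact this.mono_left nhdsWithin_le_nhds
        have t3 := (t2.mul (c0.inv₀ hne0)).norm.mul_const ‖R μ‖
        simpa using t1.add t3
      rw [VanishesAtVertex]
      refine squeeze_zero_norm' ?_ c1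
      filter_upwards [self_mem_nhdsWithin, c0.eventually_ne hne0] with t ht hne'
      have ht' : (0 : ℝ) < t := ht
      have hid := hR.ident (δ * (a + t)) μ (vertex_re hδ hR.nonneg ht') hμre
      -- The resolvent identity gives R(δ(a + t)) R(μ) = (R(δ(a + t)) - R(μ))/(μ - δ(a + t)). After
      -- multiplication by t the first term is small because t R(δ(a + t)) is bounded and its
      -- coefficient tends to 0, the second because of the factor t.
      have e : R (δ * (a + t)) * (R μ - (μ - δ * a)⁻¹ • 1) =
          ((μ - δ * (a + t))⁻¹ - (μ - δ * a)⁻¹) • R (δ * (a + t)) -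
            (μ - δ * (a + t))⁻¹ • R μ := by
        rw [sub_smul, sub_right_comm, ← smul_sub, hid, smul_smul, inv_mul_cancel₀ hne', one_smul,
          mul_sub, mul_smul_comm, mul_one]
      rw [e, smul_sub, smul_smul, smul_smul]
      refine (norm_sub_le _ _).trans (add_le_add ?_ ?_)
      · rw [norm_smul, norm_mul, Complex.norm_real, Real.norm_of_nonneg ht'.le, mul_comm t,
          mul_assoc, mul_comm t]
        gcongr
        exact hb t ht'
      · rw [norm_smul]

/-- The product rule is `contourOp_mul`. For the vertex condition, l R(ε(a + l)) f(A) is the contour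
integral of f with the extra factor l/(ε(a + l) - z); this factor is bounded on the contour
uniformly in l and tends to 0 pointwise, so dominated convergence applies. -/
theorem elemZero (hR : IsOuterResolvent R a) {ω φ' : ℝ} {f : ℂ → ℂ} (hf : MemElemZero φ a f)
    (h0 : 0 < φ) (h : φ < ω) (h' : ω < φ') (h1 : φ' < Real.pi / 2) :
    HasCalc R a φ' f (contourOp R a ω f) := by
  have hω1 : ω < Real.pi / 2 := h'.trans h1
  have hs : bisector φ' a ⊆ bisector φ a := bisector_anti h0 (h.trans h').le h1
  refine ⟨hf.holo.mono hs, ⟨hf.bdd.choose, fun z hz => hf.bdd.choose_spec z (hs hz)⟩, ?_, ?_⟩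
  · intro g φ₁ ψ hφ hψ hψ1 hg
    exact contourOp_mul hR hf hg h0 h (h'.trans_le hφ) hψ hψ1
  · intro ε hε
    refine ⟨0, ?_, ?_⟩
    · rcases hε with rfl | rfl
      · rw [one_mul]; exact hf.lim_right.mono_left (nhdsWithin_mono _ hs)
      · rw [neg_one_mul]; exact hf.lim_left.mono_left (nhdsWithin_mono _ hs)
    · rw [zero_smul, sub_zero, VanishesAtVertex]
      have hk : 0 < (1 - Real.cos φ) / 4 := by
        have := cos_lt_one_of_pos h0 (h.trans hω1); linarith
      have hd : ∀ l : ℝ, 0 < l → ∀ z ∈ bisector φ a,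
          (1 - Real.cos φ) / 4 * l ≤ ‖ε * (a + l) - z‖ := by
        intro l hl z hz
        rcases hε with rfl | rfl
        · have := norm_ofReal_sub_ge h0 (h.trans hω1) (b := a + l) (by linarith) hz
          rw [one_mul, ← Complex.ofReal_add]
          refine le_trans ?_ this
          gcongr; linarith [norm_nonneg (z - a)]
        · have := norm_ofReal_add_ge h0 (h.trans hω1) (b := a + l) (by linarith) hz
          rw [neg_one_mul, ← norm_neg, neg_sub, sub_neg_eq_add, add_comm, ← Complex.ofReal_add]
          refine le_trans ?_ this
          gcongr; linarith [norm_nonneg (z + a)]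
      have e : ∀ l : ℝ, 0 < l → (l : ℂ) • (R (ε * (a + l)) * contourOp R a ω f) =
          (2 * (Real.pi : ℂ) * Complex.I)⁻¹ • contourInt a ω
            (fun z => (l * (ε * (a + l) - z)⁻¹) • (f z • R z)) := by
        intro l hl
        rw [contourOp_commute hR hf h0 h hω1 (vertex_re hε hR.nonneg hl),
          contourOp_mul_resolvent hR hf h0 h hω1 (vertex_re hε hR.nonneg hl) (mul_pos hk hl)
            (hd l hl), ← contourOp_const_mul, contourOp]
        congr 1
        refine contourInt_congr fun i t _ => ?_
        rw [smul_smul]; congr 1; ring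
      have hif := hR.integrableOn hf h0 h hω1
      have key : Tendsto (fun l : ℝ => contourInt a ω
          (fun z => (l * (ε * (a + l) - z)⁻¹) • (f z • R z))) (𝓝[>] 0) (𝓝 0) := by
        suffices hsum : ∀ i : Fin 4, Tendsto (fun l : ℝ => ∫ t in Ioi (0 : ℝ), contourWt ω i •
            ((l * (ε * (a + l) - contourPt a ω i t)⁻¹) •
              (f (contourPt a ω i t) • R (contourPt a ω i t)))) (𝓝[>] 0) (𝓝 0) by
          have := tendsto_finsetSum Finset.univ fun i _ => hsum i
          rw [Finset.sum_const_zero] at this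
          exact this
        intro i
        have hz : ∫ t in Ioi (0 : ℝ), (0 : 𝔸) = 0 := integral_zero _ _
        rw [← hz]
        have hm : ∀ t, 0 < t → contourPt a ω i t ∈ bisector φ a := fun t ht =>
          contourPt_mem_bisector hR.nonneg h0 h hω1.le ht i
        have hne : ∀ l : ℝ, 0 < l → ∀ t : ℝ, 0 < t → ε * (a + l) - contourPt a ω i t ≠ 0 := by
          intro l hl t ht h2
          have := hd l hl _ (hm t ht)
          rw [h2, norm_zero] at this
          have := mul_pos hk hl; linarith
        refine tendsto_integral_filter_of_dominated_convergence
          (fun t => ((1 - Real.cos φ) / 4)⁻¹ * ‖f (contourPt a ω i t) • R (contourPt a ω i t)‖)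
          ?_ ?_ ((hif i).norm.const_mul _) ?_
        · filter_upwards [self_mem_nhdsWithin] with l hl
          have cc : ContinuousOn (fun t => l * (ε * (a + l) - contourPt a ω i t)⁻¹) (Ioi 0) :=
            continuousOn_const.mul (ContinuousOn.inv₀
              (continuous_const.sub (continuous_contourPt a ω i)).continuousOn
              fun t ht => hne l hl t ht)
          exact ((cc.aestronglyMeasurable measurableSet_Ioi).smul
            (hif i).aestronglyMeasurable).const_smul _
        · filter_upwards [self_mem_nhdsWithin] with l hl
          have hl' : (0 : ℝ) < l := hl
          refine (ae_restrict_iff' measurableSet_Ioi).2 (ae_of_all _ fun t ht => ?_)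
          rw [norm_smul, norm_contourWt, one_mul, norm_smul, norm_mul, Complex.norm_real,
            Real.norm_of_nonneg hl'.le, norm_inv]
          refine mul_le_mul_of_nonneg_right ?_ (norm_nonneg _)
          have h3 := hd l hl' _ (hm t ht)
          have h4 := mul_pos hk hl'
          rw [← div_eq_mul_inv, div_le_iff₀ (h4.trans_le h3), inv_mul_eq_div, le_div_iff₀ hk,
            mul_comm]
          exact h3
        · refine (ae_restrict_iff' measurableSet_Ioi).2 (ae_of_all _ fun t ht => ?_)
          have ht' : (0 : ℝ) < t := ht
          have hne0 : ε * (a + (0 : ℝ)) - contourPt a ω i t ≠ 0 := by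
            intro h2
            have h3 := contourPt_outer hR.nonneg (h0.trans h) hω1 ht' i
            rw [sub_eq_zero] at h2
            rw [← h2] at h3
            rcases hε with rfl | rfl <;> simp [abs_of_nonneg hR.nonneg] at h3
          have t2 : ContinuousAt (fun l : ℝ => contourWt ω i • ((l : ℂ) *
              (ε * (a + l) - contourPt a ω i t)⁻¹) •
              (f (contourPt a ω i t) • R (contourPt a ω i t))) 0 := by
            refine ContinuousAt.const_smul (ContinuousAt.smul ?_ continuousAt_const) _
            refine ContinuousAt.mul Complex.continuous_ofReal.continuousAt
              (ContinuousAt.inv₀ (Continuous.continuousAt (by fun_prop)) hne0)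
          have t3 := t2.tendsto.mono_left (nhdsWithin_le_nhds (s := Ioi 0))
          simpa using t3
      have key2 := key.const_smul (2 * (Real.pi : ℂ) * Complex.I)⁻¹
      rw [smul_zero] at key2
      exact key2.congr' (eventually_nhdsWithin_of_forall fun l hl => (e l hl).symm)

end HasCalc
end Calc

/-! ### Uniqueness -/

section Unique
variable {𝔸 : Type*} [NormedRing 𝔸] [NormedAlgebra ℂ 𝔸] {R : ℂ → 𝔸} {a : ℝ}

theorem VanishesAtVertex.mul_left {ε : ℂ} {x c : 𝔸} (hx : VanishesAtVertex R a ε x)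
    (hc : ∀ l : ℝ, 0 < l → R (ε * (a + l)) * c = c * R (ε * (a + l))) :
    VanishesAtVertex R a ε (c * x) := by
  have := Tendsto.const_mul c hx
  rw [mul_zero] at this
  refine this.congr' (eventually_nhdsWithin_of_forall fun l hl => ?_)
  rw [mul_smul_comm, ← mul_assoc, ← hc l hl, mul_assoc]

/-- The equation for y says that its range consists of eigenvectors for the value ε a. Then l R(ε(a
+ l)) y equals ε y for every l > 0, so its limit can be 0 only if y = 0. -/
theorem VanishesAtVertex.eq_zero (hR : IsOuterResolvent R a) {ε : ℂ} (hε : ε = 1 ∨ ε = -1) {y : 𝔸}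
    (hy : VanishesAtVertex R a ε y) (h : y = ε • (R (ε * (a + (1 : ℝ))) * y)) : y = 0 := by
  have hε2 : ε * ε = 1 := by rcases hε with rfl | rfl <;> norm_num
  have h2 : R (ε * (a + (1 : ℝ))) * y = ε • y := by
    conv_rhs => rw [h]
    rw [smul_smul, hε2, one_smul]
  have key : ∀ l : ℝ, 0 < l → (l : ℂ) • (R (ε * (a + l)) * y) = ε • y := by
    intro l hl
    have := congrArg (· * y) (hR.ident (ε * (a + l)) (ε * (a + (1 : ℝ)))
      (vertex_re hε hR.nonneg hl) (vertex_re hε hR.nonneg one_pos))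
    simp only [sub_mul (R _), smul_mul_assoc, mul_assoc (R _), h2, mul_smul_comm, smul_smul] at this
    rw [show (ε * (a + ((1 : ℝ) : ℂ)) - ε * (a + l)) * ε = 1 - l by
      push_cast; linear_combination (1 - (l : ℂ)) * hε2, sub_smul, one_smul] at this
    exact (sub_right_inj.1 this).symm
  have h3 : Tendsto (fun _ : ℝ => ε • y) (𝓝[>] 0) (𝓝 0) :=
    Tendsto.congr' (eventually_nhdsWithin_of_forall key) hy
  have h4 := tendsto_nhds_unique h3 tendsto_const_nhds
  have h5 : ε • ε • y = 0 := by rw [← h4, smul_zero]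
  rwa [smul_smul, hε2, one_smul] at h5

/-- An elementary function vanishing only at `±a`. -/
noncomputable def vertexTest (a : ℝ) (z : ℂ) : ℂ :=
  (z - a) * (z + a) * (((a + 1 : ℝ) - z)⁻¹ * (((a + 2 : ℝ) - z)⁻¹ * ((a + 1 : ℝ) + z)⁻¹))

theorem norm_inv_le_of_le {x : ℂ} {c : ℝ} (hc : 0 < c) (h : c ≤ ‖x‖) : ‖x⁻¹‖ ≤ c⁻¹ := by
  rw [norm_inv]; gcongr

theorem vertexTest_mem {φ : ℝ} (ha : 0 ≤ a) (h0 : 0 < φ) (h1 : φ < Real.pi / 2) :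
    MemElemZero φ a (vertexTest a) := by
  have hk : 0 < (1 - Real.cos φ) / 4 := by have := cos_lt_one_of_pos h0 h1; linarith
  set k := (1 - Real.cos φ) / 4 with hkdef
  have b1 : ∀ z ∈ bisector φ a, k * (1 + ‖z - a‖) ≤ ‖((a + 1 : ℝ) : ℂ) - z‖ := fun z hz => by
    have := norm_ofReal_sub_ge h0 h1 (b := a + 1) (by linarith) hz
    rwa [add_sub_cancel_left] at this
  have b2 : ∀ z ∈ bisector φ a, k * (1 + ‖z - a‖) ≤ ‖((a + 2 : ℝ) : ℂ) - z‖ := fun z hz => by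
    have := norm_ofReal_sub_ge h0 h1 (b := a + 2) (by linarith) hz
    rw [add_sub_cancel_left] at this
    exact le_trans (by gcongr; norm_num) this
  have b3 : ∀ z ∈ bisector φ a, k * (1 + ‖z + a‖) ≤ ‖((a + 1 : ℝ) : ℂ) + z‖ := fun z hz => by
    have := norm_ofReal_add_ge h0 h1 (b := a + 1) (by linarith) hz
    rwa [add_sub_cancel_left] at this
  have ne : ∀ x : ℂ, ∀ r : ℝ, 0 ≤ r → k * (1 + r) ≤ ‖x‖ → x ≠ 0 := by
    rintro x r hr h rfl
    rw [norm_zero] at h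
    have : 0 < k * (1 + r) := by positivity
    linarith
  refine memElemZero_of_le (β := 1) (C := k⁻¹ * (k⁻¹ * k⁻¹)) ha h0 h1 one_pos ?_ ?_
  · have d3 : DifferentiableOn ℂ (fun z : ℂ => ((a + 1 : ℝ) : ℂ) + z) (bisector φ a) := by fun_prop
    refine DifferentiableOn.mul (by fun_prop) ?_
    exact (differentiableOn_sub_inv fun z hz => ne _ _ (norm_nonneg _) (b1 z hz)).mul
      ((differentiableOn_sub_inv fun z hz => ne _ _ (norm_nonneg _) (b2 z hz)).mul
        (d3.fun_inv fun z hz => ne _ _ (norm_nonneg _) (b3 z hz)))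
  · intro z hz
    obtain ⟨n1, n2⟩ := ne_of_mem_bisector h0 h1 hz
    have hE : 0 < ‖z - a‖ := norm_pos_iff.2 (sub_ne_zero.2 n1)
    have hD : 0 < ‖z + a‖ := norm_pos_iff.2 fun h => n2 (eq_neg_of_add_eq_zero_left h)
    have c1 := norm_inv_le_of_le (by positivity) (b1 z hz)
    have c2 := norm_inv_le_of_le (by positivity) (b2 z hz)
    have c3 := norm_inv_le_of_le (by positivity) (b3 z hz)
    set E := ‖z - a‖
    set D := ‖z + a‖
    have step : ‖vertexTest a z‖ ≤ E * D * ((k * (1 + E))⁻¹ * ((k * (1 + E))⁻¹ *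
        (k * (1 + D))⁻¹)) := by
      rw [vertexTest, norm_mul, norm_mul, norm_mul, norm_mul]
      gcongr
    refine step.trans ?_
    have e : E * D * ((k * (1 + E))⁻¹ * ((k * (1 + E))⁻¹ * (k * (1 + D))⁻¹)) =
        k⁻¹ * (k⁻¹ * k⁻¹) * (E * D / ((1 + E) ^ 2 * (1 + D))) := by field_simp
    rw [e]
    refine mul_le_mul_of_nonneg_left ?_ (by positivity)
    rw [bump, Real.rpow_one, Real.rpow_neg_one]
    have f1 : E * D / ((1 + E) ^ 2 * (1 + D)) ≤ E := by
      rw [div_le_iff₀ (by positivity)]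
      have : D ≤ (1 + E) ^ 2 * (1 + D) := by nlinarith [mul_pos hE hD, sq_nonneg E]
      gcongr
    have f2 : E * D / ((1 + E) ^ 2 * (1 + D)) ≤ D := by
      rw [div_le_iff₀ (by positivity), mul_comm E D]
      have : E ≤ (1 + E) ^ 2 * (1 + D) := by nlinarith [mul_pos hE hD, sq_nonneg E]
      gcongr
    have f3 : E * D / ((1 + E) ^ 2 * (1 + D)) ≤ E⁻¹ := by
      rw [div_le_iff₀ (by positivity), ← div_eq_inv_mul, le_div_iff₀ hE]
      nlinarith [mul_pos hE hD, sq_nonneg E, mul_pos (mul_pos hE hE) hD]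
    refine le_min (le_min f1 f2) (f3.trans ?_)
    have : 0 < min E D := lt_min hE hD
    gcongr; exact min_le_left _ _

variable [CompleteSpace 𝔸]

theorem rayDiff_vertexTest_right (hR : IsOuterResolvent R a) {ψ : ℝ} (h0 : 0 < ψ)
    (h1 : ψ < Real.pi / 2) : rayDiff a ψ (fun z => vertexTest a z • R z) =
      (2 * (Real.pi : ℂ) * Complex.I) • (((2 * a + 1) / (2 * a + 2) : ℂ) • R (a + (1 : ℝ)) -
        (2 * (2 * a + 2) / (2 * a + 3) : ℂ) • R (a + 2)) := by
  have ha := hR.nonneg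
  have hc := cos_pos_of_lt h0 h1
  obtain ⟨C, hC, hCb⟩ := hR.right (Real.cos ψ) hc (cos_lt_one_of_pos h0 h1)
  set U : Set ℂ := {z | a < z.re} with hU
  have hUo : IsOpen U := isOpen_lt continuous_const Complex.continuous_re
  have hUabs : U ⊆ {μ : ℂ | a < |μ.re|} := fun z hz =>
    lt_of_lt_of_le (show a < z.re from hz) (le_abs_self z.re)
  -- The factor z - a compensates the singularity of the resolvent at the vertex, which gives the
  -- bound for G required by `rayDiff_residue`.
  set G : ℂ → 𝔸 := fun z => ((z - a) * ((a + 1 : ℝ) + z)⁻¹) • R z with hG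
  have hre : ∀ z ∈ U, 1 ≤ ‖((a + 1 : ℝ) : ℂ) + z‖ ∧ ‖z - a‖ ≤ ‖((a + 1 : ℝ) : ℂ) + z‖ := by
    intro z hz
    have hz' : a < z.re := hz
    constructor
    · refine le_trans ?_ (Complex.re_le_norm _)
      rw [Complex.add_re, Complex.ofReal_re]; linarith
    · rw [← sq_le_sq₀ (norm_nonneg _) (norm_nonneg _), ← Complex.normSq_eq_norm_sq,
        ← Complex.normSq_eq_norm_sq, Complex.normSq_apply, Complex.normSq_apply]
      simp only [Complex.add_re, Complex.ofReal_re, Complex.add_im, Complex.ofReal_im,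
        Complex.sub_re, Complex.sub_im]
      nlinarith
  have hne : ∀ z ∈ U, ((a + 1 : ℝ) : ℂ) + z ≠ 0 := fun z hz h => by
    have := (hre z hz).1; rw [h, norm_zero] at this; linarith
  have hGhol : DifferentiableOn ℂ G U := by
    have d : DifferentiableOn ℂ (fun z : ℂ => ((a + 1 : ℝ) : ℂ) + z) U := by fun_prop
    have d2 : DifferentiableOn ℂ (fun z : ℂ => z - a) U := by fun_prop
    exact (d2.mul (d.fun_inv hne)).smul (hR.differentiableOn.mono hUabs)
  have hGb : ∀ z : ℂ, a < z.re → Real.cos ψ * ‖z - a‖ ≤ (z - a).re →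
      ‖G z‖ * (1 + ‖z - a‖) ≤ C * 2 := by
    intro z hz hz'
    obtain ⟨h2, h3⟩ := hre z hz
    have h4 := hCb z hz hz'
    have hp : 0 < ‖((a + 1 : ℝ) : ℂ) + z‖ := by linarith
    simp only [hG]
    rw [norm_smul, norm_mul, norm_inv]
    have h5 : ‖((a + 1 : ℝ) : ℂ) + z‖⁻¹ * (1 + ‖z - a‖) ≤ 2 := by
      rw [inv_mul_le_iff₀ hp]; linarith
    calc _ = (‖R z‖ * ‖z - a‖) * (‖((a + 1 : ℝ) : ℂ) + z‖⁻¹ * (1 + ‖z - a‖)) := by ring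
      _ ≤ C * 2 := by gcongr
  have hint : ∀ b : ℝ, a < b → ∀ c : ℂ, ∀ v : ℂ, (v = Complex.exp (ψ * Complex.I) ∨
      v = Complex.exp (-(ψ * Complex.I))) →
      IntegrableOn (fun t : ℝ => ((b : ℂ) - (a + t * v))⁻¹ • (c • G (a + t * v))) (Ioi 0) := by
    intro b hb c v hv
    have hs : 0 < Real.sin ψ := Real.sin_pos_of_pos_of_lt_pi h0 (by linarith [Real.pi_pos])
    have hv' : ‖v‖ = 1 ∧ v.re = Real.cos ψ ∧ v.im ≠ 0 := by
      rcases hv with rfl | rfl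
      · exact ⟨Complex.norm_exp_ofReal_mul_I ψ, re_exp_mul_I ψ, by
          rw [im_exp_mul_I]; exact hs.ne'⟩
      · exact ⟨norm_exp_neg_mul_I ψ, re_exp_neg_mul_I ψ, by
          rw [im_exp_neg_mul_I]; exact neg_ne_zero.2 hs.ne'⟩
    have hmem : ∀ t : ℝ, 0 < t → a < ((a : ℂ) + t * v).re := by
      intro t ht
      rw [Complex.add_re, Complex.re_ofReal_mul, hv'.2.1, Complex.ofReal_re]
      have := mul_pos ht hc; linarith
    refine integrableOn_ray_mul_inv (G := fun z => c • G z) (C := ‖c‖ * (C * 2)) hv'.1 hv'.2.2 hb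
      ?_ ?_
    · have cc : Continuous fun t : ℝ => (a : ℂ) + t * v := by fun_prop
      exact ContinuousOn.const_smul (hGhol.continuousOn.comp cc.continuousOn fun t ht => hmem t ht) c
    · intro t ht
      have e : ‖(a : ℂ) + t * v - a‖ = t := by
        rw [add_sub_cancel_left, norm_mul, hv'.1, Complex.norm_real, Real.norm_of_nonneg ht.le,
          mul_one]
      have := hGb _ (hmem t ht) (by
        rw [e, add_sub_cancel_left, Complex.re_ofReal_mul, hv'.2.1, mul_comm])
      rw [e] at this
      rw [norm_smul, mul_assoc]; gcongr
  have res : ∀ b : ℝ, a < b → ∀ c : ℂ, rayDiff a ψ (fun z => ((b : ℂ) - z)⁻¹ • (c • G z)) =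
      (2 * (Real.pi : ℂ) * Complex.I) • (c • G b) := by
    intro b hb c
    refine rayDiff_residue (G := fun z => c • G z) (C := ‖c‖ * (C * 2)) h0 h1 hb
      (convex_halfSpace_re_gt a) hUo (fun z hz => hz) (fun z hz _ => hz)
      (hGhol.const_smul c) fun z hz hz' => ?_
    rw [norm_smul, mul_assoc]
    exact mul_le_mul_of_nonneg_left (hGb z hz hz') (norm_nonneg _)
  have ne1 : ∀ v : ℂ, (v = Complex.exp (ψ * Complex.I) ∨ v = Complex.exp (-(ψ * Complex.I))) →
      ∀ b : ℝ, ∀ t : ℝ, 0 < t → (b : ℂ) - (a + t * v) ≠ 0 := by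
    intro v hv b t ht h
    have hs : 0 < Real.sin ψ := Real.sin_pos_of_pos_of_lt_pi h0 (by linarith [Real.pi_pos])
    have := congrArg Complex.im h
    rw [Complex.sub_im, Complex.add_im, Complex.im_ofReal_mul, Complex.ofReal_im,
      Complex.ofReal_im, Complex.zero_im] at this
    rcases hv with rfl | rfl
    · rw [im_exp_mul_I] at this; nlinarith
    · rw [im_exp_neg_mul_I] at this; nlinarith
  -- Partial fractions: (z + a)/((a + 1 - z)(a + 2 - z)) = (2a + 1)/(a + 1 - z) - (2a + 2)/(a + 2 -
  -- z). Each summand contributes one residue.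
  rw [rayDiff_congr (G := fun z => (((a + 1 : ℝ) : ℂ) - z)⁻¹ • ((2 * a + 1 : ℂ) • G z) -
    (((a + 2 : ℝ) : ℂ) - z)⁻¹ • ((2 * a + 2 : ℂ) • G z)), rayDiff_sub
    (hint (a + 1) (by linarith) _) (hint (a + 2) (by linarith) _), res (a + 1) (by linarith),
    res (a + 2) (by linarith), ← smul_sub]
  · have q1 : (2 * a + 2 : ℂ) ≠ 0 := by
      have : (0 : ℝ) < 2 * a + 2 := by linarith
      exact_mod_cast this.ne'
    have q2 : (2 * a + 3 : ℂ) ≠ 0 := by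
      have : (0 : ℝ) < 2 * a + 3 := by linarith
      exact_mod_cast this.ne'
    simp only [hG, smul_smul]
    congr 3
    · push_cast; rw [show (a : ℂ) + 1 + (a + 1) = 2 * a + 2 by ring]; field_simp; ring
    · push_cast; rfl
    · push_cast; rw [show (a : ℂ) + 1 + (a + 2) = 2 * a + 3 by ring]; field_simp; ring
    · push_cast; rfl
  · intro t ht v hv
    have n1 := ne1 v hv (a + 1) t ht
    have n2 := ne1 v hv (a + 2) t ht
    simp only [hG, smul_smul, ← sub_smul, vertexTest]
    congr 1
    generalize (a : ℂ) + t * v = z at n1 n2 ⊢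
    generalize ((((a + 1 : ℝ) : ℂ) + z))⁻¹ = y
    push_cast at n1 n2 ⊢
    field_simp
    ring

theorem rayDiff_vertexTest_left (hR : IsOuterResolvent R a) {ψ : ℝ} (h0 : 0 < ψ)
    (h1 : ψ < Real.pi / 2) : rayDiff a ψ (fun z => vertexTest a (-z) • R (-z)) =
      (2 * (Real.pi : ℂ) * Complex.I) •
        (((2 * a + 1) / ((2 * a + 2) * (2 * a + 3)) : ℂ) • R (-(a + (1 : ℝ)))) := by
  have ha := hR.nonneg
  have hc := cos_pos_of_lt h0 h1
  obtain ⟨C, hC, hCb⟩ := hR.left (Real.cos ψ) hc (cos_lt_one_of_pos h0 h1)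
  set U : Set ℂ := {z | a < z.re} with hU
  have hUo : IsOpen U := isOpen_lt continuous_const Complex.continuous_re
  set G : ℂ → 𝔸 := fun z => ((z - a) * ((z + a) * (((a + 1 : ℝ) + z)⁻¹ * ((a + 2 : ℝ) + z)⁻¹))) •
    R (-z) with hG
  have hle : ∀ z ∈ U, ∀ c d : ℝ, -a ≤ c → |c| ≤ d → ‖z + c‖ ≤ ‖(d : ℂ) + z‖ := by
    intro z hz c d hc hd
    have hz' : a < z.re := hz
    have hd' := abs_le.1 hd
    rw [← sq_le_sq₀ (norm_nonneg _) (norm_nonneg _), ← Complex.normSq_eq_norm_sq,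
      ← Complex.normSq_eq_norm_sq, Complex.normSq_apply, Complex.normSq_apply]
    simp only [Complex.add_re, Complex.ofReal_re, Complex.add_im, Complex.ofReal_im]
    nlinarith
  have hone : ∀ z ∈ U, ∀ d : ℝ, 1 ≤ d → 1 ≤ ‖(d : ℂ) + z‖ := by
    intro z hz d hd
    have hz' : a < z.re := hz
    refine le_trans ?_ (Complex.re_le_norm _)
    rw [Complex.add_re, Complex.ofReal_re]; linarith
  have hne : ∀ z ∈ U, ∀ d : ℝ, 1 ≤ d → (d : ℂ) + z ≠ 0 := fun z hz d hd h => by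
    have := hone z hz d hd; rw [h, norm_zero] at this; linarith
  have hGhol : DifferentiableOn ℂ G U := by
    have d : ∀ c : ℝ, DifferentiableOn ℂ (fun z : ℂ => (c : ℂ) + z) U := fun c => by fun_prop
    have d2 : DifferentiableOn ℂ (fun z : ℂ => z - a) U := by fun_prop
    have d3 : DifferentiableOn ℂ (fun z : ℂ => z + a) U := by fun_prop
    have d4 : DifferentiableOn ℂ (fun z : ℂ => R (-z)) U := by
      refine hR.differentiableOn.comp differentiable_neg.differentiableOn fun z hz => ?_
      rw [mem_ofPred_eq, Complex.neg_re, abs_neg]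
      exact lt_of_lt_of_le hz (le_abs_self _)
    exact (d2.mul (d3.mul (((d (a + 1)).fun_inv fun z hz => hne z hz _ (by linarith)).mul
      ((d (a + 2)).fun_inv fun z hz => hne z hz _ (by linarith))))).smul d4
  have hGb : ∀ z : ℂ, a < z.re → Real.cos ψ * ‖z - a‖ ≤ (z - a).re →
      ‖G z‖ * (1 + ‖z - a‖) ≤ C * (1 * 2) := by
    intro z hz hz'
    have h4 := hCb z hz hz'
    have p1 := hone z hz (a + 1) (by linarith)
    have p2 := hone z hz (a + 2) (by linarith)
    have h2 : ‖z - a‖ ≤ ‖((a + 2 : ℝ) : ℂ) + z‖ := by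
      have := hle z hz (-a) (a + 2) le_rfl (by rw [abs_neg, abs_of_nonneg ha]; linarith)
      rwa [Complex.ofReal_neg, ← sub_eq_add_neg] at this
    have h3 := hle z hz a (a + 1) (by linarith) (by rw [abs_of_nonneg ha]; linarith)
    simp only [hG]
    rw [norm_smul, norm_mul, norm_mul, norm_mul, norm_inv, norm_inv]
    have h5 : ‖((a + 2 : ℝ) : ℂ) + z‖⁻¹ * (1 + ‖z - a‖) ≤ 2 := by
      rw [inv_mul_le_iff₀ (by linarith)]; linarith
    have h6 : ‖((a + 1 : ℝ) : ℂ) + z‖⁻¹ * ‖z + a‖ ≤ 1 := by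
      rw [inv_mul_le_iff₀ (by linarith)]; linarith
    calc _ = (‖R (-z)‖ * ‖z - a‖) * ((‖((a + 1 : ℝ) : ℂ) + z‖⁻¹ * ‖z + a‖) *
          (‖((a + 2 : ℝ) : ℂ) + z‖⁻¹ * (1 + ‖z - a‖))) := by ring
      _ ≤ C * (1 * 2) := by gcongr
  have res := rayDiff_residue (G := G) (b := a + 1) (C := C * (1 * 2)) h0 h1 (by linarith)
      (convex_halfSpace_re_gt a) hUo (fun z hz => hz) (fun z hz _ => hz) hGhol hGb
  rw [rayDiff_congr (G := fun z => (((a + 1 : ℝ) : ℂ) - z)⁻¹ • G z), res]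
  · simp only [hG]
    push_cast
    congr 2
    · rw [show (a : ℂ) + 1 + (a + 1) = 2 * a + 2 by ring,
        show (a : ℂ) + 2 + (a + 1) = 2 * a + 3 by ring, div_eq_mul_inv, mul_inv]
      ring
  · intro t ht v hv
    simp only [hG, smul_smul, vertexTest, sub_neg_eq_add, ← sub_eq_add_neg]
    congr 1
    ring

/-- The value of the calculus at the test function. -/
theorem contourOp_vertexTest (hR : IsOuterResolvent R a) {ψ : ℝ} (h0 : 0 < ψ)
    (h1 : ψ < Real.pi / 2) : contourOp R a ψ (vertexTest a) =
      -(R (a + 2) * ((1 - R (a + (1 : ℝ))) * (1 + R (-(a + (1 : ℝ)))))) := by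
  have ha := hR.nonneg
  rw [contourOp, contourInt_eq_rayDiff, rayDiff_vertexTest_right hR h0 h1,
    rayDiff_vertexTest_left hR h0 h1, ← smul_sub, smul_smul,
    inv_mul_cancel₀ Complex.two_pi_I_ne_zero, one_smul]
  have q1 : (2 * a + 2 : ℂ) ≠ 0 := by
    have : (0 : ℝ) < 2 * a + 2 := by linarith
    exact_mod_cast this.ne'
  have q2 : (2 * a + 3 : ℂ) ≠ 0 := by
    have : (0 : ℝ) < 2 * a + 3 := by linarith
    exact_mod_cast this.ne'
  have m1 := vertex_re (ε := 1) (Or.inl rfl) ha one_pos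
  have m2 := vertex_re (ε := -1) (Or.inr rfl) ha one_pos
  have m3 := vertex_re (ε := 1) (Or.inl rfl) ha two_pos
  rw [one_mul] at m1 m3
  rw [neg_one_mul] at m2
  rw [show ((2 : ℝ) : ℂ) = 2 by norm_num] at m3
  have i1 := hR.ident _ _ m3 m1
  have i2 := hR.ident _ _ m3 m2
  have i3 := hR.ident _ _ m1 m2
  set P := R (a + (1 : ℝ))
  set Q := R (-(a + (1 : ℝ)))
  set S := R (a + 2)
  -- The resolvent identities expand every product into a linear combination of S, P and Q, so that
  -- the claim becomes a comparison of scalar coefficients.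
  have e1 : S * P = P - S := by
    rw [show ((a : ℂ) + (1 : ℝ) - (a + 2)) = -1 by push_cast; ring, neg_one_smul] at i1
    rw [← neg_sub S P, i1, neg_neg]
  have e2 : S * Q = (2 * a + 3 : ℂ)⁻¹ • (Q - S) := by
    rw [show (-((a : ℂ) + (1 : ℝ)) - (a + 2)) = -(2 * a + 3) by push_cast; ring, neg_smul] at i2
    rw [← neg_sub S Q, i2, neg_neg, smul_smul, inv_mul_cancel₀ q2, one_smul]
  have e3 : P * Q = (2 * a + 2 : ℂ)⁻¹ • (Q - P) := by
    rw [show (-((a : ℂ) + (1 : ℝ)) - (a + (1 : ℝ))) = -(2 * a + 2) by push_cast; ring, neg_smul] at i3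
    rw [← neg_sub P Q, i3, neg_neg, smul_smul, inv_mul_cancel₀ q1, one_smul]
  have e4 : S * (P * Q) = P * Q - S * Q := by rw [← mul_assoc, e1, sub_mul]
  have e5 : S * ((1 - P) * (1 + Q)) = S + S * Q - S * P - S * (P * Q) := by noncomm_ring
  rw [e5, e4, e1, e2, e3]
  have q3 : (2 * a + 1 : ℂ) / (2 * a + 2) = 1 - (2 * a + 2 : ℂ)⁻¹ := by
    rw [div_eq_iff q1, sub_mul, inv_mul_cancel₀ q1]; ring
  have q4 : (2 * a + 1 : ℂ) / ((2 * a + 2) * (2 * a + 3)) =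
      2 * (2 * a + 3 : ℂ)⁻¹ - (2 * a + 2 : ℂ)⁻¹ := by
    rw [div_eq_iff (mul_ne_zero q1 q2)]
    linear_combination (-2 * (2 * a + 2 : ℂ)) * inv_mul_cancel₀ q2 +
      (2 * a + 3 : ℂ) * inv_mul_cancel₀ q1
  have q5 : (2 * (2 * a + 2) : ℂ) / (2 * a + 3) = 2 - 2 * (2 * a + 3 : ℂ)⁻¹ := by
    rw [div_eq_iff q2, sub_mul, mul_assoc 2 _ (2 * a + 3 : ℂ), inv_mul_cancel₀ q2]; ring
  rw [q3, q4, q5]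
  module

namespace HasCalc
variable {φ : ℝ}

/-- Testing against `vertexTest` gives R(a + 2)(1 - R(a + 1))(1 + R(-(a + 1))) T = 0. The first
factor is cancelled by injectivity. The other two have as kernels the eigenspaces for a and -a,
which the vertex conditions exclude one after the other. -/
theorem eq_zero (hR : IsOuterResolvent R a) (h0 : 0 < φ) (h1 : φ < Real.pi / 2) {h : ℂ → ℂ} {T : 𝔸}
    (hT : HasCalc R a φ h T) (hz : ∀ z ∈ bisector φ a, h z = 0) : T = 0 := by
  have ha := hR.nonneg
  obtain ⟨ψ, hψ, hψ1⟩ := exists_between h1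
  have e0 := hT.mul_left _ φ ψ le_rfl hψ hψ1 (vertexTest_mem ha h0 h1)
  have e1 : contourOp R a ψ (fun z => vertexTest a z * h z) = 0 := by
    rw [contourOp_congr (g := fun _ => 0 * 0) ha h0 hψ hψ1.le fun z hz' => by
      rw [hz z hz', mul_zero, mul_zero], contourOp_const_mul, zero_smul]
  have m1 := vertex_re (ε := 1) (Or.inl rfl) ha one_pos
  have m2 := vertex_re (ε := -1) (Or.inr rfl) ha one_pos
  have m3 := vertex_re (ε := 1) (Or.inl rfl) ha two_pos
  rw [show ((2 : ℝ) : ℂ) = 2 by norm_num] at m3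
  rw [one_mul] at m1 m3
  rw [neg_one_mul] at m2
  rw [e1, contourOp_vertexTest hR (h0.trans hψ) hψ1, neg_mul, neg_eq_zero, mul_assoc] at e0
  have e2 := hR.inj _ m3 _ e0
  have vT : ∀ ε : ℂ, (ε = 1 ∨ ε = -1) → VanishesAtVertex R a ε T := by
    intro ε hε
    obtain ⟨p, hp, hv⟩ := hT.vertex ε hε
    have := nhdsWithin_bisector_neBot ha h0 h1 hε
    have hp0 : p = 0 := tendsto_nhds_unique hp (tendsto_const_nhds.congr'
      (eventually_nhdsWithin_of_forall fun z hz' => (hz z hz').symm))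
    rwa [hp0, zero_smul, sub_zero] at hv
  have e3 : (1 + R (-(a + (1 : ℝ)))) * T = 0 := by
    refine VanishesAtVertex.eq_zero hR (Or.inl rfl) ((vT 1 (Or.inl rfl)).mul_left ?_) ?_
    · intro l hl
      rw [mul_add, add_mul, mul_one, one_mul (R _),
        hR.commute (vertex_re (Or.inl rfl) ha hl) m2]
    · rw [mul_assoc, sub_mul, one_mul, sub_eq_zero] at e2
      rw [one_smul, one_mul]; exact e2
  refine VanishesAtVertex.eq_zero hR (Or.inr rfl) (vT (-1) (Or.inr rfl)) ?_
  rw [add_mul, one_mul] at e3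
  rw [neg_one_smul, neg_one_mul]; exact eq_neg_of_add_eq_zero_left e3

theorem unique (hR : IsOuterResolvent R a) (h0 : 0 < φ) (h1 : φ < Real.pi / 2) {h k : ℂ → ℂ}
    {T S : 𝔸} (hT : HasCalc R a φ h T) (hS : HasCalc R a φ k S)
    (e : ∀ z ∈ bisector φ a, h z = k z) : T = S :=
  sub_eq_zero.1 ((hT.sub hR h0 hS).eq_zero hR h0 h1 fun z hz => by rw [e z hz, sub_self])

/-- Commutativity needs no computation: both products represent the same function. -/
theorem commute (hR : IsOuterResolvent R a) (h0 : 0 < φ) (h1 : φ < Real.pi / 2) {h k : ℂ → ℂ}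
    {T S : 𝔸} (hT : HasCalc R a φ h T) (hS : HasCalc R a φ k S) : T * S = S * T :=
  (hT.mul hR h0 hS).unique hR h0 h1 (hS.mul hR h0 hT) fun _ _ => mul_comm _ _

end HasCalc
end Unique

/-! ### Comparison functions and existence with bounds -/

/-- The function `s(2a+s) / ((a+s)² - z²)`, equal to `1` at `±a`. -/
noncomputable def vertexOne (a s : ℝ) (z : ℂ) : ℂ :=
  (s * (2 * a + s) : ℂ) * ((((a + s : ℝ) : ℂ) - z)⁻¹ * (((a + s : ℝ) : ℂ) + z)⁻¹)

/-- A function equal to `1` at `a` and to `0` at `-a`, for `a ≠ 0`. -/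
noncomputable def vertexRight (a : ℝ) (z : ℂ) : ℂ :=
  ((2 * a + 1) / (2 * a) : ℂ) * ((z + a) * ((((a + 1 : ℝ) : ℂ) - z)⁻¹ * (((a + 1 : ℝ) : ℂ) + z)⁻¹))

section Comparison
variable {a φ s : ℝ} {z : ℂ}

/-- The constant in the separation of the bisector from the real axis. -/
noncomputable def sepConst (φ : ℝ) : ℝ := (1 - Real.cos φ) / 4

theorem sepConst_pos (h0 : 0 < φ) (h1 : φ < Real.pi / 2) : 0 < sepConst φ := by
  have := cos_lt_one_of_pos h0 h1; rw [sepConst]; linarith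

theorem le_norm_right (h0 : 0 < φ) (h1 : φ < Real.pi / 2) (hs : 0 ≤ s) (hz : z ∈ bisector φ a) :
    sepConst φ * (s + ‖z - a‖) ≤ ‖((a + s : ℝ) : ℂ) - z‖ := by
  have := norm_ofReal_sub_ge h0 h1 (b := a + s) (by linarith) hz
  rwa [add_sub_cancel_left] at this

theorem le_norm_left (h0 : 0 < φ) (h1 : φ < Real.pi / 2) (hs : 0 ≤ s) (hz : z ∈ bisector φ a) :
    sepConst φ * (s + ‖z + a‖) ≤ ‖((a + s : ℝ) : ℂ) + z‖ := by
  have := norm_ofReal_add_ge h0 h1 (b := a + s) (by linarith) hz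
  rwa [add_sub_cancel_left] at this

theorem right_ne_zero (h0 : 0 < φ) (h1 : φ < Real.pi / 2) (hs : 0 < s) (hz : z ∈ bisector φ a) :
    ((a + s : ℝ) : ℂ) - z ≠ 0 := fun h => by
  have := le_norm_right h0 h1 hs.le hz
  rw [h, norm_zero] at this
  have := mul_pos (sepConst_pos h0 h1) (show 0 < s + ‖z - a‖ by positivity)
  linarith

theorem left_ne_zero (h0 : 0 < φ) (h1 : φ < Real.pi / 2) (hs : 0 < s) (hz : z ∈ bisector φ a) :
    ((a + s : ℝ) : ℂ) + z ≠ 0 := fun h => by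
  have := le_norm_left h0 h1 hs.le hz
  rw [h, norm_zero] at this
  have := mul_pos (sepConst_pos h0 h1) (show 0 < s + ‖z + a‖ by positivity)
  linarith

theorem norm_inv_mul_inv_le (h0 : 0 < φ) (h1 : φ < Real.pi / 2) (hs : 0 < s)
    (hz : z ∈ bisector φ a) :
    ‖(((a + s : ℝ) : ℂ) - z)⁻¹ * (((a + s : ℝ) : ℂ) + z)⁻¹‖ ≤
      (sepConst φ ^ 2)⁻¹ * ((s + ‖z - a‖) * (s + ‖z + a‖))⁻¹ := by
  have hk := sepConst_pos h0 h1
  rw [norm_mul]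
  refine (mul_le_mul (norm_inv_le_of_le (by positivity) (le_norm_right h0 h1 hs.le hz))
    (norm_inv_le_of_le (by positivity) (le_norm_left h0 h1 hs.le hz)) (norm_nonneg _)
    (by positivity)).trans_eq ?_
  field_simp

theorem norm_vertexOne_le {L : ℝ} (ha : 0 ≤ a) (h0 : 0 < φ) (h1 : φ < Real.pi / 2) (hs : 0 < s)
    (hL : 2 * a + s ≤ L * s) (hz : z ∈ bisector φ a) :
    ‖vertexOne a s z‖ ≤ L * (sepConst φ ^ 2)⁻¹ * (1 + min ‖z - a‖ ‖z + a‖ / s)⁻¹ := by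
  have hk := sepConst_pos h0 h1
  have hL0 : 0 ≤ L := by
    by_contra h
    nlinarith
  have hnum : ‖(s * (2 * a + s) : ℂ)‖ = s * (2 * a + s) := by
    rw [show (s * (2 * a + s) : ℂ) = ((s * (2 * a + s) : ℝ) : ℂ) by push_cast; ring,
      Complex.norm_real, Real.norm_of_nonneg (by positivity)]
  rw [vertexOne, norm_mul, hnum]
  refine (mul_le_mul_of_nonneg_left (norm_inv_mul_inv_le h0 h1 hs hz) (by positivity)).trans ?_
  set E := ‖z - a‖
  set D := ‖z + a‖
  have hE : 0 ≤ E := norm_nonneg _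
  have hD : 0 ≤ D := norm_nonneg _
  have h2 : s * (s + min E D) ≤ (s + E) * (s + D) := by
    rcases min_cases E D with ⟨h, -⟩ | ⟨h, -⟩ <;> rw [h] <;> nlinarith [mul_nonneg hE hD]
  have hm : 0 ≤ min E D := le_min hE hD
  calc s * (2 * a + s) * ((sepConst φ ^ 2)⁻¹ * ((s + E) * (s + D))⁻¹)
      ≤ s * (L * s) * ((sepConst φ ^ 2)⁻¹ * (s * (s + min E D))⁻¹) := by gcongr
    _ = L * (sepConst φ ^ 2)⁻¹ * (1 + min E D / s)⁻¹ := by field_simp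

/-- The numerator of 1 - `vertexOne a s` is a² - z², so the difference vanishes at both vertices. -/
theorem norm_one_sub_vertexOne_le (h0 : 0 < φ) (h1 : φ < Real.pi / 2) (hs : 0 < s)
    (hz : z ∈ bisector φ a) :
    ‖1 - vertexOne a s z‖ ≤ (sepConst φ ^ 2)⁻¹ * (min ‖z - a‖ ‖z + a‖ / s) := by
  have hk := sepConst_pos h0 h1
  have n1 := right_ne_zero h0 h1 hs hz
  have n2 := left_ne_zero h0 h1 hs hz
  have e : 1 - vertexOne a s z = -((z - a) * (z + a)) *
      ((((a + s : ℝ) : ℂ) - z)⁻¹ * (((a + s : ℝ) : ℂ) + z)⁻¹) := by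
    rw [vertexOne]
    push_cast at n1 n2 ⊢
    field_simp
    ring
  rw [e, norm_mul, norm_neg, norm_mul]
  refine (mul_le_mul_of_nonneg_left (norm_inv_mul_inv_le h0 h1 hs hz) (by positivity)).trans ?_
  set E := ‖z - a‖
  set D := ‖z + a‖
  have hE : 0 ≤ E := norm_nonneg _
  have hD : 0 ≤ D := norm_nonneg _
  rw [mul_left_comm]
  refine mul_le_mul_of_nonneg_left ?_ (by positivity)
  rw [← div_eq_mul_inv, div_le_div_iff₀ (by positivity) hs]
  have hE2 : 0 ≤ E * E := mul_nonneg hE hE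
  have hD2 : 0 ≤ D * D := mul_nonneg hD hD
  have hED := mul_nonneg hE hD
  rcases min_cases E D with ⟨h, -⟩ | ⟨h, -⟩ <;> rw [h]
  · have : D * s ≤ (s + E) * (s + D) := by nlinarith
    calc E * D * s = E * (D * s) := by ring
      _ ≤ _ := by gcongr
  · have : E * s ≤ (s + E) * (s + D) := by nlinarith
    calc E * D * s = D * (E * s) := by ring
      _ ≤ _ := by gcongr

theorem norm_vertexRight_le (ha : 0 ≤ a) (h0 : 0 < φ) (h1 : φ < Real.pi / 2)
    (hz : z ∈ bisector φ a) : ‖vertexRight a z‖ ≤ (2 * a + 1) / (2 * a) * (sepConst φ ^ 2)⁻¹ *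
      (‖z + a‖ * ((1 + ‖z - a‖) * (1 + ‖z + a‖))⁻¹) := by
  have hnum : ‖((2 * a + 1) / (2 * a) : ℂ)‖ = (2 * a + 1) / (2 * a) := by
    rw [show ((2 * a + 1) / (2 * a) : ℂ) = (((2 * a + 1) / (2 * a) : ℝ) : ℂ) by push_cast; ring,
      Complex.norm_real, Real.norm_of_nonneg (by positivity)]
  rw [vertexRight, norm_mul, norm_mul, hnum]
  have := norm_inv_mul_inv_le h0 h1 one_pos hz
  calc _ ≤ (2 * a + 1) / (2 * a) * (‖z + a‖ * ((sepConst φ ^ 2)⁻¹ *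
        ((1 + ‖z - a‖) * (1 + ‖z + a‖))⁻¹)) := by gcongr
    _ = _ := by ring

theorem norm_one_sub_vertexRight_le (ha : 0 < a) (h0 : 0 < φ) (h1 : φ < Real.pi / 2)
    (hz : z ∈ bisector φ a) (hE : ‖z - a‖ ≤ 1) : ‖1 - vertexRight a z‖ ≤
      (2 * (a + 1) + (2 * a ^ 2 + 2 * a + 1) / a) * (sepConst φ ^ 2)⁻¹ * ‖z - a‖ := by
  have hk := sepConst_pos h0 h1
  have n1 := right_ne_zero h0 h1 one_pos hz
  have n2 := left_ne_zero h0 h1 one_pos hz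
  have ha' : (a : ℂ) ≠ 0 := by exact_mod_cast ha.ne'
  have e : 1 - vertexRight a z = (z - a) * (-(z + (2 * a ^ 2 + 2 * a + 1) / (2 * a))) *
      ((((a + 1 : ℝ) : ℂ) - z)⁻¹ * (((a + 1 : ℝ) : ℂ) + z)⁻¹) := by
    rw [vertexRight]
    push_cast at n1 n2 ⊢
    field_simp
    ring
  rw [e, norm_mul, norm_mul, norm_neg]
  have b1 := norm_inv_mul_inv_le h0 h1 one_pos hz
  have b2 : ((1 + ‖z - a‖) * (1 + ‖z + a‖))⁻¹ ≤ 1 := by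
    refine inv_le_one_of_one_le₀ ?_
    nlinarith [norm_nonneg (z - a), norm_nonneg (z + a)]
  have b3 : ‖z + (2 * a ^ 2 + 2 * a + 1) / (2 * a)‖ ≤
      2 * (a + 1) + (2 * a ^ 2 + 2 * a + 1) / a := by
    have h3 : ‖((2 * a ^ 2 + 2 * a + 1) / (2 * a) : ℂ)‖ = (2 * a ^ 2 + 2 * a + 1) / (2 * a) := by
      rw [show ((2 * a ^ 2 + 2 * a + 1) / (2 * a) : ℂ) =
        (((2 * a ^ 2 + 2 * a + 1) / (2 * a) : ℝ) : ℂ) by push_cast; ring,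
        Complex.norm_real, Real.norm_of_nonneg (by positivity)]
    have h4 : ‖z‖ ≤ a + 1 := by
      calc ‖z‖ = ‖(z - a) + a‖ := by rw [sub_add_cancel]
        _ ≤ ‖z - a‖ + ‖(a : ℂ)‖ := norm_add_le _ _
        _ ≤ a + 1 := by rw [Complex.norm_real, Real.norm_of_nonneg ha.le]; linarith
    refine (norm_add_le _ _).trans ?_
    rw [h3]
    have h5 : (2 * a ^ 2 + 2 * a + 1) / (2 * a) ≤ (2 * a ^ 2 + 2 * a + 1) / a := by
      gcongr; linarith
    linarith
  calc _ ≤ ‖z - a‖ * (2 * (a + 1) + (2 * a ^ 2 + 2 * a + 1) / a) * ((sepConst φ ^ 2)⁻¹ * 1) := by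
        gcongr
        exact b1.trans (by gcongr)
    _ = _ := by ring

theorem differentiableOn_inv_mul_inv (h0 : 0 < φ) (h1 : φ < Real.pi / 2) (hs : 0 < s) :
    DifferentiableOn ℂ (fun z => (((a + s : ℝ) : ℂ) - z)⁻¹ * (((a + s : ℝ) : ℂ) + z)⁻¹)
      (bisector φ a) := by
  have d3 : DifferentiableOn ℂ (fun z : ℂ => ((a + s : ℝ) : ℂ) + z) (bisector φ a) := by fun_prop
  exact (differentiableOn_sub_inv fun z hz => right_ne_zero h0 h1 hs hz).mul
    (d3.fun_inv fun z hz => left_ne_zero h0 h1 hs hz)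

theorem differentiableOn_vertexOne (h0 : 0 < φ) (h1 : φ < Real.pi / 2) (hs : 0 < s) :
    DifferentiableOn ℂ (vertexOne a s) (bisector φ a) :=
  (differentiableOn_inv_mul_inv h0 h1 hs).const_mul _

theorem differentiableOn_vertexRight (h0 : 0 < φ) (h1 : φ < Real.pi / 2) :
    DifferentiableOn ℂ (vertexRight a) (bisector φ a) := by
  have d : DifferentiableOn ℂ (fun z : ℂ => z + a) (bisector φ a) := by fun_prop
  exact (d.mul (differentiableOn_inv_mul_inv h0 h1 one_pos)).const_mul _

end Comparison

/-- A holomorphic function on the bisector, with quantitative behaviour at scale `s`: it is close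
to `q` near `-a`, to `p` near `a`, and small near infinity. -/
structure IsTame (φ a d s β C : ℝ) (h : ℂ → ℂ) (p q : ℂ) : Prop where
  holo : DifferentiableOn ℂ h (bisector φ a)
  near : ∀ z ∈ bisector φ a, ‖z + a‖ ≤ s → ‖h z - q‖ ≤ C * (‖z + a‖ / s) ^ β
  far : ∀ z ∈ bisector φ a, s ≤ ‖z + a‖ → ‖h z‖ ≤ C * (‖z + a‖ / s) ^ (-β)
  right : a ≠ 0 → ∀ z ∈ bisector φ a, ‖z - a‖ ≤ d → ‖h z - p‖ ≤ C * ‖z - a‖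
  norm_right : ‖p‖ ≤ C
  norm_left : ‖q‖ ≤ C

namespace IsTame
variable {φ a d s β C : ℝ} {h : ℂ → ℂ} {p q : ℂ}

theorem nonneg (H : IsTame φ a d s β C h p q) : 0 ≤ C := (norm_nonneg _).trans H.norm_left

/-- The remainder after subtracting the comparison functions. -/
noncomputable def remainder (a s : ℝ) (h : ℂ → ℂ) (p q : ℂ) (z : ℂ) : ℂ :=
  h z - q * vertexOne a s z - (p - q) * vertexRight a z

theorem norm_sub_le (H : IsTame φ a d s β C h p q) (hβ : 0 < β) (hs : 0 < s) {z : ℂ}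
    (hz : z ∈ bisector φ a) : ‖h z - q‖ ≤ 2 * C * (‖z + a‖ / s) ^ β := by
  have hC := H.nonneg
  rcases le_total ‖z + a‖ s with h1 | h1
  · refine (H.near z hz h1).trans ?_
    gcongr; linarith
  · have h2 : 1 ≤ ‖z + a‖ / s := by rwa [one_le_div hs]
    have h3 : ‖h z‖ ≤ C := (H.far z hz h1).trans
      (mul_le_of_le_one_right hC (Real.rpow_le_one_of_one_le_of_nonpos h2 (by linarith)))
    have h4 : 1 ≤ (‖z + a‖ / s) ^ β := Real.one_le_rpow h2 hβ.le
    have h5 := _root_.norm_sub_le (h z) q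
    have h6 := H.norm_left
    nlinarith

theorem le_bump_of_le_of_le_inv {β r x : ℝ} (hβ : 0 < β) (hβ1 : β ≤ 1) (hr : 0 < r) (h1 : x ≤ r)
    (h2 : x ≤ r⁻¹) : x ≤ bump β r := by
  refine le_bump_of_le hβ.le hr (fun h => h1.trans ?_) fun h => h2.trans ?_
  · simpa using Real.rpow_le_rpow_of_exponent_ge hr h hβ1
  · rw [← Real.rpow_neg_one]
    exact Real.rpow_le_rpow_of_exponent_le h (by linarith)

theorem inv_one_add_le_bump {β d r : ℝ} (hβ : 0 < β) (hβ1 : β ≤ 1) (hd : 0 < d) (hd1 : d ≤ 1)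
    (hr : d ≤ r) : (1 + r)⁻¹ ≤ d⁻¹ * bump β r := by
  have hr0 : 0 < r := hd.trans_le hr
  have : d * (1 + r)⁻¹ ≤ bump β r := by
    refine le_bump_of_le_of_le_inv hβ hβ1 hr0 ?_ ?_
    · refine (mul_le_of_le_one_right hd.le ?_).trans hr
      exact inv_le_one_of_one_le₀ (by linarith)
    · refine (mul_le_of_le_one_left (inv_nonneg.2 (by linarith)) hd1).trans ?_
      gcongr; linarith
  rwa [inv_mul_eq_div, le_div_iff₀ hd, mul_comm]

theorem frac_le_left {D E : ℝ} (hE : 0 < E) (hD : 0 < D) : D * ((1 + E) * (1 + D))⁻¹ ≤ D := by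
  refine mul_le_of_le_one_right hD.le (inv_le_one_of_one_le₀ ?_)
  nlinarith

theorem frac_le_inv {D E : ℝ} (hD : 0 < D) (h : D ≤ E) : D * ((1 + E) * (1 + D))⁻¹ ≤ D⁻¹ := by
  have hE : 0 < E := hD.trans_le h
  rw [← div_eq_mul_inv, div_le_iff₀ (by positivity), inv_mul_eq_div, le_div_iff₀ hD]
  nlinarith

theorem frac_le_inv_one_add {D E δ : ℝ} (hD : 0 < D) (hδ : 0 ≤ δ) (h : δ ≤ E) :
    D * ((1 + E) * (1 + D))⁻¹ ≤ (1 + δ)⁻¹ := by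
  have hE : 0 ≤ E := hδ.trans h
  rw [← div_eq_mul_inv, div_le_iff₀ (by positivity), inv_mul_eq_div, le_div_iff₀ (by positivity)]
  nlinarith

/-- The remainder is regrouped according to the position of z: around the value p near a, around q
near -a or at middle distance, and termwise beyond the scale s. The bump at scale s measures h and
`vertexOne`. The bump at scale 1 measures the correction by `vertexRight` and, near the right
vertex, also h - p, whose scale stays fixed. -/
theorem norm_remainder_le (ha : 0 ≤ a) (h0 : 0 < φ) (h1 : φ < Real.pi / 2) (hβ : 0 < β)
    (hβ1 : β ≤ 1) (hd : 0 < d) (hd1 : d ≤ 1) :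
    ∃ K : ℝ, 0 < K ∧ ∀ (s C : ℝ) (h : ℂ → ℂ) (p q : ℂ), 0 < s → (a ≠ 0 → d ≤ s) →
      IsTame φ a d s β C h p q → ∀ z ∈ bisector φ a, ‖remainder a s h p q z‖ ≤
        K * C * (bump β (min ‖z - a‖ ‖z + a‖ / s) + bump β (min ‖z - a‖ ‖z + a‖)) := by
  have hk := sepConst_pos h0 h1
  set k := (sepConst φ ^ 2)⁻¹ with hkdef
  have hk0 : 0 < k := by positivity
  -- L bounds (2a + s)/s for all admitted scales: if a ≠ 0 then s ≥ d, and if a = 0 the ratio is 1.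
  set L := 1 + 2 * a / d with hLdef
  have hL1 : 1 ≤ L := by rw [hLdef]; have : 0 ≤ 2 * a / d := by positivity
                         linarith
  set J := (2 * a + 1) / (2 * a) * k with hJdef
  have hJ0 : 0 ≤ J := by positivity
  set N := (2 * (a + 1) + (2 * a ^ 2 + 2 * a + 1) / a) * k with hNdef
  have hN0 : 0 ≤ N := by positivity
  refine ⟨2 * L + L * k + k + 2 * J * d⁻¹ + 2 * J + 2 * N + 1, by positivity, ?_⟩
  intro s C h p q hs hds H z hz
  have hC := H.nonneg
  obtain ⟨n1, n2⟩ := ne_of_mem_bisector h0 h1 hz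
  have hE : 0 < ‖z - a‖ := norm_pos_iff.2 (sub_ne_zero.2 n1)
  have hD : 0 < ‖z + a‖ := norm_pos_iff.2 fun h => n2 (eq_neg_of_add_eq_zero_left h)
  have hLs : 2 * a + s ≤ L * s := by
    rw [hLdef, add_mul, one_mul, add_comm]
    rcases eq_or_ne a 0 with rfl | ha0
    · simp
    · have := hds ha0
      rw [div_mul_eq_mul_div]
      have : 2 * a ≤ 2 * a * s / d := by rw [le_div_iff₀ hd]; gcongr
      linarith
  have m1 := norm_vertexOne_le ha h0 h1 hs hLs hz
  have m2 := norm_one_sub_vertexOne_le h0 h1 hs hz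
  have j1 := norm_vertexRight_le ha h0 h1 hz
  have hDE : ‖z + a‖ ≤ ‖z - a‖ + 2 * a := by
    calc ‖z + a‖ = ‖(z - a) + ((2 * a : ℝ) : ℂ)‖ := by congr 1; push_cast; ring
      _ ≤ _ := by
        refine (norm_add_le _ _).trans_eq ?_
        rw [Complex.norm_real, Real.norm_of_nonneg (by positivity)]
  have hnear := H.norm_sub_le hβ hs hz
  have hpq : ‖p - q‖ ≤ 2 * C := by
    have := _root_.norm_sub_le p q
    have := H.norm_left
    have := H.norm_right
    linarith
  -- For a = 0 the vertices coincide and no second correction is needed; the prefactor, a division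
  -- by 2a, is then 0 by convention.
  have hj0 : a = 0 → vertexRight a z = 0 := by rintro rfl; simp [vertexRight]
  have hright := fun h0' => H.right h0' z hz
  have hr1 := fun h0' => norm_one_sub_vertexRight_le (lt_of_le_of_ne ha (Ne.symm h0')) h0 h1 hz
  have hfar := H.far z hz
  rw [← hkdef] at m1 m2 j1
  rw [← hJdef] at j1
  rw [← hkdef, ← hNdef] at hr1
  set E := ‖z - a‖ with hEdef
  set D := ‖z + a‖ with hDdef
  set δ := min E D with hδdef
  have hδ : 0 < δ := lt_min hE hD
  have hρ : 0 < δ / s := by positivity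
  set B₁ := bump β (δ / s) with hB1
  set B₂ := bump β δ with hB2
  have hB1n : 0 ≤ B₁ := bump_nonneg hρ.le
  have hB2n : 0 ≤ B₂ := bump_nonneg hδ.le
  -- the comparison function at the right vertex, away from that vertex
  have jfar : (a = 0 ∨ d ≤ δ) → ‖vertexRight a z‖ ≤ J * d⁻¹ * B₂ := by
    rintro (h2 | h2)
    · rw [hj0 h2, norm_zero]; positivity
    · have h3 : D * ((1 + E) * (1 + D))⁻¹ ≤ d⁻¹ * B₂ :=
        (frac_le_inv_one_add hD hδ.le (min_le_left _ _)).trans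
          (inv_one_add_le_bump hβ hβ1 hd hd1 h2)
      calc _ ≤ J * (D * ((1 + E) * (1 + D))⁻¹) := j1
        _ ≤ J * (d⁻¹ * B₂) := by gcongr
        _ = _ := by ring
  have jleft : D ≤ E → ‖vertexRight a z‖ ≤ J * B₂ := by
    intro h2
    have h3 : δ = D := min_eq_right h2
    refine j1.trans (mul_le_mul_of_nonneg_left ?_ hJ0)
    rw [hB2, h3]
    exact le_bump_of_le_of_le_inv hβ hβ1 hD (frac_le_left hE hD) (frac_le_inv hD h2)
  have fin : ∀ K₁ K₂ : ℝ, K₁ ≤ 2 * L + L * k + k + 2 * J * d⁻¹ + 2 * J + 2 * N + 1 →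
      K₂ ≤ 2 * L + L * k + k + 2 * J * d⁻¹ + 2 * J + 2 * N + 1 → ∀ x : ℝ,
      x ≤ K₁ * C * B₁ + K₂ * C * B₂ → x ≤
      (2 * L + L * k + k + 2 * J * d⁻¹ + 2 * J + 2 * N + 1) * C * (B₁ + B₂) := by
    intro K₁ K₂ h2 h3 x hx
    rw [mul_add]
    refine hx.trans ?_
    gcongr
  have hLk : 0 ≤ L * k := by positivity
  have hJd : 0 ≤ 2 * J * d⁻¹ := by positivity
  rcases le_total (δ / s) 1 with hρ1 | hρ1
  · -- below the scale
    have hB1e : B₁ = (δ / s) ^ β := bump_of_le_one hβ.le hρ hρ1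
    have hρβ : δ / s ≤ B₁ := by
      rw [hB1e]; simpa using Real.rpow_le_rpow_of_exponent_ge hρ hρ1 hβ1
    have hq : ‖q * (1 - vertexOne a s z)‖ ≤ k * C * B₁ := by
      rw [norm_mul]
      calc ‖q‖ * ‖1 - vertexOne a s z‖ ≤ C * (k * (δ / s)) := by
            gcongr; exact H.norm_left
        _ ≤ C * (k * B₁) := by gcongr
        _ = _ := by ring
    -- Near the right vertex both comparison functions are close to 1, so the remainder is regrouped
    -- around p.
    by_cases hcase : E ≤ D ∧ E ≤ d ∧ a ≠ 0
    · obtain ⟨h2, h3, h4⟩ := hcase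
      have hδE : δ = E := min_eq_left h2
      have hEB : E ≤ B₂ := by
        rw [hB2, hδE, bump_of_le_one hβ.le hE (h3.trans hd1)]
        simpa using Real.rpow_le_rpow_of_exponent_ge hE (h3.trans hd1) hβ1
      have e : remainder a s h p q z = (h z - p) + q * (1 - vertexOne a s z) +
          (p - q) * (1 - vertexRight a z) := by rw [remainder]; ring
      refine fin k (1 + 2 * N) (by linarith) (by linarith) _ ?_
      rw [e]
      have h5 : ‖h z - p‖ ≤ C * B₂ := (hright h4 h3).trans (by gcongr)
      have h6 : ‖(p - q) * (1 - vertexRight a z)‖ ≤ 2 * C * (N * B₂) := by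
        rw [norm_mul]
        have := hr1 h4 (h3.trans hd1)
        gcongr
        exact this.trans (by gcongr)
      have := norm_add₃_le (a := h z - p) (b := q * (1 - vertexOne a s z))
        (c := (p - q) * (1 - vertexRight a z))
      linarith
    · have e : remainder a s h p q z = (h z - q) + q * (1 - vertexOne a s z) -
          (p - q) * vertexRight a z := by rw [remainder]; ring
      have tri : ‖remainder a s h p q z‖ ≤ ‖h z - q‖ + ‖q * (1 - vertexOne a s z)‖ +
          2 * C * ‖vertexRight a z‖ := by
        rw [e]
        refine (_root_.norm_sub_le _ _).trans (add_le_add (norm_add_le _ _) ?_)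
        rw [norm_mul]; gcongr
      rcases le_total D E with h2 | h2
      · have hδD : δ = D := min_eq_right h2
        have h5 : ‖h z - q‖ ≤ 2 * C * B₁ := by rw [hB1e, hδD]; exact hnear
        have h6 := jleft h2
        have h7 : 2 * C * ‖vertexRight a z‖ ≤ 2 * C * (J * B₂) := by gcongr
        refine fin (2 + k) (2 * J) (by linarith) (by linarith) _ ?_
        linarith
      · have hδE : δ = E := min_eq_left h2
        -- Here z is nearer to a than to -a but not within d of a (or a = 0). The two distances are
        -- then comparable up to the factor L, so the estimate in terms of ‖z + a‖ carries over to
        -- the minimum.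
        have h3 : a = 0 ∨ d ≤ δ := by
          rw [hδE]
          by_contra h4
          push Not at h4
          exact hcase ⟨h2, h4.2.le, h4.1⟩
        have hDL : D / s ≤ L * (δ / s) := by
          rw [← mul_div_assoc]
          gcongr
          rcases h3 with rfl | h3
          · rw [hδE]; nlinarith
          · rw [hδE] at h3 ⊢
            have : 2 * a ≤ 2 * a / d * E := by
              rw [div_mul_eq_mul_div, le_div_iff₀ hd]; gcongr
            rw [hLdef]; linarith
        have h5 : ‖h z - q‖ ≤ 2 * C * (L * B₁) := by
          refine hnear.trans ?_
          gcongr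
          calc (D / s) ^ β ≤ (L * (δ / s)) ^ β := by gcongr
            _ = L ^ β * (δ / s) ^ β := Real.mul_rpow (by positivity) hρ.le
            _ ≤ L * B₁ := by
              rw [hB1e]; gcongr
              simpa using Real.rpow_le_rpow_of_exponent_le hL1 hβ1
        have h6 := jfar h3
        have h7 : 2 * C * ‖vertexRight a z‖ ≤ 2 * C * (J * d⁻¹ * B₂) := by gcongr
        refine fin (2 * L + k) (2 * J * d⁻¹) (by linarith) (by linarith) _ ?_
        linarith
  · -- above the scale
    have hB1e : B₁ = (δ / s) ^ (-β) := bump_of_one_le hβ.le hρ1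
    have hsD : s ≤ δ := by rwa [one_le_div hs] at hρ1
    have hδD : δ ≤ D := min_le_right _ _
    have h2 : ‖h z‖ ≤ C * B₁ := by
      refine (hfar (hsD.trans hδD)).trans ?_
      rw [hB1e]
      refine mul_le_mul_of_nonneg_left ?_ hC
      exact Real.rpow_le_rpow_of_nonpos hρ (by gcongr) (by linarith)
    have h3 : ‖q * vertexOne a s z‖ ≤ C * (L * k * B₁) := by
      rw [norm_mul]
      have h4 : (1 + δ / s)⁻¹ ≤ B₁ := by
        rw [hB1e]
        refine le_trans (b := (δ / s)⁻¹) (by gcongr; linarith) ?_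
        rw [← Real.rpow_neg_one]
        exact Real.rpow_le_rpow_of_exponent_le hρ1 (by linarith)
      gcongr
      · exact H.norm_left
      · exact m1.trans (by gcongr)
    have h6 := jfar (by
      rcases eq_or_ne a 0 with h4 | h4
      · exact Or.inl h4
      · exact Or.inr ((hds h4).trans hsD))
    have h7 : ‖(p - q) * vertexRight a z‖ ≤ 2 * C * (J * d⁻¹ * B₂) := by
      rw [norm_mul]; gcongr
    refine fin (1 + L * k) (2 * J * d⁻¹) (by linarith) (by linarith) _ ?_
    have tri : ‖remainder a s h p q z‖ ≤ ‖h z‖ + ‖q * vertexOne a s z‖ +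
        ‖(p - q) * vertexRight a z‖ := by
      rw [remainder]
      exact (_root_.norm_sub_le _ _).trans (add_le_add_left (_root_.norm_sub_le _ _) _)
    linarith

theorem remainder_mem (ha : 0 ≤ a) (h0 : 0 < φ) (h1 : φ < Real.pi / 2) (hβ : 0 < β)
    (hβ1 : β ≤ 1) (hd : 0 < d) (hd1 : d ≤ 1) (hs : 0 < s) (hds : a ≠ 0 → d ≤ s)
    (H : IsTame φ a d s β C h p q) : MemElemZero φ a (remainder a s h p q) := by
  obtain ⟨K, hK, hKb⟩ := norm_remainder_le ha h0 h1 hβ hβ1 hd hd1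
  refine memElemZero_of_le (C := K * C * ((max s s⁻¹) ^ β + 1)) ha h0 h1 hβ ?_ fun z hz => ?_
  · exact (H.holo.sub ((differentiableOn_vertexOne h0 h1 hs).const_mul q)).sub
      ((differentiableOn_vertexRight h0 h1).const_mul (p - q))
  · refine (hKb s C h p q hs hds H z hz).trans ?_
    obtain ⟨n1, n2⟩ := ne_of_mem_bisector h0 h1 hz
    have hδ : 0 < min ‖z - a‖ ‖z + a‖ := lt_min (norm_pos_iff.2 (sub_ne_zero.2 n1))
      (norm_pos_iff.2 fun h => n2 (eq_neg_of_add_eq_zero_left h))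
    rw [mul_assoc _ (_ + 1), add_mul, one_mul]
    have := bump_div_le hβ.le hδ hs
    have := H.nonneg
    gcongr

end IsTame

/-! ### Tame functions in the calculus -/

section Existence
variable {𝔸 : Type*} [NormedRing 𝔸] [NormedAlgebra ℂ 𝔸] [CompleteSpace 𝔸] {R : ℂ → 𝔸}
  {a φ s : ℝ}

theorem vertexRight_eq (ha : 0 ≤ a) (h0 : 0 < φ) (h1 : φ < Real.pi / 2) {z : ℂ}
    (hz : z ∈ bisector φ a) : vertexRight a z = ((2 * a + 1) / (2 * a) : ℂ) *
      (((2 * a + 1) / (2 * a + 2) : ℂ) * (((a + 1 : ℝ) : ℂ) - z)⁻¹ -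
        (2 * a + 2 : ℂ)⁻¹ * (((a + 1 : ℝ) : ℂ) + z)⁻¹) := by
  have n1 := right_ne_zero h0 h1 one_pos hz
  have n2 := left_ne_zero h0 h1 one_pos hz
  have q1 : (2 * a + 2 : ℂ) ≠ 0 := by
    have : (0 : ℝ) < 2 * a + 2 := by linarith
    exact_mod_cast this.ne'
  rw [vertexRight]
  congr 1
  push_cast at n1 n2 ⊢
  generalize (a : ℂ) = x at *
  have q2 : x + 1 ≠ 0 := fun h => q1 (by linear_combination 2 * h)
  field_simp
  ring

theorem vertexOne_one_eq (ha : 0 ≤ a) (h0 : 0 < φ) (h1 : φ < Real.pi / 2) {z : ℂ}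
    (hz : z ∈ bisector φ a) : vertexOne a 1 z = ((2 * a + 1) / (2 * a + 2) : ℂ) *
      ((((a + 1 : ℝ) : ℂ) - z)⁻¹ + (((a + 1 : ℝ) : ℂ) + z)⁻¹) := by
  have n1 := right_ne_zero h0 h1 one_pos hz
  have n2 := left_ne_zero h0 h1 one_pos hz
  have q1 : (2 * a + 2 : ℂ) ≠ 0 := by
    have : (0 : ℝ) < 2 * a + 2 := by linarith
    exact_mod_cast this.ne'
  rw [vertexOne]
  push_cast at n1 n2 ⊢
  generalize (a : ℂ) = x at *
  have q2 : x + 1 ≠ 0 := fun h => q1 (by linear_combination 2 * h)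
  field_simp
  ring

namespace HasCalc

theorem right_inv (hR : IsOuterResolvent R a) (h0 : 0 < φ) (h1 : φ < Real.pi / 2) (hs : 0 < s) :
    HasCalc R a φ (fun z => (((a + s : ℝ) : ℂ) - z)⁻¹) (R (a + s)) := by
  have := resolvent hR h0 h1 (ε := 1) (Or.inl rfl) hs
  simp only [one_mul] at this
  rwa [Complex.ofReal_add]

theorem left_inv (hR : IsOuterResolvent R a) (h0 : 0 < φ) (h1 : φ < Real.pi / 2) (hs : 0 < s) :
    HasCalc R a φ (fun z => (((a + s : ℝ) : ℂ) + z)⁻¹) (-R (-(a + s))) := by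
  have := (resolvent hR h0 h1 (ε := -1) (Or.inr rfl) hs).smul (-1)
  simp only [neg_one_mul, neg_one_smul] at this
  refine this.congr hR.nonneg h0 fun z _ => ?_
  rw [← inv_neg, neg_sub, sub_neg_eq_add, Complex.ofReal_add, add_comm]

theorem vertexOne (hR : IsOuterResolvent R a) (h0 : 0 < φ) (h1 : φ < Real.pi / 2) (hs : 0 < s) :
    HasCalc R a φ (vertexOne a s) ((s * (2 * a + s) : ℂ) • (R (a + s) * -R (-(a + s)))) :=
  ((right_inv hR h0 h1 hs).mul hR h0 (left_inv hR h0 h1 hs)).smul _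

theorem vertexRight (hR : IsOuterResolvent R a) (h0 : 0 < φ) (h1 : φ < Real.pi / 2) :
    HasCalc R a φ (vertexRight a) (((2 * a + 1) / (2 * a) : ℂ) •
      (((2 * a + 1) / (2 * a + 2) : ℂ) • R (a + (1 : ℝ)) -
        (2 * a + 2 : ℂ)⁻¹ • -R (-(a + (1 : ℝ))))) :=
  ((((right_inv hR h0 h1 one_pos).smul _).sub hR h0
    ((left_inv hR h0 h1 one_pos).smul _)).smul _).congr hR.nonneg h0
    fun _ hz => vertexRight_eq hR.nonneg h0 h1 hz

end HasCalc

/-- Tame functions belong to the calculus, with bounds that are uniform in the scale. -/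
theorem exists_hasCalc (hR : IsOuterResolvent R a) (h0 : 0 < φ) {φ' β d : ℝ} (h : φ < φ')
    (h1 : φ' < Real.pi / 2) (hβ : 0 < β) (hβ1 : β ≤ 1) (hd : 0 < d) (hd1 : d ≤ 1) :
    ∃ K : ℝ, 0 < K ∧ ∀ (s C : ℝ) (k : ℂ → ℂ) (p q : ℂ), 0 < s → (a ≠ 0 → d ≤ s) →
      IsTame φ a d s β C k p q → ∃ T : 𝔸, HasCalc R a φ' k T ∧ ‖T‖ ≤ K * C := by
  have ha := hR.nonneg
  obtain ⟨ω, hω, hω'⟩ := exists_between h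
  have hφ1 : φ < Real.pi / 2 := h.trans h1
  have hφ' : 0 < φ' := h0.trans h
  have hω0 : 0 < ω := h0.trans hω
  have hω1 : ω < Real.pi / 2 := hω'.trans h1
  obtain ⟨K₁, hK₁, hK₁b⟩ := IsTame.norm_remainder_le ha h0 hφ1 hβ hβ1 hd hd1
  obtain ⟨K₂, hK₂, hK₂b⟩ := norm_contourOp_le hR hω0 hω1 hβ
  obtain ⟨C₁, hC₁, hC₁b⟩ := hR.vertex_bound (ε := 1) (Or.inl rfl)
  obtain ⟨C₂, hC₂, hC₂b⟩ := hR.vertex_bound (ε := -1) (Or.inr rfl)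
  set V : 𝔸 := ((2 * a + 1) / (2 * a) : ℂ) • (((2 * a + 1) / (2 * a + 2) : ℂ) • R (a + (1 : ℝ)) -
        (2 * a + 2 : ℂ)⁻¹ • -R (-(a + (1 : ℝ)))) with hV
  set L := 1 + 2 * a / d with hLdef
  have hL1 : 0 < L := by rw [hLdef]; positivity
  refine ⟨K₂ * K₁ + L * (C₁ * C₂) + 2 * ‖V‖, by positivity, ?_⟩
  intro s C k p q hs hds H
  have hC := H.nonneg
  have hmem := H.remainder_mem ha h0 hφ1 hβ hβ1 hd hd1 hs hds
  set M : 𝔸 := (s * (2 * a + s) : ℂ) • (R (a + s) * -R (-(a + s))) with hM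
  have hLs : 2 * a + s ≤ L * s := by
    rw [hLdef, add_mul, one_mul, add_comm]
    rcases eq_or_ne a 0 with rfl | ha0
    · simp
    · have := hds ha0
      rw [div_mul_eq_mul_div]
      have : 2 * a ≤ 2 * a * s / d := by rw [le_div_iff₀ hd]; gcongr
      linarith
  -- The coefficient is at most L s², and each of the two resolvents is O(1/s), so the bound does
  -- not depend on s.
  have hMn : ‖M‖ ≤ L * (C₁ * C₂) := by
    have b1 := hC₁b s hs
    have b2 := hC₂b s hs
    rw [one_mul] at b1
    rw [neg_one_mul] at b2
    rw [hM, norm_smul, show (s * (2 * a + s) : ℂ) = ((s * (2 * a + s) : ℝ) : ℂ) by push_cast; ring,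
      Complex.norm_real, Real.norm_of_nonneg (by positivity)]
    calc s * (2 * a + s) * ‖R (a + s) * -R (-(a + s))‖
        ≤ s * (L * s) * (‖R (a + s)‖ * ‖R (-(a + s))‖) := by
          gcongr
          refine (norm_mul_le _ _).trans_eq ?_
          rw [norm_neg]
      _ = L * ((‖R (a + s)‖ * s) * (‖R (-(a + s))‖ * s)) := by ring
      _ ≤ L * (C₁ * C₂) := by gcongr
  refine ⟨contourOp R a ω (IsTame.remainder a s k p q) + q • M + (p - q) • V, ?_, ?_⟩
  · refine ((((HasCalc.elemZero hR hmem h0 hω hω' h1).add hR hφ'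
      ((HasCalc.vertexOne hR hφ' h1 hs).smul q))).add hR hφ'
      ((HasCalc.vertexRight hR hφ' h1).smul (p - q))).congr ha hφ' fun z _ => ?_
    rw [IsTame.remainder]; ring
  · have hn := hK₂b (IsTame.remainder a s k p q) (K₁ * C) s hs (by positivity) fun i t ht => by
      have := hK₁b s C k p q hs hds H _ (contourPt_mem_bisector ha h0 hω hω1.le ht i)
      rwa [min_norm_contourPt ha hω1.le hω0 ht] at this
    refine (norm_add₃_le).trans ?_
    rw [norm_smul q, norm_smul (p - q)]
    have hpq : ‖p - q‖ ≤ 2 * C := by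
      have := _root_.norm_sub_le p q
      have := H.norm_left
      have := H.norm_right
      linarith
    calc _ ≤ K₂ * (K₁ * C) + C * (L * (C₁ * C₂)) + 2 * C * ‖V‖ := by
          gcongr; exact H.norm_left
      _ = _ := by ring

end Existence

/-! ### The bounded calculus and the elementary calculus of the statement -/

section Elementary
variable {X : Type*} [NormedAddCommGroup X] [NormedSpace ℂ X] {A : X →ₗ.[ℂ] X} {a φ : ℝ}

/-- At scale 1 the comparison functions have their poles exactly at ±(a + 1). Their partial
fractions are the two rational generators of the elementary algebra, so the decomposition used for
the bounds is literally of the required form. -/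
theorem IsTame.exists_hasElemCalc (ha : 0 ≤ a) (h0 : 0 < φ) {β d C : ℝ} (h1 : φ < Real.pi / 2)
    (hβ : 0 < β) (hβ1 : β ≤ 1) (hd : 0 < d) (hd1 : d ≤ 1) {k : ℂ → ℂ} {p q : ℂ}
    (H : IsTame φ a d 1 β C k p q) : ∃ T, HasElemCalc A (Real.pi / 2) a φ k T := by
  obtain ⟨ω, hω, hω'⟩ := exists_between h1
  have hmem := H.remainder_mem ha h0 h1 hβ hβ1 hd hd1 one_pos fun _ => hd1
  refine ⟨_, IsTame.remainder a 1 k p q,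
    q * ((2 * a + 1) / (2 * a + 2) : ℂ) - (p - q) * ((2 * a + 1) / (2 * a) * (2 * a + 2 : ℂ)⁻¹ : ℂ),
    q * ((2 * a + 1) / (2 * a + 2) : ℂ) +
      (p - q) * ((2 * a + 1) / (2 * a) * ((2 * a + 1) / (2 * a + 2)) : ℂ), ω, hmem, hω, hω',
    fun z hz => ?_, rfl⟩
  rw [IsTame.remainder, vertexOne_one_eq ha h0 h1 hz, vertexRight_eq ha h0 h1 hz,
    Complex.ofReal_add, Complex.ofReal_one, div_eq_mul_inv _ ((a : ℂ) + 1 + z),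
    div_eq_mul_inv _ ((a : ℂ) + 1 - z)]
  ring

/-- Translates the elementary calculus into `HasCalc`, where uniqueness is available. The angle has
to grow beyond that of the defining contour, because the product formula needs separated contours.
-/
theorem HasElemCalc.hasCalc [CompleteSpace X] (hA : IsBisectorialOp A (Real.pi / 2) a)
    (h0 : 0 < φ) {k : ℂ → ℂ} {T : X →L[ℂ] X} (H : HasElemCalc A (Real.pi / 2) a φ k T) :
    ∃ φ', φ < φ' ∧ φ' < Real.pi / 2 ∧ HasCalc (resolventOf A) a φ' k T := by
  obtain ⟨f, c, d, ω, hf, hω, hω1, hk, hT⟩ := H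
  have hR := hA.isOuterResolvent
  obtain ⟨φ', hφ', h1⟩ := exists_between hω1
  have h0' : 0 < φ' := h0.trans (hω.trans hφ')
  refine ⟨φ', hω.trans hφ', h1, ?_⟩
  have key := ((HasCalc.elemZero hR hf h0 hω hφ' h1).add hR h0'
    ((HasCalc.left_inv hR h0' h1 one_pos).smul c)).add hR h0'
    ((HasCalc.right_inv hR h0' h1 one_pos).smul d)
  rw [hT, contourCalc_eq]
  simp only [Complex.ofReal_one, smul_neg, ← sub_eq_add_neg] at key
  refine key.congr hR.nonneg h0' fun z hz => ?_
  rw [hk z (bisector_anti h0 (hω.trans hφ').le h1 hz)]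
  push_cast
  rw [div_eq_mul_inv, div_eq_mul_inv]

end Elementary

/-! ### Ranges of power functions -/

/-- A sector around the positive axis together with a disc around `0`. -/
def powRange (κ G : ℝ) : Set ℂ := {ζ | ‖ζ‖ ≤ G ∨ Real.cos κ * ‖ζ‖ ≤ ζ.re}

/-- `g` behaves like a power of order `α` on the bisector and has values in `powRange κ G`. -/
structure IsPowerLike (φ a α κ G : ℝ) (g : ℂ → ℂ) : Prop where
  nonneg : 0 ≤ G
  eq_zero : a = 0 → G = 0
  holo : DifferentiableOn ℂ g (bisector φ a)
  norm_eq : ∀ z ∈ bisector φ a, ‖g z‖ = ‖z + a‖ ^ α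
  maps : ∀ z ∈ bisector φ a, g z ∈ powRange κ G
  holo_ball : DifferentiableOn ℂ g (Metric.ball (a : ℂ) a)
  maps_ball : ∀ z ∈ Metric.ball (a : ℂ) a, ‖g z‖ ≤ G

/-- Jordan's inequality for x = π/2 - |arg ζ|, whose sine is Re ζ/|ζ|. -/
theorem abs_abs_arg_sub_le {ζ : ℂ} {c : ℝ} (hζ : ζ ≠ 0) (h : |ζ.re| ≤ 2 * c * ‖ζ‖) :
    |Real.pi / 2 - (|ζ.arg|)| ≤ Real.pi * c := by
  have hn : 0 < ‖ζ‖ := norm_pos_iff.2 hζ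
  have h1 : |Real.pi / 2 - (|ζ.arg|)| ≤ Real.pi / 2 := by
    have := Complex.abs_arg_le_pi ζ
    have := abs_nonneg ζ.arg
    rw [abs_le]; constructor <;> linarith
  have h2 := Real.mul_abs_le_abs_sin h1
  rw [Real.sin_pi_div_two_sub, Real.cos_abs, Complex.cos_arg hζ, abs_div, abs_norm] at h2
  have h3 : |ζ.re| / ‖ζ‖ ≤ 2 * c := by rwa [div_le_iff₀ hn]
  have h4 := h2.trans h3
  rw [div_mul_eq_mul_div, div_le_iff₀ Real.pi_pos] at h4
  linarith

theorem norm_pow_mul_cpow {ζ : ℂ} {α : ℝ} (n : ℕ) (hζ : ζ ≠ 0) :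
    ‖(-1 : ℂ) ^ n * ζ ^ (α : ℂ)‖ = ‖ζ‖ ^ α := by
  rw [norm_mul, norm_pow, norm_neg, norm_one, one_pow, one_mul, Complex.norm_cpow_of_ne_zero hζ]
  simp

theorem re_pow_mul_cpow {ζ : ℂ} {α : ℝ} (n : ℕ) (hζ : ζ ≠ 0) :
    ((-1 : ℂ) ^ n * ζ ^ (α : ℂ)).re = ‖ζ‖ ^ α * ((-1 : ℝ) ^ n * Real.cos (α * ζ.arg)) := by
  have h1 : ζ ^ (α : ℂ) = ((‖ζ‖ ^ α : ℝ) : ℂ) * Complex.exp ((α * ζ.arg : ℝ) * Complex.I) := by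
    rw [Complex.cpow_def_of_ne_zero hζ, Real.rpow_def_of_pos (norm_pos_iff.2 hζ),
      Complex.ofReal_exp, ← Complex.exp_add]
    congr 1
    rw [Complex.log]
    push_cast
    ring
  rw [h1, show ((-1 : ℂ) ^ n) = (((-1 : ℝ) ^ n : ℝ) : ℂ) by push_cast; ring, Complex.re_ofReal_mul,
    Complex.re_ofReal_mul, Complex.exp_ofReal_mul_I_re]
  ring

/-- If |arg ζ| = π/2 - x, then α|arg ζ| - nπ = π(α/2 - n) - αx. The sign (-1)^n is the shift of the
cosine by nπ, and the smallness of x is paid for by η. -/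
theorem re_pow_mul_cpow_ge {ζ : ℂ} {α c η : ℝ} {n : ℕ} (hα : 0 < α) (hζ : ζ ≠ 0)
    (h : |ζ.re| ≤ 2 * c * ‖ζ‖) (hc : α * (Real.pi * c) ≤ η)
    (hη : Real.pi * |α / 2 - n| + η ≤ Real.pi) :
    Real.cos (Real.pi * |α / 2 - n| + η) * ‖ζ‖ ^ α ≤ ((-1 : ℂ) ^ n * ζ ^ (α : ℂ)).re := by
  have h1 := abs_abs_arg_sub_le hζ h
  set x := Real.pi / 2 - |ζ.arg| with hx
  have key : |α * |ζ.arg| - n * Real.pi| ≤ Real.pi * |α / 2 - n| + η := by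
    have e : α * |ζ.arg| - n * Real.pi = Real.pi * (α / 2 - n) - α * x := by rw [hx]; ring
    rw [e]
    refine (abs_sub _ _).trans ?_
    rw [abs_mul, abs_mul, abs_of_pos Real.pi_pos, abs_of_pos hα]
    have : α * |x| ≤ α * (Real.pi * c) := by gcongr
    linarith
  rw [re_pow_mul_cpow n hζ, mul_comm]
  refine mul_le_mul_of_nonneg_left ?_ (Real.rpow_nonneg (norm_nonneg _) _)
  have e2 : Real.cos (α * ζ.arg) = Real.cos (α * |ζ.arg|) := by
    rw [← Real.cos_abs (α * ζ.arg), abs_mul, abs_of_pos hα]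
  rw [e2, ← Real.cos_sub_nat_mul_pi, ← Real.cos_abs (α * |ζ.arg| - n * Real.pi)]
  exact Real.cos_le_cos_of_nonneg_of_le_pi (abs_nonneg _) hη key

/-- Take cos φ = c small. For |a + z| ≥ 4a/c the vertices are negligible and |Re(a + z)| ≤ 2c|a +
z|, so the argument estimate applies. The remaining points have |a + z|^α ≤ (4a/c)^α = G. The ball
around the right vertex is treated separately because the vertex is not in the bisector, while the
power is holomorphic across it when a > 0. -/
theorem exists_isPowerLike {a α η : ℝ} {n : ℕ} (ha : 0 ≤ a) (hα : 0 < α) (hη : 0 < η)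
    (hη1 : Real.pi * |α / 2 - n| + η ≤ Real.pi) :
    ∃ φ G : ℝ, 0 < φ ∧ φ < Real.pi / 2 ∧ IsPowerLike φ a α (Real.pi * |α / 2 - n| + η) G
      (fun z => (-1 : ℂ) ^ n * ((a : ℂ) + z) ^ (α : ℂ)) := by
  set c := min (1 / 2) (η / (α * Real.pi)) with hcdef
  have hc0 : 0 < c := lt_min (by norm_num) (by have := Real.pi_pos; positivity)
  have hc1 : c ≤ 1 / 2 := min_le_left _ _
  have hcη : α * (Real.pi * c) ≤ η := by
    have : c ≤ η / (α * Real.pi) := min_le_right _ _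
    rw [le_div_iff₀ (by have := Real.pi_pos; positivity)] at this
    linarith
  set φ := Real.arccos c with hφ
  have hφ0 : 0 < φ := Real.arccos_pos.2 (by linarith)
  have hφ1 : φ < Real.pi / 2 := Real.arccos_lt_pi_div_two.2 hc0
  have hcos : Real.cos φ = c := Real.cos_arccos (by linarith) (by linarith)
  have hne : ∀ z ∈ bisector φ a, (a : ℂ) + z ≠ 0 := fun z hz h =>
    (ne_of_mem_bisector hφ0 hφ1 hz).2 (by linear_combination h)
  have hslit : ∀ z ∈ bisector φ a, (a : ℂ) + z ∈ Complex.slitPlane := by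
    intro z hz
    have h2 := ((mem_bisector_iff hφ0 hφ1).1 hz).2
    rw [Complex.mem_slitPlane_iff_not_le_zero]
    intro h3
    obtain ⟨h4, h5⟩ := Complex.le_def.1 h3
    have h6 : ‖z + a‖ = -(z + a).re := by
      rw [Complex.norm_eq_sqrt_sq_add_sq, add_comm z, h5]
      rw [Complex.zero_im, zero_pow two_ne_zero, add_zero, Real.sqrt_sq_eq_abs]
      exact abs_of_nonpos h4
    rw [h6, hcos] at h2
    have h7 : 0 < -(z + a).re := by
      rw [← h6, add_comm]; exact norm_pos_iff.2 (hne z hz)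
    nlinarith
  have hslit2 : ∀ z ∈ Metric.ball (a : ℂ) a, (a : ℂ) + z ∈ Complex.slitPlane := by
    intro z hz
    rw [Metric.mem_ball, dist_eq_norm] at hz
    rw [Complex.mem_slitPlane_iff]; left
    have := (abs_le.1 ((Complex.abs_re_le_norm (z - a)).trans hz.le)).1
    have h3 : ‖(a : ℂ) - z‖ < a := by rwa [norm_sub_rev]
    have h4 := (Complex.abs_re_le_norm (z - a)).trans_lt hz
    rw [Complex.sub_re, Complex.ofReal_re, abs_lt] at h4
    rw [Complex.add_re, Complex.ofReal_re]; linarith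
  have hhol : ∀ s : Set ℂ, (∀ z ∈ s, (a : ℂ) + z ∈ Complex.slitPlane) →
      DifferentiableOn ℂ (fun z => (-1 : ℂ) ^ n * ((a : ℂ) + z) ^ (α : ℂ)) s := by
    intro s hs
    have d : DifferentiableOn ℂ (fun z : ℂ => (a : ℂ) + z) s := by fun_prop
    exact (d.cpow_const hs).const_mul _
  refine ⟨φ, (4 * a / c) ^ α, hφ0, hφ1, by positivity, ?_, hhol _ hslit, ?_, ?_, hhol _ hslit2, ?_⟩
  · rintro rfl
    rw [mul_zero, zero_div, Real.zero_rpow hα.ne']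
  · intro z hz
    rw [norm_pow_mul_cpow n (hne z hz), add_comm]
  · intro z hz
    rw [powRange, mem_ofPred_eq, norm_pow_mul_cpow n (hne z hz)]
    rcases le_total ‖(a : ℂ) + z‖ (4 * a / c) with h3 | h3
    · left; gcongr
    · right
      obtain ⟨h4, h5⟩ := (mem_bisector_iff hφ0 hφ1).1 hz
      refine re_pow_mul_cpow_ge hα (hne z hz) ?_ hcη hη1
      rw [hcos] at h4 h5
      rw [div_le_iff₀ hc0] at h3
      have h6 : ‖z - a‖ ≤ ‖(a : ℂ) + z‖ + 2 * a := by
        calc ‖z - a‖ = ‖((a : ℂ) + z) - ((2 * a : ℝ) : ℂ)‖ := by congr 1; push_cast; ring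
          _ ≤ _ := by
            refine (norm_sub_le _ _).trans_eq ?_
            rw [Complex.norm_real, Real.norm_of_nonneg (by positivity)]
      rw [add_comm z] at h5
      simp only [Complex.sub_re, Complex.add_re, Complex.ofReal_re] at h4 h5 ⊢
      rw [abs_le]
      constructor
      · nlinarith [norm_nonneg ((a : ℂ) + z)]
      · nlinarith [norm_nonneg ((a : ℂ) + z), mul_le_mul_of_nonneg_left h6 hc0.le]
  · intro z hz
    rw [norm_pow_mul_cpow n (Complex.slitPlane_ne_zero (hslit2 z hz))]
    rw [Metric.mem_ball, dist_eq_norm] at hz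
    have h3 : ‖(a : ℂ) + z‖ ≤ 3 * a := by
      calc ‖(a : ℂ) + z‖ = ‖(z - a) + ((2 * a : ℝ) : ℂ)‖ := by congr 1; push_cast; ring
        _ ≤ _ := by
          refine (norm_add_le _ _).trans ?_
          rw [Complex.norm_real, Real.norm_of_nonneg (by positivity)]; linarith
    refine Real.rpow_le_rpow (norm_nonneg _) (h3.trans ?_) hα.le
    rw [le_div_iff₀ hc0]; nlinarith

/-! ### Functions of a power -/

/-- A function on `powRange κ G` with quantitative behaviour at scale `σ`. -/
structure IsAdmissible (κ G θ σ C : ℝ) (F : ℂ → ℂ) : Prop where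
  diff : ∀ ζ ∈ powRange κ G, DifferentiableAt ℂ F ζ
  near : ∀ ζ ∈ powRange κ G, ‖ζ‖ ≤ σ → ‖F ζ - F 0‖ ≤ C * (‖ζ‖ / σ) ^ θ
  far : ∀ ζ ∈ powRange κ G, σ ≤ ‖ζ‖ → ‖F ζ‖ ≤ C * (‖ζ‖ / σ) ^ (-θ)
  disc : ∀ ζ, ‖ζ‖ ≤ G → ‖F ζ‖ ≤ C

/-- Since |g(z)| = |z + a|^α, the scale σ becomes σ^(1/α) and the exponent θ becomes αθ, capped at
1. At the right vertex F ∘ g is bounded and holomorphic on a full ball, which gives the Lipschitz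
bound there. -/
theorem IsAdmissible.isTame {φ a α κ G θ σ C d : ℝ} {g F : ℂ → ℂ} (ha : 0 ≤ a) (hα : 0 < α)
    (hθ : 0 < θ) (hσ : 0 < σ) (hC : 0 < C) (hd : a ≠ 0 → d < a) (hg : IsPowerLike φ a α κ G g)
    (hF : IsAdmissible κ G θ σ C F) :
    ∃ p, IsTame φ a d (σ ^ α⁻¹) (min 1 (α * θ)) ((1 + 3 / a) * C) (fun z => F (g z)) p (F 0) := by
  have hle : C ≤ (1 + 3 / a) * C := by
    have : 0 ≤ 3 / a * C := by positivity
    linarith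
  have hs : 0 < σ ^ α⁻¹ := Real.rpow_pos_of_pos hσ _
  have hpow : ∀ x : ℝ, 0 ≤ x → ∀ t : ℝ, (x ^ α / σ) ^ t = (x / σ ^ α⁻¹) ^ (α * t) := by
    intro x hx t
    rw [Real.rpow_mul (by positivity), Real.div_rpow hx hs.le, Real.rpow_inv_rpow hσ.le hα.ne']
  have hiff : ∀ x : ℝ, 0 ≤ x → (x ^ α ≤ σ ↔ x ≤ σ ^ α⁻¹) := fun x hx =>
    (Real.le_rpow_inv_iff_of_pos hx hσ.le hα).symm
  have h0 : ‖F 0‖ ≤ C := hF.disc 0 (by rw [norm_zero]; exact hg.nonneg)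
  set p : ℂ := if a = 0 then F 0 else F (g a) with hp
  have hpC : ‖p‖ ≤ C := by
    rw [hp]
    split_ifs with h
    · exact h0
    · exact hF.disc _ (hg.maps_ball _ (Metric.mem_ball_self (lt_of_le_of_ne ha (Ne.symm h))))
  refine ⟨p, ?_, ?_, ?_, ?_, hpC.trans hle, h0.trans hle⟩
  · exact fun z hz => (hF.diff _ (hg.maps z hz)).comp_differentiableWithinAt z (hg.holo z hz)
  · intro z hz hzs
    have hn := norm_nonneg (z + a)
    have := hF.near _ (hg.maps z hz) (by rw [hg.norm_eq z hz]; exact (hiff _ hn).2 hzs)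
    rw [hg.norm_eq z hz, hpow _ hn] at this
    refine this.trans ?_
    refine mul_le_mul hle ?_ (by positivity) (by positivity)
    have h1 : ‖z + a‖ / σ ^ α⁻¹ ≤ 1 := by rwa [div_le_one hs]
    rcases hn.eq_or_lt with h2 | h2
    · rw [← h2, zero_div, Real.zero_rpow (by positivity)]
      positivity
    · exact Real.rpow_le_rpow_of_exponent_ge (by positivity) h1 (min_le_right _ _)
  · intro z hz hzs
    have hn := norm_nonneg (z + a)
    have h1 : 1 ≤ ‖z + a‖ / σ ^ α⁻¹ := by rwa [one_le_div hs]
    have h2 : σ ≤ ‖z + a‖ ^ α := by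
      have := Real.rpow_le_rpow hs.le hzs hα.le
      rwa [Real.rpow_inv_rpow hσ.le hα.ne'] at this
    have := hF.far _ (hg.maps z hz) (by rwa [hg.norm_eq z hz])
    rw [hg.norm_eq z hz, hpow _ hn, mul_neg] at this
    refine this.trans ?_
    refine mul_le_mul hle ?_ (by positivity) (by positivity)
    exact Real.rpow_le_rpow_of_exponent_le h1 (neg_le_neg (min_le_right _ _))
  · intro h z _ hzd
    have ha' : 0 < a := lt_of_le_of_ne ha (Ne.symm h)
    have hzb : z ∈ Metric.ball (a : ℂ) a := by
      rw [Metric.mem_ball, dist_eq_norm]; exact hzd.trans_lt (hd h)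
    have hdiff : DifferentiableOn ℂ (fun z => F (g z)) (Metric.ball (a : ℂ) a) := fun w hw =>
      (hF.diff _ (Or.inl (hg.maps_ball w hw))).comp_differentiableWithinAt w (hg.holo_ball w hw)
    have hb : ∀ w ∈ Metric.ball (a : ℂ) a, ‖F (g w)‖ ≤ C := fun w hw =>
      hF.disc _ (hg.maps_ball w hw)
    -- A Schwarz estimate on the ball of radius a; the quotient 3/a in the constant comes from here.
    have := Complex.dist_le_div_mul_dist_of_mapsTo_ball (R₂ := 3 * C) hdiff (fun w hw => by
      rw [Metric.mem_closedBall, dist_eq_norm]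
      have := norm_sub_le (F (g w)) (F (g a))
      have := hb w hw
      have := hb a (Metric.mem_ball_self ha')
      linarith) hzb
    rw [dist_eq_norm, dist_eq_norm] at this
    rw [hp, if_neg h]
    refine this.trans ?_
    gcongr
    rw [add_mul, one_mul, div_mul_eq_mul_div]; linarith

/-- The restriction σ ≥ 1 for a ≠ 0 keeps the scale σ^(1/α) above d, as the comparison functions
require. For a = 0 all scales are allowed, which is why no shift is needed in that case. -/
theorem IsPowerLike.exists_hasCalc {𝔸 : Type*} [NormedRing 𝔸] [NormedAlgebra ℂ 𝔸] [CompleteSpace 𝔸]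
    {R : ℂ → 𝔸} {φ φ' a α κ G θ : ℝ} {g : ℂ → ℂ} (hR : IsOuterResolvent R a) (hα : 0 < α)
    (hg : IsPowerLike φ a α κ G g) (h0 : 0 < φ) (h : φ < φ') (h1 : φ' < Real.pi / 2)
    (hθ : 0 < θ) :
    ∃ K : ℝ, 0 < K ∧ ∀ (σ C : ℝ) (F : ℂ → ℂ), 0 < σ → 0 < C → (a ≠ 0 → 1 ≤ σ) →
      IsAdmissible κ G θ σ C F → ∃ T : 𝔸, HasCalc R a φ' (fun z => F (g z)) T ∧ ‖T‖ ≤ K * C := by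
  have ha := hR.nonneg
  obtain ⟨d, hd, hd1, hda⟩ : ∃ d : ℝ, 0 < d ∧ d ≤ 1 ∧ (a ≠ 0 → d < a) := by
    rcases eq_or_ne a 0 with h | h
    · exact ⟨1, one_pos, le_rfl, fun h' => absurd h h'⟩
    · have : 0 < a := lt_of_le_of_ne ha (Ne.symm h)
      exact ⟨min 1 (a / 2), lt_min one_pos (by linarith), min_le_left _ _, fun _ =>
        (min_le_right _ _).trans_lt (by linarith)⟩
  obtain ⟨K, hK, hKb⟩ := _root_.exists_hasCalc hR h0 h h1 (β := min 1 (α * θ))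
    (lt_min one_pos (by positivity)) (min_le_left _ _) hd hd1
  refine ⟨K * (1 + 3 / a), by positivity, fun σ C F hσ hC hσ1 hF => ?_⟩
  obtain ⟨p, hp⟩ := hF.isTame ha hα hθ hσ hC hda hg
  obtain ⟨T, hT, hTn⟩ := hKb _ _ _ _ _ (Real.rpow_pos_of_pos hσ _) (fun h' => hd1.trans
    (Real.one_le_rpow (hσ1 h') (by positivity))) hp
  exact ⟨T, hT, by rwa [mul_assoc]⟩

/-! ### Exponentials and resolvents of a power -/

section Scalar
variable {κ G δ θ σ C : ℝ} {w ζ μ : ℂ}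

/-- Arguments add. The imaginary parts are bounded by the sines of the angles, and the claim is the
addition formula for the cosine. -/
theorem re_mul_ge_of_cone (hκ : 0 ≤ κ) (hκ1 : κ ≤ Real.pi / 2) (hδ : 0 ≤ δ) (hδ1 : δ ≤ Real.pi / 2)
    (hw : Real.cos δ * ‖w‖ ≤ w.re) (hζ : Real.cos κ * ‖ζ‖ ≤ ζ.re) :
    Real.cos (κ + δ) * (‖w‖ * ‖ζ‖) ≤ (w * ζ).re := by
  have im_le : ∀ (x : ℝ) (z : ℂ), 0 ≤ x → x ≤ Real.pi / 2 → Real.cos x * ‖z‖ ≤ z.re →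
      |z.im| ≤ Real.sin x * ‖z‖ := by
    intro x z h0 h1 h
    have hc := Real.cos_nonneg_of_neg_pi_div_two_le_of_le (by linarith) h1
    have hs := Real.sin_nonneg_of_nonneg_of_le_pi h0 (by linarith [Real.pi_pos])
    have h2 : (Real.cos x * ‖z‖) ^ 2 ≤ z.re ^ 2 := by gcongr
    have h3 : ‖z‖ ^ 2 = z.re ^ 2 + z.im ^ 2 := by
      rw [← Complex.normSq_eq_norm_sq, Complex.normSq_apply]; ring
    refine abs_le_of_sq_le_sq ?_ (by positivity)
    have h4 := Real.sin_sq_add_cos_sq x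
    rw [mul_pow] at h2 ⊢
    rw [← eq_sub_iff_add_eq] at h4
    rw [h4]
    linarith
  have h1 := im_le κ ζ hκ hκ1 hζ
  have h2 := im_le δ w hδ hδ1 hw
  have hcκ := Real.cos_nonneg_of_neg_pi_div_two_le_of_le (by linarith) hκ1
  have hcδ := Real.cos_nonneg_of_neg_pi_div_two_le_of_le (by linarith) hδ1
  have h3 : (Real.cos δ * ‖w‖) * (Real.cos κ * ‖ζ‖) ≤ w.re * ζ.re :=
    mul_le_mul hw hζ (by positivity) ((by positivity : 0 ≤ Real.cos δ * ‖w‖).trans hw)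
  have h4 : w.im * ζ.im ≤ (Real.sin δ * ‖w‖) * (Real.sin κ * ‖ζ‖) := by
    refine (le_abs_self _).trans ?_
    rw [abs_mul]
    exact mul_le_mul h2 h1 (abs_nonneg _) ((abs_nonneg _).trans h2)
  rw [Complex.mul_re, Real.cos_add]
  linarith

theorem neg_mul_le_re_mul (hκ : 0 ≤ κ) (hδ : 0 ≤ δ) (hκδ : κ + δ ≤ Real.pi / 2)
    (hw : Real.cos δ * ‖w‖ ≤ w.re) (hG : 0 ≤ G) (hζ : ζ ∈ powRange κ G) :
    -(G * ‖w‖) ≤ (w * ζ).re := by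
  rcases hζ with hζ | hζ
  · have := (abs_le.1 (Complex.abs_re_le_norm (w * ζ))).1
    rw [norm_mul] at this
    have h2 : ‖w‖ * ‖ζ‖ ≤ ‖w‖ * G := by gcongr
    linarith
  · have h1 := re_mul_ge_of_cone hκ (by linarith) hδ (by linarith) hw hζ
    have hc := Real.cos_nonneg_of_neg_pi_div_two_le_of_le (by linarith [Real.pi_pos]) hκδ
    have : 0 ≤ Real.cos (κ + δ) * (‖w‖ * ‖ζ‖) := by positivity
    have : 0 ≤ G * ‖w‖ := by positivity
    linarith

/-- For ‖x‖ ≤ 1 the linear estimate is stronger than the power θ; beyond that the exponential is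
merely bounded and ‖x‖^θ ≥ 1. -/
theorem norm_exp_neg_sub_one_le {x : ℂ} {M : ℝ} (hθ : 0 ≤ θ) (hθ1 : θ ≤ 1) (hx : -M ≤ x.re) :
    ‖Complex.exp (-x) - 1‖ ≤ (2 + Real.exp M) * ‖x‖ ^ θ := by
  have hM := Real.exp_pos M
  rcases le_total ‖x‖ 1 with h | h
  · have h1 := Complex.norm_exp_sub_one_le (x := -x) (by rwa [norm_neg])
    rw [norm_neg] at h1
    rcases (norm_nonneg x).eq_or_lt with h2 | h2
    · rw [← h2, mul_zero] at h1
      exact h1.trans (by positivity)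
    · have h3 := Real.rpow_le_rpow_of_exponent_ge h2 h hθ1
      rw [Real.rpow_one] at h3
      have : 0 ≤ Real.exp M * ‖x‖ ^ θ := by positivity
      linarith
  · have h1 : ‖Complex.exp (-x)‖ ≤ Real.exp M := by
      rw [Complex.norm_exp, Complex.neg_re]
      exact Real.exp_le_exp.2 (by linarith)
    have h2 := norm_sub_le (Complex.exp (-x)) 1
    rw [norm_one] at h2
    have h3 := Real.one_le_rpow h hθ
    nlinarith

/-- Only the sector has to be considered far out, because the disc is bounded. -/
theorem IsAdmissible.of_sector {F : ℂ → ℂ} {D : ℝ} (hθ1 : θ ≤ 1) (hσ : 0 < σ)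
    (hD : 0 ≤ D) (hG : G ≤ D * σ) (hC : 0 ≤ C)
    (diff : ∀ ζ ∈ powRange κ G, DifferentiableAt ℂ F ζ)
    (near : ∀ ζ ∈ powRange κ G, ‖ζ‖ ≤ σ → ‖F ζ - F 0‖ ≤ C * (‖ζ‖ / σ) ^ θ)
    (far : ∀ ζ, Real.cos κ * ‖ζ‖ ≤ ζ.re → σ ≤ ‖ζ‖ → ‖F ζ‖ ≤ C * (‖ζ‖ / σ) ^ (-θ))
    (disc : ∀ ζ, ‖ζ‖ ≤ G → ‖F ζ‖ ≤ C) : IsAdmissible κ G θ σ ((1 + D) * C) F := by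
  have hle : C ≤ (1 + D) * C := by nlinarith
  refine ⟨diff, fun ζ hζ h => (near ζ hζ h).trans (by gcongr), fun ζ hζ h => ?_,
    fun ζ h => (disc ζ h).trans hle⟩
  rcases hζ with hζ | hζ
  · have h1 : 1 ≤ ‖ζ‖ / σ := by rwa [one_le_div hσ]
    have h2 : ‖ζ‖ / σ ≤ D := by rw [div_le_iff₀ hσ]; exact hζ.trans hG
    -- Inside the disc ‖ζ‖/σ is at most D, so the required decay costs only the factor 1 + D.
    have h3 : (‖ζ‖ / σ) ^ θ ≤ 1 + D := by
      have := Real.rpow_le_rpow_of_exponent_le h1 hθ1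
      rw [Real.rpow_one] at this
      linarith
    have h4 : 0 < (‖ζ‖ / σ) ^ θ := Real.rpow_pos_of_pos (by linarith) _
    rw [Real.rpow_neg (by linarith)]
    refine (disc ζ hζ).trans ?_
    rw [← div_eq_mul_inv, le_div_iff₀ h4]
    nlinarith
  · exact (far ζ hζ h).trans (by gcongr)

theorem mul_exp_neg_le {x b : ℝ} (k : ℕ) (hx : 0 ≤ x) (hb : 0 < b) :
    x ^ k * Real.exp (-(b * x)) ≤ k.factorial / b ^ k := by
  have h := Real.pow_div_factorial_le_exp (b * x) (by positivity) k
  rw [Real.exp_neg, ← div_eq_mul_inv, div_le_div_iff₀ (Real.exp_pos _) (by positivity)]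
  rw [div_le_iff₀ (by positivity), mul_pow] at h
  linarith

theorem norm_exp_neg_mul_le (hκ : 0 ≤ κ) (hδ : 0 ≤ δ) (hκδ : κ + δ < Real.pi / 2)
    (hw : Real.cos δ * ‖w‖ ≤ w.re) (hζ : Real.cos κ * ‖ζ‖ ≤ ζ.re) :
    ‖Complex.exp (-(w * ζ))‖ ≤ Real.exp (-(Real.cos (κ + δ) * ‖w‖ * ‖ζ‖)) := by
  rw [Complex.norm_exp, Complex.neg_re]
  have := re_mul_ge_of_cone hκ (by linarith) hδ (by linarith) hw hζ
  exact Real.exp_le_exp.2 (by linarith)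

theorem norm_exp_neg_mul_le' (hκ : 0 ≤ κ) (hδ : 0 ≤ δ) (hκδ : κ + δ < Real.pi / 2)
    (hw : Real.cos δ * ‖w‖ ≤ w.re) (hG : 0 ≤ G) (hζ : ζ ∈ powRange κ G) :
    ‖Complex.exp (-(w * ζ))‖ ≤ Real.exp (G * ‖w‖) := by
  rw [Complex.norm_exp, Complex.neg_re]
  have := neg_mul_le_re_mul hκ hδ hκδ.le hw hG hζ
  exact Real.exp_le_exp.2 (by linarith)

/-- The natural scale of exp(-wζ) is 1/|w|. It is replaced by 1 when |w| > 1, since smaller scales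
are not admitted for a ≠ 0; the price is the factor 1 + |w|, and the disc costs exp(G|w|). Both are
harmless for exponential boundedness. -/
theorem isAdmissible_exp (hκ : 0 ≤ κ) (hδ : 0 ≤ δ) (hκδ : κ + δ < Real.pi / 2) (hG : 0 ≤ G)
    (hw0 : w ≠ 0) (hw : Real.cos δ * ‖w‖ ≤ w.re) :
    IsAdmissible κ G 1 (max 1 ‖w‖⁻¹)
      ((1 + G) * ((3 + 1 / Real.cos (κ + δ)) * (1 + ‖w‖) * Real.exp (G * ‖w‖)))
      (fun ζ => Complex.exp (-(w * ζ))) := by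
  have hn : 0 < ‖w‖ := norm_pos_iff.2 hw0
  have hc : 0 < Real.cos (κ + δ) := Real.cos_pos_of_mem_Ioo ⟨by linarith [Real.pi_pos], hκδ⟩
  set c := Real.cos (κ + δ) with hcdef
  have hE : 1 ≤ Real.exp (G * ‖w‖) := Real.one_le_exp (by positivity)
  set E := Real.exp (G * ‖w‖) with hEdef
  set σ := max 1 ‖w‖⁻¹ with hσdef
  have hσ1 : 1 ≤ σ := le_max_left _ _
  have hσ : 0 < σ := by linarith
  have hσw : 1 ≤ σ * ‖w‖ := by
    have : ‖w‖⁻¹ ≤ σ := le_max_right _ _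
    rwa [inv_le_iff_one_le_mul₀ hn] at this
  have hσw2 : σ * ‖w‖ ≤ 1 + ‖w‖ := by
    rw [hσdef, max_mul_of_nonneg _ _ hn.le, inv_mul_cancel₀ hn.ne']
    exact max_le (by linarith) (by linarith)
  have hp : 0 < 1 / c := by positivity
  refine IsAdmissible.of_sector le_rfl hσ hG (by nlinarith) (by positivity) ?_ ?_ ?_ ?_
  · intro ζ _; fun_prop
  · intro ζ hζ _
    have := norm_exp_neg_sub_one_le (θ := 1) zero_le_one le_rfl
      (neg_mul_le_re_mul hκ hδ hκδ.le hw hG hζ)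
    rw [Real.rpow_one, norm_mul] at this
    simp only [mul_zero, neg_zero, Complex.exp_zero, Real.rpow_one]
    refine this.trans ?_
    rw [mul_div_assoc', le_div_iff₀ hσ]
    calc (2 + E) * (‖w‖ * ‖ζ‖) * σ = (2 + E) * (σ * ‖w‖) * ‖ζ‖ := by ring
      _ ≤ ((3 + 1 / c) * E) * (1 + ‖w‖) * ‖ζ‖ := by
          gcongr
          nlinarith
      _ = _ := by ring
  · intro ζ hζ hζσ
    refine (norm_exp_neg_mul_le hκ hδ hκδ hw hζ).trans ?_
    have hζ0 : 0 < ‖ζ‖ := hσ.trans_le hζσ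
    have h1 := mul_exp_neg_le (x := ‖ζ‖) (b := c * ‖w‖) 1 hζ0.le (by positivity)
    rw [Real.rpow_neg_one, inv_div, ← hcdef]
    rw [pow_one, pow_one, Nat.factorial_one, Nat.cast_one, mul_comm, ← le_div_iff₀ hζ0] at h1
    refine h1.trans ?_
    rw [mul_div_assoc']
    gcongr
    rw [div_le_iff₀ (by positivity)]
    have h2 : (1 / c) * c = 1 := by field_simp
    have h3 : 1 ≤ (3 + 1 / c) * c := by nlinarith
    calc (1 : ℝ) ≤ ((3 + 1 / c) * c) * (σ * ‖w‖) := one_le_mul_of_one_le_of_one_le h3 hσw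
      _ ≤ ((3 + 1 / c) * c) * (σ * ‖w‖) * ((1 + ‖w‖) * E) :=
          le_mul_of_one_le_right (by positivity)
            (one_le_mul_of_one_le_of_one_le (by linarith) hE)
      _ = _ := by ring
  · intro ζ hζ
    refine (norm_exp_neg_mul_le' hκ hδ hκδ hw hG (Or.inl hζ)).trans ?_
    exact le_mul_of_one_le_left (by positivity)
      (one_le_mul_of_one_le_of_one_le (by linarith) (by linarith))

theorem isAdmissible_mul_exp (hκ : 0 ≤ κ) (hδ : 0 ≤ δ) (hκδ : κ + δ < Real.pi / 2) (hG : 0 ≤ G)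
    (hw0 : w ≠ 0) (hw : Real.cos δ * ‖w‖ ≤ w.re) :
    ∃ C, 0 < C ∧ IsAdmissible κ G 1 1 C (fun ζ => ζ * Complex.exp (-(w * ζ))) := by
  have hn : 0 < ‖w‖ := norm_pos_iff.2 hw0
  have hc : 0 < Real.cos (κ + δ) := Real.cos_pos_of_mem_Ioo ⟨by linarith [Real.pi_pos], hκδ⟩
  have hb : 0 < Real.cos (κ + δ) * ‖w‖ := by positivity
  set b := Real.cos (κ + δ) * ‖w‖ with hbdef
  have hE := Real.exp_pos (G * ‖w‖)
  set E := Real.exp (G * ‖w‖) with hEdef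
  have hp : 0 < 2 / b ^ 2 := by positivity
  refine ⟨(1 + G) * ((1 + G) * E + 2 / b ^ 2), by positivity,
    IsAdmissible.of_sector le_rfl one_pos hG (by linarith) (by positivity) ?_ ?_ ?_ ?_⟩
  · intro ζ _; fun_prop
  · intro ζ hζ _
    simp only [zero_mul, sub_zero, Real.rpow_one, div_one, norm_mul]
    rw [mul_comm]
    gcongr
    have := norm_exp_neg_mul_le' hκ hδ hκδ hw hG hζ
    nlinarith
  · intro ζ hζ hζ1
    have h0 : 0 < ‖ζ‖ := by linarith
    rw [div_one, Real.rpow_neg_one, norm_mul, ← div_eq_mul_inv, le_div_iff₀ h0]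
    have h1 := mul_exp_neg_le 2 h0.le hb
    rw [show ((2 : ℕ).factorial : ℝ) = 2 by norm_num] at h1
    have h2 := norm_exp_neg_mul_le hκ hδ hκδ hw hζ
    calc _ ≤ ‖ζ‖ * Real.exp (-(b * ‖ζ‖)) * ‖ζ‖ := by gcongr
      _ = ‖ζ‖ ^ 2 * Real.exp (-(b * ‖ζ‖)) := by ring
      _ ≤ _ := by
        have : 0 ≤ (1 + G) * E := by positivity
        linarith
  · intro ζ hζ
    rw [norm_mul]
    have h2 := norm_exp_neg_mul_le' hκ hδ hκδ hw hG (Or.inl hζ)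
    calc _ ≤ G * E := by gcongr
      _ ≤ _ := by nlinarith

theorem norm_exp_neg_sub_le (x : ℂ) : ‖Complex.exp (-x) - 1 + x‖ ≤ ‖x‖ ^ 2 * Real.exp ‖x‖ := by
  have := Complex.norm_exp_sub_sum_le_norm_mul_exp (-x) 2
  simp only [Finset.sum_range_succ, Finset.sum_range_zero, norm_neg] at this
  convert this using 2
  simp
  ring

/-- The second-order Taylor remainder of w ↦ exp(-wζ). Half of the decay rate b of exp(-wζ) pays for
exp(|kζ|), whence the restriction |k| ≤ b/2; the other half absorbs the powers of ζ. -/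
theorem isAdmissible_exp_remainder (hκ : 0 ≤ κ) (hδ : 0 ≤ δ) (hκδ : κ + δ < Real.pi / 2)
    (hG : 0 ≤ G) (hw0 : w ≠ 0) (hw : Real.cos δ * ‖w‖ ≤ w.re) :
    ∃ C r, 0 < C ∧ 0 < r ∧ ∀ k : ℂ, k ≠ 0 → ‖k‖ ≤ r → IsAdmissible κ G 1 1 (C * ‖k‖ ^ 2)
      (fun ζ => Complex.exp (-(w * ζ)) * (Complex.exp (-(k * ζ)) - 1 + k * ζ)) := by
  have hn : 0 < ‖w‖ := norm_pos_iff.2 hw0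
  have hc : 0 < Real.cos (κ + δ) := Real.cos_pos_of_mem_Ioo ⟨by linarith [Real.pi_pos], hκδ⟩
  have hb : 0 < Real.cos (κ + δ) * ‖w‖ := by positivity
  set b := Real.cos (κ + δ) * ‖w‖ with hbdef
  have hE := Real.exp_pos (G * ‖w‖)
  set E := Real.exp (G * ‖w‖) with hEdef
  have hE2 := Real.exp_pos (b / 2 * (1 + G))
  set E' := Real.exp (b / 2 * (1 + G)) with hEdef'
  have hp : 0 < 6 / (b / 2) ^ 3 := by positivity
  have key : ∀ k ζ : ℂ, ‖k‖ ≤ b / 2 → ζ ∈ powRange κ G → ‖ζ‖ ≤ 1 + G →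
      ‖Complex.exp (-(w * ζ)) * (Complex.exp (-(k * ζ)) - 1 + k * ζ)‖ ≤
        E * E' * ‖k‖ ^ 2 * ‖ζ‖ ^ 2 := by
    intro k ζ hk hζ h1
    have h2 := norm_exp_neg_mul_le' hκ hδ hκδ hw hG hζ
    have h3 := norm_exp_neg_sub_le (k * ζ)
    have h4 : Real.exp ‖k * ζ‖ ≤ E' := by
      rw [norm_mul]; exact Real.exp_le_exp.2 (by gcongr)
    rw [norm_mul]
    calc _ ≤ E * (‖k * ζ‖ ^ 2 * E') := by gcongr; exact h3.trans (by gcongr)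
      _ = _ := by rw [norm_mul]; ring
  refine ⟨(1 + G) * (E * E' * (1 + G) ^ 2 + 6 / (b / 2) ^ 3), b / 2, by positivity,
    by positivity, fun k hk0 hk => ?_⟩
  rw [mul_assoc]
  refine IsAdmissible.of_sector le_rfl one_pos hG (by linarith) (by positivity)
    ?_ ?_ ?_ ?_
  · intro ζ _; fun_prop
  · intro ζ hζ h1
    simp only [mul_zero, neg_zero, Complex.exp_zero, sub_self, add_zero, sub_zero, Real.rpow_one,
      div_one]
    refine (key k ζ hk hζ (by linarith)).trans ?_
    calc E * E' * ‖k‖ ^ 2 * ‖ζ‖ ^ 2 ≤ E * E' * ‖k‖ ^ 2 * ‖ζ‖ := by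
          gcongr
          have := norm_nonneg ζ
          nlinarith
      _ = (E * E' * 1 + 0) * ‖k‖ ^ 2 * ‖ζ‖ := by ring
      _ ≤ _ := by
        gcongr
        exact one_le_pow₀ (by linarith)
  · intro ζ hζ hζ1
    have h0 : 0 < ‖ζ‖ := by linarith
    rw [div_one, Real.rpow_neg_one, ← div_eq_mul_inv, le_div_iff₀ h0]
    -- Two powers of ‖ζ‖ come from the Taylor remainder, and the third provides the decay demanded
    -- at infinity.
    have h1 := mul_exp_neg_le 3 h0.le (half_pos hb)
    rw [show ((3 : ℕ).factorial : ℝ) = 6 by norm_num [Nat.factorial]] at h1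
    have h2 := norm_exp_neg_mul_le hκ hδ hκδ hw hζ
    rw [← hbdef] at h2
    have h3 := norm_exp_neg_sub_le (k * ζ)
    have h4 : Real.exp ‖k * ζ‖ ≤ Real.exp (b / 2 * ‖ζ‖) := by
      rw [norm_mul]; exact Real.exp_le_exp.2 (by gcongr)
    rw [norm_mul]
    calc _ ≤ Real.exp (-(b * ‖ζ‖)) * (‖k * ζ‖ ^ 2 * Real.exp (b / 2 * ‖ζ‖)) * ‖ζ‖ := by
          gcongr; exact h3.trans (by gcongr)
      _ = (Real.exp (-(b * ‖ζ‖)) * Real.exp (b / 2 * ‖ζ‖)) * ‖ζ‖ ^ 3 * ‖k‖ ^ 2 := by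
          rw [norm_mul]; ring
      _ = (‖ζ‖ ^ 3 * Real.exp (-(b / 2 * ‖ζ‖))) * ‖k‖ ^ 2 := by
          rw [← Real.exp_add]; ring_nf
      _ ≤ _ := by
        gcongr
        have : 0 ≤ E * E' * (1 + G) ^ 2 := by positivity
        linarith
  · intro ζ hζ
    refine (key k ζ hk (Or.inl hζ) (by linarith)).trans ?_
    calc _ ≤ E * E' * ‖k‖ ^ 2 * (1 + G) ^ 2 := by gcongr; linarith
      _ = (E * E' * (1 + G) ^ 2 + 0) * ‖k‖ ^ 2 := by ring
      _ ≤ _ := by gcongr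

/-- On the sector, ζ and -μ lie in separated cones. On the disc |ζ| ≤ |μ|/2, so that |μ + ζ| ≥ |μ|/2
≥ (|μ| + |ζ|)/3. The maximum with 0 serves `cone_separation`, which needs a nonnegative outer slope.
-/
theorem exists_le_norm_add (hκ : 0 ≤ κ) (hκ1 : κ < Real.pi / 2) (hθ : κ < θ) (hθ1 : θ ≤ Real.pi) :
    ∃ c : ℝ, 0 < c ∧ ∀ (G : ℝ) (μ ζ : ℂ), -(Real.cos θ * ‖μ‖) ≤ μ.re → 2 * G ≤ ‖μ‖ →
      ζ ∈ powRange κ G → c * (‖μ‖ + ‖ζ‖) ≤ ‖μ + ζ‖ := by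
  have h1 : Real.cos θ < Real.cos κ := Real.cos_lt_cos_of_nonneg_of_le_pi hκ hθ1 hθ
  have h2 : 0 < Real.cos κ := Real.cos_pos_of_mem_Ioo ⟨by linarith [Real.pi_pos], hκ1⟩
  have h3 : max (Real.cos θ) 0 < Real.cos κ := max_lt h1 h2
  refine ⟨min (1 / 3) ((Real.cos κ - max (Real.cos θ) 0) / 4),
    lt_min (by norm_num) (by linarith), fun G μ ζ hμ hμG hζ => ?_⟩
  have hs : 0 ≤ ‖μ‖ + ‖ζ‖ := by positivity
  rcases hζ with hζ | hζ
  · refine (mul_le_mul_of_nonneg_right (min_le_left _ _) hs).trans ?_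
    have := norm_sub_le (μ + ζ) ζ
    rw [add_sub_cancel_right] at this
    linarith
  · refine (mul_le_mul_of_nonneg_right (min_le_right _ _) hs).trans ?_
    have := cone_separation (w := ζ) (x := -μ) (κ₁ := Real.cos κ) (κ₂ := max (Real.cos θ) 0)
      (le_max_right _ _) (Real.cos_le_one _) h3.le hζ (by
        rw [Complex.neg_re, norm_neg]
        have := mul_le_mul_of_nonneg_right (le_max_left (Real.cos θ) 0) (norm_nonneg μ)
        linarith)
    rwa [norm_neg, sub_neg_eq_add, add_comm ‖ζ‖, add_comm ζ] at this

theorem add_ne_zero_of_le {c : ℝ} (hc : 0 < c) (hμ0 : μ ≠ 0)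
    (h : c * (‖μ‖ + ‖ζ‖) ≤ ‖μ + ζ‖) : μ + ζ ≠ 0 := by
  have := norm_pos_iff.2 hμ0
  rw [← norm_pos_iff]
  exact lt_of_lt_of_le (by positivity) h

/-- At the scale |μ| the constant does not depend on μ; this is the scalar form of the sectorial
resolvent estimate. -/
theorem isAdmissible_resolvent {c : ℝ} (hc : 0 < c) (hμ0 : μ ≠ 0)
    (h : ∀ ζ ∈ powRange κ G, c * (‖μ‖ + ‖ζ‖) ≤ ‖μ + ζ‖) :
    IsAdmissible κ G 1 ‖μ‖ (1 / c) (fun ζ => μ / (μ + ζ)) := by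
  have hn : 0 < ‖μ‖ := norm_pos_iff.2 hμ0
  have hne : ∀ ζ ∈ powRange κ G, μ + ζ ≠ 0 := fun ζ hζ => add_ne_zero_of_le hc hμ0 (h ζ hζ)
  refine ⟨fun ζ hζ => ?_, fun ζ hζ _ => ?_, fun ζ hζ hζ1 => ?_, fun ζ hζ => ?_⟩
  · exact (differentiableAt_const _).div (by fun_prop) (hne ζ hζ)
  · have h1 := hne ζ hζ
    have e : μ / (μ + ζ) - μ / (μ + 0) = -(ζ / (μ + ζ)) := by
      rw [add_zero, div_self hμ0]; field_simp; ring
    rw [e, norm_neg, norm_div, Real.rpow_one, div_le_iff₀ (norm_pos_iff.2 h1)]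
    calc ‖ζ‖ = 1 / c * (‖ζ‖ / ‖μ‖) * (c * ‖μ‖) := by field_simp
      _ ≤ _ := by
        gcongr
        refine le_trans ?_ (h ζ hζ)
        gcongr
        linarith [norm_nonneg ζ]
  · have h1 := hne ζ hζ
    have h2 : 0 < ‖ζ‖ := hn.trans_le hζ1
    rw [norm_div, Real.rpow_neg_one, inv_div, div_le_iff₀ (norm_pos_iff.2 h1)]
    calc ‖μ‖ = 1 / c * (‖μ‖ / ‖ζ‖) * (c * ‖ζ‖) := by field_simp
      _ ≤ _ := by
        gcongr
        refine le_trans ?_ (h ζ hζ)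
        gcongr
        linarith
  · have h1 := hne ζ (Or.inl hζ)
    rw [norm_div, div_le_iff₀ (norm_pos_iff.2 h1)]
    calc ‖μ‖ = 1 / c * (c * ‖μ‖) := by field_simp
      _ ≤ _ := by
        gcongr
        refine le_trans ?_ (h ζ (Or.inl hζ))
        gcongr
        linarith [norm_nonneg ζ]

/-- Half of the decay of (μ + ζ)⁻¹ is traded for a factor t^(1/2). This gives T(t) L → L in norm for
the resolvent L, without density of the domain. -/
theorem isAdmissible_exp_sub_one_div {c : ℝ} (hκ : 0 ≤ κ) (hκ1 : κ < Real.pi / 2) (hc : 0 < c)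
    (hG : 0 ≤ G) (hμ0 : μ ≠ 0) (h : ∀ ζ ∈ powRange κ G, c * (‖μ‖ + ‖ζ‖) ≤ ‖μ + ζ‖) :
    ∃ C, 0 < C ∧ ∀ t : ℝ, 0 < t → t ≤ 1 → IsAdmissible κ G (1 / 2) 1 (C * t ^ (1 / 2 : ℝ))
      (fun ζ => (Complex.exp (-(t * ζ)) - 1) / (μ + ζ)) := by
  have hn : 0 < ‖μ‖ := norm_pos_iff.2 hμ0
  have hne : ∀ ζ ∈ powRange κ G, μ + ζ ≠ 0 := fun ζ hζ => add_ne_zero_of_le hc hμ0 (h ζ hζ)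
  set E := 2 + Real.exp G with hE
  have hE0 : 0 < E := by positivity
  have hp : 0 < 1 / (c * ‖μ‖) := by positivity
  have hp2 : 0 < 1 / c := by positivity
  have hGp : 0 ≤ G ^ (1 / 2 : ℝ) := by positivity
  have key : ∀ (t : ℝ) (ζ : ℂ), 0 < t → t ≤ 1 → ζ ∈ powRange κ G →
      ‖Complex.exp (-(t * ζ)) - 1‖ ≤ E * (t ^ (1 / 2 : ℝ) * ‖ζ‖ ^ (1 / 2 : ℝ)) := by
    intro t ζ ht ht1 hζ
    have h1 := neg_mul_le_re_mul (w := (t : ℂ)) hκ le_rfl (by linarith) (by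
      rw [Real.cos_zero, one_mul, Complex.norm_real, Real.norm_of_nonneg ht.le,
        Complex.ofReal_re]) hG hζ
    rw [Complex.norm_real, Real.norm_of_nonneg ht.le] at h1
    have h2 := norm_exp_neg_sub_one_le (x := t * ζ) (M := G) (θ := 1 / 2) (by norm_num)
      (by norm_num) (by nlinarith)
    rwa [norm_mul, Complex.norm_real, Real.norm_of_nonneg ht.le,
      Real.mul_rpow ht.le (norm_nonneg _)] at h2
  refine ⟨(1 + G) * (E * ((1 + G ^ (1 / 2 : ℝ)) * (1 / (c * ‖μ‖)) + 1 / c)), by positivity,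
    fun t ht ht1 => ?_⟩
  have htp : 0 < t ^ (1 / 2 : ℝ) := Real.rpow_pos_of_pos ht _
  have near : ∀ ζ ∈ powRange κ G, ‖(Complex.exp (-(t * ζ)) - 1) / (μ + ζ)‖ ≤
      E * (t ^ (1 / 2 : ℝ) * ‖ζ‖ ^ (1 / 2 : ℝ)) * (1 / (c * ‖μ‖)) := by
    intro ζ hζ
    rw [norm_div, div_eq_mul_one_div]
    have h1 := key t ζ ht ht1 hζ
    gcongr
    refine le_trans ?_ (h ζ hζ)
    gcongr
    linarith [norm_nonneg ζ]
  rw [mul_assoc]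
  refine IsAdmissible.of_sector (by norm_num) one_pos hG (by linarith)
    (by positivity) ?_ ?_ ?_ ?_
  · intro ζ hζ
    exact DifferentiableAt.div (by fun_prop) (by fun_prop) (hne ζ hζ)
  · intro ζ hζ _
    simp only [mul_zero, neg_zero, Complex.exp_zero, sub_self, zero_div, sub_zero, div_one]
    refine (near ζ hζ).trans ?_
    calc _ = E * ((1 + 0) * (1 / (c * ‖μ‖)) + 0) * t ^ (1 / 2 : ℝ) * ‖ζ‖ ^ (1 / 2 : ℝ) := by ring
      _ ≤ _ := by gcongr
  · intro ζ hζ hζ1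
    have h0 : 0 < ‖ζ‖ := by linarith
    have h1 := key t ζ ht ht1 (Or.inr hζ)
    rw [div_one, norm_div]
    calc _ ≤ E * (t ^ (1 / 2 : ℝ) * ‖ζ‖ ^ (1 / 2 : ℝ)) / (c * ‖ζ‖) := by
          gcongr
          refine le_trans ?_ (h ζ (Or.inr hζ))
          gcongr
          linarith
      _ = E * (0 + 1 / c) * t ^ (1 / 2 : ℝ) * ‖ζ‖ ^ (-(1 / 2) : ℝ) := by
          have e : ‖ζ‖ ^ (-(1 / 2) : ℝ) = ‖ζ‖ ^ (1 / 2 : ℝ) / ‖ζ‖ := by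
            rw [← Real.rpow_sub_one h0.ne']; norm_num
          rw [e]; field_simp; ring
      _ ≤ _ := by gcongr; positivity
  · intro ζ hζ
    refine (near ζ (Or.inl hζ)).trans ?_
    calc _ ≤ E * (t ^ (1 / 2 : ℝ) * G ^ (1 / 2 : ℝ)) * (1 / (c * ‖μ‖)) := by gcongr
      _ = E * ((0 + G ^ (1 / 2 : ℝ)) * (1 / (c * ‖μ‖)) + 0) * t ^ (1 / 2 : ℝ) := by ring
      _ ≤ _ := by gcongr; norm_num

end Scalar

/-! ### Operators and their resolvents -/

section Operators
variable {X : Type*} [NormedAddCommGroup X] [NormedSpace ℂ X] {A : X →ₗ.[ℂ] X} {μ : ℂ}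
  {L : X →L[ℂ] X}

theorem HasResolventAt.mem_graph_iff (h : HasResolventAt A μ L) (x y : X) :
    (x, y) ∈ A.graph ↔ L (μ • x - y) = x := by
  rw [LinearPMap.mem_graph_iff]
  constructor
  · rintro ⟨u, hu, hy⟩
    simp only at hu hy
    rw [← hy, ← hu, h.1 u]
  · intro hxy
    obtain ⟨u, hu, hu2⟩ := h.2 (μ • x - y)
    rw [hxy] at hu
    refine ⟨u, hu, ?_⟩
    rw [hu, sub_right_inj] at hu2
    exact hu2

theorem HasResolventAt.isClosed (h : HasResolventAt A μ L) : A.IsClosed := by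
  have e : (A.graph : Set (X × X)) = {p | L (μ • p.1 - p.2) = p.1} := by
    ext ⟨x, y⟩
    exact h.mem_graph_iff x y
  rw [LinearPMap.IsClosed, e]
  exact isClosed_eq (by fun_prop) (by fun_prop)

theorem HasResolventAt.vadd {ν : ℂ} (h : HasResolventAt A (μ - ν) L) :
    HasResolventAt ((ν • (LinearMap.id : X →ₗ[ℂ] X)) +ᵥ A) μ L := by
  refine ⟨fun x => ?_, fun y => ?_⟩
  · refine Eq.trans ?_ (h.1 x)
    congr 1
    rw [LinearPMap.vadd_apply, LinearMap.smul_apply, LinearMap.id_apply, sub_smul, sub_sub]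
  · obtain ⟨x, hx, hxy⟩ := h.2 y
    refine ⟨x, hx, ?_⟩
    rw [← hxy, LinearPMap.vadd_apply, LinearMap.smul_apply, LinearMap.id_apply, sub_smul, sub_sub]

theorem exists_linearPMap_graph {T S : X →L[ℂ] X} (hT : Function.Injective T) :
    ∃ B : X →ₗ.[ℂ] X, ∀ x y : X, (x, y) ∈ B.graph ↔ T y = S x := by
  set Γ : Submodule ℂ (X × X) :=
    LinearMap.ker (T.toLinearMap.comp (LinearMap.snd ℂ X X) -
      S.toLinearMap.comp (LinearMap.fst ℂ X X)) with hΓ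
  have hmem : ∀ x y : X, (x, y) ∈ Γ ↔ T y = S x := by
    intro x y
    rw [hΓ, LinearMap.mem_ker]
    simp [sub_eq_zero]
  refine ⟨Γ.toLinearPMap, fun x y => ?_⟩
  rw [Submodule.toLinearPMap_graph_eq]
  · exact hmem x y
  · rintro ⟨x, y⟩ hxy hx
    simp only at hx
    subst hx
    rw [hmem, map_zero] at hxy
    exact hT (by rw [hxy, map_zero])

/-- B is T⁻¹S. An operator L that commutes with T and S and satisfies L(νT - cS) = T inverts ν - cB,
because T can be cancelled by injectivity. -/
theorem hasResolventAt_smul_of_regularizer {B : X →ₗ.[ℂ] X} {T S : X →L[ℂ] X} {c ν : ℂ}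
    (hT : Function.Injective T) (hB : ∀ x y : X, (x, y) ∈ B.graph ↔ T y = S x) (hc : c ≠ 0)
    (h1 : L * (ν • T - c • S) = T) (h2 : T * L = L * T) (h3 : S * L = L * S) :
    HasResolventAt (c • B) ν L := by
  have e : ∀ x : B.domain, (c • B) x = c • B x := fun x => LinearPMap.smul_apply c B x
  have a1 : ∀ x, L (ν • T x - c • S x) = T x := fun x => DFunLike.congr_fun h1 x
  have a2 : ∀ x, T (L x) = L (T x) := fun x => DFunLike.congr_fun h2 x
  have a3 : ∀ x, S (L x) = L (S x) := fun x => DFunLike.congr_fun h3 x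
  refine ⟨fun x => hT ?_, fun y => ?_⟩
  · have h4 := (hB x (B x)).1 (B.mem_graph x)
    have : L (ν • T x - c • S x) = T (L (ν • (x : X) - c • B x)) := by
      rw [a2, map_sub T, map_smul, map_smul, h4]
    rw [a1] at this
    exact (congrArg (fun u => T (L (ν • (x : X) - u))) (e x)).trans this.symm
  · have h4 : (L y, c⁻¹ • (ν • L y - y)) ∈ B.graph := by
      rw [hB, map_smul, map_sub, map_smul, inv_smul_eq_iff₀ hc, a2, a3]
      have h5 := a1 y
      rw [map_sub, map_smul, map_smul, sub_eq_iff_eq_add] at h5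
      rw [h5, add_sub_cancel_left]
    obtain ⟨u, hu, hu2⟩ := (LinearPMap.mem_graph_iff _).1 h4
    simp only at hu hu2
    refine ⟨u, hu, ?_⟩
    have : ν • (u : X) - c • B u = y := by
      rw [hu2, hu, smul_inv_smul₀ hc, sub_sub_cancel]
    exact (congrArg (fun w => ν • (u : X) - w) (e u)).trans this

end Operators

/-! ### The natural functional calculus -/

section Natural
variable {a φ β d C : ℝ} {k : ℂ → ℂ} {p q : ℂ}

theorem norm_one_sub_pow_le {v : ℂ} {M : ℝ} (hv : ‖v‖ ≤ M) (N : ℕ) :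
    ‖1 - v ^ N‖ ≤ (∑ i ∈ Finset.range N, M ^ i) * ‖1 - v‖ := by
  rw [← mul_neg_geom_sum, norm_mul, mul_comm]
  gcongr
  refine (norm_sum_le _ _).trans (Finset.sum_le_sum fun i _ => ?_)
  rw [norm_pow]
  gcongr

theorem exists_norm_vertexOne_le (ha : 0 ≤ a) (h0 : 0 < φ) (h1 : φ < Real.pi / 2) :
    ∃ M : ℝ, 0 < M ∧ ∀ z ∈ bisector φ a, ‖vertexOne a 1 z‖ ≤ M * ((1 + ‖z + a‖) ^ 2)⁻¹ ∧
      ‖1 - vertexOne a 1 z‖ ≤ M * min ‖z - a‖ ‖z + a‖ := by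
  have hk := sepConst_pos h0 h1
  refine ⟨(2 * a + 1) ^ 2 * (sepConst φ ^ 2)⁻¹, by positivity, fun z hz => ⟨?_, ?_⟩⟩
  · have hnum : ‖((1 : ℝ) * (2 * a + (1 : ℝ)) : ℂ)‖ = 2 * a + 1 := by
      rw [show ((1 : ℝ) * (2 * a + (1 : ℝ)) : ℂ) = ((2 * a + 1 : ℝ) : ℂ) by push_cast; ring,
        Complex.norm_real, Real.norm_of_nonneg (by positivity)]
    rw [vertexOne, norm_mul, hnum]
    refine (mul_le_mul_of_nonneg_left (norm_inv_mul_inv_le h0 h1 one_pos hz)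
      (by positivity)).trans ?_
    have hE : 1 + ‖z + a‖ ≤ (2 * a + 1) * (1 + ‖z - a‖) := by
      have : ‖z + a‖ ≤ ‖z - a‖ + 2 * a := by
        calc ‖z + a‖ = ‖(z - a) + ((2 * a : ℝ) : ℂ)‖ := by congr 1; push_cast; ring
          _ ≤ _ := by
            refine (norm_add_le _ _).trans_eq ?_
            rw [Complex.norm_real, Real.norm_of_nonneg (by positivity)]
      nlinarith [mul_nonneg ha (norm_nonneg (z - a))]
    have hE2 : ((1 + ‖z - a‖) * (1 + ‖z + a‖))⁻¹ ≤ (2 * a + 1) * ((1 + ‖z + a‖) ^ 2)⁻¹ := by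
      rw [← div_eq_mul_inv, inv_le_comm₀ (by positivity) (by positivity), inv_div,
        div_le_iff₀ (by positivity), sq]
      calc _ ≤ ((2 * a + 1) * (1 + ‖z - a‖)) * (1 + ‖z + a‖) := by gcongr
        _ = _ := by ring
    calc _ ≤ (2 * a + 1) * ((sepConst φ ^ 2)⁻¹ * ((2 * a + 1) * ((1 + ‖z + a‖) ^ 2)⁻¹)) := by
          gcongr
      _ = _ := by ring
  · refine (norm_one_sub_vertexOne_le h0 h1 one_pos hz).trans ?_
    rw [div_one]
    gcongr
    exact le_mul_of_one_le_left (by positivity) (one_le_pow₀ (by linarith))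

/-- `vertexOne a 1` decays quadratically, so its N-th power beats growth of order N and leaves decay
of order N ≥ 1. It equals 1 at both vertices, so the limits p and q are unchanged. -/
theorem exists_isTame_vertexOne_pow_mul (ha : 0 ≤ a) (h0 : 0 < φ) (h1 : φ < Real.pi / 2) {N : ℕ}
    (hN : 1 ≤ N) (hβ1 : β ≤ 1) (hC : 0 ≤ C)
    (hk : DifferentiableOn ℂ k (bisector φ a))
    (hb : ∀ z ∈ bisector φ a, ‖k z‖ ≤ C * (1 + ‖z + a‖) ^ N)
    (hq : ∀ z ∈ bisector φ a, ‖z + a‖ ≤ 1 → ‖k z - q‖ ≤ C * ‖z + a‖ ^ β)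
    (hp : a ≠ 0 → ∀ z ∈ bisector φ a, ‖z - a‖ ≤ d → ‖k z - p‖ ≤ C * ‖z - a‖)
    (hpC : ‖p‖ ≤ C) (hqC : ‖q‖ ≤ C) :
    ∃ C', IsTame φ a d 1 β C' (fun z => vertexOne a 1 z ^ N * k z) p q := by
  obtain ⟨M, hM, hMb⟩ := exists_norm_vertexOne_le ha h0 h1
  have hv : ∀ z ∈ bisector φ a, ‖vertexOne a 1 z‖ ≤ M := fun z hz => by
    refine (hMb z hz).1.trans (mul_le_of_le_one_right hM.le ?_)
    exact inv_le_one_of_one_le₀ (one_le_pow₀ (by linarith [norm_nonneg (z + a)]))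
  have hS : 0 ≤ ∑ i ∈ Finset.range N, M ^ i := Finset.sum_nonneg fun i _ => by positivity
  set S := ∑ i ∈ Finset.range N, M ^ i with hSdef
  have key : ∀ z ∈ bisector φ a, ∀ (y : ℂ) (b : ℝ), ‖y‖ ≤ C → min ‖z - a‖ ‖z + a‖ ≤ b →
      ‖k z - y‖ ≤ C * b → ‖vertexOne a 1 z ^ N * k z - y‖ ≤ (M ^ N + S * M) * C * b := by
    intro z hz y b hy hmb hb
    have e1 : vertexOne a 1 z ^ N * k z - y = vertexOne a 1 z ^ N * (k z - y) -
      (1 - vertexOne a 1 z ^ N) * y := by ring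
    rw [e1]
    refine (norm_sub_le _ _).trans ?_
    rw [norm_mul, norm_mul, norm_pow]
    have h3 : ‖1 - vertexOne a 1 z ^ N‖ ≤ S * (M * b) := by
      refine (norm_one_sub_pow_le (hv z hz) N).trans ?_
      gcongr
      exact (hMb z hz).2.trans (by gcongr)
    have hmn : 0 ≤ b := (le_min (norm_nonneg _) (norm_nonneg _)).trans hmb
    calc _ ≤ M ^ N * (C * b) + S * (M * b) * C := by gcongr; exact hv z hz
      _ = _ := by ring
  have hle : C ≤ (1 + M ^ N + S * M) * C := by
    have : 0 ≤ (M ^ N + S * M) * C := by positivity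
    linarith
  refine ⟨(1 + M ^ N + S * M) * C, ((differentiableOn_vertexOne h0 h1 one_pos).pow N).mul hk,
    fun z hz h => ?_, fun z hz h => ?_, fun ha0 z hz h => ?_, hpC.trans hle, hqC.trans hle⟩
  · rw [div_one]
    have hn := norm_nonneg (z + a)
    refine (key z hz q _ hqC ?_ (hq z hz h)).trans ?_
    · refine (min_le_right _ _).trans ?_
      rcases hn.eq_or_lt with h2 | h2
      · rw [← h2]; positivity
      · simpa using Real.rpow_le_rpow_of_exponent_ge h2 h hβ1
    · gcongr; linarith
  · rw [div_one, norm_mul, norm_pow]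
    have hn : 0 < ‖z + a‖ := by linarith
    have h2 := pow_le_pow_left₀ (norm_nonneg _) (hMb z hz).1 N
    have h3 : ((1 + ‖z + a‖) ^ N)⁻¹ ≤ ‖z + a‖ ^ (-β) := by
      rw [Real.rpow_neg hn.le]
      refine inv_anti₀ (by positivity) ?_
      calc ‖z + a‖ ^ β ≤ ‖z + a‖ ^ (1 : ℝ) := Real.rpow_le_rpow_of_exponent_le h hβ1
        _ ≤ 1 + ‖z + a‖ := by rw [Real.rpow_one]; linarith
        _ ≤ _ := le_self_pow₀ (by linarith) (by omega)
    calc _ ≤ (M * ((1 + ‖z + a‖) ^ 2)⁻¹) ^ N * (C * (1 + ‖z + a‖) ^ N) := by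
          gcongr; exact hb z hz
      _ = M ^ N * C * ((1 + ‖z + a‖) ^ N)⁻¹ := by
          rw [mul_pow, inv_pow, ← pow_mul, mul_comm 2 N, pow_mul]
          field_simp
      _ ≤ (1 + M ^ N + S * M) * C * ‖z + a‖ ^ (-β) := by
          gcongr
          have : 0 ≤ S * M := by positivity
          linarith
  · refine (key z hz p _ hpC (min_le_left _ _) (hp ha0 z hz h)).trans ?_
    gcongr; linarith

theorem HasCalc.pow {𝔸 : Type*} [NormedRing 𝔸] [NormedAlgebra ℂ 𝔸] {R : ℂ → 𝔸}
    (hR : IsOuterResolvent R a) (h0 : 0 < φ) {T : 𝔸} (hT : HasCalc R a φ k T) (N : ℕ) :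
    HasCalc R a φ (fun z => k z ^ N) (T ^ N) := by
  induction N with
  | zero => simpa only [pow_zero] using HasCalc.one
  | succ N ih => simpa only [pow_succ] using ih.mul hR h0 hT

theorem IsBisectorialOp.injective_vertexOne {X : Type*} [NormedAddCommGroup X] [NormedSpace ℂ X]
    {A : X →ₗ.[ℂ] X} (hA : IsBisectorialOp A (Real.pi / 2) a) (N : ℕ) :
    Function.Injective
      ((((1 : ℝ) * (2 * a + (1 : ℝ)) : ℂ) • (resolventOf A (a + (1 : ℝ)) *
        -resolventOf A (-(a + (1 : ℝ))))) ^ N : X →L[ℂ] X) := by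
  have hR := hA.isOuterResolvent
  have ha := hR.nonneg
  have r1 : Function.Injective (resolventOf A (a + (1 : ℝ))) :=
    (resolventOf_spec (hA.outer_mem (by
      have := vertex_re (ε := 1) (Or.inl rfl) ha one_pos
      rwa [one_mul] at this))).injective
  have r2 : Function.Injective (resolventOf A (-(a + (1 : ℝ)))) :=
    (resolventOf_spec (hA.outer_mem (by
      have := vertex_re (ε := -1) (Or.inr rfl) ha one_pos
      rwa [neg_one_mul] at this))).injective
  have hc : ((1 : ℝ) * (2 * a + (1 : ℝ)) : ℂ) ≠ 0 := by
    have : (0 : ℝ) < 1 * (2 * a + 1) := by linarith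
    exact_mod_cast this.ne'
  induction N with
  | zero => rw [pow_zero]; exact Function.injective_id
  | succ N ih =>
    rw [pow_succ]
    refine ih.comp fun x y hxy => ?_
    have h := smul_right_injective X hc hxy
    have h2 : -resolventOf A (-(a + (1 : ℝ))) x = -resolventOf A (-(a + (1 : ℝ))) y := r1 h
    exact r2 (neg_injective h2)

variable {X : Type*} [NormedAddCommGroup X] [NormedSpace ℂ X] [CompleteSpace X]
  {A B : X →ₗ.[ℂ] X}

/-- Independence of the regularizer: e · (e' f) = e' · (e f) as functions, so T S' = T' S by
uniqueness. Cancelling the injective T transfers membership from one graph to the other. -/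
theorem HasNFC.graph_eq (hA : IsBisectorialOp A (Real.pi / 2) a) {f : ℂ → ℂ} {B' : X →ₗ.[ℂ] X}
    (h : HasNFC A (Real.pi / 2) a f B) (h' : HasNFC A (Real.pi / 2) a f B') : B = B' := by
  have aux : ∀ B B' : X →ₗ.[ℂ] X, HasNFC A (Real.pi / 2) a f B → HasNFC A (Real.pi / 2) a f B' →
      ∀ x y, (x, y) ∈ B.graph → (x, y) ∈ B'.graph := by
    rintro B B' ⟨φ₁, h1, h2, -, e, T, S, hT, hS, hTi, hB⟩
      ⟨φ₂, h1', h2', -, e', T', S', hT', hS', hTi', hB'⟩ x y hxy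
    have hR := hA.isOuterResolvent
    obtain ⟨ψ₁, i1, j1, k1⟩ := hT.hasCalc hA h1
    obtain ⟨ψ₂, i2, j2, k2⟩ := hS.hasCalc hA h1
    obtain ⟨ψ₃, i3, j3, k3⟩ := hT'.hasCalc hA h1'
    obtain ⟨ψ₄, i4, j4, k4⟩ := hS'.hasCalc hA h1'
    set ψ := max (max ψ₁ ψ₂) (max ψ₃ ψ₄) with hψ
    have hψ1 : ψ < Real.pi / 2 := max_lt (max_lt j1 j2) (max_lt j3 j4)
    have k1' := k1.mono (h1.trans i1) ((le_max_left _ _).trans (le_max_left _ _)) hψ1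
    have k2' := k2.mono (h1.trans i2) ((le_max_right _ _).trans (le_max_left _ _)) hψ1
    have k3' := k3.mono (h1'.trans i3) ((le_max_left _ _).trans (le_max_right _ _)) hψ1
    have k4' := k4.mono (h1'.trans i4) ((le_max_right _ _).trans (le_max_right _ _)) hψ1
    have hψ0 : 0 < ψ := (h1.trans i1).trans_le ((le_max_left _ _).trans (le_max_left _ _))
    have c1 : T * T' = T' * T := k1'.commute hR hψ0 hψ1 k3'
    have c2 : T * S' = T' * S := (k1'.mul hR hψ0 k4').unique hR hψ0 hψ1 (k3'.mul hR hψ0 k2')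
      fun z _ => by ring
    rw [hB] at hxy
    rw [hB']
    apply hTi
    have d1 : T (T' y) = T' (T y) := DFunLike.congr_fun c1 y
    have d2 : T (S' x) = T' (S x) := DFunLike.congr_fun c2 x
    rw [d1, d2, hxy]
  refine LinearPMap.eq_of_eq_graph (Submodule.ext ?_)
  rintro ⟨x, y⟩
  exact ⟨aux B B' h h' x y, aux B' B h' h x y⟩

/-- Multiplying r(ν - c f) = 1 by the regularizer e gives r(νe - c e f) = e, an identity between
functions of the bounded calculus, hence one between operators. -/
theorem HasNFC.hasResolventAt_smul (hA : IsBisectorialOp A (Real.pi / 2) a) {f : ℂ → ℂ}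
    (h : HasNFC A (Real.pi / 2) a f B) {r : ℂ → ℂ} {L : X →L[ℂ] X} {c ν : ℂ} (h0 : 0 < φ)
    (h1 : φ < Real.pi / 2) (hL : HasCalc (resolventOf A) a φ r L) (hc : c ≠ 0)
    (hr : ∀ z ∈ bisector φ a, r z * (ν - c * f z) = 1) : HasResolventAt (c • B) ν L := by
  obtain ⟨φ₁, h2, h3, -, e, T, S, hT, hS, hTi, hB⟩ := h
  have hR := hA.isOuterResolvent
  obtain ⟨ψ₁, i1, j1, k1⟩ := hT.hasCalc hA h2
  obtain ⟨ψ₂, i2, j2, k2⟩ := hS.hasCalc hA h2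
  set ψ := max (max ψ₁ ψ₂) φ with hψ
  have hψ1 : ψ < Real.pi / 2 := max_lt (max_lt j1 j2) h1
  have hψ0 : 0 < ψ := h0.trans_le (le_max_right _ _)
  have k1' := k1.mono (h2.trans i1) ((le_max_left _ _).trans (le_max_left _ _)) hψ1
  have k2' := k2.mono (h2.trans i2) ((le_max_right _ _).trans (le_max_left _ _)) hψ1
  have k3' := hL.mono h0 (le_max_right _ _) hψ1
  refine hasResolventAt_smul_of_regularizer hTi hB hc ?_ (k1'.commute hR hψ0 hψ1 k3')
    (k2'.commute hR hψ0 hψ1 k3')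
  refine (k3'.mul hR hψ0 ((k1'.smul ν).sub hR hψ0 (k2'.smul c))).unique hR hψ0 hψ1 k1'
    fun z hz => ?_
  have := hr z (bisector_anti h0 (le_max_right _ _) hψ1 hz)
  linear_combination e z * this

theorem exists_hasNFC (hA : IsBisectorialOp A (Real.pi / 2) a) {α κ G : ℝ} {g : ℂ → ℂ} {c : ℂ}
    (hc : ‖c‖ = 1) (hα : 0 < α) (h0 : 0 < φ) (h1 : φ < Real.pi / 2)
    (hg : IsPowerLike φ a α κ G g) : ∃ B, HasNFC A (Real.pi / 2) a (fun z => c * g z) B := by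
  have ha := hA.2.2.1
  have hR := hA.isOuterResolvent
  obtain ⟨d, hd, hd1, hda⟩ : ∃ d : ℝ, 0 < d ∧ d ≤ 1 ∧ (a ≠ 0 → d < a) := by
    rcases eq_or_ne a 0 with h | h
    · exact ⟨1, one_pos, le_rfl, fun h' => absurd h h'⟩
    · have : 0 < a := lt_of_le_of_ne ha (Ne.symm h)
      exact ⟨min 1 (a / 2), lt_min one_pos (by linarith), min_le_left _ _, fun _ =>
        (min_le_right _ _).trans_lt (by linarith)⟩
  -- N ≥ α controls the growth |z + a|^α. The case k = 1 below provides the regularizer itself, the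
  -- case k = c g its product with the function.
  set N := ⌈α⌉₊ with hNdef
  have hN : 1 ≤ N := Nat.one_le_ceil_iff.2 hα
  have hG := hg.nonneg
  have hβ : 0 < min 1 α := lt_min one_pos hα
  obtain ⟨C₁, H₁⟩ := exists_isTame_vertexOne_pow_mul (k := fun _ => 1) (p := 1) (q := 1) (C := 1)
    (d := d) ha h0 h1 hN (min_le_left _ _) zero_le_one (differentiableOn_const _)
    (fun z _ => by
      rw [norm_one, one_mul]; exact one_le_pow₀ (by linarith [norm_nonneg (z + a)]))
    (fun z _ _ => by rw [sub_self, norm_zero]; positivity)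
    (fun _ z _ _ => by rw [sub_self, norm_zero]; positivity) norm_one.le norm_one.le
  obtain ⟨C₂, H₂⟩ := exists_isTame_vertexOne_pow_mul (k := fun z => c * g z)
    (p := if a = 0 then 0 else c * g a) (q := 0) (C := 1 + G + 2 * G / a)
    (d := d) ha h0 h1 hN (min_le_left _ _) (by positivity) (hg.holo.const_mul c)
    (fun z hz => by
      rw [norm_mul, hc, one_mul, hg.norm_eq z hz]
      have hn := norm_nonneg (z + a)
      calc ‖z + a‖ ^ α ≤ (1 + ‖z + a‖) ^ α := by gcongr; linarith
        _ ≤ (1 + ‖z + a‖) ^ (N : ℝ) :=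
          Real.rpow_le_rpow_of_exponent_le (by linarith) (Nat.le_ceil α)
        _ = (1 + ‖z + a‖) ^ N := Real.rpow_natCast _ _
        _ ≤ _ := le_mul_of_one_le_left (by positivity) (by
          have : 0 ≤ 2 * G / a := by positivity
          linarith))
    (fun z hz h => by
      rw [sub_zero, norm_mul, hc, one_mul, hg.norm_eq z hz]
      have hn := norm_nonneg (z + a)
      have h3 : ‖z + a‖ ^ α ≤ ‖z + a‖ ^ min 1 α := by
        rcases hn.eq_or_lt with h2 | h2
        · rw [← h2, Real.zero_rpow hα.ne']; positivity
        · exact Real.rpow_le_rpow_of_exponent_ge h2 h (min_le_right _ _)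
      refine h3.trans (le_mul_of_one_le_left (by positivity) ?_)
      have : 0 ≤ 2 * G / a := by positivity
      linarith)
    (fun h z _ hzd => by
      have ha' : 0 < a := lt_of_le_of_ne ha (Ne.symm h)
      have hzb : z ∈ Metric.ball (a : ℂ) a := by
        rw [Metric.mem_ball, dist_eq_norm]; exact hzd.trans_lt (hda h)
      have := Complex.dist_le_div_mul_dist_of_mapsTo_ball (R₂ := 2 * G) hg.holo_ball (fun w hw => by
        rw [Metric.mem_closedBall, dist_eq_norm]
        have := norm_sub_le (g w) (g a)
        have := hg.maps_ball w hw
        have := hg.maps_ball a (Metric.mem_ball_self ha')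
        linarith) hzb
      rw [dist_eq_norm, dist_eq_norm] at this
      rw [if_neg h, ← mul_sub, norm_mul, hc, one_mul]
      refine this.trans ?_
      gcongr
      linarith)
    (by
      have : 0 ≤ 2 * G / a := by positivity
      split_ifs with h
      · rw [norm_zero]; linarith
      · have := hg.maps_ball a (Metric.mem_ball_self (lt_of_le_of_ne ha (Ne.symm h)))
        rw [norm_mul, hc, one_mul]; linarith)
    (by rw [norm_zero]; positivity)
  obtain ⟨T, hT⟩ := H₁.exists_hasElemCalc (A := A) ha h0 h1 hβ (min_le_left _ _) hd hd1
  obtain ⟨S, hS⟩ := H₂.exists_hasElemCalc (A := A) ha h0 h1 hβ (min_le_left _ _) hd hd1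
  have hTi : Function.Injective T := by
    obtain ⟨ψ, i, j, hT'⟩ := hT.hasCalc hA h0
    have := hT'.unique hR (h0.trans i) j
      ((HasCalc.vertexOne hR (h0.trans i) j one_pos).pow hR (h0.trans i) N)
      fun z _ => by rw [mul_one]
    rw [this]
    exact hA.injective_vertexOne N
  obtain ⟨B, hB⟩ := exists_linearPMap_graph (S := S) hTi
  simp only [mul_one] at hT
  exact ⟨B, φ, h0, h1, hg.holo.const_mul c, _, T, S, hT, hS, hTi, hB⟩

end Natural

/-! ### Semigroups generated by powers -/

section Semigroup
variable {𝔸 : Type*} [NormedRing 𝔸] [NormedAlgebra ℂ 𝔸] {R : ℂ → 𝔸}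
  {φ φ' a α κ G δ : ℝ} {g : ℂ → ℂ} {T : ℂ → 𝔸}

/-- `T w = exp (-w g)(A)` for `w` in the sector of angle `δ`, with a bound. -/
structure IsPowerSemigroup (R : ℂ → 𝔸) (a φ δ G : ℝ) (g : ℂ → ℂ) (T : ℂ → 𝔸) : Prop where
  hasCalc : ∀ w, w ≠ 0 → Real.cos δ * ‖w‖ ≤ w.re →
    HasCalc R a φ (fun z => Complex.exp (-(w * g z))) (T w)
  bound : ∃ K : ℝ, 0 < K ∧ ∀ w, w ≠ 0 → Real.cos δ * ‖w‖ ≤ w.re →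
    ‖T w‖ ≤ K * ((1 + ‖w‖) * Real.exp (G * ‖w‖))

section
variable [CompleteSpace 𝔸]

theorem IsPowerLike.exists_isPowerSemigroup (hR : IsOuterResolvent R a) (hα : 0 < α)
    (hg : IsPowerLike φ a α κ G g) (h0 : 0 < φ) (h : φ < φ') (h1 : φ' < Real.pi / 2)
    (hκ : 0 ≤ κ) (hδ : 0 ≤ δ) (hκδ : κ + δ < Real.pi / 2) :
    ∃ T, IsPowerSemigroup R a φ' δ G g T := by
  obtain ⟨K, hK, H⟩ := hg.exists_hasCalc hR hα h0 h h1 one_pos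
  have hG := hg.nonneg
  have hc : 0 < Real.cos (κ + δ) := Real.cos_pos_of_mem_Ioo ⟨by linarith [Real.pi_pos], hκδ⟩
  have key : ∀ w : ℂ, ∃ S : 𝔸, w ≠ 0 → Real.cos δ * ‖w‖ ≤ w.re →
      HasCalc R a φ' (fun z => Complex.exp (-(w * g z))) S ∧
        ‖S‖ ≤ K * ((1 + G) * ((3 + 1 / Real.cos (κ + δ)) * (1 + ‖w‖) * Real.exp (G * ‖w‖))) := by
    intro w
    by_cases hw : w ≠ 0 ∧ Real.cos δ * ‖w‖ ≤ w.re
    · obtain ⟨S, hS⟩ := H _ _ _ (lt_of_lt_of_le one_pos (le_max_left _ _)) (by positivity)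
        (fun _ => le_max_left _ _) (isAdmissible_exp hκ hδ hκδ hG hw.1 hw.2)
      exact ⟨S, fun _ _ => hS⟩
    · exact ⟨0, fun h2 h3 => absurd ⟨h2, h3⟩ hw⟩
  choose T hT using key
  refine ⟨T, fun w h2 h3 => (hT w h2 h3).1, K * ((1 + G) * (3 + 1 / Real.cos (κ + δ))),
    by positivity, fun w h2 h3 => (hT w h2 h3).2.trans_eq ?_⟩
  ring

theorem IsPowerSemigroup.mul (hT : IsPowerSemigroup R a φ' δ G g T) (hR : IsOuterResolvent R a)
    (h0 : 0 < φ') (h1 : φ' < Real.pi / 2) (hδ : 0 ≤ δ) (hδ1 : δ < Real.pi / 2) {z w : ℂ}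
    (hz0 : z ≠ 0) (hz : Real.cos δ * ‖z‖ ≤ z.re) (hw0 : w ≠ 0) (hw : Real.cos δ * ‖w‖ ≤ w.re) :
    T z * T w = T (z + w) := by
  have hc : 0 < Real.cos δ := Real.cos_pos_of_mem_Ioo ⟨by linarith [Real.pi_pos], hδ1⟩
  have hz1 : 0 < z.re := (mul_pos hc (norm_pos_iff.2 hz0)).trans_le hz
  have hw1 : 0 < w.re := (mul_pos hc (norm_pos_iff.2 hw0)).trans_le hw
  have hzw : Real.cos δ * ‖z + w‖ ≤ (z + w).re := by
    rw [Complex.add_re]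
    refine (mul_le_mul_of_nonneg_left (norm_add_le z w) hc.le).trans ?_
    linarith
  have hzw0 : z + w ≠ 0 := fun h => by
    have := congrArg Complex.re h
    rw [Complex.add_re, Complex.zero_re] at this
    linarith
  refine ((hT.hasCalc z hz0 hz).mul hR h0 (hT.hasCalc w hw0 hw)).unique hR h0 h1
    (hT.hasCalc _ hzw0 hzw) fun ζ _ => ?_
  rw [← Complex.exp_add]
  ring_nf

/-- T(w + k) - T(w) + kD is the operator of the Taylor remainder of the exponential, which is
O(|k|²) in norm. -/
theorem IsPowerSemigroup.exists_hasDerivAt (hT : IsPowerSemigroup R a φ' δ G g T)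
    (hR : IsOuterResolvent R a) (hα : 0 < α)
    (hg : IsPowerLike φ a α κ G g) (h0 : 0 < φ) (h : φ < φ') (h1 : φ' < Real.pi / 2)
    (hκ : 0 ≤ κ) (hδ : 0 ≤ δ) (hκδ : κ + δ < Real.pi / 2) {w : ℂ} (hw0 : w ≠ 0)
    (hw : Real.cos δ * ‖w‖ < w.re) :
    ∃ D, HasCalc R a φ' (fun z => g z * Complex.exp (-(w * g z))) D ∧ HasDerivAt T (-D) w := by
  obtain ⟨K, hK, H⟩ := hg.exists_hasCalc hR hα h0 h h1 one_pos
  have hG := hg.nonneg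
  have h0' : 0 < φ' := h0.trans h
  obtain ⟨C₁, hC₁, H₁⟩ := isAdmissible_mul_exp hκ hδ hκδ hG hw0 hw.le
  obtain ⟨D, hD, -⟩ := H _ _ _ one_pos hC₁ (fun _ => le_rfl) H₁
  obtain ⟨C, r, hC, hr, H₂⟩ := isAdmissible_exp_remainder hκ hδ hκδ hG hw0 hw.le
  refine ⟨D, hD, hasDerivAt_iff_isLittleO_nhds_zero.2 ?_⟩
  have t1 : Tendsto (fun k : ℂ => w + k) (𝓝 0) (𝓝 w) := by
    have : Continuous fun k : ℂ => w + k := by fun_prop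
    simpa using this.tendsto 0
  have e1 : ∀ᶠ k : ℂ in 𝓝 0, w + k ≠ 0 := t1.eventually (isOpen_ne.mem_nhds hw0)
  have e2 : ∀ᶠ k : ℂ in 𝓝 0, Real.cos δ * ‖w + k‖ < (w + k).re := by
    have o : IsOpen {x : ℂ | Real.cos δ * ‖x‖ < x.re} :=
      isOpen_lt (by fun_prop) Complex.continuous_re
    exact t1.eventually (o.mem_nhds hw)
  have e3 : ∀ᶠ k : ℂ in 𝓝 0, ‖k‖ ≤ r := by
    filter_upwards [Metric.ball_mem_nhds (0 : ℂ) hr] with k hk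
    rw [mem_ball_zero_iff] at hk
    exact hk.le
  refine (Asymptotics.IsBigO.of_bound (K * C) ?_).trans_isLittleO
    (Asymptotics.isLittleO_pow_id (𝕜 := ℂ) one_lt_two)
  filter_upwards [e1, e2, e3] with k hk1 hk2 hk3
  rcases eq_or_ne k 0 with rfl | hk0
  · simp
  obtain ⟨Q, hQ, hQn⟩ := H 1 (C * ‖k‖ ^ 2) _ one_pos
    (by have := norm_pos_iff.2 hk0; positivity) (fun _ => le_rfl) (H₂ k hk0 hk3)
  have e : T (w + k) - T w - k • -D = Q := by
    have := ((hT.hasCalc _ hk1 hk2.le).sub hR h0' (hT.hasCalc w hw0 hw.le)).add hR h0' (hD.smul k)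
    rw [smul_neg, sub_neg_eq_add]
    refine this.unique hR h0' h1 hQ fun z _ => ?_
    rw [add_mul, neg_add, Complex.exp_add]
    ring
  rw [e, norm_pow, mul_assoc]
  exact hQn

theorem IsPowerLike.exists_hasCalc_inv (hR : IsOuterResolvent R a) (hα : 0 < α)
    (hg : IsPowerLike φ a α κ G g) (h0 : 0 < φ) (h : φ < φ') (h1 : φ' < Real.pi / 2)
    {θ : ℝ} (hκ : 0 ≤ κ) (hκ1 : κ < Real.pi / 2) (hθ : κ < θ) (hθ1 : θ ≤ Real.pi) :
    ∃ M : ℝ, 0 < M ∧ ∀ μ : ℂ, μ ≠ 0 → -(Real.cos θ * ‖μ‖) ≤ μ.re → 2 * G ≤ ‖μ‖ →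
      (a ≠ 0 → 1 ≤ ‖μ‖) → ∃ L : 𝔸, HasCalc R a φ' (fun z => (μ + g z)⁻¹) L ∧ ‖μ • L‖ ≤ M ∧
        ∀ z ∈ bisector φ' a, μ + g z ≠ 0 := by
  obtain ⟨K, hK, H⟩ := hg.exists_hasCalc hR hα h0 h h1 one_pos
  obtain ⟨c, hc, hcb⟩ := exists_le_norm_add hκ hκ1 hθ hθ1
  refine ⟨K * (1 / c), by positivity, fun μ hμ0 hμ hμG hμ1 => ?_⟩
  have hb : ∀ ζ ∈ powRange κ G, c * (‖μ‖ + ‖ζ‖) ≤ ‖μ + ζ‖ := fun ζ hζ => hcb G μ ζ hμ hμG hζ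
  obtain ⟨P, hP, hPn⟩ := H _ _ _ (norm_pos_iff.2 hμ0) (by positivity) hμ1
    (isAdmissible_resolvent hc hμ0 hb)
  refine ⟨μ⁻¹ • P, (hP.smul μ⁻¹).congr hR.nonneg (h0.trans h) fun z hz => ?_, ?_, fun z hz => ?_⟩
  · rw [mul_div_assoc', inv_mul_cancel₀ hμ0, one_div]
  · rwa [smul_inv_smul₀ hμ0]
  · exact add_ne_zero_of_le hc hμ0 (hb _ (hg.maps z (bisector_anti h0 h.le h1 hz)))

end

theorem IsPowerSemigroup.norm_exp_smul_le (hT : IsPowerSemigroup R a φ' δ G g T)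
    (hδ1 : Real.cos δ ≤ 1) {μ : ℂ} (hμ : G < μ.re) :
    ∃ M b : ℝ, 0 < M ∧ 0 < b ∧ ∀ t : ℝ, 0 < t →
      ‖Complex.exp (-(μ * t)) • T t‖ ≤ M * Real.exp (-b * t) := by
  obtain ⟨K, hK, H⟩ := hT.bound
  -- Half of the gap gives the exponential decay; the other half absorbs the linear factor 1 + t.
  set b := (μ.re - G) / 2 with hbdef
  have hb : 0 < b := by rw [hbdef]; linarith
  refine ⟨K * (1 + 1 / b), b, by positivity, hb, fun t ht => ?_⟩
  have hn : ‖(t : ℂ)‖ = t := by rw [Complex.norm_real, Real.norm_of_nonneg ht.le]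
  have h2 := H t (by exact_mod_cast ht.ne') (by
    rw [hn, Complex.ofReal_re]
    exact mul_le_of_le_one_left ht.le hδ1)
  rw [hn] at h2
  rw [norm_smul, Complex.norm_exp, Complex.neg_re, Complex.re_mul_ofReal]
  have h3 := mul_exp_neg_le 1 ht.le hb
  rw [pow_one, pow_one, Nat.factorial_one, Nat.cast_one] at h3
  have h4 : Real.exp (-(b * t)) ≤ 1 := Real.exp_le_one_iff.2 (by have := mul_pos hb ht; linarith)
  calc _ ≤ Real.exp (-(μ.re * t)) * (K * ((1 + t) * Real.exp (G * t))) := by gcongr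
    _ = K * ((1 + t) * Real.exp (-(b * t))) * Real.exp (-b * t) := by
        have e : Real.exp (-(μ.re * t)) * Real.exp (G * t) =
            Real.exp (-(b * t)) * Real.exp (-b * t) := by
          rw [← Real.exp_add, ← Real.exp_add, hbdef]
          ring_nf
        linear_combination K * (1 + t) * e
    _ ≤ _ := by
        gcongr
        linarith

variable [CompleteSpace 𝔸]

/-- Let L represent (μ + g)⁻¹. Since T(t) = μ T(t) L + D L with D = -T'(t), the function -exp(-μt)
T(t) L is a primitive of the Laplace integrand. Its limits are -L at 0 and 0 at infinity, so the
integral is L. The bound on Re μ ensures |μ| ≥ 2G and |μ| ≥ 1, as the estimates for (μ + g)⁻¹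
require. -/
theorem IsPowerSemigroup.laplace (hT : IsPowerSemigroup R a φ' δ G g T)
    (hR : IsOuterResolvent R a) (hα : 0 < α)
    (hg : IsPowerLike φ a α κ G g) (h0 : 0 < φ) (h : φ < φ') (h1 : φ' < Real.pi / 2)
    (hκ : 0 ≤ κ) (hδ : 0 < δ) (hκδ : κ + δ < Real.pi / 2) {μ : ℂ} (hμ : 2 * G + 1 < μ.re) :
    IntegrableOn (fun t : ℝ => Complex.exp (-(μ * t)) • T t) (Ioi 0) ∧
      HasCalc R a φ' (fun z => (μ + g z)⁻¹) (∫ t in Ioi (0 : ℝ), Complex.exp (-(μ * t)) • T t) ∧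
      ∀ z ∈ bisector φ' a, μ + g z ≠ 0 := by
  have hG := hg.nonneg
  have h0' : 0 < φ' := h0.trans h
  have hμn : μ.re ≤ ‖μ‖ := Complex.re_le_norm μ
  have hμ0 : μ ≠ 0 := norm_pos_iff.1 (by linarith)
  have hcδ : Real.cos δ < 1 := by
    have := Real.cos_lt_cos_of_nonneg_of_le_pi le_rfl (by linarith [Real.pi_pos]) hδ
    rwa [Real.cos_zero] at this
  have hn : ∀ t : ℝ, 0 < t → ‖(t : ℂ)‖ = t := fun t ht => by
    rw [Complex.norm_real, Real.norm_of_nonneg ht.le]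
  have ht0 : ∀ t : ℝ, 0 < t → (t : ℂ) ≠ 0 := fun t ht => by exact_mod_cast ht.ne'
  have htc : ∀ t : ℝ, 0 < t → Real.cos δ * ‖(t : ℂ)‖ < (t : ℂ).re := fun t ht => by
    rw [hn t ht, Complex.ofReal_re]
    exact mul_lt_of_lt_one_left ht hcδ
  obtain ⟨M₀, -, HL⟩ := hg.exists_hasCalc_inv hR hα h0 h h1 (θ := Real.pi / 2) hκ (by linarith)
    (by linarith) (by linarith [Real.pi_pos])
  obtain ⟨L, hL, -, hne⟩ := HL μ hμ0 (by rw [Real.cos_pi_div_two, zero_mul]; linarith)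
    (by linarith) fun _ => by linarith
  obtain ⟨M, b, hM, hb, hMb⟩ := hT.norm_exp_smul_le hcδ.le (μ := μ) (by linarith)
  have hderiv : ∀ t : ℝ, 0 < t → ∃ D, HasCalc R a φ' (fun z => g z * Complex.exp (-(t * g z))) D ∧
      HasDerivAt (fun s : ℝ => T s) (-D) t := by
    intro t ht
    obtain ⟨D, hD, hd⟩ := hT.exists_hasDerivAt hR hα hg h0 h h1 hκ hδ.le hκδ (ht0 t ht) (htc t ht)
    have := hd.scomp t Complex.ofRealCLM.hasDerivAt
    rw [Complex.ofRealCLM_apply, Complex.ofReal_one, one_smul] at this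
    exact ⟨D, hD, this⟩
  have hexp : ∀ t : ℝ, HasDerivAt (fun s : ℝ => Complex.exp (-(μ * s)))
      (-μ * Complex.exp (-(μ * t))) t := by
    intro t
    have : HasDerivAt (fun s : ℂ => Complex.exp (-(μ * s))) (Complex.exp (-(μ * t)) * -(μ * 1)) t :=
      (((hasDerivAt_id (t : ℂ)).const_mul μ).fun_neg).cexp
    convert this.comp_ofReal using 1
    ring
  have hcont : ContinuousOn (fun t : ℝ => Complex.exp (-(μ * t)) • T t) (Ioi 0) := by
    intro t ht
    obtain ⟨D, -, hd⟩ := hderiv t ht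
    exact ((hexp t).continuousAt.smul hd.continuousAt).continuousWithinAt
  have hint : IntegrableOn (fun t : ℝ => Complex.exp (-(μ * t)) • T t) (Ioi 0) := by
    refine Integrable.mono' ((exp_neg_integrableOn_Ioi 0 hb).const_mul M)
      (hcont.aestronglyMeasurable measurableSet_Ioi) ?_
    filter_upwards [ae_restrict_mem measurableSet_Ioi] with t ht
    exact hMb t ht
  refine ⟨hint, ?_, hne⟩
  have hd : ∀ t ∈ Ioi (0 : ℝ), HasDerivAt (fun s : ℝ => -((Complex.exp (-(μ * s)) • T s) * L))
      (Complex.exp (-(μ * t)) • T t) t := by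
    intro t ht
    obtain ⟨D, hD, hd⟩ := hderiv t ht
    have key : T t = μ • (T t * L) + D * L := by
      have c1 := hT.hasCalc t (ht0 t ht) (htc t ht).le
      refine c1.unique hR h0' h1
        (((c1.mul hR h0' hL).smul μ).add hR h0' (hD.mul hR h0' hL)) fun z hz => ?_
      have := hne z hz
      field_simp
    have := (((hexp t).smul hd).mul_const L).fun_neg
    refine HasDerivAt.congr_deriv this ?_
    conv_rhs => rw [key]
    simp only [add_mul, smul_mul_assoc, smul_add, smul_neg, neg_mul, neg_smul, smul_smul, neg_add,
      neg_neg]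
    rw [add_comm, mul_comm (Complex.exp _) μ]
  have hlim0 : Tendsto (fun s : ℝ => -((Complex.exp (-(μ * s)) • T s) * L)) (𝓝[>] 0) (𝓝 (-L)) := by
    obtain ⟨K, hK, H⟩ := hg.exists_hasCalc hR hα h0 h h1 (θ := 1 / 2) (by norm_num)
    obtain ⟨c, hc, hcb⟩ := exists_le_norm_add (θ := Real.pi / 2) hκ (by linarith)
      (by linarith) (by linarith [Real.pi_pos])
    obtain ⟨C, hC, HC⟩ := isAdmissible_exp_sub_one_div (κ := κ) hκ (by linarith) hc hG hμ0
      fun ζ hζ => hcb G μ ζ (by rw [Real.cos_pi_div_two, zero_mul]; linarith) (by linarith) hζ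
    have hTL : Tendsto (fun s : ℝ => T s * L) (𝓝[>] 0) (𝓝 L) := by
      rw [tendsto_iff_norm_sub_tendsto_zero]
      have l1 : Tendsto (fun t : ℝ => K * (C * t ^ (1 / 2 : ℝ))) (𝓝[>] 0) (𝓝 0) := by
        have : Continuous fun t : ℝ => K * (C * t ^ (1 / 2 : ℝ)) :=
          ((Real.continuous_rpow_const (by norm_num)).const_mul C).const_mul K
        have := this.tendsto 0
        rw [Real.zero_rpow (by norm_num), mul_zero, mul_zero] at this
        exact this.mono_left nhdsWithin_le_nhds
      refine squeeze_zero' (Eventually.of_forall fun _ => norm_nonneg _) ?_ l1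
      filter_upwards [Ioc_mem_nhdsGT one_pos] with t ht
      obtain ⟨Q, hQ, hQn⟩ := H 1 _ _ one_pos (by have := ht.1; positivity) (fun _ => le_rfl)
        (HC t ht.1 ht.2)
      have e : T t * L - L = Q := by
        have c1 := hT.hasCalc t (ht0 t ht.1) (htc t ht.1).le
        refine ((c1.mul hR h0' hL).sub hR h0' hL).unique hR h0' h1 hQ fun z hz => ?_
        rw [div_eq_mul_inv]
        ring
      rw [e]
      exact hQn
    have l2 : Tendsto (fun s : ℝ => Complex.exp (-(μ * s))) (𝓝[>] 0) (𝓝 1) := by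
      have := (hexp 0).continuousAt.tendsto
      simp only [Complex.ofReal_zero, mul_zero, neg_zero, Complex.exp_zero] at this
      exact this.mono_left nhdsWithin_le_nhds
    have := (l2.smul hTL).neg
    simpa only [one_smul, smul_mul_assoc] using this
  have hlim1 : Tendsto (fun s : ℝ => -((Complex.exp (-(μ * s)) • T s) * L)) atTop (𝓝 0) := by
    have l1 : Tendsto (fun s : ℝ => M * Real.exp (-b * s) * ‖L‖) atTop (𝓝 0) := by
      have := ((Real.tendsto_exp_atBot.comp
        (tendsto_id.const_mul_atTop_of_neg (neg_neg_iff_pos.2 hb))).const_mul M).mul_const ‖L‖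
      simpa using this
    refine squeeze_zero_norm' ?_ l1
    filter_upwards [eventually_gt_atTop 0] with t ht
    rw [norm_neg]
    refine (norm_mul_le _ _).trans ?_
    gcongr
    exact hMb t ht
  rw [integral_Ioi_of_hasDerivAt_of_tendsto_nhdsGT hd hint hlim0 hlim1, zero_sub, neg_neg]
  exact hL

end Semigroup

/-! ### Sectors -/

theorem cos_mul_norm_lt_re {δ : ℝ} {z : ℂ} (hδ : 0 < δ) (hδ1 : δ ≤ Real.pi)
    (hz : z ∈ openSector δ) : z ≠ 0 ∧ Real.cos δ * ‖z‖ < z.re := by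
  rw [openSector, if_neg hδ.ne', mem_ofPred_eq] at hz
  refine ⟨hz.1, ?_⟩
  rw [← Complex.norm_mul_cos_arg z, mul_comm, ← Real.cos_abs z.arg]
  exact mul_lt_mul_of_pos_left (Real.cos_lt_cos_of_nonneg_of_le_pi (abs_nonneg _) hδ1 hz.2)
    (norm_pos_iff.2 hz.1)

theorem re_le_cos_mul_norm {δ : ℝ} {z : ℂ} (hδ : 0 < δ) (hz : z ∉ openSector δ) (hz0 : z ≠ 0) :
    z.re ≤ Real.cos δ * ‖z‖ := by
  rw [openSector, if_neg hδ.ne', mem_ofPred_eq, not_and, not_lt] at hz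
  rw [← Complex.norm_mul_cos_arg z, mul_comm, ← Real.cos_abs z.arg]
  exact mul_le_mul_of_nonneg_right (Real.cos_le_cos_of_nonneg_of_le_pi hδ.le
    (Complex.abs_arg_le_pi z) (hz hz0)) (norm_nonneg z)

theorem openSector_mono {δ δ' : ℝ} (hδ : 0 < δ) (h : δ ≤ δ') : openSector δ ⊆ openSector δ' := by
  rw [openSector, openSector, if_neg hδ.ne', if_neg (hδ.trans_le h).ne']
  exact fun z hz => ⟨hz.1, hz.2.trans_le h⟩

theorem zero_mem_closure_openSector {δ : ℝ} (hδ : 0 < δ) : (0 : ℂ) ∈ closure (openSector δ) := by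
  have t : Tendsto (fun t : ℝ => (t : ℂ)) (𝓝[>] 0) (𝓝 0) := by
    have := Complex.continuous_ofReal.tendsto 0
    rw [Complex.ofReal_zero] at this
    exact this.mono_left nhdsWithin_le_nhds
  refine mem_closure_of_tendsto t ?_
  filter_upwards [self_mem_nhdsWithin] with x hx
  rw [openSector, if_neg hδ.ne']
  refine ⟨by exact_mod_cast (ne_of_gt hx), ?_⟩
  rw [Complex.arg_ofReal_of_nonneg (le_of_lt hx), abs_zero]
  exact hδ

theorem neg_one_notMem_openSector {δ : ℝ} (hδ : 0 < δ) (hδ1 : δ ≤ Real.pi) :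
    (-1 : ℂ) ∉ openSector δ := by
  rw [openSector, if_neg hδ.ne']
  rintro ⟨-, h⟩
  rw [Complex.arg_neg_one, abs_of_pos Real.pi_pos] at h
  linarith

theorem isSectorialOp_of_resolvent {X : Type*} [NormedAddCommGroup X] [NormedSpace ℂ X]
    {C : X →ₗ.[ℂ] X} {θ M : ℝ} (hθ : 0 < θ) (hθ1 : θ < Real.pi)
    (h : ∀ l : ℂ, l ∉ openSector θ → l ≠ 0 → ∃ L, HasResolventAt C l L ∧ ‖l • L‖ ≤ M) :
    IsSectorialOp C θ := by
  refine ⟨hθ.le, hθ1, ?_, fun l hl => ?_, fun θ' h1 _ => ⟨max M 1, by positivity,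
    fun l hl hl0 => ?_⟩⟩
  · obtain ⟨L, hL, -⟩ := h (-1) (neg_one_notMem_openSector hθ hθ1.le) (by norm_num)
    exact hL.isClosed
  · by_contra hc
    have hl0 : l ≠ 0 := by
      rintro rfl
      exact hc (zero_mem_closure_openSector hθ)
    obtain ⟨L, hL, -⟩ := h l (fun h' => hc (subset_closure h')) hl0
    exact hl ⟨L, hL⟩
  · obtain ⟨L, hL, hLM⟩ := h l (fun h' => hl (openSector_mono hθ h1.le h')) hl0
    rw [hL.resolventOf_eq]
    exact hLM.trans (le_max_left _ _)

/-! ### Sectoriality and generation for the power -/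

section Power
variable {X : Type*} [NormedAddCommGroup X] [NormedSpace ℂ X] [CompleteSpace X]
  {A B : X →ₗ.[ℂ] X} {a α φ κ G : ℝ}

/-- For l outside the sector put μ = ρ - l; the resolvent of ρ + cB at l is -(μ + c f)⁻¹(A). For ρ
large, |μ| exceeds the size of the disc for every such l, and |l| is dominated by |μ|, so the bound
on μ(μ + c f)⁻¹ carries over. -/
theorem HasNFC.exists_isSectorialOp (hA : IsBisectorialOp A (Real.pi / 2) a) {f : ℂ → ℂ}
    (hB : HasNFC A (Real.pi / 2) a f B) (hα : 0 < α) {c : ℂ} (hc : c ≠ 0)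
    (hg : IsPowerLike φ a α κ G (fun z => c * f z)) (h0 : 0 < φ)
    (h1 : φ < Real.pi / 2) (hκ : 0 ≤ κ) (hκ1 : κ < Real.pi / 2) {θ : ℝ} (hθ : κ < θ)
    (hθ1 : θ < Real.pi) :
    ∃ ρ : ℝ, 0 ≤ ρ ∧ (a = 0 → ρ = 0) ∧
      IsSectorialOp (((ρ : ℂ) • (LinearMap.id : X →ₗ[ℂ] X)) +ᵥ (c • B)) θ := by
  have hR := hA.isOuterResolvent
  have hG := hg.nonneg
  have hθ0 : 0 < θ := hκ.trans_lt hθ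
  obtain ⟨φ', h2, h3⟩ := exists_between h1
  obtain ⟨M, hM, H⟩ := hg.exists_hasCalc_inv hR hα h0 h2 h3 hκ hκ1 hθ hθ1.le
  have hcos : Real.cos θ < 1 := by
    have := Real.cos_lt_cos_of_nonneg_of_le_pi le_rfl hθ1.le hθ0
    rwa [Real.cos_zero] at this
  set m := (1 - max (Real.cos θ) 0) / 4 with hm
  have hm0 : 0 < m := by
    have : max (Real.cos θ) 0 < 1 := max_lt hcos one_pos
    rw [hm]; linarith
  -- For a = 0 the disc is reduced to a point and all scales are admitted, so no shift is needed.
  obtain ⟨ρ, hρ, hρa, hρG⟩ : ∃ ρ : ℝ, 0 ≤ ρ ∧ (a = 0 → ρ = 0) ∧ (a ≠ 0 → 2 * G + 1 ≤ m * ρ) := by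
    by_cases ha : a = 0
    · exact ⟨0, le_rfl, fun _ => rfl, fun h => absurd ha h⟩
    · refine ⟨(2 * G + 1) / m, by positivity, fun h => absurd h ha, fun _ => ?_⟩
      rw [mul_div_cancel₀ _ hm0.ne']
  refine ⟨ρ, hρ, hρa, isSectorialOp_of_resolvent (M := M / m) hθ0 hθ1 fun l hl hl0 => ?_⟩
  have hlre := re_le_cos_mul_norm hθ0 hl hl0
  have hln : 0 < ‖l‖ := norm_pos_iff.2 hl0
  have hρn : ‖(ρ : ℂ)‖ = ρ := by rw [Complex.norm_real, Real.norm_of_nonneg hρ]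
  have hsep : m * (ρ + ‖l‖) ≤ ‖(ρ : ℂ) - l‖ := by
    have := cone_separation (w := (ρ : ℂ)) (x := l) (κ₁ := 1) (κ₂ := max (Real.cos θ) 0)
      (le_max_right _ _) le_rfl (max_le hcos.le zero_le_one) (by
        rw [hρn, one_mul, Complex.ofReal_re]) (hlre.trans (by gcongr; exact le_max_left _ _))
    rwa [hρn] at this
  set μ : ℂ := (ρ : ℂ) - l with hμ
  have hμn : 0 < ‖μ‖ := lt_of_lt_of_le (by positivity) hsep
  have hμ0 : μ ≠ 0 := norm_pos_iff.1 hμn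
  have hμρ : a ≠ 0 → 2 * G + 1 ≤ ‖μ‖ := fun ha => (hρG ha).trans (le_trans (by
    gcongr; linarith) hsep)
  have hμG : 2 * G ≤ ‖μ‖ := by
    by_cases ha : a = 0
    · rw [hg.eq_zero ha]; linarith
    · linarith [hμρ ha]
  -- Shifting -l to the right by ρ does not leave the cone: the norm changes by at most ρ, and |cos
  -- θ| ≤ 1. The sign of cos θ decides which triangle inequality is used.
  have hμre : -(Real.cos θ * ‖μ‖) ≤ μ.re := by
    have t1 : ‖μ‖ ≤ ρ + ‖l‖ := (norm_sub_le _ _).trans_eq (by rw [hρn])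
    have t2 : ‖l‖ ≤ ρ + ‖μ‖ := by
      calc ‖l‖ = ‖(ρ : ℂ) - μ‖ := by rw [hμ, sub_sub_cancel]
        _ ≤ _ := (norm_sub_le _ _).trans_eq (by rw [hρn])
    have e : μ.re = ρ - l.re := by rw [hμ, Complex.sub_re, Complex.ofReal_re]
    rw [e]
    have hcm := Real.neg_one_le_cos θ
    rcases le_total 0 (Real.cos θ) with h4 | h4 <;> nlinarith
  obtain ⟨L, hL, hLM, hne⟩ := H μ hμ0 hμre hμG fun ha => by linarith [hμρ ha]
  have key : HasResolventAt (c • B) (l - ρ) (-1 • L) := by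
    refine hB.hasResolventAt_smul hA (h0.trans h2) h3 (r := fun z => -1 * (μ + c * f z)⁻¹)
      (by simpa using hL.smul (-1)) hc fun z hz => ?_
    have := hne z hz
    rw [show l - ρ - c * f z = -(μ + c * f z) by rw [hμ]; ring]
    field_simp
  refine ⟨_, key.vadd, ?_⟩
  rw [le_div_iff₀ hm0]
  rw [norm_smul] at hLM ⊢
  rw [neg_smul, one_smul, norm_neg]
  calc ‖l‖ * ‖L‖ * m = (m * ‖l‖) * ‖L‖ := by ring
    _ ≤ ‖μ‖ * ‖L‖ := by
      gcongr
      refine le_trans ?_ hsep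
      gcongr
      linarith
    _ ≤ M := hLM

theorem HasNFC.exists_isGeneratorOf (hA : IsBisectorialOp A (Real.pi / 2) a) {f : ℂ → ℂ}
    (hB : HasNFC A (Real.pi / 2) a f B) (hα : 0 < α) {c : ℂ} (hc : c ≠ 0)
    (hg : IsPowerLike φ a α κ G (fun z => c * f z)) (h0 : 0 < φ)
    (h1 : φ < Real.pi / 2) (hκ : 0 ≤ κ) {δ : ℝ} (hδ : 0 < δ) (hκδ : κ + δ < Real.pi / 2) :
    ∃ T : ℂ → X →L[ℂ] X, IsExpBddHolSemigroup δ T ∧ IsGeneratorOf ((-c) • B) T := by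
  have hR := hA.isOuterResolvent
  obtain ⟨φ', h2, h3⟩ := exists_between h1
  have h0' : 0 < φ' := h0.trans h2
  have hδ1 : δ < Real.pi / 2 := by linarith
  have hδ2 : δ ≤ Real.pi := by linarith [Real.pi_pos]
  obtain ⟨T, hT⟩ := hg.exists_isPowerSemigroup hR hα h0 h2 h3 hκ hδ.le hκδ
  refine ⟨T, ⟨hδ, hδ1.le, fun z hz w hw => ?_, fun w hw => ?_, fun δ' h4 h5 => ?_⟩,
    2 * G + 1, fun μ hμ => ?_⟩
  · obtain ⟨hz0, hz1⟩ := cos_mul_norm_lt_re hδ hδ2 hz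
    obtain ⟨hw0, hw1⟩ := cos_mul_norm_lt_re hδ hδ2 hw
    exact hT.mul hR h0' h3 hδ.le hδ1 hz0 hz1.le hw0 hw1.le
  · obtain ⟨hw0, hw1⟩ := cos_mul_norm_lt_re hδ hδ2 hw
    obtain ⟨D, -, hD⟩ := hT.exists_hasDerivAt hR hα hg h0 h2 h3 hκ hδ.le hκδ hw0 hw1
    exact hD.differentiableAt.differentiableWithinAt
  · obtain ⟨K, hK, H⟩ := hT.bound
    refine ⟨K * ((1 + 1) * Real.exp (G * 1)), fun w hw hw1 => ?_⟩
    obtain ⟨hw0, hw2⟩ := cos_mul_norm_lt_re hδ hδ2 (openSector_mono h4 h5.le hw)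
    refine (H w hw0 hw2.le).trans ?_
    have := hg.nonneg
    gcongr
  · obtain ⟨hint, hL, hne⟩ := hT.laplace hR hα hg h0 h2 h3 hκ hδ hκδ hμ
    refine ⟨hint, hB.hasResolventAt_smul hA h0' h3 hL (neg_ne_zero.2 hc) fun z hz => ?_⟩
    rw [neg_mul, sub_neg_eq_add]
    exact inv_mul_cancel₀ (hne z hz)

end Power

theorem existsUnique_nat_mem_Ioo {α : ℝ} (hα : 0 < α) (hodd : ∀ k : ℕ, α ≠ 2 * (k : ℝ) + 1) :
    ∃! n : ℕ, α ∈ Ioo (2 * (n : ℝ) - 1) (2 * (n : ℝ) + 1) := by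
  refine ⟨⌊(α + 1) / 2⌋₊, ⟨?_, ?_⟩, fun m hm => ?_⟩
  · have h1 := Nat.floor_le (show 0 ≤ (α + 1) / 2 by linarith)
    refine lt_of_le_of_ne (by linarith) fun h => ?_
    -- Equality at the left endpoint would make α equal to -1 or to an odd natural number.
    rcases Nat.eq_zero_or_pos ⌊(α + 1) / 2⌋₊ with h2 | h2
    · rw [h2] at h
      push_cast at h
      linarith
    · apply hodd (⌊(α + 1) / 2⌋₊ - 1)
      rw [Nat.cast_sub h2, Nat.cast_one]
      linarith
  · have h1 := Nat.lt_floor_add_one ((α + 1) / 2)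
    linarith
  · obtain ⟨h1, h2⟩ := hm
    symm
    rw [Nat.floor_eq_iff (by linarith)]
    constructor <;> linarith

theorem mainTheorem2 {X : Type*} [NormedAddCommGroup X] [NormedSpace ℂ X] [CompleteSpace X]
    (A : X →ₗ.[ℂ] X) (a : ℝ) (hA : IsBisectorialOp A (Real.pi / 2) a)
    (α : ℝ) (hα : 0 < α) (hodd : ∀ k : ℕ, α ≠ 2 * (k : ℝ) + 1) :
    (∃! n : ℕ, α ∈ Set.Ioo (2 * (n : ℝ) - 1) (2 * (n : ℝ) + 1)) ∧
    ∀ n : ℕ, α ∈ Set.Ioo (2 * (n : ℝ) - 1) (2 * (n : ℝ) + 1) →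
      -- `B` is the operator `(A + a I)^α`, well defined by the functional calculus of `A`
      ∃ B : X →ₗ.[ℂ] X,
        (∀ B' : X →ₗ.[ℂ] X,
          HasNFC A (Real.pi / 2) a (fun z => ((a : ℂ) + z) ^ (α : ℂ)) B' ↔ B' = B) ∧
        (∀ ε : ℝ, 0 < ε → Real.pi * |α / 2 - n| + ε < Real.pi →
          ∃ ρ : ℝ, 0 ≤ ρ ∧ (a = 0 → ρ = 0) ∧
            IsSectorialOp (((ρ : ℂ) • (LinearMap.id : X →ₗ[ℂ] X)) +ᵥ ((-1 : ℂ) ^ n • B))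
              (Real.pi * |α / 2 - n| + ε)) ∧
        (∀ δ : ℝ, 0 < δ → δ < Real.pi / 2 - Real.pi * |α / 2 - n| →
          ∃ T : ℂ → X →L[ℂ] X,
            IsExpBddHolSemigroup δ T ∧ IsGeneratorOf ((-1 : ℂ) ^ (n + 1) • B) T) := by
  refine ⟨existsUnique_nat_mem_Ioo hα hodd, fun n hn => ?_⟩
  set κ₀ := Real.pi * |α / 2 - n| with hκ₀
  have hpi := Real.pi_pos
  have hκ0 : 0 ≤ κ₀ := by positivity
  have hκ1 : κ₀ < Real.pi / 2 := by
    have : |α / 2 - n| < 1 / 2 := by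
      rw [abs_lt]
      constructor <;> linarith [hn.1, hn.2]
    rw [hκ₀]
    nlinarith
  have ha := hA.2.2.1
  have hc : ((-1 : ℂ) ^ n) ≠ 0 := pow_ne_zero _ (by norm_num)
  have hsq : ((-1 : ℂ) ^ n) * (-1) ^ n = 1 := by
    rw [← mul_pow, neg_one_mul, neg_neg, one_pow]
  have hpow : ∀ η : ℝ, 0 < η → η < Real.pi / 2 - κ₀ → ∃ φ G : ℝ, 0 < φ ∧ φ < Real.pi / 2 ∧
      IsPowerLike φ a α (κ₀ + η) G (fun z => (-1 : ℂ) ^ n * ((a : ℂ) + z) ^ (α : ℂ)) :=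
    fun η h0 h1 => exists_isPowerLike ha hα h0 (by linarith)
  obtain ⟨B, hB⟩ : ∃ B, HasNFC A (Real.pi / 2) a (fun z => ((a : ℂ) + z) ^ (α : ℂ)) B := by
    obtain ⟨φ, G, h0, h1, hg⟩ := hpow ((Real.pi / 2 - κ₀) / 2) (by linarith) (by linarith)
    -- The power-like function carries the sign (-1)^n; multiplying by the same sign once more
    -- recovers (a + z)^α.
    have := exists_hasNFC hA (c := (-1) ^ n) (by simp) hα h0 h1 hg
    simpa only [← mul_assoc, hsq, one_mul] using this
  refine ⟨B, fun B' => ⟨fun h => h.graph_eq hA hB, fun h => h ▸ hB⟩, fun ε h0 h1 => ?_,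
    fun δ h0 h1 => ?_⟩
  · set η := min (ε / 2) ((Real.pi / 2 - κ₀) / 2) with hη
    have hη0 : 0 < η := lt_min (by linarith) (by linarith)
    have hη1 : η ≤ ε / 2 := min_le_left _ _
    have hη2 : η ≤ (Real.pi / 2 - κ₀) / 2 := min_le_right _ _
    obtain ⟨φ, G, h2, h3, hg⟩ := hpow η hη0 (by linarith)
    exact hB.exists_isSectorialOp hA hα hc hg h2 h3 (by linarith) (by linarith) (by linarith) h1
  · set η := (Real.pi / 2 - κ₀ - δ) / 2 with hη
    obtain ⟨φ, G, h2, h3, hg⟩ := hpow η (by linarith) (by linarith)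
    have := hB.exists_isGeneratorOf hA hα hc hg h2 h3 (by linarith) h0 (by linarith)
    rwa [show -((-1 : ℂ) ^ n) = (-1) ^ (n + 1) by ring] at this
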